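/- The \emph{size} of an equilateral triangle is its side length. A tiling of a set $P\subseteq\mathbb{R}^2$ by $n$ equilateral triangles is a family $\mathcal{T}=\{T_1,\ldots,T_n\}$ of (nondegenerate) equilateral triangles with mutually disjoint interiors and $P=T_1\cup\cdots\cup T_n$; let $s(\mathcal{T})$ be the number of different sizes of the triangles $T_1,\ldots,T_n$. For each of the shapes triangle, trapezoid, parallelogram, convex pentagon, convex hexagon (trapezoids are understood not to be parallelograms), let $s_{\mathrm{tri}}(n)$, $s_{\mathrm{trap}}(n)$, $s_{\mathrm{par}}(n)$, $s_{\mathrm{pent}}(n)$, $s_{\mathrm{hex}}(n)$, respectively, be the maximum of $s(\mathcal{T})$ over all tilings $\mathcal{T}$ of some polygon of that shape by $n$ equilateral triangles. The domain $\mathrm{dom}$ of each of these functions is the set of all $n$ for which such a tiling exists. Then: (a) $\mathrm{dom}(s_{\mathrm{tri}})=\{1,4\}\cup\{6,7,\ldots\}$, with $s_{\mathrm{tri}}(1)=s_{\mathrm{tri}}(4)=1$, $s_{\mathrm{tri}}(6)=2$ and $s_{\mathrm{tri}}(n)=n-5$ for all $n\ge 7$. (b) $\mathrm{dom}(s_{\mathrm{trap}})=\{3\}\cup\{5,6,\ldots\}$,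 with $s_{\mathrm{trap}}(3)=1$, $s_{\mathrm{trap}}(5)=2$ and $s_{\mathrm{trap}}(n)=n-4$ for all $n\ge 6$. (c) $\mathrm{dom}(s_{\mathrm{par}})=\{2\}\cup\{4,5,\ldots\}$, with $s_{\mathrm{par}}(2)=s_{\mathrm{par}}(4)=1$, $s_{\mathrm{par}}(5)=2$ and $s_{\mathrm{par}}(n)=n-4$ for all $n\ge 6$. (d) $\mathrm{dom}(s_{\mathrm{pent}})=\{4,5,\ldots\}$, with $s_{\mathrm{pent}}(4)=2$ and $s_{\mathrm{pent}}(n)=n-3$ for all $n\ge 5$. (e) $\mathrm{dom}(s_{\mathrm{hex}})=\{6,7,\ldots\}$, with $s_{\mathrm{hex}}(n)=n-5$ for $n=6,7,8$; $s_{\mathrm{hex}}(n)=n-4$ for $n=9,10,\ldots,19$ and $n=21,22,24,25$; and $s_{\mathrm{hex}}(n)\in\{n-5,n-4\}$ for $n=20$, $n=23$ and all $n\ge 26$. -/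

import Mathlib

/-- The Euclidean plane. -/
abbrev Plane : Type := EuclideanSpace ℝ (Fin 2)

/-- A nondegenerate triangle in the plane, given by its three (affinely independent) vertices. -/
abbrev PlaneTriangle : Type := Affine.Triangle ℝ Plane

/-- The region covered by a triangle: the convex hull of its vertices. -/
def triangleRegion (t : PlaneTriangle) : Set Plane :=
  convexHull ℝ (Set.range t.points)

/-- The size of an equilateral triangle: the length of one of its sides. -/
noncomputable def triangleSize (t : PlaneTriangle) : ℝ :=
  dist (t.points 0) (t.points 1)

/-- The `n` triangles `T 0, …, T (n - 1)` are equilateral and they tile the set `P`: their union is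
`P` and their interiors are mutually disjoint. -/
structure IsEquilateralTiling {n : ℕ} (P : Set Plane) (T : Fin n → PlaneTriangle) : Prop where
  equilateral : ∀ i, (T i).Equilateral
  union_eq : ⋃ i, triangleRegion (T i) = P
  disjoint_interiors : ∀ i j, i ≠ j →
    Disjoint (interior (triangleRegion (T i))) (interior (triangleRegion (T j)))

/-- The number of different sizes of the triangles of a finite family. -/
noncomputable def numSizes {n : ℕ} (T : Fin n → PlaneTriangle) : ℕ :=
  (Set.range fun i => triangleSize (T i)).ncard

/-- `P` is a convex polygon with exactly `k` vertices (meant for `3 ≤ k`): the convex hull of `k`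
points none of which lies in the convex hull of the others. -/
def IsConvexPolygon (k : ℕ) (P : Set Plane) : Prop :=
  ∃ v : Fin k → Plane, ConvexIndependent ℝ v ∧ P = convexHull ℝ (Set.range v)

/-- `P` is a triangle. -/
def IsTriangle (P : Set Plane) : Prop := IsConvexPolygon 3 P

/-- `P` is a convex quadrilateral `a b c d` whose sides `a b` and `d c` are parallel and of
different lengths, that is, a trapezoid that is not a parallelogram. -/
def IsTrapezoid (P : Set Plane) : Prop :=
  ∃ a b c d : Plane, AffineIndependent ℝ ![a, b, d] ∧
    (∃ r : ℝ, 0 < r ∧ r ≠ 1 ∧ c - d = r • (b - a)) ∧ P = convexHull ℝ {a, b, c, d}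

/-- `P` is a (nondegenerate) parallelogram `a b c d`. -/
def IsParallelogram (P : Set Plane) : Prop :=
  ∃ a b c d : Plane, AffineIndependent ℝ ![a, b, d] ∧
    c - d = b - a ∧ P = convexHull ℝ {a, b, c, d}

/-- `P` is a convex pentagon. -/
def IsConvexPentagon (P : Set Plane) : Prop := IsConvexPolygon 5 P

/-- `P` is a convex hexagon. -/
def IsConvexHexagon (P : Set Plane) : Prop := IsConvexPolygon 6 P

/-- The numbers `s(T)` of different sizes, for all tilings `T` of some polygon of the given shape
by `n` equilateral triangles. -/
def sizeCounts (Shape : Set Plane → Prop) (n : ℕ) : Set ℕ :=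
  {s | ∃ P : Set Plane, Shape P ∧
    ∃ T : Fin n → PlaneTriangle, IsEquilateralTiling P T ∧ numSizes T = s}

/-- The domain for the given shape: the set of all `n` such that some polygon of that shape has a
tiling by `n` equilateral triangles. -/
def tilingDomain (Shape : Set Plane → Prop) : Set ℕ :=
  {n | ∃ P : Set Plane, Shape P ∧ ∃ T : Fin n → PlaneTriangle, IsEquilateralTiling P T}

/-- `s` is the maximal number of different sizes in a tiling of some polygon of the given shape by
`n` equilateral triangles (in particular, such a tiling exists and the maximum is attained). -/
def IsMaxSizes (Shape : Set Plane → Prop) (n s : ℕ) : Prop :=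
  IsGreatest (sizeCounts Shape n) s

namespace TriTiling

open Finset

/-! ### Tiles in triangular coordinates -/

/-! In coordinates along three directions at 120°, an equilateral triangle with sides in these
directions is a single vector `p`: the up triangle `p ≤ f` if `wt p < 0`, the down triangle `f ≤ p`
if `wt p > 0`, of size `|wt p|`. Every tiling of a convex polygon has this form. Along a segment
that avoids all vertices, neighbouring tiles touch at inner points of sides and hence share a side
direction (`FrameTiling.aligned`), and a convex union of such tiles is cut out by lines of the three
directions (`FrameTiling.mem_of_bounds`). So the polygon is a region `L ≤ f ≤ U` with six side
lengths `lowLen`, `upLen`, some possibly zero (`exists_tightTiling`), and its shape is read off from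
the lengths that vanish.

For the upper bounds, let the defect be the number of tiles minus the number of sizes, and let `b`
count the incidences of tiles with sides of the region. The key inequality `HexTiling.bdCount_le`
says that `b` is at most the defect plus 3, unless the defect is at least 5. A flag is a vertex
together with an up and a down tile having sides along a common ray from it. If these sides have
different lengths, the shorter one ends inside the longer one, and its tile starts a new flag there.
This successor relation is injective and never leads to a flag on the boundary, so flags with equal
sides are at least as numerous as boundary flags. There are at least `2b - 6` boundary flags, and
each pair of tiles sharing a full side carries at most two equal flags. Among at most five tiles of
one size the graph of shared sides is a forest, so the number of such pairs is at most the defect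
(`card_edges_le`).

Every side meets a tile, so a small defect leaves few possibilities for the numbers of tiles along
the sides. Corner tiles then fill whole sides or have equal sizes, and cutting them off leads to a
simpler shape whose bound is known. Hexagons have no 60° corners: six incidences force six equal
tiles, and seven incidences with at most eight tiles are settled by comparing neighbouring tiles and
by balancing the sizes on both sides of interior lines (`TightTiling.hexagon_of_seven`).

For the lower bounds, the spiral of triangles with Padovan sizes gives pentagons with `n - 3` sizes
(`realizable_spiral`). Attaching tiles of sizes already present gives trapezoids, parallelograms and
triangles, and attaching three tiles of half a side gives hexagons with `n - 5` sizes. The hexagons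
with `n - 4` sizes come from explicit integral tilings of a triangle by cutting off three corner
tiles; for these, disjointness and the right total area imply covering (`hexTiling_of_area`). -/

/-- The sum of the coordinates. The plane is `{f : Fin 3 → ℝ | wt f = 0}`; a vector `p` with `wt p ≠ 0`
represents an equilateral triangle of size `|wt p|`. -/
def wt (p : Fin 3 → ℝ) : ℝ := p 0 + p 1 + p 2

lemma wt_perm (π : Equiv.Perm (Fin 3)) (p : Fin 3 → ℝ) :
    wt p = p (π 0) + p (π 1) + p (π 2) := by
  have h := Equiv.sum_comp π p
  simp only [Fin.sum_univ_three] at h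
  rw [wt, h]

lemma forall_perm (π : Equiv.Perm (Fin 3)) {P : Fin 3 → Prop} :
    (∀ j, P j) ↔ P (π 0) ∧ P (π 1) ∧ P (π 2) := by
  rw [← π.forall_congr_right (q := P)]
  simp [Fin.forall_fin_succ]

lemma exists_perm (π : Equiv.Perm (Fin 3)) {P : Fin 3 → Prop} :
    (∃ j, P j) ↔ P (π 0) ∨ P (π 1) ∨ P (π 2) := by
  rw [← π.exists_congr_right (q := P)]
  simp [Fin.exists_fin_succ]

lemma ext_perm (π : Equiv.Perm (Fin 3)) {p q : Fin 3 → ℝ} (h0 : p (π 0) = q (π 0))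
    (h1 : p (π 1) = q (π 1)) (h2 : p (π 2) = q (π 2)) : p = q :=
  funext ((forall_perm π).2 ⟨h0, h1, h2⟩)

@[simp] lemma wt_neg (p : Fin 3 → ℝ) : wt (-p) = -wt p := by simp [wt]; ring

/-- The vector with prescribed coordinates along a permutation. -/
def vec (π : Equiv.Perm (Fin 3)) (a b c : ℝ) : Fin 3 → ℝ := fun j => ![a, b, c] (π.symm j)

@[simp] lemma vec_zero (π : Equiv.Perm (Fin 3)) (a b c : ℝ) : vec π a b c (π 0) = a := by simp [vec]
@[simp] lemma vec_one (π : Equiv.Perm (Fin 3)) (a b c : ℝ) : vec π a b c (π 1) = b := by simp [vec]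
@[simp] lemma vec_two (π : Equiv.Perm (Fin 3)) (a b c : ℝ) : vec π a b c (π 2) = c := by simp [vec]

@[simp] lemma wt_vec (π : Equiv.Perm (Fin 3)) (a b c : ℝ) : wt (vec π a b c) = a + b + c := by
  rw [wt_perm π]; simp

/-- `f` lies in the interior of the tile `p`. -/
def Inside (p f : Fin 3 → ℝ) : Prop :=
  (wt p < 0 ∧ ∀ j, p j < f j) ∨ (0 < wt p ∧ ∀ j, f j < p j)

/-- `f` lies in the tile `p`. -/
def Covers (p f : Fin 3 → ℝ) : Prop :=
  (wt p < 0 ∧ ∀ j, p j ≤ f j) ∨ (0 < wt p ∧ ∀ j, f j ≤ p j)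

/-- The tiles `p` and `q` have disjoint interiors. -/
def Apart (p q : Fin 3 → ℝ) : Prop := ∀ f, wt f = 0 → Inside p f → ¬ Inside q f

/-! ### Symmetries and coordinate criteria for disjoint interiors -/

lemma Apart.symm {p q : Fin 3 → ℝ} (h : Apart p q) : Apart q p := fun f hf hq hp => h f hf hp hq

lemma inside_neg {p f : Fin 3 → ℝ} : Inside (-p) (-f) ↔ Inside p f := by
  simp [Inside, or_comm]

lemma covers_neg {p f : Fin 3 → ℝ} : Covers (-p) (-f) ↔ Covers p f := by
  simp [Covers, or_comm]

lemma Apart.neg {p q : Fin 3 → ℝ} (h : Apart p q) : Apart (-p) (-q) := by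
  intro f hf hp hq
  rw [← neg_neg f, inside_neg] at hp hq
  exact h (-f) (by simp [hf]) hp hq

/-- The intersection of two up tiles is described by the coordinatewise maximum, which has interior
points exactly when its weight is negative. The slack, divided equally among the three coordinates,
gives such a point. -/
lemma Apart.up_up {p q : Fin 3 → ℝ} (h : Apart p q) (hp : wt p < 0) (hq : wt q < 0)
    (π : Equiv.Perm (Fin 3)) :
    0 ≤ max (p (π 0)) (q (π 0)) + max (p (π 1)) (q (π 1)) + max (p (π 2)) (q (π 2)) := by
  by_contra! hlt
  set t := -(max (p (π 0)) (q (π 0)) + max (p (π 1)) (q (π 1)) + max (p (π 2)) (q (π 2))) / 3 with ht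
  have ht0 : 0 < t := by rw [ht]; linarith
  refine h (vec π (max (p (π 0)) (q (π 0)) + t) (max (p (π 1)) (q (π 1)) + t)
    (max (p (π 2)) (q (π 2)) + t)) (by rw [wt_vec]; rw [ht]; ring)
    (Or.inl ⟨hp, (forall_perm π).2 ?_⟩) (Or.inl ⟨hq, (forall_perm π).2 ?_⟩)
  · simp only [vec_zero, vec_one, vec_two]
    refine ⟨?_, ?_, ?_⟩ <;> linarith [le_max_left (p (π 0)) (q (π 0)),
      le_max_left (p (π 1)) (q (π 1)), le_max_left (p (π 2)) (q (π 2))]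
  · simp only [vec_zero, vec_one, vec_two]
    refine ⟨?_, ?_, ?_⟩ <;> linarith [le_max_right (p (π 0)) (q (π 0)),
      le_max_right (p (π 1)) (q (π 1)), le_max_right (p (π 2)) (q (π 2))]

lemma Apart.down_down {p q : Fin 3 → ℝ} (h : Apart p q) (hp : 0 < wt p) (hq : 0 < wt q)
    (π : Equiv.Perm (Fin 3)) :
    min (p (π 0)) (q (π 0)) + min (p (π 1)) (q (π 1)) + min (p (π 2)) (q (π 2)) ≤ 0 := by
  have := h.neg.up_up (by simpa using hp) (by simpa using hq) π
  simp only [Pi.neg_apply, max_neg_neg] at this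
  linarith

/-- If `q` exceeded `p` strictly in every coordinate, the convex combination of `p` and `q` of
weight zero would be a point of the plane interior to both tiles. -/
lemma Apart.up_down {p q : Fin 3 → ℝ} (h : Apart p q) (hp : wt p < 0) (hq : 0 < wt q)
    (π : Equiv.Perm (Fin 3)) :
    q (π 0) ≤ p (π 0) ∨ q (π 1) ≤ p (π 1) ∨ q (π 2) ≤ p (π 2) := by
  rw [← exists_perm π (P := fun j => q j ≤ p j)]
  by_contra! hlt
  have hD : 0 < wt q - wt p := by linarith
  have h1 : 0 < -wt p / (wt q - wt p) := div_pos (by linarith) hD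
  have h2 : 0 < wt q / (wt q - wt p) := div_pos hq hD
  have h3 : -wt p / (wt q - wt p) + wt q / (wt q - wt p) = 1 := by field_simp; ring
  refine h (fun j => (wt q / (wt q - wt p)) * p j + (-wt p / (wt q - wt p)) * q j) ?_
    (Or.inl ⟨hp, fun j => ?_⟩) (Or.inr ⟨hq, fun j => ?_⟩)
  · have : wt (fun j => (wt q / (wt q - wt p)) * p j + (-wt p / (wt q - wt p)) * q j) =
      (wt q / (wt q - wt p)) * wt p + (-wt p / (wt q - wt p)) * wt q := by
      simp only [wt]; ring
    rw [this]; field_simp; ring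
  · have h4 := mul_pos h1 (sub_pos.2 (hlt j))
    have h5 := congrArg (· * p j) h3
    simp only at h5 ⊢
    linarith
  · have h4 := mul_pos h2 (sub_pos.2 (hlt j))
    have h5 := congrArg (· * q j) h3
    simp only at h5 ⊢
    linarith

/-- The converses of the three criteria serve to verify explicit tilings. -/
lemma apart_of_up_up {p q : Fin 3 → ℝ} (hp : wt p < 0) (hq : wt q < 0)
    (h : 0 ≤ max (p 0) (q 0) + max (p 1) (q 1) + max (p 2) (q 2)) : Apart p q := by
  rintro f hf (⟨-, h1⟩ | ⟨h1, -⟩) (⟨-, h2⟩ | ⟨h2, -⟩) <;> try linarith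
  have h3 : ∀ j, max (p j) (q j) < f j := fun j => max_lt (h1 j) (h2 j)
  have := h3 0; have := h3 1; have := h3 2
  rw [wt] at hf; linarith

lemma apart_of_down_down {p q : Fin 3 → ℝ} (hp : 0 < wt p) (hq : 0 < wt q)
    (h : min (p 0) (q 0) + min (p 1) (q 1) + min (p 2) (q 2) ≤ 0) : Apart p q := by
  rintro f hf (⟨h1, -⟩ | ⟨-, h1⟩) (⟨h2, -⟩ | ⟨-, h2⟩) <;> try linarith
  have h3 : ∀ j, f j < min (p j) (q j) := fun j => lt_min (h1 j) (h2 j)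
  have := h3 0; have := h3 1; have := h3 2
  rw [wt] at hf; linarith

lemma apart_of_up_down {p q : Fin 3 → ℝ} (hp : wt p < 0) (hq : 0 < wt q) (j : Fin 3)
    (h : q j ≤ p j) : Apart p q := by
  rintro f hf (⟨-, h1⟩ | ⟨h1, -⟩) (⟨h2, -⟩ | ⟨-, h2⟩) <;> try linarith
  linarith [h1 j, h2 j]

/-! ### Tilings of convex regions bounded by lines of the three directions -/

/-- The tiles in `T` tile the region `{f | wt f = 0 ∧ L ≤ f ≤ U}`. -/
structure HexTiling (L U : Fin 3 → ℝ) (T : Finset (Fin 3 → ℝ)) : Prop where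
  wt_ne : ∀ p ∈ T, wt p ≠ 0
  low : ∀ p ∈ T, ∀ j, L j ≤ p j ∧ L j ≤ p j - wt p
  up : ∀ p ∈ T, ∀ j, p j ≤ U j ∧ p j - wt p ≤ U j
  cover : ∀ f, wt f = 0 → (∀ j, L j ≤ f j ∧ f j ≤ U j) → ∃ p ∈ T, Covers p f
  apart : ∀ p ∈ T, ∀ q ∈ T, p ≠ q → Apart p q

open Classical in
/-- The reflected tiles. -/
noncomputable def negTiles (T : Finset (Fin 3 → ℝ)) : Finset (Fin 3 → ℝ) := T.image (fun p => -p)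

lemma mem_negTiles {T : Finset (Fin 3 → ℝ)} {p : Fin 3 → ℝ} : p ∈ negTiles T ↔ -p ∈ T := by
  simp only [negTiles, mem_image]
  constructor
  · rintro ⟨q, hq, rfl⟩; simpa using hq
  · intro h; exact ⟨-p, h, by simp⟩

lemma card_negTiles (T : Finset (Fin 3 → ℝ)) : (negTiles T).card = T.card := by
  classical
  exact card_image_of_injective _ neg_injective

lemma negTiles_negTiles (T : Finset (Fin 3 → ℝ)) : negTiles (negTiles T) = T := by
  ext p; simp [mem_negTiles]

variable {L U : Fin 3 → ℝ} {T : Finset (Fin 3 → ℝ)}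

lemma HexTiling.neg (h : HexTiling L U T) : HexTiling (-U) (-L) (negTiles T) where
  wt_ne p hp := by simpa using h.wt_ne _ (mem_negTiles.1 hp)
  low p hp j := by
    have := h.up _ (mem_negTiles.1 hp) j
    simp only [Pi.neg_apply, wt_neg] at *
    constructor <;> linarith
  up p hp j := by
    have := h.low _ (mem_negTiles.1 hp) j
    simp only [Pi.neg_apply, wt_neg] at *
    constructor <;> linarith
  cover f hf hj := by
    obtain ⟨p, hp, hc⟩ := h.cover (-f) (by simp [hf]) (fun j => by
      have := hj j
      simp only [Pi.neg_apply] at *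
      constructor <;> linarith)
    exact ⟨-p, by simpa [mem_negTiles] using hp, by rw [← covers_neg]; simpa using hc⟩
  apart p hp q hq hne := by
    have := (h.apart _ (mem_negTiles.1 hp) _ (mem_negTiles.1 hq) (by simpa using hne)).neg
    simpa using this

/-- If `v` and `v + d` lie in the region, then some tile contains `v + ε d` for all small `ε ≥ 0`. -/
lemma HexTiling.exists_germ (h : HexTiling L U T) {v d : Fin 3 → ℝ} (hv : wt v = 0) (hd : wt d = 0)
    (h0 : ∀ j, L j ≤ v j ∧ v j ≤ U j) (h1 : ∀ j, (v j = L j → 0 ≤ d j) ∧ (v j = U j → d j ≤ 0)) :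
    ∃ p ∈ T, (wt p < 0 ∧ ∀ j, p j ≤ v j ∧ (p j = v j → 0 ≤ d j)) ∨
      (0 < wt p ∧ ∀ j, v j ≤ p j ∧ (v j = p j → d j ≤ 0)) := by
  have key : ∀ a b c : ℝ, ∀ᶠ ε in nhdsWithin (0 : ℝ) (Set.Ioi 0),
      (a < b → a + ε * c < b) ∧ (b < a → b < a + ε * c) := by
    intro a b c
    have hc : Filter.Tendsto (fun ε : ℝ => a + ε * c) (nhdsWithin 0 (Set.Ioi 0)) (nhds a) := by
      have : Continuous (fun ε : ℝ => a + ε * c) := by fun_prop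
      simpa using (this.tendsto 0).mono_left nhdsWithin_le_nhds
    refine Filter.Eventually.and ?_ ?_
    · by_cases hab : a < b
      · filter_upwards [hc.eventually_lt_const hab] with ε hε _ using hε
      · exact Filter.Eventually.of_forall fun _ h => absurd h hab
    · by_cases hab : b < a
      · filter_upwards [hc.eventually_const_lt hab] with ε hε _ using hε
      · exact Filter.Eventually.of_forall fun _ h => absurd h hab
  -- There are finitely many tiles and bounds, so one `ε` preserves all strict inequalities valid at
  -- `v`. An inequality of the covering tile that failed at `v` would then still fail at `v + ε d`.
  have e1 : ∀ᶠ ε in nhdsWithin (0 : ℝ) (Set.Ioi 0), ∀ p ∈ T, ∀ j,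
      (v j < p j → v j + ε * d j < p j) ∧ (p j < v j → p j < v j + ε * d j) := by
    rw [Filter.eventually_all_finset]
    intro p _
    rw [Filter.eventually_all]
    exact fun j => key _ _ _
  have e2 : ∀ᶠ ε in nhdsWithin (0 : ℝ) (Set.Ioi 0), ∀ j,
      (v j < U j → v j + ε * d j < U j) ∧ (L j < v j → L j < v j + ε * d j) := by
    rw [Filter.eventually_all]
    exact fun j => ((key (v j) (U j) (d j)).mono fun _ h => h.1).and
      ((key (v j) (L j) (d j)).mono fun _ h => h.2)
  have e3 : ∀ᶠ ε in nhdsWithin (0 : ℝ) (Set.Ioi 0), 0 < ε := self_mem_nhdsWithin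
  obtain ⟨ε, h1e, h2e, hε⟩ := (e1.and (e2.and e3)).exists
  obtain ⟨p, hp, hc⟩ := h.cover (fun j => v j + ε * d j) (by
      simp only [wt] at *; linear_combination hv + ε * hd) (fun j => by
      constructor
      · rcases (h0 j).1.lt_or_eq with hlt | heq
        · exact ((h2e j).2 hlt).le
        · have := (h1 j).1 heq.symm; nlinarith
      · rcases (h0 j).2.lt_or_eq with hlt | heq
        · exact ((h2e j).1 hlt).le
        · have := (h1 j).2 heq; nlinarith)
  refine ⟨p, hp, ?_⟩
  rcases hc with ⟨hw, hc⟩ | ⟨hw, hc⟩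
  · refine Or.inl ⟨hw, fun j => ⟨?_, fun heq => ?_⟩⟩
    · by_contra! hlt
      linarith [(h1e p hp j).1 hlt, hc j]
    · have := hc j
      by_contra! hneg
      nlinarith
  · refine Or.inr ⟨hw, fun j => ⟨?_, fun heq => ?_⟩⟩
    · by_contra! hlt
      linarith [(h1e p hp j).2 hlt, hc j]
    · have := hc j
      by_contra! hneg
      nlinarith

/-- The cyclic rotation of the three indices. -/
def rot : Equiv.Perm (Fin 3) := finRotate 3

lemma rot_zero : rot 0 = 1 := by decide
lemma rot_one : rot 1 = 2 := by decide
lemma rot_two : rot 2 = 0 := by decide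
lemma rot_symm_zero : rot⁻¹ 0 = 2 := by decide
lemma rot_symm_one : rot⁻¹ 1 = 0 := by decide
lemma rot_symm_two : rot⁻¹ 2 = 1 := by decide

/-- Two tiles of `T` sharing a point are equal, if both contain a common germ. -/
lemma HexTiling.eq_of_up (h : HexTiling L U T) {p q : Fin 3 → ℝ} (hp : p ∈ T) (hq : q ∈ T)
    (hwp : wt p < 0) (hwq : wt q < 0) (π : Equiv.Perm (Fin 3))
    (hlt : max (p (π 0)) (q (π 0)) + max (p (π 1)) (q (π 1)) + max (p (π 2)) (q (π 2)) < 0) :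
    p = q := by
  by_contra hne
  linarith [(h.apart p hp q hq hne).up_up hwp hwq π]

lemma HexTiling.eq_of_down (h : HexTiling L U T) {p q : Fin 3 → ℝ} (hp : p ∈ T) (hq : q ∈ T)
    (hwp : 0 < wt p) (hwq : 0 < wt q) (π : Equiv.Perm (Fin 3))
    (hlt : 0 < min (p (π 0)) (q (π 0)) + min (p (π 1)) (q (π 1)) + min (p (π 2)) (q (π 2))) :
    p = q := by
  by_contra hne
  linarith [(h.apart p hp q hq hne).down_down hwp hwq π]

lemma HexTiling.up_down (h : HexTiling L U T) {p q : Fin 3 → ℝ} (hp : p ∈ T) (hq : q ∈ T)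
    (hwp : wt p < 0) (hwq : 0 < wt q) (π : Equiv.Perm (Fin 3)) :
    q (π 0) ≤ p (π 0) ∨ q (π 1) ≤ p (π 1) ∨ q (π 2) ≤ p (π 2) :=
  (h.apart p hp q hq (by rintro rfl; linarith)).up_down hwp hwq π

/-- Two up tiles on the same two lines share a vertex and the whole angle there, so they overlap. -/
lemma HexTiling.eq_of_up_two (h : HexTiling L U T) {p q : Fin 3 → ℝ} (hp : p ∈ T) (hq : q ∈ T)
    (hwp : wt p < 0) (hwq : wt q < 0) (π : Equiv.Perm (Fin 3)) (h0 : p (π 0) = q (π 0))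
    (h1 : p (π 1) = q (π 1)) : p = q := by
  refine h.eq_of_up hp hq hwp hwq π ?_
  rw [wt_perm π] at hwp hwq
  rw [h0, h1, max_self, max_self]
  rcases max_choice (p (π 2)) (q (π 2)) with hm | hm <;> rw [hm] <;> linarith

lemma HexTiling.eq_of_down_two (h : HexTiling L U T) {p q : Fin 3 → ℝ} (hp : p ∈ T) (hq : q ∈ T)
    (hwp : 0 < wt p) (hwq : 0 < wt q) (π : Equiv.Perm (Fin 3)) (h0 : p (π 0) = q (π 0))
    (h1 : p (π 1) = q (π 1)) : p = q := by
  refine h.eq_of_down hp hq hwp hwq π ?_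
  rw [wt_perm π] at hwp hwq
  rw [h0, h1, min_self, min_self]
  rcases min_choice (p (π 2)) (q (π 2)) with hm | hm <;> rw [hm] <;> linarith

end TriTiling

namespace TriTiling

open Finset

variable {L U : Fin 3 → ℝ} {T : Finset (Fin 3 → ℝ)}

/-! ### Flags: pairs of tiles with a common vertex and sides along a common ray -/

/-- The up tile `x.1` and the down tile `x.2.1` have a common vertex, and sides on a common ray
from that vertex; the ray lies on a line in the direction `x.2.2 0`. -/
def IsFlag (T : Finset (Fin 3 → ℝ)) (x : (Fin 3 → ℝ) × (Fin 3 → ℝ) × Equiv.Perm (Fin 3)) : Prop :=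
  x.1 ∈ T ∧ x.2.1 ∈ T ∧ wt x.1 < 0 ∧ 0 < wt x.2.1 ∧ x.1 (x.2.2 0) = x.2.1 (x.2.2 0) ∧
    x.1 (x.2.2 0) + x.1 (x.2.2 1) + x.2.1 (x.2.2 2) = 0

/-- Point reflection exchanges up and down tiles. The common vertex is located by index 1 of the up
tile and index 2 of the down tile, hence the swap of these indices. -/
lemma IsFlag.neg {p q : Fin 3 → ℝ} {π : Equiv.Perm (Fin 3)} (h : IsFlag T (p, q, π)) :
    IsFlag (negTiles T) (-q, -p, π * Equiv.swap 1 2) := by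
  obtain ⟨hp, hq, hwp, hwq, h0, h1⟩ := h
  have e0 : (Equiv.swap 1 2 : Equiv.Perm (Fin 3)) 0 = 0 := by decide
  have e1 : (Equiv.swap 1 2 : Equiv.Perm (Fin 3)) 1 = 2 := by decide
  have e2 : (Equiv.swap 1 2 : Equiv.Perm (Fin 3)) 2 = 1 := by decide
  simp only at hp hq hwp hwq h0 h1
  refine ⟨by simpa [mem_negTiles], by simpa [mem_negTiles], by simpa, by simpa, ?_, ?_⟩
  · simp [e0, h0]
  · simp only [Equiv.Perm.mul_apply, e0, e1, e2, Pi.neg_apply]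
    linarith

/-- At a vertex of an up tile `p` where one side of a line is blocked, there is a flag. -/
lemma HexTiling.exists_flag_of_blocked (h : HexTiling L U T) {p : Fin 3 → ℝ} (hp : p ∈ T)
    (hwp : wt p < 0) (π : Equiv.Perm (Fin 3)) (hL : L (π 0) < p (π 0))
    (hb : ∀ z ∈ T, 0 < wt z → p (π 1) < z (π 1) → p (π 0) ≤ z (π 0) →
      -p (π 0) - p (π 1) ≤ z (π 2) → z (π 0) = p (π 0) ∧ z (π 2) = -p (π 0) - p (π 1)) :
    ∃ z, IsFlag T (p, z, π) := by
  have hw := wt_perm π p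
  have l0 := h.low p hp (π 0)
  have l1 := h.low p hp (π 1)
  have l2 := h.low p hp (π 2)
  have u0 := h.up p hp (π 0)
  have u1 := h.up p hp (π 1)
  have u2 := h.up p hp (π 2)
  -- The direction `(-1, 2, -1)` bisects the 60° angle that a down tile across the line would occupy
  -- at this vertex of `p`.
  obtain ⟨z, hz, hc⟩ := h.exists_germ (v := vec π (p (π 0)) (p (π 1)) (-p (π 0) - p (π 1)))
    (d := vec π (-1) 2 (-1)) (by rw [wt_vec]; ring) (by rw [wt_vec]; norm_num)
    ((forall_perm π).2 (by
      simp only [vec_zero, vec_one, vec_two]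
      refine ⟨⟨?_, ?_⟩, ⟨?_, ?_⟩, ⟨?_, ?_⟩⟩ <;> linarith))
    ((forall_perm π).2 (by
      simp only [vec_zero, vec_one, vec_two]
      refine ⟨⟨?_, ?_⟩, ⟨?_, ?_⟩, ⟨?_, ?_⟩⟩ <;> intro _ <;> linarith))
  rcases hc with ⟨hwz, hc⟩ | ⟨hwz, hc⟩
  -- An up tile containing this germ would reach across the line and overlap `p`.
  · exfalso
    have hwz' := wt_perm π z
    obtain ⟨⟨h0, h0'⟩, ⟨h1, -⟩, ⟨h2, h2'⟩⟩ := (forall_perm π).1 hc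
    simp only [vec_zero, vec_one, vec_two] at h0 h0' h1 h2 h2'
    have h0'' : z (π 0) < p (π 0) := lt_of_le_of_ne h0 (fun e => by linarith [h0' e])
    have h2'' : z (π 2) < -p (π 0) - p (π 1) := lt_of_le_of_ne h2 (fun e => by linarith [h2' e])
    have := h.eq_of_up hp hz hwp hwz π (by
      rw [max_eq_left h0, max_eq_left h1]
      have : max (p (π 2)) (z (π 2)) < -p (π 0) - p (π 1) := max_lt (by linarith) h2''
      linarith)
    rw [this] at h0''
    exact lt_irrefl _ h0''
  · obtain ⟨⟨h0, -⟩, ⟨h1, h1'⟩, ⟨h2, -⟩⟩ := (forall_perm π).1 hc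
    simp only [vec_zero, vec_one, vec_two] at h0 h1 h1' h2
    obtain ⟨e0, e2⟩ := hb z hz hwz (lt_of_le_of_ne h1 (fun e => by linarith [h1' e])) h0 h2
    exact ⟨z, hp, hz, hwp, hwz, e0.symm, by simp only; linarith⟩

/-- The side of `p` ends inside the longer side of `q`. At that end `q` blocks the way, so the tile
across the next side of `p` must have a vertex there. -/
lemma HexTiling.exists_next_up (h : HexTiling L U T) {p q : Fin 3 → ℝ} {π : Equiv.Perm (Fin 3)}
    (hf : IsFlag T (p, q, π)) (hlt : -wt p < wt q) : ∃ z, IsFlag T (p, z, π * rot⁻¹) := by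
  obtain ⟨hp, hq, hwp, hwq, h0, h1⟩ := hf
  simp only at hp hq hwp hwq h0 h1
  have hw := wt_perm π p
  have hw' := wt_perm π q
  have l2 := h.low q hq (π 2)
  refine h.exists_flag_of_blocked hp hwp _ ?_ ?_ <;>
    simp only [Equiv.Perm.mul_apply, rot_symm_zero, rot_symm_one, rot_symm_two]
  · linarith
  · intro z hz hwz z0 z2 z1
    by_contra hne
    have hlt : (p (π 2) < z (π 2)) ∨ (-p (π 2) - p (π 0) < z (π 1)) := by
      -- Otherwise `z` sits at the vertex exactly as claimed; any excess in one of these two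
      -- coordinates makes `z` overlap `q`.
      by_contra! hle
      exact hne ⟨le_antisymm hle.1 z2, le_antisymm hle.2 z1⟩
    have hzq : z = q := by
      refine h.eq_of_down hz hq hwz hwq π ?_
      rw [min_eq_right (by linarith : q (π 0) ≤ z (π 0))]
      have m1 : -p (π 2) - p (π 0) < q (π 1) := by linarith
      have m2 : p (π 2) < q (π 2) := by linarith
      rcases hlt with hlt | hlt
      · have : p (π 2) < min (z (π 2)) (q (π 2)) := lt_min hlt m2
        have : -p (π 2) - p (π 0) ≤ min (z (π 1)) (q (π 1)) := le_min z1 m1.le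
        linarith
      · have : p (π 2) ≤ min (z (π 2)) (q (π 2)) := le_min z2 m2.le
        have : -p (π 2) - p (π 0) < min (z (π 1)) (q (π 1)) := lt_min hlt m1
        linarith
    rw [hzq] at z0
    linarith

lemma swap_rot_swap : Equiv.swap 1 2 * rot⁻¹ * Equiv.swap 1 2 = rot := by decide

lemma HexTiling.exists_next_down (h : HexTiling L U T) {p q : Fin 3 → ℝ} {π : Equiv.Perm (Fin 3)}
    (hf : IsFlag T (p, q, π)) (hlt : wt q < -wt p) : ∃ z, IsFlag T (z, q, π * rot) := by
  obtain ⟨z, hz⟩ := h.neg.exists_next_up hf.neg (by simpa using hlt)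
  refine ⟨-z, ?_⟩
  have := hz.neg
  rw [negTiles_negTiles, neg_neg, mul_assoc, mul_assoc, ← mul_assoc _ rot⁻¹, swap_rot_swap] at this
  exact this

/-- One tile and the permutation fix the vertex and the ray, and these fix the other tile. -/
lemma HexTiling.flag_unique_up (h : HexTiling L U T) {p q q' : Fin 3 → ℝ}
    {π : Equiv.Perm (Fin 3)} (hf : IsFlag T (p, q, π)) (hf' : IsFlag T (p, q', π)) : q = q' := by
  obtain ⟨hp, hq, hwp, hwq, h0, h1⟩ := hf
  obtain ⟨-, hq', -, hwq', h0', h1'⟩ := hf'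
  simp only at *
  refine h.eq_of_down_two hq hq' hwq hwq' (π * Equiv.swap 1 2) ?_ ?_
  · have e0 : (Equiv.swap 1 2 : Equiv.Perm (Fin 3)) 0 = 0 := by decide
    rw [Equiv.Perm.mul_apply, e0, ← h0, h0']
  · have e1 : (Equiv.swap 1 2 : Equiv.Perm (Fin 3)) 1 = 2 := by decide
    rw [Equiv.Perm.mul_apply, e1]
    linarith

lemma HexTiling.flag_unique_down (h : HexTiling L U T) {p p' q : Fin 3 → ℝ}
    {π : Equiv.Perm (Fin 3)} (hf : IsFlag T (p, q, π)) (hf' : IsFlag T (p', q, π)) : p = p' := by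
  obtain ⟨hp, hq, hwp, hwq, h0, h1⟩ := hf
  obtain ⟨hp', -, hwp', -, h0', h1'⟩ := hf'
  simp only at *
  exact h.eq_of_up_two hp hp' hwp hwp' π (by rw [h0, h0']) (by linarith)

/-- The successor relation for flags whose two sides have different lengths. -/
def Next (x y : (Fin 3 → ℝ) × (Fin 3 → ℝ) × Equiv.Perm (Fin 3)) : Prop :=
  (-wt x.1 < wt x.2.1 ∧ y.1 = x.1 ∧ y.2.2 = x.2.2 * rot⁻¹) ∨
  (wt x.2.1 < -wt x.1 ∧ y.2.1 = x.2.1 ∧ y.2.2 = x.2.2 * rot)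

lemma HexTiling.exists_next (h : HexTiling L U T)
    {x : (Fin 3 → ℝ) × (Fin 3 → ℝ) × Equiv.Perm (Fin 3)} (hx : IsFlag T x)
    (hne : wt x.1 + wt x.2.1 ≠ 0) : ∃ y, IsFlag T y ∧ Next x y := by
  obtain ⟨p, q, π⟩ := x
  simp only at hne
  rcases lt_or_gt_of_ne hne with hlt | hlt
  · obtain ⟨z, hz⟩ := h.exists_next_down hx (by linarith)
    exact ⟨_, hz, Or.inr ⟨by simp only; linarith, rfl, rfl⟩⟩
  · obtain ⟨z, hz⟩ := h.exists_next_up hx (by linarith)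
    exact ⟨_, hz, Or.inl ⟨by simp only; linarith, rfl, rfl⟩⟩

/-! ### Injectivity of the successor relation -/

lemma rot_mul_rot : rot * rot = rot⁻¹ := by decide

/-- This is the mixed case of injectivity. The vertex of the common successor is an inner point of a
side of `q` and of a side of `p'`. These sides have different directions, so the half discs of the
two tiles there overlap. -/
lemma HexTiling.not_next_next (h : HexTiling L U T) {p q p' q' : Fin 3 → ℝ}
    {π : Equiv.Perm (Fin 3)} (hf : IsFlag T (p, q, π)) (hf' : IsFlag T (p', q', π * rot))
    (hy : IsFlag T (p, q', π * rot⁻¹)) (h1 : -wt p < wt q) (h2 : wt q' < -wt p') : False := by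
  obtain ⟨hp, hq, hwp, hwq, a0, a1⟩ := hf
  obtain ⟨hp', hq', hwp', hwq', b0, b1⟩ := hf'
  obtain ⟨-, -, -, -, c0, c1⟩ := hy
  simp only [Equiv.Perm.mul_apply, rot_zero, rot_one, rot_two, rot_symm_zero, rot_symm_one,
    rot_symm_two] at *
  have e1 := wt_perm π p
  have e2 := wt_perm π q
  have e3 := wt_perm π p'
  have e4 := wt_perm π q'
  rcases h.up_down hp' hq hwp' hwq π with hh | hh | hh <;> linarith

lemma HexTiling.next_injective (h : HexTiling L U T)
    {x x' y : (Fin 3 → ℝ) × (Fin 3 → ℝ) × Equiv.Perm (Fin 3)} (hx : IsFlag T x)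
    (hx' : IsFlag T x') (hy : IsFlag T y) (h1 : Next x y) (h2 : Next x' y) : x = x' := by
  obtain ⟨p, q, π⟩ := x
  obtain ⟨p', q', π'⟩ := x'
  obtain ⟨r, s, ρ⟩ := y
  rcases h1 with ⟨l1, e1, f1⟩ | ⟨l1, e1, f1⟩ <;> rcases h2 with ⟨l2, e2, f2⟩ | ⟨l2, e2, f2⟩ <;>
    simp only at * <;> subst e1 f1 <;> subst e2
  · obtain rfl := mul_right_cancel f2
    rw [h.flag_unique_up hx hx']
  · exfalso
    have : π' = π * rot := by
      rw [← rot_mul_rot, ← mul_assoc] at f2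
      exact (mul_right_cancel f2).symm
    subst this
    exact h.not_next_next hx hx' hy l1 l2
  · exfalso
    have : π = π' * rot := by
      rw [← rot_mul_rot, ← mul_assoc] at f2
      exact (mul_right_cancel f2)
    subst this
    exact h.not_next_next hx' hx (by rwa [mul_assoc, rot_mul_rot] at hy) l2 l1
  · obtain rfl := mul_right_cancel f2
    rw [h.flag_unique_down hx hx']

/-- The vertex of the flag lies on the boundary of the region. -/
def BdFlag (L U : Fin 3 → ℝ) (x : (Fin 3 → ℝ) × (Fin 3 → ℝ) × Equiv.Perm (Fin 3)) : Prop :=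
  x.1 (x.2.2 1) = L (x.2.2 1) ∨ x.2.1 (x.2.2 2) = U (x.2.2 2)

/-- The vertex of a successor is an inner point of a side of the longer tile, and this tile extends
beyond the vertex towards both boundary lines in question. -/
lemma HexTiling.not_bdFlag_of_next (h : HexTiling L U T)
    {x y : (Fin 3 → ℝ) × (Fin 3 → ℝ) × Equiv.Perm (Fin 3)} (hx : IsFlag T x)
    (hy : IsFlag T y) (hn : Next x y) : ¬ BdFlag L U y := by
  obtain ⟨p, q, π⟩ := x
  obtain ⟨r, s, ρ⟩ := y
  obtain ⟨hp, hq, hwp, hwq, a0, a1⟩ := hx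
  obtain ⟨hr, hs, hwr, hws, b0, b1⟩ := hy
  have e1 := wt_perm π p
  have e2 := wt_perm π q
  rcases hn with ⟨l, e, f⟩ | ⟨l, e, f⟩ <;> simp only at * <;> subst e f <;>
    simp only [BdFlag, Equiv.Perm.mul_apply, rot_zero, rot_one, rot_two, rot_symm_zero,
      rot_symm_one, rot_symm_two, not_or] at *
  · have := h.low q hq (π 0)
    have := h.up q hq (π 1)
    constructor <;> intro hh <;> linarith
  · have := h.low p hp (π 2)
    have := h.up p hp (π 0)
    constructor <;> intro hh <;> linarith

open Classical in
/-- All flags of a tiling. -/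
noncomputable def flags (T : Finset (Fin 3 → ℝ)) :
    Finset ((Fin 3 → ℝ) × (Fin 3 → ℝ) × Equiv.Perm (Fin 3)) :=
  (T ×ˢ T ×ˢ univ).filter (IsFlag T)

lemma mem_flags {x : (Fin 3 → ℝ) × (Fin 3 → ℝ) × Equiv.Perm (Fin 3)} :
    x ∈ flags T ↔ IsFlag T x := by
  classical
  simp only [flags, mem_filter, mem_product, mem_univ, and_true, and_iff_right_iff_imp]
  exact fun h => ⟨h.1, h.2.1⟩

open Classical in
/-- There are at least as many flags with equal sides as flags on the boundary. -/
lemma HexTiling.card_bdFlags_le (h : HexTiling L U T) :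
    ((flags T).filter (BdFlag L U)).card ≤
      ((flags T).filter (fun x => wt x.1 + wt x.2.1 = 0)).card := by
  -- The successor injects the unequal flags into the flags off the boundary; complements in the
  -- finite set of all flags give the claim.
  have h1 : ((flags T).filter (fun x => ¬ wt x.1 + wt x.2.1 = 0)).card ≤
      ((flags T).filter (fun x => ¬ BdFlag L U x)).card := by
    have hex : ∀ x ∈ (flags T).filter (fun x => ¬ wt x.1 + wt x.2.1 = 0),
        ∃ y, IsFlag T y ∧ Next x y := fun x hx => by
      rw [mem_filter, mem_flags] at hx
      exact h.exists_next hx.1 hx.2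
    choose! g hg using hex
    refine card_le_card_of_injOn g (fun x hx => ?_) (fun x hx x' hx' he => ?_)
    · have hg' := hg x hx
      simp only [coe_filter, Set.mem_ofPred_eq, mem_flags] at hx ⊢
      exact ⟨hg'.1, h.not_bdFlag_of_next hx.1 hg'.1 hg'.2⟩
    · have hg1 := hg x hx
      have hg2 := hg x' hx'
      simp only [coe_filter, Set.mem_ofPred_eq, mem_flags] at hx hx'
      rw [← he] at hg2
      exact h.next_injective hx.1 hx'.1 hg1.1 hg1.2 hg2.2
  have h2 := card_filter_add_card_filter_not (s := flags T) (BdFlag L U)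
  have h3 := card_filter_add_card_filter_not (s := flags T) (fun x => wt x.1 + wt x.2.1 = 0)
  omega

end TriTiling

namespace TriTiling

open Finset

variable {L U : Fin 3 → ℝ} {T : Finset (Fin 3 → ℝ)}

/-! ### Pairs of tiles sharing a full side, and the defect -/

open Classical in
/-- Pairs consisting of an up tile and a down tile that share a full side. -/
noncomputable def edges (T : Finset (Fin 3 → ℝ)) : Finset ((Fin 3 → ℝ) × (Fin 3 → ℝ)) :=
  (T ×ˢ T).filter (fun x => 0 < wt x.2 ∧
    ∃ j, ∀ i, x.1 i = x.2 i - if i = j then 0 else wt x.2)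

lemma mem_edges {p q : Fin 3 → ℝ} : (p, q) ∈ edges T ↔ p ∈ T ∧ q ∈ T ∧ 0 < wt q ∧
    ∃ j, ∀ i, p i = q i - if i = j then 0 else wt q := by
  classical
  simp [edges, and_assoc]

lemma wt_of_edge {p q : Fin 3 → ℝ} {j : Fin 3} (h : ∀ i, p i = q i - if i = j then 0 else wt q) :
    wt p = -wt q := by
  have h0 := h 0
  have h1 := h 1
  have h2 := h 2
  have hw : wt q = q 0 + q 1 + q 2 := rfl
  fin_cases j <;> simp at h0 h1 h2 <;> rw [wt] <;> linarith

open Classical in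
lemma card_eqFlags_le :
    ((flags T).filter (fun x => wt x.1 + wt x.2.1 = 0)).card ≤ 2 * (edges T).card := by
  set S := (flags T).filter (fun x => wt x.1 + wt x.2.1 = 0) with hS
  have hkey : ∀ x ∈ S, ∀ i, x.1 i = x.2.1 i - if i = x.2.2 0 then 0 else wt x.2.1 := by
    rintro ⟨p, q, π⟩ hx
    rw [hS, mem_filter, mem_flags] at hx
    obtain ⟨⟨hp, hq, hwp, hwq, h0, h1⟩, h2⟩ := hx
    simp only at *
    have e1 := wt_perm π p
    have e2 := wt_perm π q
    refine (forall_perm π).2 ⟨?_, ?_, ?_⟩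
    · simp [h0]
    · rw [if_neg (by simp)]; linarith
    · rw [if_neg (by simp)]; linarith
  have hpos : ∀ x ∈ S, 0 < wt x.2.1 := fun x hx => by
    rw [hS, mem_filter, mem_flags] at hx
    exact hx.1.2.2.2.1
  have h1 : S.card ≤ 2 * (S.image (fun x => (x.1, x.2.1))).card := by
    refine card_le_mul_card_image _ _ (fun a ha => ?_)
    obtain ⟨y, hy, rfl⟩ := mem_image.1 ha
    -- The two tiles determine the line of their common side, hence `π 0`. Two permutations remain,
    -- one for each end of the side.
    have hsub : (S.filter (fun x => (x.1, x.2.1) = (y.1, y.2.1))) ⊆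
        (univ.filter (fun π : Equiv.Perm (Fin 3) => π 0 = y.2.2 0)).image
          (fun π => (y.1, y.2.1, π)) := by
      intro x hx
      rw [mem_filter] at hx
      obtain ⟨hx, he⟩ := hx
      obtain ⟨e1, e2⟩ := Prod.mk.inj he
      refine mem_image.2 ⟨x.2.2, ?_, by rw [← e1, ← e2]⟩
      simp only [mem_filter, mem_univ, true_and]
      by_contra hne
      have a1 := hkey x hx (x.2.2 0)
      have a2 := hkey y hy (x.2.2 0)
      rw [if_pos rfl] at a1
      rw [if_neg hne, ← e1, ← e2] at a2
      linarith [hpos x hx]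
    refine (card_le_card hsub).trans (card_image_le.trans ?_)
    generalize y.2.2 0 = j
    revert j
    decide
  refine h1.trans (Nat.mul_le_mul_left _ (card_le_card ?_))
  intro x hx
  obtain ⟨y, hy, rfl⟩ := mem_image.1 hx
  have hf := hy
  rw [hS, mem_filter, mem_flags] at hf
  exact mem_edges.2 ⟨hf.1.1, hf.1.2.1, hpos y hy, _, hkey y hy⟩

/-- Two vertices in `A` have at most one common neighbour, so their degrees add up to at most
`B.card + 1`. -/
lemma card_le_of_no_square_aux {α β : Type*} [DecidableEq α] [DecidableEq β] {A : Finset α}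
    {B : Finset β} {R : Finset (α × β)} (hR : R ⊆ A ×ˢ B)
    (hK : ∀ a a' b b', a ≠ a' → b ≠ b' → (a, b) ∈ R → (a, b') ∈ R → (a', b) ∈ R → (a', b') ∉ R)
    (hA : A.card ≤ 2) (hpos : 0 < A.card + B.card) : R.card + 1 ≤ A.card + B.card := by
  have hcard : R.card = ∑ a ∈ A, (B.filter (fun b => (a, b) ∈ R)).card := by
    rw [card_eq_sum_card_fiberwise (f := Prod.fst) (t := A)
      (fun x hx => (mem_product.1 (hR hx)).1)]
    refine sum_congr rfl (fun a _ => ?_)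
    refine card_bij (fun x _ => x.2) ?_ ?_ ?_
    · rintro ⟨a', b⟩ hx
      rw [mem_filter] at hx ⊢
      obtain ⟨hx, rfl⟩ := hx
      exact ⟨(mem_product.1 (hR hx)).2, hx⟩
    · rintro ⟨a1, b1⟩ h1 ⟨a2, b2⟩ h2 rfl
      rw [mem_filter] at h1 h2
      rw [Prod.mk.injEq]
      exact ⟨h1.2.trans h2.2.symm, rfl⟩
    · intro b hb
      rw [mem_filter] at hb
      exact ⟨(a, b), mem_filter.2 ⟨hb.2, rfl⟩, rfl⟩
  interval_cases hc : A.card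
  · rw [card_eq_zero] at hc
    subst hc
    simp at hcard
    simp [hcard] at *
    omega
  · obtain ⟨a, rfl⟩ := card_eq_one.1 hc
    rw [hcard, sum_singleton]
    have := card_filter_le B (fun b => (a, b) ∈ R)
    omega
  · obtain ⟨a, a', hne, rfl⟩ := card_eq_two.1 hc
    rw [hcard, sum_pair hne, ← card_union_add_card_inter]
    have h1 : (B.filter (fun b => (a, b) ∈ R) ∪ B.filter (fun b => (a', b) ∈ R)).card ≤ B.card :=
      card_le_card (union_subset (filter_subset _ _) (filter_subset _ _))
    have h2 : (B.filter (fun b => (a, b) ∈ R) ∩ B.filter (fun b => (a', b) ∈ R)).card ≤ 1 := by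
      rw [card_le_one]
      intro b hb b' hb'
      simp only [mem_inter, mem_filter] at hb hb'
      by_contra hbb
      exact hK a a' b b' hne hbb hb.1.2 hb'.1.2 hb.2.2 hb'.2.2
    omega

/-- With at most five vertices, one side of the bipartite graph has at most two. -/
lemma card_le_of_no_square {α β : Type*} [DecidableEq α] [DecidableEq β] {A : Finset α}
    {B : Finset β} {R : Finset (α × β)} (hR : R ⊆ A ×ˢ B)
    (hK : ∀ a a' b b', a ≠ a' → b ≠ b' → (a, b) ∈ R → (a, b') ∈ R → (a', b) ∈ R → (a', b') ∉ R)
    (hpos : 0 < A.card + B.card) (h5 : A.card + B.card ≤ 5) : R.card + 1 ≤ A.card + B.card := by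
  rcases Nat.lt_or_ge 2 A.card with hA | hA
  · have hinj : Function.Injective (Prod.swap : α × β → β × α) := Prod.swap_injective
    have := card_le_of_no_square_aux (A := B) (B := A) (R := R.image Prod.swap) (by
        intro x hx
        obtain ⟨y, hy, rfl⟩ := mem_image.1 hx
        have := mem_product.1 (hR hy)
        exact mem_product.2 ⟨this.2, this.1⟩) (by
        have hm : ∀ a b, (b, a) ∈ R.image Prod.swap ↔ (a, b) ∈ R := by
          intro a b; simp
        intro b b' a a' hb ha h1 h2 h3
        rw [hm] at *
        exact hK a a' b b' ha hb h1 h3 h2) (by omega) (by omega)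
    rw [card_image_of_injective _ hinj] at this
    omega
  · exact card_le_of_no_square_aux hR hK hA hpos

/-- For tiles of one size, an edge is determined by `q` and the index `j` of the common line. The
difference `p - p'` determines the indices of both edges at a common neighbour, so `p` and `p'` have
only one common neighbour. -/
lemma edges_no_square {p p' q q' : Fin 3 → ℝ} (hp : p ≠ p') (hq : q ≠ q') (hw : wt q = wt q')
    (h1 : (p, q) ∈ edges T) (h2 : (p, q') ∈ edges T) (h3 : (p', q) ∈ edges T) :
    (p', q') ∉ edges T := by
  intro h4
  obtain ⟨-, -, hwq, j1, e1⟩ := mem_edges.1 h1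
  obtain ⟨-, -, hwq', j2, e2⟩ := mem_edges.1 h2
  obtain ⟨-, -, -, j3, e3⟩ := mem_edges.1 h3
  obtain ⟨-, -, -, j4, e4⟩ := mem_edges.1 h4
  rw [← hw] at e2 e4
  have d1 : ∀ i, p i - p' i = (if i = j3 then 0 else wt q) - (if i = j1 then 0 else wt q) :=
    fun i => by rw [e1, e3]; ring
  have d2 : ∀ i, p i - p' i = (if i = j4 then 0 else wt q) - (if i = j2 then 0 else wt q) :=
    fun i => by rw [e2, e4]; ring
  have hne : j1 ≠ j3 := by
    rintro rfl
    exact hp (funext fun i => by have := d1 i; linarith)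
  have hne' : j2 ≠ j4 := by
    rintro rfl
    exact hp (funext fun i => by have := d2 i; linarith)
  have h12 : j1 = j2 := by
    by_contra hcon
    have a := d1 j1
    have b := d2 j1
    rw [if_neg hne, if_pos rfl] at a
    rw [if_neg hcon] at b
    split_ifs at b <;> linarith
  subst h12
  exact hq (funext fun i => by have a := e1 i; have b := e2 i; linarith)

open Classical in
/-- The set of sizes of the tiles. -/
noncomputable def sizes (T : Finset (Fin 3 → ℝ)) : Finset ℝ := T.image (fun p => |wt p|)

/-- The number of tiles minus the number of their sizes. -/
noncomputable def defect (T : Finset (Fin 3 → ℝ)) : ℕ := T.card - (sizes T).card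

/-! ### Behaviour of the defect under removal of tiles -/

lemma card_sizes_le : (sizes T).card ≤ T.card := by
  classical
  exact card_image_le

lemma defect_add_card_sizes : defect T + (sizes T).card = T.card :=
  Nat.sub_add_cancel card_sizes_le

lemma sizes_negTiles (T : Finset (Fin 3 → ℝ)) : sizes (negTiles T) = sizes T := by
  classical
  simp [sizes, negTiles, image_image, Function.comp_def]

lemma defect_negTiles (T : Finset (Fin 3 → ℝ)) : defect (negTiles T) = defect T := by
  rw [defect, defect, card_negTiles, sizes_negTiles]

lemma defect_erase_le [DecidableEq (Fin 3 → ℝ)] {p : Fin 3 → ℝ} (hp : p ∈ T) :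
    defect (T.erase p) ≤ defect T := by
  classical
  have h1 := defect_add_card_sizes (T := T)
  have h2 := defect_add_card_sizes (T := T.erase p)
  have h3 := card_erase_add_one hp
  have h4 : (sizes T).card ≤ (sizes (T.erase p)).card + 1 := by
    have : sizes T = insert |wt p| (sizes (T.erase p)) := by
      conv_lhs => rw [← insert_erase hp]
      rw [sizes, image_insert, sizes]
    rw [this]
    exact card_insert_le _ _
  omega

/-- This is the gain when corner tiles are cut off: a tile whose size occurs again contributes
exactly one to the defect. -/
lemma defect_erase_eq [DecidableEq (Fin 3 → ℝ)] {p q : Fin 3 → ℝ} (hp : p ∈ T) (hq : q ∈ T)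
    (hne : q ≠ p) (hs : |wt q| = |wt p|) : defect T = defect (T.erase p) + 1 := by
  classical
  have h1 := defect_add_card_sizes (T := T)
  have h2 := defect_add_card_sizes (T := T.erase p)
  have h3 := card_erase_add_one hp
  have h4 : sizes T = sizes (T.erase p) := by
    have : sizes T = insert |wt p| (sizes (T.erase p)) := by
      conv_lhs => rw [← insert_erase hp]
      rw [sizes, image_insert, sizes]
    rw [this, insert_eq_of_mem]
    exact mem_image.2 ⟨q, mem_erase.2 ⟨hne, hq⟩, hs⟩
  rw [h4] at h1
  omega

/-- The tiles in `S` contribute only one size altogether. -/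
lemma le_defect_of_class {S : Finset (Fin 3 → ℝ)} (hS : S ⊆ T) {s : ℝ}
    (hs : ∀ p ∈ S, |wt p| = s) : S.card ≤ defect T + 1 := by
  classical
  have h1 := defect_add_card_sizes (T := T)
  have h2 : sizes T ⊆ insert s (sizes (T \ S)) := by
    intro x hx
    obtain ⟨p, hp, rfl⟩ := mem_image.1 hx
    by_cases h : p ∈ S
    · simp [hs p h]
    · exact mem_insert_of_mem (mem_image.2 ⟨p, mem_sdiff.2 ⟨hp, h⟩, rfl⟩)
  have h3 := (card_le_card h2).trans (card_insert_le _ _)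
  have h4 := card_sizes_le (T := T \ S)
  rw [card_sdiff_of_subset hS] at h4
  have := card_le_card hS
  omega

/-- Only tiles of equal size share a full side. A size class of at most five tiles carries a
bipartite graph without 4-cycles, hence a forest, with fewer edges than tiles; summing over the
classes gives the defect. A class of six tiles has defect 5 already. Six tiles around a point, with
six edges, show that the alternative is needed. -/
lemma card_edges_le : (edges T).card ≤ defect T ∨ 5 ≤ defect T := by
  classical
  by_cases hbig : ∃ s, 6 ≤ (T.filter (fun p => |wt p| = s)).card
  · obtain ⟨s, hs⟩ := hbig
    right
    have := le_defect_of_class (T := T) (S := T.filter (fun p => |wt p| = s)) (s := s)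
      (filter_subset _ _) (fun p hp => (mem_filter.1 hp).2)
    omega
  · left
    push Not at hbig
    have hT : T.card = ∑ s ∈ sizes T, (T.filter (fun p => |wt p| = s)).card :=
      card_eq_sum_card_image _ _
    have hE : (edges T).card =
        ∑ s ∈ sizes T, ((edges T).filter (fun x => |wt x.2| = s)).card := by
      refine card_eq_sum_card_fiberwise (fun x hx => ?_)
      exact mem_image.2 ⟨x.2, (mem_edges.1 hx).2.1, rfl⟩
    have hcls : ∀ s ∈ sizes T, ((edges T).filter (fun x => |wt x.2| = s)).card + 1 ≤
        (T.filter (fun p => |wt p| = s)).card := by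
      intro s hs
      obtain ⟨r, hr, hrs⟩ := mem_image.1 hs
      have hsplit := card_filter_add_card_filter_not (s := T.filter (fun p => |wt p| = s))
        (fun p => wt p < 0)
      have hne : 0 < (T.filter (fun p => |wt p| = s)).card :=
        card_pos.2 ⟨r, mem_filter.2 ⟨hr, hrs⟩⟩
      rw [← hsplit]
      refine card_le_of_no_square ?_ ?_ (by omega) (by have := hbig s; omega)
      · rintro ⟨p, q⟩ hx
        obtain ⟨hx, hxs⟩ := mem_filter.1 hx
        obtain ⟨hp, hq, hwq, j, e⟩ := mem_edges.1 hx
        have hw := wt_of_edge e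
        simp only at hxs
        simp only [mem_product, mem_filter, not_lt]
        exact ⟨⟨⟨hp, by rw [hw, abs_neg, hxs]⟩, by linarith⟩, ⟨hq, hxs⟩, hwq.le⟩
      · intro a a' b b' ha hb h1 h2 h3 h4
        rw [mem_filter] at h1 h2 h3 h4
        have w1 := (mem_edges.1 h1.1).2.2.1
        have w2 := (mem_edges.1 h2.1).2.2.1
        have e1 := h1.2
        have e2 := h2.2
        simp only at e1 e2
        rw [abs_of_pos w1] at e1
        rw [abs_of_pos w2] at e2
        exact edges_no_square ha hb (e1.trans e2.symm) h1.1 h2.1 h3.1 h4.1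
    have h1 := sum_le_sum hcls
    rw [sum_add_distrib, ← hE, ← hT, sum_const, smul_eq_mul, mul_one] at h1
    have := defect_add_card_sizes (T := T)
    omega

/-! ### Tiles along the boundary -/

open Classical in
/-- The tiles with a side on the lower boundary line number `j`. -/
noncomputable def lowSide (L : Fin 3 → ℝ) (T : Finset (Fin 3 → ℝ)) (j : Fin 3) :
    Finset (Fin 3 → ℝ) := T.filter (fun p => wt p < 0 ∧ p j = L j)

open Classical in
/-- The tiles with a side on the upper boundary line number `j`. -/
noncomputable def upSide (U : Fin 3 → ℝ) (T : Finset (Fin 3 → ℝ)) (j : Fin 3) :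
    Finset (Fin 3 → ℝ) := T.filter (fun p => 0 < wt p ∧ p j = U j)

lemma mem_lowSide {p : Fin 3 → ℝ} {j : Fin 3} :
    p ∈ lowSide L T j ↔ p ∈ T ∧ wt p < 0 ∧ p j = L j := by simp [lowSide]

lemma mem_upSide {p : Fin 3 → ℝ} {j : Fin 3} :
    p ∈ upSide U T j ↔ p ∈ T ∧ 0 < wt p ∧ p j = U j := by simp [upSide]

lemma mem_lowSide_neg {p : Fin 3 → ℝ} {j : Fin 3} :
    p ∈ lowSide (-U) (negTiles T) j ↔ -p ∈ upSide U T j := by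
  simp [mem_lowSide, mem_upSide, mem_negTiles, neg_eq_iff_eq_neg]

lemma mem_upSide_neg {p : Fin 3 → ℝ} {j : Fin 3} :
    p ∈ upSide (-L) (negTiles T) j ↔ -p ∈ lowSide L T j := by
  simp [mem_lowSide, mem_upSide, mem_negTiles, neg_eq_iff_eq_neg]

lemma lowSide_neg (j : Fin 3) : lowSide (-U) (negTiles T) j = negTiles (upSide U T j) := by
  ext p; rw [mem_lowSide_neg, mem_negTiles]

lemma upSide_neg (j : Fin 3) : upSide (-L) (negTiles T) j = negTiles (lowSide L T j) := by
  ext p; rw [mem_upSide_neg, mem_negTiles]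

/-- The number of incidences of tiles with sides of the region. -/
noncomputable def bdCount (L U : Fin 3 → ℝ) (T : Finset (Fin 3 → ℝ)) : ℕ :=
  ∑ j, ((lowSide L T j).card + (upSide U T j).card)

lemma bdCount_perm (π : Equiv.Perm (Fin 3)) : bdCount L U T =
    (lowSide L T (π 0)).card + (upSide U T (π 0)).card +
    ((lowSide L T (π 1)).card + (upSide U T (π 1)).card) +
    ((lowSide L T (π 2)).card + (upSide U T (π 2)).card) := by
  rw [bdCount, ← Equiv.sum_comp π, Fin.sum_univ_three]

lemma bdCount_neg : bdCount (-U) (-L) (negTiles T) = bdCount L U T := by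
  simp only [bdCount, lowSide_neg, upSide_neg, card_negTiles]
  exact sum_congr rfl fun _ _ => add_comm _ _

lemma sum_perm_apply (i : Fin 3) (f : Fin 3 → ℕ) :
    ∑ π : Equiv.Perm (Fin 3), f (π i) = 2 * ∑ j, f j := by
  have h : ∀ j, (univ.filter (fun π : Equiv.Perm (Fin 3) => π i = j)).card = 2 := by
    revert i; decide
  rw [← sum_fiberwise univ (fun π : Equiv.Perm (Fin 3) => π i), mul_sum]
  refine sum_congr rfl (fun j _ => ?_)
  rw [sum_congr rfl (g := fun _ => f j) (fun π hπ => by rw [(mem_filter.1 hπ).2]), sum_const, h,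
    smul_eq_mul]

/-- At the end of a side on the boundary, the boundary line itself does the blocking. -/
lemma HexTiling.exists_bdFlag_low (h : HexTiling L U T) {p : Fin 3 → ℝ} {π : Equiv.Perm (Fin 3)}
    (hp : p ∈ lowSide L T (π 1)) (hne : p (π 0) ≠ L (π 0)) : ∃ z, IsFlag T (p, z, π) := by
  obtain ⟨hpT, hwp, hpL⟩ := mem_lowSide.1 hp
  refine h.exists_flag_of_blocked hpT hwp π
    (lt_of_le_of_ne (h.low p hpT _).1 (Ne.symm hne)) (fun z hz hwz _ h0 h2 => ?_)
  have := (h.low z hz (π 1)).2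
  have := wt_perm π z
  constructor <;> linarith

lemma HexTiling.exists_bdFlag_up (h : HexTiling L U T) {q : Fin 3 → ℝ} {π : Equiv.Perm (Fin 3)}
    (hq : q ∈ upSide U T (π 2)) (hne : q (π 0) ≠ U (π 0)) : ∃ z, IsFlag T (z, q, π) := by
  have e0 : (Equiv.swap 1 2 : Equiv.Perm (Fin 3)) 0 = 0 := by decide
  have e1 : (Equiv.swap 1 2 : Equiv.Perm (Fin 3)) 1 = 2 := by decide
  obtain ⟨z, hz⟩ := h.neg.exists_bdFlag_low (p := -q) (π := π * Equiv.swap 1 2)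
    (by rw [mem_lowSide_neg, Equiv.Perm.mul_apply, e1, neg_neg]; exact hq)
    (by rw [Equiv.Perm.mul_apply, e0]; simpa using hne)
  refine ⟨-z, ?_⟩
  have := hz.neg
  rw [negTiles_negTiles, neg_neg, mul_assoc, Equiv.swap_mul_self, mul_one] at this
  exact this

-- A tile with a side on the boundary yields a boundary flag at each of the two ends of this side,
-- unless it fills a 60° corner there. Two such tiles yield the same flag only at a 120° corner,
-- where one is up and the other down. Both kinds of exception are charged to the permutation `π`,
-- and each of the six permutations is charged at most once.
open Classical in
lemma HexTiling.two_mul_bdCount_le (h : HexTiling L U T) :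
    2 * bdCount L U T ≤ ((flags T).filter (BdFlag L U)).card + 6 := by
  -- A pair `(p, π)` encodes a boundary side together with one of its ends; `A` collects the up
  -- tiles and `B` the down tiles.
  set A := ((T ×ˢ (univ : Finset (Equiv.Perm (Fin 3)))).filter
    (fun x => x.1 ∈ lowSide L T (x.2 1))) with hA
  set B := ((T ×ˢ (univ : Finset (Equiv.Perm (Fin 3)))).filter
    (fun x => x.1 ∈ upSide U T (x.2 2))) with hB
  have cA : A.card = 2 * ∑ j, (lowSide L T j).card := by
    rw [← sum_perm_apply 1 (fun j => (lowSide L T j).card),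
      card_eq_sum_card_fiberwise (f := Prod.snd) (t := univ) (fun _ _ => mem_coe.2 (mem_univ _))]
    refine sum_congr rfl (fun π _ => ?_)
    refine card_bij (fun x _ => x.1) ?_ ?_ ?_
    · rintro ⟨p, ρ⟩ hx
      simp only [hA, mem_filter, mem_product] at hx
      obtain ⟨⟨-, hx⟩, rfl⟩ := hx
      exact hx
    · rintro ⟨p, ρ⟩ hx ⟨p', ρ'⟩ hx' rfl
      rw [mem_filter] at hx hx'
      rw [Prod.mk.injEq]
      exact ⟨rfl, hx.2.trans hx'.2.symm⟩
    · intro p hp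
      refine ⟨(p, π), ?_, rfl⟩
      simp only [hA, mem_filter, mem_product, mem_univ, and_true]
      exact ⟨(mem_lowSide.1 hp).1, hp⟩
  have cB : B.card = 2 * ∑ j, (upSide U T j).card := by
    rw [← sum_perm_apply 2 (fun j => (upSide U T j).card),
      card_eq_sum_card_fiberwise (f := Prod.snd) (t := univ) (fun _ _ => mem_coe.2 (mem_univ _))]
    refine sum_congr rfl (fun π _ => ?_)
    refine card_bij (fun x _ => x.1) ?_ ?_ ?_
    · rintro ⟨p, ρ⟩ hx
      simp only [hB, mem_filter, mem_product] at hx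
      obtain ⟨⟨-, hx⟩, rfl⟩ := hx
      exact hx
    · rintro ⟨p, ρ⟩ hx ⟨p', ρ'⟩ hx' rfl
      rw [mem_filter] at hx hx'
      rw [Prod.mk.injEq]
      exact ⟨rfl, hx.2.trans hx'.2.symm⟩
    · intro p hp
      refine ⟨(p, π), ?_, rfl⟩
      simp only [hB, mem_filter, mem_product, mem_univ, and_true]
      exact ⟨(mem_upSide.1 hp).1, hp⟩
  have hcard : 2 * bdCount L U T = (A.disjSum B).card := by
    rw [card_disjSum, cA, cB, bdCount, sum_add_distrib]; ring
  set F := (flags T).filter (BdFlag L U) with hF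
  have hcard' : F.card + 6 = (F.disjSum (univ : Finset (Equiv.Perm (Fin 3)))).card := by
    rw [card_disjSum, card_univ, Fintype.card_perm]; rfl
  rw [hcard, hcard']
  have exA : ∀ x ∈ A, ∃ t ∈ F.disjSum (univ : Finset (Equiv.Perm (Fin 3))),
      (∃ z, t = Sum.inl (x.1, z, x.2) ∧ IsFlag T (x.1, z, x.2)) ∨
      (t = Sum.inr x.2 ∧ x.1 (x.2 0) = L (x.2 0)) := by
    rintro ⟨p, π⟩ hx
    simp only [hA, mem_filter, mem_product] at hx
    by_cases hne : p (π 0) = L (π 0)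
    · exact ⟨Sum.inr π, by simp, Or.inr ⟨rfl, hne⟩⟩
    · obtain ⟨z, hz⟩ := h.exists_bdFlag_low hx.2 hne
      refine ⟨Sum.inl (p, z, π), ?_, Or.inl ⟨z, rfl, hz⟩⟩
      rw [inl_mem_disjSum, hF, mem_filter, mem_flags]
      exact ⟨hz, Or.inl (mem_lowSide.1 hx.2).2.2⟩
  have exB : ∀ x ∈ B, ∃ t ∈ F.disjSum (univ : Finset (Equiv.Perm (Fin 3))),
      (∃ z, t = Sum.inl (z, x.1, x.2) ∧ IsFlag T (z, x.1, x.2) ∧ z (x.2 1) ≠ L (x.2 1)) ∨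
      (t = Sum.inr x.2 ∧ (x.1 (x.2 0) = U (x.2 0) ∨
        ∃ z, IsFlag T (z, x.1, x.2) ∧ z (x.2 1) = L (x.2 1))) := by
    rintro ⟨q, π⟩ hx
    simp only [hB, mem_filter, mem_product] at hx
    by_cases hne : q (π 0) = U (π 0)
    · exact ⟨Sum.inr π, by simp, Or.inr ⟨rfl, Or.inl hne⟩⟩
    · obtain ⟨z, hz⟩ := h.exists_bdFlag_up hx.2 hne
      by_cases hzL : z (π 1) = L (π 1)
      · exact ⟨Sum.inr π, by simp, Or.inr ⟨rfl, Or.inr ⟨z, hz, hzL⟩⟩⟩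
      · refine ⟨Sum.inl (z, q, π), ?_, Or.inl ⟨z, rfl, hz, hzL⟩⟩
        rw [inl_mem_disjSum, hF, mem_filter, mem_flags]
        exact ⟨hz, Or.inr (mem_upSide.1 hx.2).2.2⟩
  choose! f hf hf' using exA
  choose! g hg hg' using exB
  have mA : ∀ {p π}, (p, π) ∈ A → p ∈ T ∧ wt p < 0 ∧ p (π 1) = L (π 1) := fun hx => by
    simp only [hA, mem_filter, mem_product] at hx
    exact mem_lowSide.1 hx.2
  have mB : ∀ {p π}, (p, π) ∈ B → p ∈ T ∧ 0 < wt p ∧ p (π 2) = U (π 2) := fun hx => by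
    simp only [hB, mem_filter, mem_product] at hx
    exact mem_upSide.1 hx.2
  -- A flag at a 120° corner is kept for its up tile only. A permutation charged from `A` belongs to
  -- a 60° corner, which is incompatible with a charge from `B`.
  have cross : ∀ x ∈ A, ∀ y ∈ B, f x ≠ g y := by
    rintro ⟨p, π⟩ hx ⟨q, ρ⟩ hy he
    obtain ⟨hp, hwp, hpL⟩ := mA hx
    obtain ⟨hq, hwq, hqU⟩ := mB hy
    rcases hf' _ hx with ⟨z, e1, h1⟩ | ⟨e1, h1⟩ <;>
      rcases hg' _ hy with ⟨z', e2, h2, h3⟩ | ⟨e2, h2⟩ <;> rw [e1, e2] at he <;> simp at he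
    · obtain ⟨rfl, rfl, rfl⟩ := he
      exact h3 hpL
    · subst he
      have w1 := wt_perm π p
      have w2 := wt_perm π q
      have a1 := (h.up p hp (π 2)).2
      have a2 := (h.low q hq (π 1)).2
      have a3 := (h.low q hq (π 0)).2
      have a4 := (h.up p hp (π 0)).2
      simp only at h1 h2
      rcases h2 with h2 | ⟨z, ⟨-, -, hwz, -, b0, b1⟩, h3⟩
      · linarith
      · simp only at *
        linarith
  refine card_le_card_of_injOn (Sum.elim f g) ?_ ?_
  · rintro (x | x) hx
    · exact hf x (by simpa using hx)
    · exact hg x (by simpa using hx)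
  · rintro (⟨p, π⟩ | ⟨p, π⟩) hx (⟨q, ρ⟩ | ⟨q, ρ⟩) hy he <;>
      simp only [mem_coe, inl_mem_disjSum, inr_mem_disjSum, Sum.elim_inl, Sum.elim_inr] at hx hy he
    · obtain ⟨hp, hwp, hpL⟩ := mA hx
      obtain ⟨hq, hwq, hqL⟩ := mA hy
      rcases hf' _ hx with ⟨z, e1, h1⟩ | ⟨e1, h1⟩ <;>
        rcases hf' _ hy with ⟨z', e2, h2⟩ | ⟨e2, h2⟩ <;> rw [e1, e2] at he <;> simp at he
      · obtain ⟨rfl, -, rfl⟩ := he; rfl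
      · subst he
        simp only at h1 h2
        rw [h.eq_of_up_two hp hq hwp hwq π (by rw [h1, h2]) (by rw [hpL, hqL])]
    · exact absurd he (cross _ hx _ hy)
    · exact absurd he.symm (cross _ hy _ hx)
    · obtain ⟨hp, hwp, hpL⟩ := mB hx
      obtain ⟨hq, hwq, hqL⟩ := mB hy
      have e0 : (Equiv.swap 1 2 : Equiv.Perm (Fin 3)) 0 = 0 := by decide
      have e1' : (Equiv.swap 1 2 : Equiv.Perm (Fin 3)) 1 = 2 := by decide
      rcases hg' _ hx with ⟨z, e1, h1, h3⟩ | ⟨e1, h1⟩ <;>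
        rcases hg' _ hy with ⟨z', e2, h2, h4⟩ | ⟨e2, h2⟩ <;> rw [e1, e2] at he <;> simp at he
      · obtain ⟨-, rfl, rfl⟩ := he; rfl
      · subst he
        have w1 := wt_perm π p
        have w2 := wt_perm π q
        have a1 := (h.low p hp (π 1)).2
        have a2 := (h.low q hq (π 1)).2
        have a3 := (h.up p hp (π 0)).1
        have a4 := (h.up q hq (π 0)).1
        have : p (π 0) = q (π 0) := by
          rcases h1 with h1 | ⟨z, ⟨-, -, hwz, -, b0, b1⟩, h3⟩ <;>
            rcases h2 with h2 | ⟨z', ⟨-, -, hwz', -, b0', b1'⟩, h4⟩ <;> simp only at * <;> linarith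
        rw [h.eq_of_down_two hp hq hwp hwq (π * Equiv.swap 1 2)
          (by rw [Equiv.Perm.mul_apply, e0, this])
          (by rw [Equiv.Perm.mul_apply, e1', hpL, hqL])]

/-- The number of boundary incidences bounds the defect from below. -/
lemma HexTiling.bdCount_le (h : HexTiling L U T) : bdCount L U T ≤ defect T + 3 ∨ 5 ≤ defect T := by
  classical
  -- Twice the incidences, minus 6, are at most the boundary flags, hence at most the equal flags,
  -- hence at most twice the shared sides, hence at most twice the defect.
  have h1 := h.two_mul_bdCount_le
  have h2 := h.card_bdFlags_le
  have h3 := card_eqFlags_le (T := T)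
  rcases card_edges_le (T := T) with h4 | h4
  · left; omega
  · right; exact h4

end TriTiling

namespace TriTiling

open Finset MeasureTheory

variable {L U : Fin 3 → ℝ} {T : Finset (Fin 3 → ℝ)}

/-! ### Lengths along lines -/

/-- The length of the lower side number `j`. -/
def lowLen (L U : Fin 3 → ℝ) (j : Fin 3) : ℝ := L j + wt U - U j

/-- The length of the upper side number `j`. -/
def upLen (L U : Fin 3 → ℝ) (j : Fin 3) : ℝ := L j - wt L - U j

lemma lowLen_perm (π : Equiv.Perm (Fin 3)) :
    lowLen L U (π 0) = L (π 0) + U (π 1) + U (π 2) ∧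
    lowLen L U (π 1) = U (π 0) + L (π 1) + U (π 2) ∧
    lowLen L U (π 2) = U (π 0) + U (π 1) + L (π 2) := by
  simp only [lowLen, wt_perm π U]
  refine ⟨?_, ?_, ?_⟩ <;> ring

lemma upLen_perm (π : Equiv.Perm (Fin 3)) :
    upLen L U (π 0) = -(U (π 0) + L (π 1) + L (π 2)) ∧
    upLen L U (π 1) = -(L (π 0) + U (π 1) + L (π 2)) ∧
    upLen L U (π 2) = -(L (π 0) + L (π 1) + U (π 2)) := by
  simp only [upLen, wt_perm π L]
  refine ⟨?_, ?_, ?_⟩ <;> ring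

/-- All six lines bounding the region touch it. -/
structure Tight (L U : Fin 3 → ℝ) : Prop where
  low_nonneg : ∀ j, 0 ≤ lowLen L U j
  up_nonneg : ∀ j, 0 ≤ upLen L U j

lemma lowLen_neg (j : Fin 3) : lowLen (-U) (-L) j = upLen L U j := by
  simp only [lowLen, upLen, wt_neg, Pi.neg_apply]; ring

lemma upLen_neg (j : Fin 3) : upLen (-U) (-L) j = lowLen L U j := by
  simp only [lowLen, upLen, wt_neg, Pi.neg_apply]; ring

lemma Tight.neg (h : Tight L U) : Tight (-U) (-L) :=
  ⟨fun j => by rw [lowLen_neg]; exact h.up_nonneg j, fun j => by rw [upLen_neg]; exact h.low_nonneg j⟩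

/-- The germ points just above the line. At a point on no other side line, the tile found there
either has the point inside its side on this line or contains it in its interior. -/
lemma HexTiling.line_up (h : HexTiling L U T) (π : Equiv.Perm (Fin 3)) {c t : ℝ}
    (hc : L (π 0) ≤ c) (hc' : c < U (π 0)) (h1 : L (π 1) < t) (h1' : t < U (π 1))
    (h2 : L (π 2) < -c - t) (h2' : -c - t < U (π 2))
    (ht : ∀ z ∈ T, z (π 1) ≠ t ∧ z (π 2) ≠ -c - t) :
    ∃ z ∈ T, (wt z < 0 ∧ z (π 0) = c ∧ t ∈ Set.Ioo (z (π 1)) (z (π 1) - wt z)) ∨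
      (wt z < 0 ∧ z (π 0) < c ∧ z (π 1) < t ∧ z (π 2) < -c - t) ∨
      (0 < wt z ∧ c < z (π 0) ∧ t < z (π 1) ∧ -c - t < z (π 2)) := by
  obtain ⟨z, hz, hh⟩ := h.exists_germ (v := vec π c t (-c - t)) (d := vec π 2 (-1) (-1))
    (by rw [wt_vec]; ring) (by rw [wt_vec]; norm_num)
    ((forall_perm π).2 (by
      simp only [vec_zero, vec_one, vec_two]
      refine ⟨⟨?_, ?_⟩, ⟨?_, ?_⟩, ⟨?_, ?_⟩⟩ <;> linarith))
    ((forall_perm π).2 (by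
      simp only [vec_zero, vec_one, vec_two]
      refine ⟨⟨?_, ?_⟩, ⟨?_, ?_⟩, ⟨?_, ?_⟩⟩ <;> intro _ <;> linarith))
  have hw := wt_perm π z
  have hg := ht z hz
  refine ⟨z, hz, ?_⟩
  rcases hh with ⟨hwz, hh⟩ | ⟨hwz, hh⟩
  · obtain ⟨⟨a0, -⟩, ⟨a1, -⟩, ⟨a2, -⟩⟩ := (forall_perm π).1 hh
    simp only [vec_zero, vec_one, vec_two] at a0 a1 a2
    have b1 := lt_of_le_of_ne a1 hg.1
    have b2 := lt_of_le_of_ne a2 hg.2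
    rcases a0.lt_or_eq with b0 | b0
    · exact Or.inr (Or.inl ⟨hwz, b0, b1, b2⟩)
    · exact Or.inl ⟨hwz, b0, b1, by linarith⟩
  · obtain ⟨⟨a0, a0'⟩, ⟨a1, -⟩, ⟨a2, -⟩⟩ := (forall_perm π).1 hh
    simp only [vec_zero, vec_one, vec_two] at a0 a0' a1 a2
    exact Or.inr (Or.inr ⟨hwz, lt_of_le_of_ne a0 (fun e => by linarith [a0' e]),
      lt_of_le_of_ne a1 hg.1.symm, lt_of_le_of_ne a2 hg.2.symm⟩)

/-- A point inside a side of one tile cannot be interior to another tile. -/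
lemma HexTiling.line_disjoint (h : HexTiling L U T) (π : Equiv.Perm (Fin 3)) {c t : ℝ}
    {p z : Fin 3 → ℝ} (hp : p ∈ T) (hz : z ∈ T) (hwp : wt p < 0) (hpc : p (π 0) = c)
    (hpt : t ∈ Set.Ioo (p (π 1)) (p (π 1) - wt p))
    (hh : (wt z < 0 ∧ z (π 0) < c ∧ z (π 1) < t ∧ z (π 2) < -c - t) ∨
      (0 < wt z ∧ c < z (π 0) ∧ t < z (π 1) ∧ -c - t < z (π 2))) : False := by
  have hw := wt_perm π p
  obtain ⟨h1, h2⟩ := hpt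
  rcases hh with ⟨hwz, a0, a1, a2⟩ | ⟨hwz, a0, a1, a2⟩
  · have := h.eq_of_up hp hz hwp hwz π (by
      have m0 : max (p (π 0)) (z (π 0)) ≤ c := max_le hpc.le a0.le
      have m1 : max (p (π 1)) (z (π 1)) < t := max_lt h1 a1
      have m2 : max (p (π 2)) (z (π 2)) < -c - t := max_lt (by linarith) a2
      linarith)
    rw [this] at hpc
    linarith
  · rcases h.up_down hp hz hwp hwz π with hh | hh | hh <;> linarith

/-- Up tiles whose sides overlap on a common line overlap themselves, so the lengths add. -/
lemma HexTiling.volume_up (h : HexTiling L U T) (π : Equiv.Perm (Fin 3)) (c : ℝ)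
    {S : Finset (Fin 3 → ℝ)} (hS : ∀ p ∈ S, p ∈ T ∧ wt p < 0 ∧ p (π 0) = c) :
    volume (⋃ p ∈ S, Set.Ioo (p (π 1)) (p (π 1) - wt p)) = ENNReal.ofReal (∑ p ∈ S, -wt p) := by
  rw [measure_biUnion_finset]
  · rw [ENNReal.ofReal_sum_of_nonneg (fun p hp => by linarith [(hS p hp).2.1])]
    refine sum_congr rfl (fun p _ => ?_)
    rw [Real.volume_Ioo]
    congr 1
    ring
  · intro p hp q hq hne
    rw [Function.onFun, Set.disjoint_left]
    intro t h1 h2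
    obtain ⟨hpT, hwp, hp0⟩ := hS p hp
    obtain ⟨hqT, hwq, hq0⟩ := hS q hq
    have e1 := wt_perm π p
    have e2 := wt_perm π q
    refine hne (h.eq_of_up hpT hqT hwp hwq π ?_)
    have m0 : max (p (π 0)) (q (π 0)) ≤ c := max_le hp0.le hq0.le
    have m1 : max (p (π 1)) (q (π 1)) < t := max_lt h1.1 h2.1
    have m2 : max (p (π 2)) (q (π 2)) < -c - t := max_lt (by linarith [h1.2]) (by linarith [h2.2])
    linarith
  · exact fun p _ => measurableSet_Ioo

lemma generic_null (T : Finset (Fin 3 → ℝ)) (π : Equiv.Perm (Fin 3)) (c : ℝ) :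
    volume {t : ℝ | ¬ ∀ z ∈ T, z (π 1) ≠ t ∧ z (π 2) ≠ -c - t} = 0 := by
  have hfin : {t : ℝ | ¬ ∀ z ∈ T, z (π 1) ≠ t ∧ z (π 2) ≠ -c - t}.Finite := by
    refine ((T.finite_toSet.image (fun z => z (π 1))).union
      (T.finite_toSet.image (fun z => -c - z (π 2)))).subset ?_
    intro t ht
    simp only [Set.mem_ofPred_eq] at ht
    push Not at ht
    obtain ⟨z, hz, hh⟩ := ht
    by_cases he : z (π 1) = t
    · exact Or.inl ⟨z, hz, he⟩
    · exact Or.inr ⟨z, hz, by simp only; rw [hh he]; ring⟩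
  exact hfin.measure_zero _

/-- The sizes of the tiles along a lower side add up to its length. -/
lemma HexTiling.sum_lowSide (h : HexTiling L U T) (ht : Tight L U) (hne : ∀ j, L j < U j)
    (j : Fin 3) : ∑ p ∈ lowSide L T j, -wt p = lowLen L U j := by
  obtain ⟨π, rfl⟩ : ∃ π : Equiv.Perm (Fin 3), π 0 = j := ⟨Equiv.swap 0 j, by simp⟩
  have t0 := (lowLen_perm (L := L) (U := U) π).1
  have t1 := (upLen_perm (L := L) (U := U) π).2.1
  have t2 := (upLen_perm (L := L) (U := U) π).2.2
  have s1 := ht.up_nonneg (π 1)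
  have s2 := ht.up_nonneg (π 2)
  have hS : ∀ p ∈ lowSide L T (π 0), p ∈ T ∧ wt p < 0 ∧ p (π 0) = L (π 0) :=
    fun p hp => mem_lowSide.1 hp
  have hv := h.volume_up π (L (π 0)) hS
  have hle : volume (⋃ p ∈ lowSide L T (π 0), Set.Ioo (p (π 1)) (p (π 1) - wt p)) ≤
      volume (Set.Ioo (-L (π 0) - U (π 2)) (U (π 1))) := by
    refine measure_mono (Set.iUnion₂_subset fun p hp => Set.Ioo_subset_Ioo ?_ ?_)
    · have := (h.up p (hS p hp).1 (π 2)).2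
      have := wt_perm π p
      linarith [(hS p hp).2.2]
    · exact (h.up p (hS p hp).1 (π 1)).2
  -- Apart from finitely many points of the side, `line_up` places a tile along it: the other two
  -- alternatives would cross the boundary line.
  have hge : volume (Set.Ioo (-L (π 0) - U (π 2)) (U (π 1))) ≤
      volume (⋃ p ∈ lowSide L T (π 0), Set.Ioo (p (π 1)) (p (π 1) - wt p)) := by
    have hsub : Set.Ioo (-L (π 0) - U (π 2)) (U (π 1)) ⊆
        (⋃ p ∈ lowSide L T (π 0), Set.Ioo (p (π 1)) (p (π 1) - wt p)) ∪
        {t : ℝ | ¬ ∀ z ∈ T, z (π 1) ≠ t ∧ z (π 2) ≠ -L (π 0) - t} := by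
      intro t ⟨ht1, ht2⟩
      by_cases hg : ∀ z ∈ T, z (π 1) ≠ t ∧ z (π 2) ≠ -L (π 0) - t
      · left
        obtain ⟨z, hz, hh⟩ := h.line_up π le_rfl (hne _) (by linarith) ht2 (by linarith)
          (by linarith) hg
        rcases hh with ⟨hwz, h0, hm⟩ | ⟨hwz, h0, -⟩ | ⟨hwz, h0, h1, h2⟩
        · exact Set.mem_iUnion₂.2 ⟨z, mem_lowSide.2 ⟨hz, hwz, h0⟩, hm⟩
        · linarith [(h.low z hz (π 0)).1]
        · have := (h.low z hz (π 0)).2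
          have := wt_perm π z
          linarith
      · exact Or.inr hg
    refine (measure_mono hsub).trans ((measure_union_le _ _).trans ?_)
    rw [generic_null, add_zero]
  have := le_antisymm hle hge
  rw [hv, Real.volume_Ioo, ENNReal.ofReal_eq_ofReal_iff
    (sum_nonneg fun p hp => by linarith [(hS p hp).2.1]) (by linarith [ht.low_nonneg (π 0)])] at this
  rw [this, t0]
  ring

lemma sum_neg_upSide (j : Fin 3) :
    ∑ p ∈ lowSide (-U) (negTiles T) j, -wt p = ∑ p ∈ upSide U T j, wt p := by
  classical
  rw [lowSide_neg, negTiles, sum_image (fun _ _ _ _ h => neg_injective h)]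
  simp

/-- The sizes of the tiles along an upper side add up to its length. -/
lemma HexTiling.sum_upSide (h : HexTiling L U T) (ht : Tight L U) (hne : ∀ j, L j < U j)
    (j : Fin 3) : ∑ p ∈ upSide U T j, wt p = upLen L U j := by
  rw [← sum_neg_upSide, h.neg.sum_lowSide ht.neg (fun j => neg_lt_neg (hne j)), lowLen_neg]

open Classical in
/-- On each line through the interior, the up tiles and the down tiles have the same total size. -/
lemma HexTiling.balance_le (h : HexTiling L U T) (j : Fin 3) {c : ℝ}
    (hc : L j < c) (hc' : c < U j) :
    ∑ p ∈ T.filter (fun p => wt p < 0 ∧ p j = c), -wt p ≤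
      ∑ p ∈ T.filter (fun p => 0 < wt p ∧ p j = c), wt p := by
  obtain ⟨π, rfl⟩ : ∃ π : Equiv.Perm (Fin 3), π 0 = j := ⟨Equiv.swap 0 j, by simp⟩
  set A := T.filter (fun p => wt p < 0 ∧ p (π 0) = c) with hA
  set B := T.filter (fun p => 0 < wt p ∧ p (π 0) = c) with hB
  have hSA : ∀ p ∈ A, p ∈ T ∧ wt p < 0 ∧ p (π 0) = c := fun p hp => by
    simpa [hA] using hp
  have hSB : ∀ p ∈ B, p ∈ T ∧ 0 < wt p ∧ p (π 0) = c := fun p hp => by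
    simpa [hB] using hp
  have vA := h.volume_up π c hSA
  have hle : volume (⋃ p ∈ A, Set.Ioo (p (π 1)) (p (π 1) - wt p)) ≤
      volume (⋃ p ∈ B, Set.Ioo (p (π 1) - wt p) (p (π 1))) := by
    have hsub : (⋃ p ∈ A, Set.Ioo (p (π 1)) (p (π 1) - wt p)) ⊆
        (⋃ p ∈ B, Set.Ioo (p (π 1) - wt p) (p (π 1))) ∪
        {t : ℝ | ¬ ∀ z ∈ T, z (π 1) ≠ t ∧ z (π 2) ≠ -c - t} := by
      intro t ht
      by_cases hg : ∀ z ∈ T, z (π 1) ≠ t ∧ z (π 2) ≠ -c - t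
      · left
        obtain ⟨p, hp, hpt⟩ := Set.mem_iUnion₂.1 ht
        obtain ⟨hpT, hwp, hp0⟩ := hSA p hp
        have ew := wt_perm π p
        -- The reflected tiling shows the tiles just below the line; `line_disjoint` leaves only
        -- down tiles with a side on it.
        obtain ⟨z, hz, hh⟩ := h.neg.line_up π (c := -c) (t := -t) (by simp; linarith)
          (by simp; linarith) (by simp; linarith [hpt.2, (h.up p hpT (π 1)).2])
          (by simp; linarith [hpt.1, (h.low p hpT (π 1)).1])
          (by simp; linarith [hpt.1, (h.up p hpT (π 2)).2])
          (by simp; linarith [hpt.2, (h.low p hpT (π 2)).1])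
          (fun z hz => by
            have := hg _ (mem_negTiles.1 hz)
            simp only [Pi.neg_apply, ne_eq, neg_eq_iff_eq_neg] at this
            refine ⟨this.1, fun e => this.2 (by rw [e]; ring)⟩)
        have hzT := mem_negTiles.1 hz
        rcases hh with ⟨hwz, h0, hm⟩ | hh
        · refine Set.mem_iUnion₂.2 ⟨-z, ?_, ?_⟩
          · simp only [hB, mem_filter, wt_neg, Pi.neg_apply]
            exact ⟨hzT, by linarith, by rw [h0]; ring⟩
          · simp only [Pi.neg_apply, wt_neg]
            constructor <;> linarith [hm.1, hm.2]
        · exfalso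
          refine h.line_disjoint π hpT hzT hwp hp0 hpt ?_
          simp only [Pi.neg_apply, wt_neg]
          rcases hh with ⟨a, b, c, d⟩ | ⟨a, b, c, d⟩
          · right; refine ⟨?_, ?_, ?_, ?_⟩ <;> linarith
          · left; refine ⟨?_, ?_, ?_, ?_⟩ <;> linarith
      · exact Or.inr hg
    refine (measure_mono hsub).trans ((measure_union_le _ _).trans ?_)
    rw [generic_null, add_zero]
  rw [vA] at hle
  have hle' : volume (⋃ p ∈ B, Set.Ioo (p (π 1) - wt p) (p (π 1))) ≤
      ENNReal.ofReal (∑ p ∈ B, wt p) := by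
    refine (measure_biUnion_finset_le _ _).trans ?_
    rw [ENNReal.ofReal_sum_of_nonneg (fun p hp => (hSB p hp).2.1.le)]
    refine sum_le_sum (fun p _ => ?_)
    rw [Real.volume_Ioo]
    simp
  exact (ENNReal.ofReal_le_ofReal_iff (sum_nonneg fun p hp => (hSB p hp).2.1.le)).1 (hle.trans hle')

/-- The reflected tiling supplies the reverse inequality. These linear equations for the sizes
settle the hexagons with eight tiles. -/
lemma HexTiling.balance (h : HexTiling L U T) (j : Fin 3) {c : ℝ}
    (hc : L j < c) (hc' : c < U j) : ∑ p ∈ T, (if p j = c then wt p else 0) = 0 := by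
  classical
  have h1 := h.balance_le j hc hc'
  have h2 := h.neg.balance_le j (c := -c) (neg_lt_neg hc') (neg_lt_neg hc)
  have e1 : ∑ p ∈ (negTiles T).filter (fun p => wt p < 0 ∧ p j = -c), -wt p =
      ∑ p ∈ T.filter (fun p => 0 < wt p ∧ p j = c), wt p := by
    rw [sum_filter, sum_filter, negTiles, sum_image (fun _ _ _ _ h => neg_injective h)]
    simp
  have e2 : ∑ p ∈ (negTiles T).filter (fun p => 0 < wt p ∧ p j = -c), wt p =
      ∑ p ∈ T.filter (fun p => wt p < 0 ∧ p j = c), -wt p := by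
    rw [sum_filter, sum_filter, negTiles, sum_image (fun _ _ _ _ h => neg_injective h)]
    simp
  rw [e1, e2] at h2
  have h3 := le_antisymm h1 h2
  have e3 : ∑ p ∈ T, (if p j = c then wt p else 0) =
      ∑ p ∈ T.filter (fun p => 0 < wt p ∧ p j = c), wt p -
      ∑ p ∈ T.filter (fun p => wt p < 0 ∧ p j = c), -wt p := by
    rw [sum_filter, sum_filter, ← sum_sub_distrib]
    refine sum_congr rfl (fun p hp => ?_)
    by_cases hpc : p j = c
    · rcases lt_or_gt_of_ne (h.wt_ne p hp) with hw | hw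
      · simp [hpc, hw, hw.le]
      · simp [hpc, hw, not_lt.2 hw.le]
    · simp [hpc]
  rw [e3, h3, sub_self]

end TriTiling

namespace TriTiling

open Finset

variable {L U : Fin 3 → ℝ} {T : Finset (Fin 3 → ℝ)}

/-! ### Tilings of tight regions and removal of corner tiles -/

/-- A nonempty tiling of a region all of whose bounding lines are tight. -/
structure TightTiling (L U : Fin 3 → ℝ) (T : Finset (Fin 3 → ℝ)) : Prop extends
    HexTiling L U T, Tight L U where
  nonempty : T.Nonempty

lemma TightTiling.neg (h : TightTiling L U T) : TightTiling (-U) (-L) (negTiles T) :=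
  ⟨h.toHexTiling.neg, h.toTight.neg, by
    obtain ⟨p, hp⟩ := h.nonempty
    exact ⟨-p, by simpa [mem_negTiles] using hp⟩⟩

lemma TightTiling.lt (h : TightTiling L U T) (j : Fin 3) : L j < U j := by
  obtain ⟨p, hp⟩ := h.nonempty
  have h1 := h.low p hp j
  have h2 := h.up p hp j
  rcases lt_or_gt_of_ne (h.wt_ne p hp) with hw | hw <;> linarith

/-- Opposite sides differ by the same amount in all three directions, which ties the six lengths
together. -/
lemma low_sub_up (j : Fin 3) : lowLen L U j - upLen L U j = wt L + wt U := by
  rw [lowLen, upLen]; ring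

lemma TightTiling.sum_low (h : TightTiling L U T) (j : Fin 3) :
    ∑ p ∈ lowSide L T j, -wt p = lowLen L U j :=
  h.toHexTiling.sum_lowSide h.toTight h.lt j

lemma TightTiling.sum_up (h : TightTiling L U T) (j : Fin 3) :
    ∑ p ∈ upSide U T j, wt p = upLen L U j :=
  h.toHexTiling.sum_upSide h.toTight h.lt j

/-! ### Sums of positive lengths with few terms -/

section Sums

variable {α : Type*} {S : Finset α} {f : α → ℝ} {l : ℝ}

lemma card_pos_of_sum (hs : ∑ p ∈ S, f p = l) (hl : 0 < l) : 1 ≤ S.card := by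
  rw [Nat.one_le_iff_ne_zero]
  intro h
  rw [card_eq_zero] at h
  subst h
  simp at hs
  linarith

lemma le_of_sum (hf : ∀ p ∈ S, 0 < f p) (hs : ∑ p ∈ S, f p = l) {p : α} (hp : p ∈ S) : f p ≤ l :=
  hs ▸ single_le_sum (f := f) (fun q hq => (hf q hq).le) hp

lemma eq_of_sum (hs : ∑ p ∈ S, f p = l) {p : α} (hp : p ∈ S) (h1 : S.card = 1) : f p = l := by
  obtain ⟨a, rfl⟩ := card_eq_one.1 h1
  obtain rfl := mem_singleton.1 hp
  simpa using hs

lemma two_le_of_sum (hf : ∀ p ∈ S, 0 < f p) (hs : ∑ p ∈ S, f p = l) {p q : α} (hp : p ∈ S)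
    (hq : q ∈ S) (hne : p ≠ q) : f p + f q ≤ l := by
  classical
  have : ({p, q} : Finset α) ⊆ S := by
    intro x hx
    rcases mem_insert.1 hx with rfl | hx
    · exact hp
    · rwa [mem_singleton.1 hx]
  rw [← sum_pair hne, ← hs]
  exact sum_le_sum_of_subset_of_nonneg this fun i hi _ => (hf i hi).le

lemma lt_of_sum (hf : ∀ p ∈ S, 0 < f p) (hs : ∑ p ∈ S, f p = l) {p : α} (hp : p ∈ S)
    (h2 : 2 ≤ S.card) : f p < l := by
  obtain ⟨q, hq, hne⟩ := exists_mem_ne h2 p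
  linarith [two_le_of_sum hf hs hp hq hne.symm, hf q hq]

lemma eq_two_of_sum (hs : ∑ p ∈ S, f p = l) {p q : α} (hp : p ∈ S)
    (hq : q ∈ S) (hne : p ≠ q) (h2 : S.card = 2) : f p + f q = l := by
  classical
  have : ({p, q} : Finset α) = S := by
    refine eq_of_subset_of_card_le ?_ (by rw [card_pair hne, h2])
    intro x hx
    rcases mem_insert.1 hx with rfl | hx
    · exact hp
    · rwa [mem_singleton.1 hx]
  rw [← sum_pair hne, this, hs]

lemma lt_two_of_sum (hf : ∀ p ∈ S, 0 < f p) (hs : ∑ p ∈ S, f p = l) {p q : α} (hp : p ∈ S)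
    (hq : q ∈ S) (hne : p ≠ q) (h3 : 3 ≤ S.card) : f p + f q < l := by
  classical
  have hsub : ({p, q} : Finset α) ⊆ S := by
    intro x hx
    rcases mem_insert.1 hx with rfl | hx
    · exact hp
    · rwa [mem_singleton.1 hx]
  have hpos : 0 < (S \ {p, q}).card := by
    rw [card_sdiff_of_subset hsub, card_pair hne]; omega
  obtain ⟨r, hr⟩ := card_pos.1 hpos
  rw [← sum_pair hne, ← hs]
  have hr' := mem_sdiff.1 hr
  exact sum_lt_sum_of_subset hsub hr'.1 hr'.2 (hf r hr'.1) fun i hi _ => (hf i hi).le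

end Sums

lemma pos_low {j : Fin 3} : ∀ p ∈ lowSide L T j, 0 < -wt p := fun p hp => by
  linarith [(mem_lowSide.1 hp).2.1]

lemma pos_up {j : Fin 3} : ∀ p ∈ upSide U T j, 0 < wt p := fun _ hp => (mem_upSide.1 hp).2.1

/-- At a 60° corner there is an up tile filling the corner. -/
lemma TightTiling.exists_up_corner (h : TightTiling L U T) (π : Equiv.Perm (Fin 3))
    (h0 : upLen L U (π 0) = 0) : ∃ p ∈ T, wt p < 0 ∧ p (π 1) = L (π 1) ∧ p (π 2) = L (π 2) := by
  rw [(upLen_perm π).1] at h0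
  have l0 := h.lt (π 0)
  have l1 := h.lt (π 1)
  have l2 := h.lt (π 2)
  -- As the upper side has length zero, the two lower lines and this upper line meet in one point;
  -- `(-2, 1, 1)` bisects the 60° corner there.
  obtain ⟨z, hz, hh⟩ := h.exists_germ (v := vec π (U (π 0)) (L (π 1)) (L (π 2)))
    (d := vec π (-2) 1 1) (by rw [wt_vec]; linarith) (by rw [wt_vec]; norm_num)
    ((forall_perm π).2 (by
      simp only [vec_zero, vec_one, vec_two]
      refine ⟨⟨?_, ?_⟩, ⟨?_, ?_⟩, ⟨?_, ?_⟩⟩ <;> linarith))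
    ((forall_perm π).2 (by
      simp only [vec_zero, vec_one, vec_two]
      refine ⟨⟨?_, ?_⟩, ⟨?_, ?_⟩, ⟨?_, ?_⟩⟩ <;> intro _ <;> linarith))
  have hw := wt_perm π z
  have z1 := h.low z hz (π 1)
  have z2 := h.low z hz (π 2)
  have z0 := h.up z hz (π 0)
  rcases hh with ⟨hwz, hh⟩ | ⟨hwz, hh⟩
  · obtain ⟨⟨a0, -⟩, ⟨a1, -⟩, ⟨a2, -⟩⟩ := (forall_perm π).1 hh
    simp only [vec_one, vec_two] at a1 a2
    exact ⟨z, hz, hwz, le_antisymm a1 z1.1, le_antisymm a2 z2.1⟩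
  · exfalso
    obtain ⟨⟨a0, -⟩, ⟨a1, a1'⟩, ⟨a2, -⟩⟩ := (forall_perm π).1 hh
    simp only [vec_zero, vec_one, vec_two] at a0 a1 a1' a2
    have := lt_of_le_of_ne a1 (fun e => by linarith [a1' e])
    linarith

lemma TightTiling.exists_down_corner (h : TightTiling L U T) (π : Equiv.Perm (Fin 3))
    (h0 : lowLen L U (π 0) = 0) : ∃ p ∈ T, 0 < wt p ∧ p (π 1) = U (π 1) ∧ p (π 2) = U (π 2) := by
  obtain ⟨p, hp, hw, h1, h2⟩ := h.neg.exists_up_corner π (by rw [upLen_neg]; exact h0)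
  refine ⟨-p, mem_negTiles.1 hp, by simpa using hw, ?_, ?_⟩ <;> simp [h1, h2]

-- The tile `p` fills the part of the region beyond the line `f (π 0) = p (π 0)`. Every other tile
-- is disjoint from `p` and so lies on the near side of this line, which becomes the new upper
-- bound.
open Classical in
lemma HexTiling.erase_up_corner (h : HexTiling L U T) (π : Equiv.Perm (Fin 3)) {p q : Fin 3 → ℝ}
    (hp : p ∈ T) (hwp : wt p < 0) (h1 : p (π 1) = L (π 1)) (h2 : p (π 2) = L (π 2)) (hq : q ∈ T)
    (hqp : q ≠ p) : HexTiling L (vec π (p (π 0)) (U (π 1)) (U (π 2))) (T.erase p) := by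
  have hle : ∀ z ∈ T, z ≠ p → z (π 0) ≤ p (π 0) ∧ z (π 0) - wt z ≤ p (π 0) := by
    intro z hz hne
    have e := wt_perm π z
    have e1 := h.low z hz (π 1)
    have e2 := h.low z hz (π 2)
    rcases lt_or_gt_of_ne (h.wt_ne z hz) with hwz | hwz
    · have := (h.apart p hp z hz hne.symm).up_up hwp hwz π
      rw [max_eq_right (h1.trans_le e1.1), max_eq_right (h2.trans_le e2.1)] at this
      rcases max_choice (p (π 0)) (z (π 0)) with hm | hm <;> rw [hm] at this
      · constructor <;> linarith
      · linarith
    · rcases h.up_down hp hz hwp hwz π with hh | hh | hh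
      · constructor <;> linarith
      · linarith
      · linarith
  refine ⟨fun z hz => h.wt_ne z (mem_of_mem_erase hz), fun z hz => h.low z (mem_of_mem_erase hz),
    fun z hz => ?_, fun f hf hj => ?_, fun z hz z' hz' => h.apart z (mem_of_mem_erase hz) z'
      (mem_of_mem_erase hz')⟩
  · obtain ⟨hne, hz⟩ := mem_erase.1 hz
    refine (forall_perm π).2 ?_
    simp only [vec_zero, vec_one, vec_two]
    exact ⟨hle z hz hne, h.up z hz _, h.up z hz _⟩
  · obtain ⟨⟨a0, b0⟩, ⟨a1, b1⟩, ⟨a2, b2⟩⟩ := (forall_perm π).1 hj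
    simp only [vec_zero, vec_one, vec_two] at b0 b1 b2
    have hg : ∀ j, L j ≤ q j - wt q / 3 ∧ q j - wt q / 3 ≤ U j := fun j => by
      have := h.low q hq j
      have := h.up q hq j
      constructor <;> linarith
    have hg0 : q (π 0) - wt q / 3 < p (π 0) := by
      have := hle q hq hqp
      rcases lt_or_gt_of_ne (h.wt_ne q hq) with hw | hw <;> linarith
    have hpU := (h.up p hp (π 0)).1
    -- Points on the cut may belong to `p` as well, so the germ towards the centre of `q` is used;
    -- it leads away from `p`.
    obtain ⟨z, hz, hh⟩ := h.exists_germ (v := f) (d := fun j => q j - wt q / 3 - f j) hf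
      (by simp only [wt] at *; linarith)
      ((forall_perm π).2 ⟨⟨a0, b0.trans hpU⟩, ⟨a1, b1⟩, ⟨a2, b2⟩⟩)
      (fun j => ⟨fun e => by linarith [(hg j).1], fun e => by linarith [(hg j).2]⟩)
    refine ⟨z, mem_erase.2 ⟨?_, hz⟩, ?_⟩
    · rintro rfl
      rcases hh with ⟨-, hh⟩ | ⟨hw, -⟩
      · have := (hh (π 0)).2 (le_antisymm (hh (π 0)).1 b0)
        linarith [(hh (π 0)).1]
      · linarith
    · rcases hh with ⟨hw, hh⟩ | ⟨hw, hh⟩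
      · exact Or.inl ⟨hw, fun j => (hh j).1⟩
      · exact Or.inr ⟨hw, fun j => (hh j).1⟩

-- The tile `q` keeps the rest nonempty. All six new lengths are recorded, since the next cuts
-- depend on which of them vanish.
open Classical in
lemma TightTiling.erase_up_corner (h : TightTiling L U T) (π : Equiv.Perm (Fin 3))
    {p q : Fin 3 → ℝ} (hp : p ∈ T) (hwp : wt p < 0) (h1 : p (π 1) = L (π 1))
    (h2 : p (π 2) = L (π 2)) (hq : q ∈ T) (hqp : q ≠ p) :
    ∃ U', TightTiling L U' (T.erase p) ∧
      (lowLen L U' (π 0) = lowLen L U (π 0) ∧ lowLen L U' (π 1) = lowLen L U (π 1) + wt p ∧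
        lowLen L U' (π 2) = lowLen L U (π 2) + wt p) ∧
      (upLen L U' (π 0) = -wt p ∧ upLen L U' (π 1) = upLen L U (π 1) ∧
        upLen L U' (π 2) = upLen L U (π 2)) ∧
      U' (π 0) = p (π 0) ∧ U' (π 1) = U (π 1) ∧ U' (π 2) = U (π 2) := by
  set U' := vec π (p (π 0)) (U (π 1)) (U (π 2)) with hU'
  have hw := wt_perm π p
  have a := lowLen_perm (L := L) (U := U) π
  have b := upLen_perm (L := L) (U := U) π
  have a' := lowLen_perm (L := L) (U := U') π
  have b' := upLen_perm (L := L) (U := U') π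
  simp only [hU', vec_zero, vec_one, vec_two] at a' b'
  rw [← hU'] at a' b'
  have hB0 : upLen L U (π 0) = 0 := by
    refine le_antisymm ?_ (h.up_nonneg _)
    have := (h.up p hp (π 0)).2
    linarith [b.1]
  have hl1 : -wt p ≤ lowLen L U (π 1) :=
    le_of_sum pos_low (h.sum_low _) (mem_lowSide.2 ⟨hp, hwp, h1⟩)
  have hl2 : -wt p ≤ lowLen L U (π 2) :=
    le_of_sum pos_low (h.sum_low _) (mem_lowSide.2 ⟨hp, hwp, h2⟩)
  have hA : lowLen L U' (π 0) = lowLen L U (π 0) ∧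
      lowLen L U' (π 1) = lowLen L U (π 1) + wt p ∧
      lowLen L U' (π 2) = lowLen L U (π 2) + wt p := by
    refine ⟨?_, ?_, ?_⟩ <;> linarith [a.1, a.2.1, a.2.2, a'.1, a'.2.1, a'.2.2, b.1]
  have hB : upLen L U' (π 0) = -wt p ∧ upLen L U' (π 1) = upLen L U (π 1) ∧
      upLen L U' (π 2) = upLen L U (π 2) := by
    refine ⟨?_, ?_, ?_⟩ <;> linarith [b.1, b.2.1, b.2.2, b'.1, b'.2.1, b'.2.2]
  refine ⟨U', ⟨h.toHexTiling.erase_up_corner π hp hwp h1 h2 hq hqp, ⟨?_, ?_⟩,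
    ⟨q, mem_erase.2 ⟨hqp, hq⟩⟩⟩, hA, hB, by simp [hU']⟩
  · refine (forall_perm π).2 ⟨?_, ?_, ?_⟩ <;> linarith [h.low_nonneg (π 0), hA.1, hA.2.1, hA.2.2]
  · refine (forall_perm π).2 ⟨?_, ?_, ?_⟩ <;>
      linarith [h.up_nonneg (π 1), h.up_nonneg (π 2), hB.1, hB.2.1, hB.2.2]

open Classical in
lemma negTiles_erase {p : Fin 3 → ℝ} : negTiles ((negTiles T).erase (-p)) = T.erase p := by
  ext z
  simp [mem_negTiles, mem_erase]

open Classical in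
lemma TightTiling.erase_down_corner (h : TightTiling L U T) (π : Equiv.Perm (Fin 3))
    {p q : Fin 3 → ℝ} (hp : p ∈ T) (hwp : 0 < wt p) (h1 : p (π 1) = U (π 1))
    (h2 : p (π 2) = U (π 2)) (hq : q ∈ T) (hqp : q ≠ p) :
    ∃ L', TightTiling L' U (T.erase p) ∧
      (upLen L' U (π 0) = upLen L U (π 0) ∧ upLen L' U (π 1) = upLen L U (π 1) - wt p ∧
        upLen L' U (π 2) = upLen L U (π 2) - wt p) ∧
      (lowLen L' U (π 0) = wt p ∧ lowLen L' U (π 1) = lowLen L U (π 1) ∧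
        lowLen L' U (π 2) = lowLen L U (π 2)) ∧
      L' (π 0) = p (π 0) ∧ L' (π 1) = L (π 1) ∧ L' (π 2) = L (π 2) := by
  obtain ⟨U', hT, ⟨a0, a1, a2⟩, ⟨b0, b1, b2⟩, c0, c1, c2⟩ := h.neg.erase_up_corner π (p := -p)
    (q := -q) (by simpa [mem_negTiles] using hp) (by simpa using hwp) (by simp [h1]) (by simp [h2])
    (by simpa [mem_negTiles] using hq) (by simpa using hqp)
  have hT' := hT.neg
  rw [neg_neg, negTiles_erase] at hT'
  have e1 : ∀ j, lowLen (-U) U' j = upLen (-U') U j := fun j => by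
    rw [← lowLen_neg, neg_neg]
  have e2 : ∀ j, upLen (-U) U' j = lowLen (-U') U j := fun j => by
    rw [← upLen_neg, neg_neg]
  simp only [e1, e2, lowLen_neg, upLen_neg, wt_neg, neg_neg, Pi.neg_apply, ← sub_eq_add_neg] at *
  refine ⟨-U', hT', ⟨a0, a1, a2⟩, ⟨b0, b1, b2⟩, ?_, ?_, ?_⟩ <;> simp [c0, c1, c2]

/-! ### Lower bounds for the defect -/

lemma TightTiling.defect_lt (h : TightTiling L U T) : defect T < T.card := by
  classical
  have h1 := defect_add_card_sizes (T := T)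
  have h2 : 0 < (sizes T).card := card_pos.2 (h.nonempty.image _)
  omega

lemma TightTiling.low_card_pos (h : TightTiling L U T) {j : Fin 3} (hj : 0 < lowLen L U j) :
    1 ≤ (lowSide L T j).card := card_pos_of_sum (h.sum_low j) hj

lemma TightTiling.up_card_pos (h : TightTiling L U T) {j : Fin 3} (hj : 0 < upLen L U j) :
    1 ≤ (upSide U T j).card := card_pos_of_sum (h.sum_up j) hj

lemma HexTiling.eq_singleton (h : HexTiling L U T) (hL : L ∈ T) (hw : wt L < 0) : T = {L} := by
  refine eq_singleton_iff_unique_mem.2 ⟨hL, fun q hq => ?_⟩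
  have e0 := h.low q hq 0
  have e1 := h.low q hq 1
  have e2 := h.low q hq 2
  rcases lt_or_gt_of_ne (h.wt_ne q hq) with hwq | hwq
  · refine (h.eq_of_up hL hq hw hwq 1 ?_).symm
    simp only [Equiv.Perm.coe_one, id_eq]
    rw [max_eq_right e0.1, max_eq_right e1.1, max_eq_right e2.1]
    exact hwq
  · rcases h.up_down hL hq hw hwq 1 with hh | hh | hh <;>
      simp only [Equiv.Perm.coe_one, id_eq] at hh <;> linarith

/-- A tile lying in two corners of the triangle is the whole triangle. -/
lemma TightTiling.triangle_side (h : TightTiling L U T) (hB : ∀ j, upLen L U j = 0)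
    (π : Equiv.Perm (Fin 3)) (hT : T.card ≠ 1) {c c' : Fin 3 → ℝ} (hc : c ∈ T) (hwc : wt c < 0)
    (c1 : c (π 1) = L (π 1)) (c2 : c (π 2) = L (π 2)) (c0' : c' (π 0) = L (π 0)) : c ≠ c' := by
  rintro rfl
  have : c = L := ext_perm π c0' c1 c2
  subst this
  exact hT (by rw [h.toHexTiling.eq_singleton hc hwc, card_singleton])

/-- A triangle tiled by more than one tile has defect at least 3. -/
lemma TightTiling.triangle_sides (h : TightTiling L U T) (hB : ∀ j, upLen L U j = 0)
    (hT : T.card ≠ 1) (j : Fin 3) : 2 ≤ (lowSide L T j).card := by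
  obtain ⟨π, rfl⟩ : ∃ π : Equiv.Perm (Fin 3), π 2 = j := ⟨Equiv.swap 2 j, by simp⟩
  obtain ⟨c, hc, hwc, c1, c2⟩ := h.exists_up_corner π (hB _)
  obtain ⟨c', hc', hwc', c2', c0'⟩ := h.exists_up_corner (π * rot) (hB _)
  simp only [Equiv.Perm.mul_apply, rot_one, rot_two] at c2' c0'
  have hne := h.triangle_side hB π hT hc hwc c1 c2 c0'
  exact one_lt_card.2 ⟨c, mem_lowSide.2 ⟨hc, hwc, c2⟩, c', mem_lowSide.2 ⟨hc', hwc', c2'⟩, hne⟩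

/-- Each side has different tiles at its two ends. This gives six incidences, and `bdCount_le` turns
them into a defect of at least 3. -/
lemma TightTiling.triangle_basic (h : TightTiling L U T) (hB : ∀ j, upLen L U j = 0) :
    T.card = 1 ∨ 3 ≤ defect T := by
  by_cases hT : T.card = 1
  · exact Or.inl hT
  right
  have h0 := h.triangle_sides hB hT
  have h3 := bdCount_perm (L := L) (U := U) (T := T) 1
  have := h0 ((1 : Equiv.Perm (Fin 3)) 0)
  have := h0 ((1 : Equiv.Perm (Fin 3)) 1)
  have := h0 ((1 : Equiv.Perm (Fin 3)) 2)
  rcases h.toHexTiling.bdCount_le with hh | hh <;> omega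

lemma TightTiling.triangle_basic_down (h : TightTiling L U T) (hA : ∀ j, lowLen L U j = 0) :
    T.card = 1 ∨ 3 ≤ defect T := by
  have := h.neg.triangle_basic (fun j => by rw [upLen_neg, hA])
  rwa [card_negTiles, defect_negTiles] at this

end TriTiling

namespace TriTiling

/-! ### Parallelograms and trapezoids -/

open Finset

variable {L U : Fin 3 → ℝ} {T : Finset (Fin 3 → ℝ)}

lemma TightTiling.triangle_sides_down (h : TightTiling L U T) (hA : ∀ j, lowLen L U j = 0)
    (hT : T.card ≠ 1) (j : Fin 3) : 2 ≤ (upSide U T j).card := by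
  have := h.neg.triangle_sides (fun j => by rw [upLen_neg, hA]) (by rwa [card_negTiles]) j
  rwa [lowSide_neg, card_negTiles] at this

/-- The tile `c` fills both sides at its corner, so a down triangle remains. The tile `e` has the
full side length of that triangle and therefore fills it. -/
lemma TightTiling.parallelogram_full (h : TightTiling L U T) (π : Equiv.Perm (Fin 3))
    (hA2 : lowLen L U (π 2) = 0) {c e : Fin 3 → ℝ} (hc : c ∈ T)
    (hwc : wt c < 0) (c0 : c (π 0) = L (π 0)) (c1 : c (π 1) = L (π 1)) (he : e ∈ T)
    (hwe : 0 < wt e) (e0 : e (π 0) = U (π 0))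
    (h0 : -wt c = lowLen L U (π 0)) (h1 : -wt c = lowLen L U (π 1)) (h2 : wt e = upLen L U (π 0)) :
    T.card = 2 := by
  classical
  have hne : e ≠ c := by rintro rfl; linarith
  obtain ⟨U', hT, hA', hB', hU'⟩ := h.erase_up_corner (π * rot⁻¹) hc hwc
    (by simp only [Equiv.Perm.mul_apply, rot_symm_one]; exact c0) (by simp only [Equiv.Perm.mul_apply, rot_symm_two]; exact c1) he hne
  simp only [Equiv.Perm.mul_apply, rot_symm_zero, rot_symm_one, rot_symm_two] at hA' hB' hU'
  have hz : ∀ j, lowLen L U' j = 0 := (forall_perm π).2 ⟨by linarith [hA'.2.1],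
    by linarith [hA'.2.2], by linarith [hA'.1]⟩
  have h3 : (T.erase c).card = 1 := by
    by_contra hcon
    have h4 := hT.triangle_sides_down hz hcon (π 0)
    have h5 := lt_of_sum pos_up (hT.sum_up (π 0)) (p := e)
      (mem_upSide.2 ⟨mem_erase.2 ⟨hne, he⟩, hwe, by rw [e0, hU'.2.1]⟩) h4
    linarith [hB'.2.1]
  have := card_erase_add_one hc
  omega

/-- Four sides give at least four incidences. If the defect is at most 2, there are at most five, so
three of the sides consist of one tile each; then the tiles in the two 60° corners fill the
parallelogram. -/
lemma TightTiling.parallelogram_basic (h : TightTiling L U T) (π : Equiv.Perm (Fin 3))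
    (hA2 : lowLen L U (π 2) = 0) (hB2 : upLen L U (π 2) = 0) :
    (T.card = 2 ∨ 3 ≤ defect T) ∧ 1 ≤ defect T := by
  have d0 := low_sub_up (L := L) (U := U) (π 0)
  have d1 := low_sub_up (L := L) (U := U) (π 1)
  have d2 := low_sub_up (L := L) (U := U) (π 2)
  have a := lowLen_perm (L := L) (U := U) π
  have b := upLen_perm (L := L) (U := U) π
  have l0 := h.lt (π 0)
  have l1 := h.lt (π 1)
  have pA0 : 0 < lowLen L U (π 0) := by linarith [a.1, b.2.2]
  have pA1 : 0 < lowLen L U (π 1) := by linarith [a.2.1, b.2.2]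
  obtain ⟨c, hc, hwc, c0, c1⟩ := h.exists_up_corner (π * rot⁻¹)
    (by simp only [Equiv.Perm.mul_apply, rot_symm_zero]; exact hB2)
  obtain ⟨e, he, hwe, e0, e1⟩ := h.exists_down_corner (π * rot⁻¹)
    (by simp only [Equiv.Perm.mul_apply, rot_symm_zero]; exact hA2)
  simp only [Equiv.Perm.mul_apply, rot_symm_one, rot_symm_two] at c0 c1 e0 e1
  have k1 := h.low_card_pos pA0
  have k2 := h.low_card_pos pA1
  have k3 := h.up_card_pos (j := π 0) (by linarith)
  have k4 := h.up_card_pos (j := π 1) (by linarith)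
  have hM := bdCount_perm (L := L) (U := U) (T := T) π
  refine ⟨?_, by rcases h.bdCount_le with hh | hh <;> omega⟩
  by_cases hD : 3 ≤ defect T
  · exact Or.inr hD
  left
  have hM5 : bdCount L U T ≤ 5 := by rcases h.bdCount_le with hh | hh <;> omega
  have mc0 := mem_lowSide.2 ⟨hc, hwc, c0⟩
  have mc1 := mem_lowSide.2 ⟨hc, hwc, c1⟩
  have me0 := mem_upSide.2 ⟨he, hwe, e0⟩
  have me1 := mem_upSide.2 ⟨he, hwe, e1⟩
  have f1 := fun hh => eq_of_sum (h.sum_low (π 0)) mc0 hh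
  have f2 := fun hh => eq_of_sum (h.sum_low (π 1)) mc1 hh
  have f3 := fun hh => eq_of_sum (h.sum_up (π 0)) me0 hh
  have f4 := fun hh => eq_of_sum (h.sum_up (π 1)) me1 hh
  have hcases : ((lowSide L T (π 0)).card = 1 ∧ (lowSide L T (π 1)).card = 1 ∧
      ((upSide U T (π 0)).card = 1 ∨ (upSide U T (π 1)).card = 1)) ∨
      ((upSide U T (π 0)).card = 1 ∧ (upSide U T (π 1)).card = 1 ∧
      ((lowSide L T (π 0)).card = 1 ∨ (lowSide L T (π 1)).card = 1)) := by omega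
  have hall : -wt c = lowLen L U (π 0) ∧ -wt c = lowLen L U (π 1) ∧
      wt e = upLen L U (π 0) := by
    rcases hcases with ⟨h1, h2, h3 | h3⟩ | ⟨h1, h2, h3 | h3⟩
    · exact ⟨f1 h1, f2 h2, f3 h3⟩
    · exact ⟨f1 h1, f2 h2, by linarith [f1 h1, f2 h2, f4 h3]⟩
    · refine ⟨f1 h3, ?_, f3 h1⟩; linarith [f3 h1, f4 h2, f1 h3]
    · refine ⟨?_, f2 h3, f3 h1⟩; linarith [f3 h1, f4 h2, f2 h3]
  exact h.parallelogram_full π hA2 hc hwc c0 c1 he hwe e0 hall.1 hall.2.1 hall.2.2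

/-- Here `c` fills a leg, and `c` and `c'` fill the long base. After both are cut off, a down tile
`q` filling the short base sits in a new corner. Comparing lengths, `q` and `c'` have the same size,
which gains one, and a parallelogram remains after cutting off `q`. -/
lemma TightTiling.trapezoid_leg (h : TightTiling L U T) (π : Equiv.Perm (Fin 3))
    (hB0 : upLen L U (π 0) = 0) (hB1 : upLen L U (π 1) = 0)
    (hB2 : 0 < upLen L U (π 2)) (hD : 3 ≤ defect T)
    (m1 : (lowSide L T (π 1)).card = 1) (m0 : 2 ≤ (lowSide L T (π 0)).card)
    (m2 : (lowSide L T (π 2)).card = 2) (k2 : (upSide U T (π 2)).card = 1) :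
    (T.card = 5 ∧ 3 ≤ defect T) ∨ (6 ≤ T.card ∧ 4 ≤ defect T) := by
  classical
  have d0 := low_sub_up (L := L) (U := U) (π 0)
  have d1 := low_sub_up (L := L) (U := U) (π 1)
  have d2 := low_sub_up (L := L) (U := U) (π 2)
  obtain ⟨c, hc, hwc, c1, c2⟩ := h.exists_up_corner π hB0
  obtain ⟨c', hc', hwc', c2', c0'⟩ := h.exists_up_corner (π * rot)
    (by simpa [rot_zero] using hB1)
  simp only [Equiv.Perm.mul_apply, rot_one, rot_two] at c2' c0'
  have s1 := eq_of_sum (h.sum_low (π 1)) (mem_lowSide.2 ⟨hc, hwc, c1⟩) m1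
  have s0 := lt_of_sum pos_low (h.sum_low (π 0)) (mem_lowSide.2 ⟨hc', hwc', c0'⟩) m0
  have hne : c' ≠ c := by rintro rfl; linarith
  have s2 := eq_two_of_sum (h.sum_low (π 2)) (mem_lowSide.2 ⟨hc, hwc, c2⟩)
    (mem_lowSide.2 ⟨hc', hwc', c2'⟩) hne.symm m2
  obtain ⟨U1, h1, a1, b1, u1⟩ := h.erase_up_corner π hc hwc c1 c2 hc' hne
  have hc1 : c' ∈ T.erase c := mem_erase.2 ⟨hne, hc'⟩
  obtain ⟨r, hr⟩ := card_pos.1 (h1.up_card_pos (j := π 2) (by linarith [b1.2.2]))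
  have hr' := mem_upSide.1 hr
  obtain ⟨U2, h2, a2, b2, u2⟩ := h1.erase_up_corner (π * rot) hc1 hwc'
    (by simpa [rot_one] using c2') (by simpa [rot_two] using c0') (q := r) hr'.1
    (by rintro rfl; linarith [hr'.2.1])
  simp only [Equiv.Perm.mul_apply, rot_zero, rot_one, rot_two] at a2 b2 u2
  obtain ⟨q, hq, hwq, q2, q0⟩ := h2.exists_down_corner (π * rot)
    (by simp only [Equiv.Perm.mul_apply, rot_zero]; linarith [a1.2.1, a2.1])
  simp only [Equiv.Perm.mul_apply, rot_one, rot_two] at q2 q0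
  have hqT1 := mem_of_mem_erase hq
  have hqT := mem_of_mem_erase hqT1
  have sq := eq_of_sum (h.sum_up (π 2)) (p := q)
    (mem_upSide.2 ⟨hqT, hwq, by rw [q2, u2.2.1, u1.2.2]⟩) k2
  have hq0 : q ∈ upSide U2 ((T.erase c).erase c') (π 0) := mem_upSide.2 ⟨hq, hwq, q0⟩
  obtain ⟨r', hr1, hr2⟩ : ∃ r' ∈ upSide U2 ((T.erase c).erase c') (π 0), r' ≠ q := by
    refine exists_mem_ne ?_ q
    by_contra hcon
    have h3 := card_pos.2 ⟨q, hq0⟩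
    have := eq_of_sum (h2.sum_up (π 0)) hq0 (by omega)
    linarith [b2.2.2, b1.1]
  obtain ⟨L3, h3, b3, a3, -⟩ := h2.erase_down_corner (π * rot) hq hwq
    (by simpa [rot_one] using q2) (by simpa [rot_two] using q0) (mem_upSide.1 hr1).1 hr2
  simp only [Equiv.Perm.mul_apply, rot_zero, rot_one, rot_two] at a3 b3
  have hP := h3.parallelogram_basic π (by linarith [a3.2.1, a2.2.1, a1.2.2])
    (by linarith [b3.2.1, b2.2.1, b1.2.2])
  have e1 := card_erase_add_one hc
  have e2 := card_erase_add_one hc1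
  have e3 := card_erase_add_one hq
  have f1 := defect_erase_le hc
  have f2 := defect_erase_eq hc1 (q := q) hqT1 (by rintro rfl; linarith)
    (by rw [abs_of_pos hwq, abs_of_neg hwc']; linarith)
  have f3 := defect_erase_le hq
  have f4 := h3.defect_lt
  rcases hP.1 with hP | hP
  · left; omega
  · right; omega

/-- The defect of a tiling of a trapezoid. -/
lemma TightTiling.trapezoid (h : TightTiling L U T) (π : Equiv.Perm (Fin 3))
    (hB0 : upLen L U (π 0) = 0) (hB1 : upLen L U (π 1) = 0)
    (hB2 : 0 < upLen L U (π 2)) :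
    (T.card = 3 ∧ 2 ≤ defect T) ∨ (T.card = 5 ∧ 3 ≤ defect T) ∨
      (6 ≤ T.card ∧ 4 ≤ defect T) := by
  classical
  have d0 := low_sub_up (L := L) (U := U) (π 0)
  have d1 := low_sub_up (L := L) (U := U) (π 1)
  have d2 := low_sub_up (L := L) (U := U) (π 2)
  have a := lowLen_perm (L := L) (U := U) π
  have b := upLen_perm (L := L) (U := U) π
  have hlt := h.defect_lt
  obtain ⟨c, hc, hwc, c1, c2⟩ := h.exists_up_corner π hB0
  obtain ⟨c', hc', hwc', c2', c0'⟩ := h.exists_up_corner (π * rot)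
    (by simpa [rot_zero] using hB1)
  simp only [Equiv.Perm.mul_apply, rot_one, rot_two] at c2' c0'
  have hne : c' ≠ c := by
    rintro rfl
    have := wt_perm π c'
    have := (h.up c' hc' (π 2)).2
    linarith [b.2.2]
  have mc1 := mem_lowSide.2 ⟨hc, hwc, c1⟩
  have mc2 := mem_lowSide.2 ⟨hc, hwc, c2⟩
  have mc0' := mem_lowSide.2 ⟨hc', hwc', c0'⟩
  have mc2' := mem_lowSide.2 ⟨hc', hwc', c2'⟩
  have n0 := card_pos.2 ⟨c', mc0'⟩
  have n1 := card_pos.2 ⟨c, mc1⟩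
  have n2 : 2 ≤ (lowSide L T (π 2)).card := one_lt_card.2 ⟨c', mc2', c, mc2, hne⟩
  have k2 := h.up_card_pos hB2
  have hM := bdCount_perm (L := L) (U := U) (T := T) π
  by_cases hD : 4 ≤ defect T
  · omega
  have hM6 : bdCount L U T ≤ defect T + 3 := by rcases h.bdCount_le with hh | hh <;> omega
  have n3 : (lowSide L T (π 2)).card = 2 ∨ (3 ≤ (lowSide L T (π 2)).card ∧
    (lowSide L T (π 0)).card = 1 ∧ (lowSide L T (π 1)).card = 1 ∧ (upSide U T (π 2)).card = 1) := by
    omega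
  rcases n3 with n3 | ⟨n3, m0, m1, k2'⟩
  swap
  -- Both legs are single tiles, and the long base is longer than two of them together. The tile
  -- filling the short base would then be taller than the trapezoid.
  · exfalso
    have s0 := eq_of_sum (h.sum_low _) mc0' m0
    have s1 := eq_of_sum (h.sum_low _) mc1 m1
    have s2 := lt_two_of_sum pos_low (h.sum_low _) mc2 mc2' hne.symm n3
    obtain ⟨q, hq⟩ := card_pos.1 (show 0 < (upSide U T (π 2)).card by omega)
    have sq := eq_of_sum (h.sum_up _) hq k2'
    have hq' := mem_upSide.1 hq
    have := (h.low q hq'.1 (π 2)).2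
    linarith [b.1, b.2.1, b.2.2, a.1, a.2.1, a.2.2, hq'.2.2]
  have s2 := eq_two_of_sum (h.sum_low _) mc2 mc2' hne.symm n3
  by_cases m1 : (lowSide L T (π 1)).card = 1
  · by_cases m0 : (lowSide L T (π 0)).card = 1
    -- Both legs are single tiles of equal size; cutting them off uses up the long base and leaves a
    -- down triangle.
    · have s0 := eq_of_sum (h.sum_low _) mc0' m0
      have s1 := eq_of_sum (h.sum_low _) mc1 m1
      obtain ⟨U1, h1, a1, b1, u1⟩ := h.erase_up_corner π hc hwc c1 c2 hc' hne
      have hc1 : c' ∈ T.erase c := mem_erase.2 ⟨hne, hc'⟩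
      obtain ⟨r, hr⟩ := card_pos.1 (h1.up_card_pos (j := π 2) (by linarith [b1.2.2]))
      have hr' := mem_upSide.1 hr
      obtain ⟨U2, h2, a2, b2, u2⟩ := h1.erase_up_corner (π * rot) hc1 hwc'
        (by simpa [rot_one] using c2') (by simpa [rot_two] using c0') (q := r) hr'.1
        (by rintro rfl; linarith [hr'.2.1])
      simp only [Equiv.Perm.mul_apply, rot_zero, rot_one, rot_two] at a2 b2
      have h3 := h2.triangle_basic_down ((forall_perm π).2 ⟨by linarith [a2.2.2, a1.1],
        by linarith [a2.1, a1.2.1], by linarith [a2.2.1, a1.2.2]⟩)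
      have e1 := card_erase_add_one hc
      have e2 := card_erase_add_one hc1
      have f1 := defect_erase_eq hc hc' hne
        (by rw [abs_of_neg hwc, abs_of_neg hwc']; linarith)
      have f2 := defect_erase_le hc1
      rcases h3 with h3 | h3 <;> omega
    · have := h.trapezoid_leg π hB0 hB1 hB2 (by omega) m1 (by omega) n3 (by omega)
      omega
  · have e0 : (Equiv.swap 0 1 : Equiv.Perm (Fin 3)) 0 = 1 := by decide
    have e1 : (Equiv.swap 0 1 : Equiv.Perm (Fin 3)) 1 = 0 := by decide
    have e2 : (Equiv.swap 0 1 : Equiv.Perm (Fin 3)) 2 = 2 := by decide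
    have := h.trapezoid_leg (π * Equiv.swap 0 1) (by simpa [e0] using hB1) (by simpa [e1] using hB0)
      (by simpa [e2] using hB2) (by omega) (by simp only [Equiv.Perm.mul_apply, e1]; omega)
      (by simp only [Equiv.Perm.mul_apply, e0]; omega) (by simp only [Equiv.Perm.mul_apply, e2]; omega)
      (by simp only [Equiv.Perm.mul_apply, e2]; omega)
    omega

end TriTiling

namespace TriTiling

/-! ### Triangles and pentagons -/

open Finset

variable {L U : Fin 3 → ℝ} {T : Finset (Fin 3 → ℝ)}

/-- The tile `c` lies in the corner common to the two sides, and each side is completed by one more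
tile. So `c'` and `e` are equal, and cutting off `c'` gains one and leaves a trapezoid. -/
lemma TightTiling.triangle_of_two (h : TightTiling L U T) (hB : ∀ j, upLen L U j = 0)
    (π : Equiv.Perm (Fin 3)) (m1 : (lowSide L T (π 1)).card = 2)
    (m2 : (lowSide L T (π 2)).card = 2) :
    (T.card = 4 ∧ 3 ≤ defect T) ∨ (T.card = 6 ∧ 4 ≤ defect T) ∨ (7 ≤ T.card ∧ 5 ≤ defect T) := by
  classical
  have hT : T.card ≠ 1 := by
    have : (lowSide L T (π 1)).card ≤ T.card := card_le_card fun p hp => (mem_lowSide.1 hp).1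
    omega
  have d1 := low_sub_up (L := L) (U := U) (π 1)
  have d2 := low_sub_up (L := L) (U := U) (π 2)
  have b1 := hB (π 1)
  have b2 := hB (π 2)
  obtain ⟨c, hc, hwc, c1, c2⟩ := h.exists_up_corner π (hB _)
  obtain ⟨c', hc', hwc', c2', c0'⟩ := h.exists_up_corner (π * rot) (hB _)
  obtain ⟨e, he, hwe, e0, e1⟩ := h.exists_up_corner (π * rot⁻¹) (hB _)
  simp only [Equiv.Perm.mul_apply, rot_one, rot_two, rot_symm_one, rot_symm_two] at c2' c0' e0 e1
  have hcc' : c ≠ c' := h.triangle_side hB π hT hc hwc c1 c2 c0'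
  have hce : c ≠ e := h.triangle_side hB π hT hc hwc c1 c2 e0
  have hec' : c' ≠ e := by
    refine h.triangle_side hB (π * rot) hT hc' hwc' ?_ ?_ ?_ <;>
      simpa [rot_one, rot_two, rot_zero]
  have s2 := eq_two_of_sum (h.sum_low (π 2)) (mem_lowSide.2 ⟨hc, hwc, c2⟩)
    (mem_lowSide.2 ⟨hc', hwc', c2'⟩) hcc' m2
  have s1 := eq_two_of_sum (h.sum_low (π 1)) (mem_lowSide.2 ⟨hc, hwc, c1⟩)
    (mem_lowSide.2 ⟨he, hwe, e1⟩) hce m1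
  obtain ⟨U', h', a, b, -⟩ := h.erase_up_corner (π * rot) hc' hwc'
    (by simpa [rot_one] using c2') (by simpa [rot_two] using c0') (q := c) hc hcc'
  simp only [Equiv.Perm.mul_apply, rot_zero, rot_one, rot_two] at a b
  have key := h'.trapezoid (π * rot⁻¹)
    (by simp only [Equiv.Perm.mul_apply, rot_symm_zero]; rw [b.2.1, b2])
    (by simp only [Equiv.Perm.mul_apply, rot_symm_one]; rw [b.2.2, hB])
    (by simp only [Equiv.Perm.mul_apply, rot_symm_two]; rw [b.1]; linarith)
  have e1 := card_erase_add_one hc'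
  have f1 := defect_erase_eq hc' he hec'.symm (by rw [abs_of_neg hwe, abs_of_neg hwc']; linarith)
  omega

/-- The defect of a tiling of a triangle. -/
lemma TightTiling.triangle (h : TightTiling L U T) (hB : ∀ j, upLen L U j = 0) :
    T.card = 1 ∨ (T.card = 4 ∧ 3 ≤ defect T) ∨ (T.card = 6 ∧ 4 ≤ defect T) ∨
      (7 ≤ T.card ∧ 5 ≤ defect T) := by
  have hlt := h.defect_lt
  by_cases hT : T.card = 1
  · exact Or.inl hT
  right
  by_cases hD : 5 ≤ defect T
  · omega
  have hs := h.triangle_sides hB hT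
  have hM := bdCount_perm (L := L) (U := U) (T := T) 1
  have := h.bdCount_le
  have h0 := hs 0
  have h1 := hs 1
  have h2 := hs 2
  simp only [Equiv.Perm.coe_one, id_eq] at hM
  -- A defect of at most 4 allows at most seven incidences, and each side has at least two.
  have : ((lowSide L T 1).card = 2 ∧ (lowSide L T 2).card = 2) ∨
    ((lowSide L T 2).card = 2 ∧ (lowSide L T 0).card = 2) ∨
    ((lowSide L T 0).card = 2 ∧ (lowSide L T 1).card = 2) := by omega
  rcases this with ⟨m1, m2⟩ | ⟨m1, m2⟩ | ⟨m1, m2⟩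
  · exact h.triangle_of_two hB 1 m1 m2
  · exact h.triangle_of_two hB rot (by rwa [rot_one]) (by rwa [rot_two])
  · exact h.triangle_of_two hB rot⁻¹ (by rwa [rot_symm_one]) (by rwa [rot_symm_two])

lemma TightTiling.triangle_down (h : TightTiling L U T) (hA : ∀ j, lowLen L U j = 0) :
    T.card = 1 ∨ (T.card = 4 ∧ 3 ≤ defect T) ∨ (T.card = 6 ∧ 4 ≤ defect T) ∨
      (7 ≤ T.card ∧ 5 ≤ defect T) := by
  have := h.neg.triangle (fun j => by rw [upLen_neg, hA])
  rwa [card_negTiles, defect_negTiles] at this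

/-- Cutting off `c` leaves a down triangle with at least five tiles, hence with at least six and
defect at least 4. -/
lemma TightTiling.rhombus_of_full (h : TightTiling L U T) (π : Equiv.Perm (Fin 3))
    (hA2 : lowLen L U (π 2) = 0) {c e : Fin 3 → ℝ} (hc : c ∈ T)
    (hwc : wt c < 0) (c0 : c (π 0) = L (π 0)) (c1 : c (π 1) = L (π 1)) (he : e ∈ T)
    (hwe : 0 < wt e) (h0 : -wt c = lowLen L U (π 0)) (h1 : -wt c = lowLen L U (π 1))
    (hn : 6 ≤ T.card) : 4 ≤ defect T := by
  classical
  obtain ⟨U', h', a, b, -⟩ := h.erase_up_corner (π * rot⁻¹) hc hwc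
    (by simp only [Equiv.Perm.mul_apply, rot_symm_one]; exact c0)
    (by simp only [Equiv.Perm.mul_apply, rot_symm_two]; exact c1) he (by rintro rfl; linarith)
  simp only [Equiv.Perm.mul_apply, rot_symm_zero, rot_symm_one, rot_symm_two] at a
  have := h'.triangle_down ((forall_perm π).2 ⟨by linarith [a.2.1], by linarith [a.2.2],
    by linarith [a.1]⟩)
  have := card_erase_add_one hc
  have := defect_erase_le hc
  omega

/-- A long side cannot be a single tile, since its corner tile must also fit along a short side. If
the defect is at most 3, both short sides are therefore single tiles. These have equal sizes, which
gains one, and cutting them off leaves a parallelogram with at least four tiles. -/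
lemma TightTiling.parallelogram_of_lt (h : TightTiling L U T) (π : Equiv.Perm (Fin 3))
    (hA2 : lowLen L U (π 2) = 0) (hB2 : upLen L U (π 2) = 0)
    (hlt : lowLen L U (π 0) < lowLen L U (π 1)) (hn : 6 ≤ T.card) : 4 ≤ defect T := by
  classical
  have d0 := low_sub_up (L := L) (U := U) (π 0)
  have d1 := low_sub_up (L := L) (U := U) (π 1)
  have d2 := low_sub_up (L := L) (U := U) (π 2)
  have a := lowLen_perm (L := L) (U := U) π
  have b := upLen_perm (L := L) (U := U) π
  have l0 := h.lt (π 0)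
  have l1 := h.lt (π 1)
  have pA0 : 0 < lowLen L U (π 0) := by linarith [a.1, b.2.2]
  have pA1 : 0 < lowLen L U (π 1) := by linarith [a.2.1, b.2.2]
  obtain ⟨c, hc, hwc, c0, c1⟩ := h.exists_up_corner (π * rot⁻¹)
    (by simp only [Equiv.Perm.mul_apply, rot_symm_zero]; exact hB2)
  obtain ⟨e, he, hwe, e0, e1⟩ := h.exists_down_corner (π * rot⁻¹)
    (by simp only [Equiv.Perm.mul_apply, rot_symm_zero]; exact hA2)
  have hec : e ≠ c := by rintro rfl; linarith
  simp only [Equiv.Perm.mul_apply, rot_symm_one, rot_symm_two] at c0 c1 e0 e1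
  by_contra hD
  have hM := bdCount_perm (L := L) (U := U) (T := T) π
  have hM6 := h.bdCount_le
  have mc0 := mem_lowSide.2 ⟨hc, hwc, c0⟩
  have mc1 := mem_lowSide.2 ⟨hc, hwc, c1⟩
  have me0 := mem_upSide.2 ⟨he, hwe, e0⟩
  have me1 := mem_upSide.2 ⟨he, hwe, e1⟩
  have k1 := h.low_card_pos pA0
  have k3 := h.up_card_pos (j := π 0) (by linarith)
  have k2 : 2 ≤ (lowSide L T (π 1)).card := by
    by_contra hcon
    have := card_pos.2 ⟨c, mc1⟩
    have := eq_of_sum (h.sum_low (π 1)) mc1 (by omega)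
    have := le_of_sum pos_low (h.sum_low (π 0)) mc0
    linarith
  have k4 : 2 ≤ (upSide U T (π 1)).card := by
    by_contra hcon
    have := card_pos.2 ⟨e, me1⟩
    have := eq_of_sum (h.sum_up (π 1)) me1 (by omega)
    have := le_of_sum pos_up (h.sum_up (π 0)) me0
    linarith
  have s1 := eq_of_sum (h.sum_low (π 0)) mc0 (by omega)
  have s2 := eq_of_sum (h.sum_up (π 0)) me0 (by omega)
  obtain ⟨U1, h1, a1, b1, u1⟩ := h.erase_up_corner (π * rot⁻¹) hc hwc
    (by simp only [Equiv.Perm.mul_apply, rot_symm_one]; exact c0)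
    (by simp only [Equiv.Perm.mul_apply, rot_symm_two]; exact c1) he hec
  simp only [Equiv.Perm.mul_apply, rot_symm_zero, rot_symm_one, rot_symm_two] at a1 b1 u1
  have he1 : e ∈ T.erase c := mem_erase.2 ⟨hec, he⟩
  have n1 := card_erase_add_one hc
  obtain ⟨r, hr, hre⟩ := exists_mem_ne (show 1 < (T.erase c).card by omega) e
  obtain ⟨L2, h2, b2, a2, -⟩ := h1.erase_down_corner (π * rot⁻¹) he1 hwe
    (by simp only [Equiv.Perm.mul_apply, rot_symm_one]; rw [e0, u1.2.1])
    (by simp only [Equiv.Perm.mul_apply, rot_symm_two]; rw [e1, u1.2.2]) hr hre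
  simp only [Equiv.Perm.mul_apply, rot_symm_zero, rot_symm_one, rot_symm_two] at a2 b2
  have key := (h2.parallelogram_basic (π * rot) (by
      simp only [Equiv.Perm.mul_apply, rot_two]; linarith [a2.2.1, a1.2.1])
    (by simp only [Equiv.Perm.mul_apply, rot_two]; linarith [b2.2.1, b1.2.1])).1
  have n2 := card_erase_add_one he1
  have f1 := defect_erase_eq hc he hec (by rw [abs_of_pos hwe, abs_of_neg hwc]; linarith)
  have f2 := defect_erase_le he1
  omega

/-- The defect of a tiling of a parallelogram. -/
lemma TightTiling.parallelogram (h : TightTiling L U T) (π : Equiv.Perm (Fin 3))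
    (hA2 : lowLen L U (π 2) = 0) (hB2 : upLen L U (π 2) = 0) :
    (T.card = 2 ∧ 1 ≤ defect T) ∨ (T.card = 4 ∧ 3 ≤ defect T) ∨ (T.card = 5 ∧ 3 ≤ defect T) ∨
      (6 ≤ T.card ∧ 4 ≤ defect T) := by
  have hb := h.parallelogram_basic π hA2 hB2
  have hD := h.defect_lt
  suffices 6 ≤ T.card → 4 ≤ defect T by omega
  intro hn
  have d0 := low_sub_up (L := L) (U := U) (π 0)
  have d1 := low_sub_up (L := L) (U := U) (π 1)
  have d2 := low_sub_up (L := L) (U := U) (π 2)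
  have e0 : (Equiv.swap 0 1 : Equiv.Perm (Fin 3)) 0 = 1 := by decide
  have e1 : (Equiv.swap 0 1 : Equiv.Perm (Fin 3)) 1 = 0 := by decide
  have e2 : (Equiv.swap 0 1 : Equiv.Perm (Fin 3)) 2 = 2 := by decide
  rcases lt_trichotomy (lowLen L U (π 0)) (lowLen L U (π 1)) with hlt | heq | hlt
  · exact h.parallelogram_of_lt π hA2 hB2 hlt hn
  · obtain ⟨c, hc, hwc, c0, c1⟩ := h.exists_up_corner (π * rot⁻¹)
      (by simp only [Equiv.Perm.mul_apply, rot_symm_zero]; exact hB2)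
    obtain ⟨e, he, hwe, e0, e1⟩ := h.exists_down_corner (π * rot⁻¹)
      (by simp only [Equiv.Perm.mul_apply, rot_symm_zero]; exact hA2)
    simp only [Equiv.Perm.mul_apply, rot_symm_one, rot_symm_two] at c0 c1 e0 e1
    by_contra hcon
    have hM := bdCount_perm (L := L) (U := U) (T := T) π
    have hM6 := h.bdCount_le
    have mc0 := mem_lowSide.2 ⟨hc, hwc, c0⟩
    have mc1 := mem_lowSide.2 ⟨hc, hwc, c1⟩
    have me0 := mem_upSide.2 ⟨he, hwe, e0⟩
    have me1 := mem_upSide.2 ⟨he, hwe, e1⟩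
    have q1 := card_pos.2 ⟨c, mc0⟩
    have q2 := card_pos.2 ⟨c, mc1⟩
    have q3 := card_pos.2 ⟨e, me0⟩
    have q4 := card_pos.2 ⟨e, me1⟩
    have f1 := fun hh => eq_of_sum (h.sum_low (π 0)) mc0 hh
    have f2 := fun hh => eq_of_sum (h.sum_low (π 1)) mc1 hh
    have f3 := fun hh => eq_of_sum (h.sum_up (π 0)) me0 hh
    have f4 := fun hh => eq_of_sum (h.sum_up (π 1)) me1 hh
    -- A rhombus has at most six incidences on its four sides here, so some side is a single corner
    -- tile; since all sides are equal, it fills the other side of its corner as well.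
    have hone : (lowSide L T (π 0)).card = 1 ∨ (lowSide L T (π 1)).card = 1 ∨
        (upSide U T (π 0)).card = 1 ∨ (upSide U T (π 1)).card = 1 := by omega
    have hup : -wt c = lowLen L U (π 0) → False := fun hh =>
      hcon (h.rhombus_of_full π hA2 hc hwc c0 c1 he hwe hh (by linarith) hn)
    have hdown : wt e = upLen L U (π 0) → False := fun hh => by
      have := h.neg.rhombus_of_full π (by rw [lowLen_neg]; exact hB2) (c := -e) (e := -c)
        (mem_negTiles.2 (by simpa using he)) (by simpa using hwe) (by simp [e0]) (by simp [e1])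
        (mem_negTiles.2 (by simpa using hc)) (by simpa using hwc)
        (by rw [lowLen_neg, wt_neg]; linarith) (by rw [lowLen_neg, wt_neg]; linarith)
        (by rwa [card_negTiles])
      rw [defect_negTiles] at this
      exact hcon this
    rcases hone with hh | hh | hh | hh
    · exact hup (f1 hh)
    · exact hup (by linarith [f2 hh])
    · exact hdown (f3 hh)
    · exact hdown (by linarith [f4 hh])
  · exact h.parallelogram_of_lt (π * Equiv.swap 0 1) (by simpa [e2] using hA2)
      (by simpa [e2] using hB2) (by simpa [e0, e1] using hlt) hn

/-- The defect of a tiling of a pentagon. -/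
lemma TightTiling.pentagon (h : TightTiling L U T) (π : Equiv.Perm (Fin 3))
    (hB2 : upLen L U (π 2) = 0) (hB0 : 0 < upLen L U (π 0)) (hB1 : 0 < upLen L U (π 1))
    (hA : ∀ j, 0 < lowLen L U j) :
    (T.card = 4 ∧ 2 ≤ defect T) ∨ (5 ≤ T.card ∧ 3 ≤ defect T) := by
  classical
  have hM := bdCount_perm (L := L) (U := U) (T := T) π
  have hM6 := h.bdCount_le
  have hD := h.defect_lt
  have k0 := h.low_card_pos (hA (π 0))
  have k1 := h.low_card_pos (hA (π 1))
  have k2 := h.low_card_pos (hA (π 2))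
  have k3 := h.up_card_pos hB0
  have k4 := h.up_card_pos hB1
  by_cases hD3 : 3 ≤ defect T
  · omega
  obtain ⟨c, hc, hwc, c0, c1⟩ := h.exists_up_corner (π * rot⁻¹)
    (by simp only [Equiv.Perm.mul_apply, rot_symm_zero]; exact hB2)
  simp only [Equiv.Perm.mul_apply, rot_symm_one, rot_symm_two] at c0 c1
  -- A defect of at most 2 leaves one tile on each of the five sides. The tile in the 60° corner
  -- fills both sides there, and cutting it off leaves a trapezoid.
  have s0 := eq_of_sum (h.sum_low (π 0)) (mem_lowSide.2 ⟨hc, hwc, c0⟩) (by omega)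
  have s1 := eq_of_sum (h.sum_low (π 1)) (mem_lowSide.2 ⟨hc, hwc, c1⟩) (by omega)
  obtain ⟨r, hr⟩ := card_pos.1 k3
  have hr' := mem_upSide.1 hr
  obtain ⟨U1, h1, a1, b1, -⟩ := h.erase_up_corner (π * rot⁻¹) hc hwc
    (by simp only [Equiv.Perm.mul_apply, rot_symm_one]; exact c0)
    (by simp only [Equiv.Perm.mul_apply, rot_symm_two]; exact c1) (q := r) hr'.1
    (by rintro rfl; linarith [hr'.2.1])
  simp only [Equiv.Perm.mul_apply, rot_symm_zero, rot_symm_one, rot_symm_two] at a1 b1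
  have key := h1.neg.trapezoid π (by rw [upLen_neg]; linarith [a1.2.1])
    (by rw [upLen_neg]; linarith [a1.2.2]) (by rw [upLen_neg]; linarith [a1.1, hA (π 2)])
  rw [card_negTiles, defect_negTiles] at key
  have := card_erase_add_one hc
  have := defect_erase_le hc
  omega

end TriTiling

namespace TriTiling

/-! ### Boundary tiles of hexagons -/

open Finset

variable {L U : Fin 3 → ℝ} {T : Finset (Fin 3 → ℝ)}

open Classical in
/-- The tiles that have an edge on the boundary of the region. -/
noncomputable def bdTiles (L U : Fin 3 → ℝ) (T : Finset (Fin 3 → ℝ)) : Finset (Fin 3 → ℝ) :=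
  univ.biUnion fun j => lowSide L T j ∪ upSide U T j

lemma mem_bdTiles {p : Fin 3 → ℝ} :
    p ∈ bdTiles L U T ↔ ∃ j, p ∈ lowSide L T j ∨ p ∈ upSide U T j := by simp [bdTiles]

lemma bdTiles_subset : bdTiles L U T ⊆ T := by
  intro p hp
  obtain ⟨j, hj | hj⟩ := mem_bdTiles.1 hp
  · exact (mem_lowSide.1 hj).1
  · exact (mem_upSide.1 hj).1

lemma exists_perm_of_ne : ∀ i j : Fin 3, i ≠ j → ∃ π : Equiv.Perm (Fin 3), π 0 = i ∧ π 1 = j := by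
  decide

/-- A tile on two lower lines would contain their intersection, which lies outside the region when
the upper side between them has positive length. So in a hexagon incidences count tiles. -/
lemma TightTiling.low_low (h : TightTiling L U T) (hB : ∀ j, 0 < upLen L U j)
    {p : Fin 3 → ℝ} {i j : Fin 3} (hi : p ∈ lowSide L T i) (hj : p ∈ lowSide L T j) : i = j := by
  by_contra hne
  obtain ⟨π, rfl, rfl⟩ := exists_perm_of_ne i j hne
  have h1 := (h.up p (mem_lowSide.1 hi).1 (π 2)).2
  rw [wt_perm π, (mem_lowSide.1 hi).2.2, (mem_lowSide.1 hj).2.2] at h1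
  linarith [hB (π 2), (upLen_perm (L := L) (U := U) π).2.2]

lemma TightTiling.up_up (h : TightTiling L U T) (hA : ∀ j, 0 < lowLen L U j)
    {p : Fin 3 → ℝ} {i j : Fin 3} (hi : p ∈ upSide U T i) (hj : p ∈ upSide U T j) : i = j := by
  by_contra hne
  obtain ⟨π, rfl, rfl⟩ := exists_perm_of_ne i j hne
  have h1 := (h.low p (mem_upSide.1 hi).1 (π 2)).2
  rw [wt_perm π, (mem_upSide.1 hi).2.2, (mem_upSide.1 hj).2.2] at h1
  linarith [hA (π 2), (lowLen_perm (L := L) (U := U) π).2.2]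

lemma TightTiling.sum_bdTiles (h : TightTiling L U T) (hA : ∀ j, 0 < lowLen L U j)
    (hB : ∀ j, 0 < upLen L U j) {M : Type*} [AddCommMonoid M] (f : (Fin 3 → ℝ) → M) :
    ∑ p ∈ bdTiles L U T, f p = ∑ j, (∑ p ∈ lowSide L T j, f p + ∑ p ∈ upSide U T j, f p) := by
  classical
  rw [bdTiles, sum_biUnion]
  · refine sum_congr rfl fun j _ => ?_
    rw [sum_union]
    rw [disjoint_left]
    intro p h1 h2
    linarith [(mem_lowSide.1 h1).2.1, (mem_upSide.1 h2).2.1]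
  · intro i _ j _ hne
    simp only [Function.onFun]
    rw [disjoint_left]
    intro p h1 h2
    rw [mem_union] at h1 h2
    rcases h1 with h1 | h1 <;> rcases h2 with h2 | h2
    · exact hne (h.low_low hB h1 h2)
    · linarith [(mem_lowSide.1 h1).2.1, (mem_upSide.1 h2).2.1]
    · linarith [(mem_lowSide.1 h2).2.1, (mem_upSide.1 h1).2.1]
    · exact hne (h.up_up hA h1 h2)

lemma TightTiling.card_bdTiles (h : TightTiling L U T) (hA : ∀ j, 0 < lowLen L U j)
    (hB : ∀ j, 0 < upLen L U j) : (bdTiles L U T).card = bdCount L U T := by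
  rw [card_eq_sum_ones, h.sum_bdTiles hA hB, bdCount]
  simp

/-! ### Comparison of tiles that fill their sides -/

lemma TightTiling.low_full (h : TightTiling L U T) (π : Equiv.Perm (Fin 3)) {p : Fin 3 → ℝ}
    (hp : p ∈ lowSide L T (π 0)) (h1 : (lowSide L T (π 0)).card = 1) :
    -wt p = lowLen L U (π 0) ∧ p (π 1) = -L (π 0) - U (π 2) ∧ p (π 2) = -L (π 0) - U (π 1) := by
  have hs := eq_of_sum (h.sum_low _) hp h1
  obtain ⟨hpT, hw, h0⟩ := mem_lowSide.1 hp
  have e := wt_perm π p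
  have a := (lowLen_perm (L := L) (U := U) π).1
  have u1 := (h.up p hpT (π 1)).2
  have u2 := (h.up p hpT (π 2)).2
  refine ⟨hs, ?_, ?_⟩ <;> linarith

lemma TightTiling.up_full (h : TightTiling L U T) (π : Equiv.Perm (Fin 3)) {p : Fin 3 → ℝ}
    (hp : p ∈ upSide U T (π 0)) (h1 : (upSide U T (π 0)).card = 1) :
    wt p = upLen L U (π 0) ∧ p (π 1) = -U (π 0) - L (π 2) ∧ p (π 2) = -U (π 0) - L (π 1) := by
  have hs := eq_of_sum (h.sum_up _) hp h1
  obtain ⟨hpT, hw, h0⟩ := mem_upSide.1 hp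
  have e := wt_perm π p
  have a := (upLen_perm (L := L) (U := U) π).1
  have u1 := (h.low p hpT (π 1)).2
  have u2 := (h.low p hpT (π 2)).2
  refine ⟨hs, ?_, ?_⟩ <;> linarith

/-- The corner tiles at the two ends of a side cannot both be longer than this side. -/
lemma TightTiling.le_upLen (h : TightTiling L U T) (π : Equiv.Perm (Fin 3)) {p q : Fin 3 → ℝ}
    (hB : 0 < upLen L U (π 2)) (hp : p ∈ lowSide L T (π 0)) (hp1 : p (π 1) = -L (π 0) - U (π 2))
    (hq : q ∈ lowSide L T (π 1)) (hq0 : q (π 0) = -L (π 1) - U (π 2)) :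
    -wt p ≤ upLen L U (π 2) ∨ -wt q ≤ upLen L U (π 2) := by
  by_contra! hcon
  obtain ⟨hpT, hwp, hp0⟩ := mem_lowSide.1 hp
  obtain ⟨hqT, hwq, hq1⟩ := mem_lowSide.1 hq
  have b := (upLen_perm (L := L) (U := U) π).2.2
  have ep := wt_perm π p
  have eq := wt_perm π q
  have : p = q := by
    refine h.eq_of_up hpT hqT hwp hwq π ?_
    rw [max_eq_right (by linarith), max_eq_left (by linarith)]
    rcases max_choice (p (π 2)) (q (π 2)) with hm | hm <;> rw [hm] <;> linarith
  subst this
  linarith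

lemma TightTiling.le_lowLen (h : TightTiling L U T) (π : Equiv.Perm (Fin 3)) {p q : Fin 3 → ℝ}
    (hA : 0 < lowLen L U (π 2)) (hp : p ∈ upSide U T (π 0)) (hp1 : p (π 1) = -U (π 0) - L (π 2))
    (hq : q ∈ upSide U T (π 1)) (hq0 : q (π 0) = -U (π 1) - L (π 2)) :
    wt p ≤ lowLen L U (π 2) ∨ wt q ≤ lowLen L U (π 2) := by
  have := h.neg.le_upLen π (p := -p) (q := -q) (by rwa [upLen_neg])
    (by rw [mem_lowSide_neg, neg_neg]; exact hp) (by simp only [Pi.neg_apply]; linarith)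
    (by rw [mem_lowSide_neg, neg_neg]; exact hq) (by simp only [Pi.neg_apply]; linarith)
  simpa only [upLen_neg, wt_neg, neg_neg] using this

/-- Opposite tiles filling their sides do not overlap. -/
lemma TightTiling.opposite (h : TightTiling L U T) (π : Equiv.Perm (Fin 3))
    (h1 : (lowSide L T (π 0)).card = 1) (h2 : (upSide U T (π 0)).card = 1) :
    upLen L U (π 0) ≤ upLen L U (π 1) ∨ upLen L U (π 0) ≤ upLen L U (π 2) := by
  obtain ⟨p, hp⟩ := card_pos.1 (h1 ▸ one_pos)
  obtain ⟨q, hq⟩ := card_pos.1 (h2 ▸ one_pos)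
  obtain ⟨-, p1, p2⟩ := h.low_full π hp h1
  obtain ⟨-, q1, q2⟩ := h.up_full π hq h2
  obtain ⟨hpT, hwp, hp0⟩ := mem_lowSide.1 hp
  obtain ⟨hqT, hwq, hq0⟩ := mem_upSide.1 hq
  have b := upLen_perm (L := L) (U := U) π
  have hlt := h.lt (π 0)
  rcases h.up_down hpT hqT hwp hwq π with hh | hh | hh
  · linarith
  · right; linarith
  · left; linarith

lemma TightTiling.low_adjacent (h : TightTiling L U T) (π : Equiv.Perm (Fin 3))
    (hB : 0 < upLen L U (π 2)) (h0 : (lowSide L T (π 0)).card = 1)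
    (h1 : (lowSide L T (π 1)).card = 1) :
    lowLen L U (π 0) ≤ upLen L U (π 2) ∨ lowLen L U (π 1) ≤ upLen L U (π 2) := by
  obtain ⟨p, hp⟩ := card_pos.1 (h0 ▸ one_pos)
  obtain ⟨q, hq⟩ := card_pos.1 (h1 ▸ one_pos)
  obtain ⟨p0, p1, p2⟩ := h.low_full π hp h0
  have e0 : (Equiv.swap 0 1 : Equiv.Perm (Fin 3)) 0 = 1 := by decide
  have e1 : (Equiv.swap 0 1 : Equiv.Perm (Fin 3)) 1 = 0 := by decide
  have e2 : (Equiv.swap 0 1 : Equiv.Perm (Fin 3)) 2 = 2 := by decide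
  have hq' := h.low_full (π * Equiv.swap 0 1) (p := q)
  simp only [Equiv.Perm.mul_apply, e0, e1, e2] at hq'
  obtain ⟨q0, q1, q2⟩ := hq' hq h1
  have := h.le_upLen π hB hp p1 hq q1
  rwa [p0, q0] at this

lemma TightTiling.up_adjacent (h : TightTiling L U T) (π : Equiv.Perm (Fin 3))
    (hA : 0 < lowLen L U (π 2)) (h0 : (upSide U T (π 0)).card = 1)
    (h1 : (upSide U T (π 1)).card = 1) :
    upLen L U (π 0) ≤ lowLen L U (π 2) ∨ upLen L U (π 1) ≤ lowLen L U (π 2) := by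
  have := h.neg.low_adjacent π (by rwa [upLen_neg]) (by rwa [lowSide_neg, card_negTiles])
    (by rwa [lowSide_neg, card_negTiles])
  simpa only [lowLen_neg, upLen_neg] using this

/-- At the smallest of the three numbers, the first group of inequalities gives `d ≤ 0` and the
second `0 ≤ d`. With `d = 0` the minimum and the maximum are both attained twice, so the three
numbers agree. -/
lemma eq_of_neighbours {b0 b1 b2 d : ℝ} (h0 : b1 + d ≤ b0 ∨ b2 + d ≤ b0)
    (h1 : b2 + d ≤ b1 ∨ b0 + d ≤ b1) (h2 : b0 + d ≤ b2 ∨ b1 + d ≤ b2)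
    (g0 : b1 ≤ b0 + d ∨ b2 ≤ b0 + d) (g1 : b2 ≤ b1 + d ∨ b0 ≤ b1 + d)
    (g2 : b0 ≤ b2 + d ∨ b1 ≤ b2 + d) (m0 : b0 ≤ b1 ∨ b0 ≤ b2) (m1 : b1 ≤ b2 ∨ b1 ≤ b0)
    (m2 : b2 ≤ b0 ∨ b2 ≤ b1) : d = 0 ∧ b0 = b1 ∧ b2 = b1 := by
  have d1 : d ≤ 0 := by
    rcases h0 with h0 | h0 <;> rcases h1 with h1 | h1 <;> rcases h2 with h2 | h2 <;> linarith
  have d2 : 0 ≤ d := by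
    rcases g0 with h0 | h0 <;> rcases g1 with h1 | h1 <;> rcases g2 with h2 | h2 <;> linarith
  obtain rfl : d = 0 := le_antisymm d1 d2
  refine ⟨rfl, ?_⟩
  clear g0 g1 g2 d1 d2
  rcases m0 with m0 | m0 <;> rcases m1 with m1 | m1 <;> rcases m2 with m2 | m2 <;>
  rcases h0 with h0 | h0 <;> rcases h1 with h1 | h1 <;> rcases h2 with h2 | h2 <;>
  constructor <;> linarith

/-- If every side is a single tile, the restrictions on adjacent and opposite tiles force the
hexagon to be equilateral. Then six tiles have the same size. -/
lemma TightTiling.hexagon_of_six (h : TightTiling L U T) (hA : ∀ j, 0 < lowLen L U j)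
    (hB : ∀ j, 0 < upLen L U j) (h1 : ∀ j, (lowSide L T j).card = 1)
    (h2 : ∀ j, (upSide U T j).card = 1) : 5 ≤ defect T := by
  have hd := fun j => low_sub_up (L := L) (U := U) j
  have l2 := h.low_adjacent 1 (hB _) (h1 _) (h1 _)
  have l0 := h.low_adjacent rot (hB _) (h1 _) (h1 _)
  have l1 := h.low_adjacent rot⁻¹ (hB _) (h1 _) (h1 _)
  have u2 := h.up_adjacent 1 (hA _) (h2 _) (h2 _)
  have u0 := h.up_adjacent rot (hA _) (h2 _) (h2 _)
  have u1 := h.up_adjacent rot⁻¹ (hA _) (h2 _) (h2 _)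
  have o0 := h.opposite 1 (h1 _) (h2 _)
  have o1 := h.opposite rot (h1 _) (h2 _)
  have o2 := h.opposite rot⁻¹ (h1 _) (h2 _)
  simp only [Equiv.Perm.coe_one, id_eq, rot_zero, rot_one, rot_two, rot_symm_zero, rot_symm_one,
    rot_symm_two] at l0 l1 l2 u0 u1 u2 o0 o1 o2
  have ha : ∀ j, lowLen L U j = upLen L U j + (wt L + wt U) := fun j => by rw [← hd j]; ring
  simp only [ha] at l0 l1 l2 u0 u1 u2
  obtain ⟨d0, e0, e2⟩ := eq_of_neighbours l0 l1 l2 u0 u1 u2 o0 o1 o2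
  have hall : ∀ j, upLen L U j = upLen L U 1 := by
    intro j; fin_cases j
    · exact e0
    · rfl
    · exact e2
  have hcard := h.card_bdTiles hA hB
  simp only [bdCount, h1, h2] at hcard
  have := le_defect_of_class (bdTiles_subset (L := L) (U := U) (T := T)) (s := upLen L U 1) (by
    intro p hp
    obtain ⟨j, hj | hj⟩ := mem_bdTiles.1 hp
    · rw [abs_of_neg (mem_lowSide.1 hj).2.1, eq_of_sum (h.sum_low _) hj (h1 j), ha, d0, hall,
        add_zero]
    · rw [abs_of_pos (mem_upSide.1 hj).2.1, eq_of_sum (h.sum_up _) hj (h2 j), hall])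
  rw [hcard] at this
  simp at this
  omega

end TriTiling

namespace TriTiling

/-! ### Hexagons -/

open Finset

variable {L U : Fin 3 → ℝ} {T : Finset (Fin 3 → ℝ)}

/-- Two tiles along one side. -/
lemma TightTiling.two_on_side (h : TightTiling L U T) (π : Equiv.Perm (Fin 3))
    (h2 : (lowSide L T (π 0)).card = 2) : ∃ x y, x ≠ y ∧ lowSide L T (π 0) = {x, y} ∧
      -wt x - wt y = lowLen L U (π 0) ∧ x (π 1) = U (π 1) + wt x ∧ x (π 2) = -L (π 0) - U (π 1) ∧
      y (π 2) = U (π 2) + wt y ∧ y (π 1) = -L (π 0) - U (π 2) := by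
  obtain ⟨x, y, hne, hxy⟩ := card_eq_two.1 h2
  have hx : x ∈ lowSide L T (π 0) := by rw [hxy]; simp
  have hy : y ∈ lowSide L T (π 0) := by rw [hxy]; simp
  have hs := eq_two_of_sum (h.sum_low _) hx hy hne h2
  obtain ⟨hxT, hwx, hx0⟩ := mem_lowSide.1 hx
  obtain ⟨hyT, hwy, hy0⟩ := mem_lowSide.1 hy
  have a := (lowLen_perm (L := L) (U := U) π).1
  have ex := wt_perm π x
  have ey := wt_perm π y
  have ux1 := (h.up x hxT (π 1)).2
  have ux2 := (h.up x hxT (π 2)).2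
  have uy1 := (h.up y hyT (π 1)).2
  have uy2 := (h.up y hyT (π 2)).2
  have hap := (h.apart x hxT y hyT hne).up_up hwx hwy π
  rw [hx0, hy0, max_self] at hap
  rcases le_total (y (π 1)) (x (π 1)) with h1 | h1 <;>
    rcases le_total (y (π 2)) (x (π 2)) with h3 | h3
  · rw [max_eq_left h1, max_eq_left h3] at hap; linarith
  · rw [max_eq_left h1, max_eq_right h3] at hap
    refine ⟨x, y, hne, hxy, ?_, ?_, ?_, ?_, ?_⟩ <;> linarith
  · rw [max_eq_right h1, max_eq_left h3] at hap
    refine ⟨y, x, hne.symm, by rw [hxy, pair_comm], ?_, ?_, ?_, ?_, ?_⟩ <;> linarith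
  · rw [max_eq_right h1, max_eq_right h3] at hap; linarith

/-- Where the two up tiles meet on the side they leave an angle of 60°, and only a down tile fits
into it. -/
lemma TightTiling.exists_between (h : TightTiling L U T) (π : Equiv.Perm (Fin 3))
    {x y : Fin 3 → ℝ} (hxy : lowSide L T (π 0) = {x, y})
    (hs : -wt x - wt y = lowLen L U (π 0)) (x1 : x (π 1) = U (π 1) + wt x)
    (x2 : x (π 2) = -L (π 0) - U (π 1)) (y2 : y (π 2) = U (π 2) + wt y)
    (y1 : y (π 1) = -L (π 0) - U (π 2)) :
    ∃ z ∈ T, 0 < wt z ∧ z (π 1) = x (π 1) ∧ z (π 2) = y (π 2) := by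
  have hx : x ∈ lowSide L T (π 0) := by rw [hxy]; simp
  have hy : y ∈ lowSide L T (π 0) := by rw [hxy]; simp
  obtain ⟨hxT, hwx, hx0⟩ := mem_lowSide.1 hx
  obtain ⟨hyT, hwy, hy0⟩ := mem_lowSide.1 hy
  have a := (lowLen_perm (L := L) (U := U) π).1
  have l0 := h.lt (π 0)
  have lx := (h.low x hxT (π 2)).1
  have ly := (h.low y hyT (π 1)).1
  obtain ⟨z, hz, hh⟩ := h.exists_germ (v := vec π (L (π 0)) (x (π 1)) (y (π 2)))
    (d := vec π 2 (-1) (-1)) (by rw [wt_vec]; linarith) (by rw [wt_vec]; norm_num)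
    ((forall_perm π).2 (by
      simp only [vec_zero, vec_one, vec_two]
      refine ⟨⟨?_, ?_⟩, ⟨?_, ?_⟩, ⟨?_, ?_⟩⟩ <;> linarith))
    ((forall_perm π).2 (by
      simp only [vec_zero, vec_one, vec_two]
      refine ⟨⟨?_, ?_⟩, ⟨?_, ?_⟩, ⟨?_, ?_⟩⟩ <;> intro <;> linarith))
  refine ⟨z, hz, ?_⟩
  simp only [forall_perm π, vec_zero, vec_one, vec_two] at hh
  rcases hh with ⟨hw, ⟨h0, -⟩, ⟨h1, h1'⟩, h2, h2'⟩ | ⟨hw, ⟨h0, h0'⟩, ⟨h1, -⟩, h2, -⟩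
  · exfalso
    have hz0 : z ∈ lowSide L T (π 0) :=
      mem_lowSide.2 ⟨hz, hw, le_antisymm h0 (h.low z hz (π 0)).1⟩
    rw [hxy, mem_insert, mem_singleton] at hz0
    rcases hz0 with rfl | rfl
    · linarith [h1' rfl]
    · linarith [h2' rfl]
  · refine ⟨hw, ?_, ?_⟩
    · rcases h.up_down hxT hz hwx hw π with hh | hh | hh
      · have := h0' (by linarith); linarith
      · linarith
      · linarith
    · rcases h.up_down hyT hz hwy hw π with hh | hh | hh
      · have := h0' (by linarith); linarith
      · linarith
      · linarith

/-- Masses `m1`, `m2`, `m3` sit at levels `v ≠ y` and `g`, and the total mass at each level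
vanishes; the cases are those of which levels coincide. It evaluates `balance` in the two directions
other than that of the divided side. -/
lemma three_levels {v y g m1 m2 m3 : ℝ} (hvy : v ≠ y)
    (H : ∀ c, c = v ∨ c = y ∨ c = g → (if v = c then m1 else 0) + (if y = c then m2 else 0) +
      (if g = c then m3 else 0) = 0) :
    (g = v ∧ m2 = 0) ∨ (g = y ∧ m1 = 0) ∨ (m1 = 0 ∧ m2 = 0 ∧ m3 = 0) := by
  have h1 := H v (Or.inl rfl)
  have h2 := H y (Or.inr (Or.inl rfl))
  have h3 := H g (Or.inr (Or.inr rfl))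
  rw [if_pos rfl, if_neg hvy.symm] at h1
  rw [if_pos rfl, if_neg hvy] at h2
  rw [if_pos (rfl : g = g)] at h3
  by_cases hgv : g = v
  · rw [if_neg (by rw [hgv]; exact hvy)] at h2
    exact Or.inl ⟨hgv, by linarith⟩
  · by_cases hgy : g = y
    · rw [if_neg hgv] at h1
      exact Or.inr (Or.inl ⟨hgy, by linarith⟩)
    · rw [if_neg hgv] at h1
      rw [if_neg hgy] at h2
      rw [if_neg (Ne.symm hgv), if_neg (Ne.symm hgy)] at h3
      exact Or.inr (Or.inr ⟨by linarith, by linarith, by linarith⟩)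

/-- `X` and `Y` are the sizes along the divided side, `Ab` and `Ac` the other lower sizes, `Ba`,
`Bb`, `Bc` the upper ones, `m` the inner tile and `d` the difference of opposite sides. The three
alternatives come from balancing in the three directions; the positive solutions leave only three
possible sizes. -/
lemma eight_tiles {X Y Ab Ac Ba Bb Bc m d : ℝ} (hX : 0 < X) (hY : 0 < Y) (hm : 0 < m)
    (eb : Bb = Ab - d) (ec : Bc = Ac - d) (ea : Ba = X + Y - d)
    (ha : (Bc = m ∧ Bb = m ∧ Bc - Ab + (Bb - Ac) + m = 0) ∨
      (Bc = m ∧ Bc - Ab + m = 0 ∧ Bb - Ac = 0) ∨ (Bb = m ∧ Bb - Ac + m = 0 ∧ Bc - Ab = 0))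
    (hb : (X = Ac ∧ Bc - Y = 0) ∨ (Ac = X + Y ∧ m - X = 0) ∨
      (m - X = 0 ∧ Bc - Y = 0 ∧ Ba - Ac = 0))
    (hc : (Y = Ab ∧ Bb - X = 0) ∨ (Ab = X + Y ∧ m - Y = 0) ∨
      (m - Y = 0 ∧ Bb - X = 0 ∧ Ba - Ab = 0)) :
    ∀ s ∈ ({X, Y, Ab, Ac, Ba, Bb, Bc, m} : Finset ℝ), s ∈ ({2 * d, 3 * d, 4 * d} : Finset ℝ) := by
  subst eb ec ea
  have hd : m = 2 * d := by
    rcases ha with ⟨h1, h2, h3⟩ | ⟨h1, h2, h3⟩ | ⟨h1, h2, h3⟩ <;> linarith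
  simp only [mem_insert, mem_singleton, forall_eq_or_imp, forall_eq]
  rcases ha with ⟨h1, h2, h3⟩ | ⟨h1, h2, h3⟩ | ⟨h1, h2, h3⟩ <;>
  rcases hb with ⟨k1, k2⟩ | ⟨k1, k2⟩ | ⟨k1, k2, k3⟩ <;>
  rcases hc with ⟨l1, l2⟩ | ⟨l1, l2⟩ | ⟨l1, l2, l3⟩ <;>
  first
  | (exfalso; linarith)
  | (refine ⟨?_, ?_, ?_, ?_, ?_, ?_, ?_, ?_⟩ <;>
      first | (left; linarith) | (right; left; linarith) | (right; right; linarith))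

set_option maxHeartbeats 1000000 in
lemma TightTiling.hexagon_of_seven (h : TightTiling L U T) (hA : ∀ j, 0 < lowLen L U j)
    (hB : ∀ j, 0 < upLen L U j) (π : Equiv.Perm (Fin 3)) (ma : (lowSide L T (π 0)).card = 2)
    (mb : (lowSide L T (π 1)).card = 1) (mc : (lowSide L T (π 2)).card = 1)
    (hu : ∀ j, (upSide U T j).card = 1) (hn : T.card ≤ 8) : 5 ≤ defect T := by
  classical
  obtain ⟨x, y, hne, hxy, hs, x1, x2, y2, y1⟩ := h.two_on_side π ma
  obtain ⟨z, hz, hwz, z1, z2⟩ := h.exists_between π hxy hs x1 x2 y2 y1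
  have hx : x ∈ lowSide L T (π 0) := by rw [hxy]; simp
  have hy : y ∈ lowSide L T (π 0) := by rw [hxy]; simp
  obtain ⟨p, hp⟩ := card_eq_one.1 mb
  obtain ⟨q, hq⟩ := card_eq_one.1 mc
  obtain ⟨a, ha⟩ := card_eq_one.1 (hu (π 0))
  obtain ⟨b, hb⟩ := card_eq_one.1 (hu (π 1))
  obtain ⟨c, hc⟩ := card_eq_one.1 (hu (π 2))
  have mp : p ∈ lowSide L T (π 1) := by rw [hp]; simp
  have mq : q ∈ lowSide L T (π 2) := by rw [hq]; simp
  have mma : a ∈ upSide U T (π 0) := by rw [ha]; simp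
  have mmb : b ∈ upSide U T (π 1) := by rw [hb]; simp
  have mmc : c ∈ upSide U T (π 2) := by rw [hc]; simp
  have fp := h.low_full (π * rot) (p := p)
  have fq := h.low_full (π * rot⁻¹) (p := q)
  have fa := h.up_full π mma (hu _)
  have fb := h.up_full (π * rot) (p := b)
  have fc := h.up_full (π * rot⁻¹) (p := c)
  simp only [Equiv.Perm.mul_apply, rot_zero, rot_one, rot_two, rot_symm_zero, rot_symm_one,
    rot_symm_two] at fp fq fb fc
  obtain ⟨p0, p2, p3⟩ := fp mp mb
  obtain ⟨q0, q2, q3⟩ := fq mq mc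
  obtain ⟨b0, b2, b3⟩ := fb mmb (hu _)
  obtain ⟨c0, c2, c3⟩ := fc mmc (hu _)
  obtain ⟨a0, a2, a3⟩ := fa
  have da := low_sub_up (L := L) (U := U) (π 0)
  have db := low_sub_up (L := L) (U := U) (π 1)
  have dc := low_sub_up (L := L) (U := U) (π 2)
  have la := lowLen_perm (L := L) (U := U) π
  have lb := upLen_perm (L := L) (U := U) π
  have gx := mem_lowSide.1 hx
  have gy := mem_lowSide.1 hy
  have gp := mem_lowSide.1 mp
  have gq := mem_lowSide.1 mq
  have ga := mem_upSide.1 mma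
  have gb := mem_upSide.1 mmb
  have gc := mem_upSide.1 mmc
  have hAa := hA (π 0)
  have hAb := hA (π 1)
  have hAc := hA (π 2)
  have hBa := hB (π 0)
  have hBb := hB (π 1)
  have hBc := hB (π 2)
  have ez := wt_perm π z
  have exw := wt_perm π x
  have eyw := wt_perm π y
  by_cases hza : z ∈ upSide U T (π 0)
  -- The tile `z` reaches the opposite side. Comparing neighbours around the hexagon then makes the
  -- six other boundary tiles equal.
  · have : z = a := by rwa [ha, mem_singleton] at hza
    subst this
    have e1 := h.le_upLen (π * rot⁻¹) (p := q) (q := x)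
    have e2 := h.le_upLen π (p := y) (q := p)
    have hbc : upLen L U (π 1) ≤ lowLen L U (π 2) := by
      have := h.le_lowLen π (p := z) (q := b)
      rcases this hAc mma (by linarith) mmb (by linarith) with hh | hh <;> linarith
    have hcb : upLen L U (π 2) ≤ lowLen L U (π 1) := by
      have := h.le_lowLen (π * rot⁻¹) (p := c) (q := z)
      simp only [Equiv.Perm.mul_apply, rot_symm_zero, rot_symm_one, rot_symm_two] at this
      rcases this hAb mmc (by linarith) mma (by linarith) with hh | hh <;> linarith
    simp only [Equiv.Perm.mul_apply, rot_symm_zero, rot_symm_one, rot_symm_two] at e1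
    have k1 : lowLen L U (π 2) ≤ upLen L U (π 1) := by
      rcases e1 hBb mq (by linarith) hx (by linarith) with hh | hh <;> linarith
    have k2 : lowLen L U (π 1) ≤ upLen L U (π 2) := by
      rcases e2 hBc hy (by linarith) mp (by linarith) with hh | hh <;> linarith
    have hcard := le_defect_of_class (T := T) (S := (bdTiles L U T).erase z)
      ((erase_subset _ _).trans bdTiles_subset) (s := -wt x) (by
        intro r hr
        obtain ⟨hra, hr⟩ := mem_erase.1 hr
        obtain ⟨j, hr⟩ := mem_bdTiles.1 hr
        revert j
        rw [forall_perm π, hxy, hp, hq, ha, hb, hc]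
        simp only [mem_insert, mem_singleton]
        refine ⟨?_, ?_, ?_⟩
        · rintro ((rfl | rfl) | rfl)
          · rw [abs_of_neg gx.2.1]
          · rw [abs_of_neg gy.2.1]; linarith
          · exact absurd rfl hra
        · rintro (rfl | rfl)
          · rw [abs_of_neg gp.2.1]; linarith
          · rw [abs_of_pos gb.2.1]; linarith
        · rintro (rfl | rfl)
          · rw [abs_of_neg gq.2.1]; linarith
          · rw [abs_of_pos gc.2.1]; linarith)
    rw [card_erase_of_mem (mem_bdTiles.2 ⟨_, Or.inr mma⟩), h.card_bdTiles hA hB, bdCount_perm π,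
      ma, mb, mc, hu, hu, hu] at hcard
    omega
  -- Otherwise `z` is the only tile off the boundary. All eight tiles are then known, and the
  -- balance equations can be written out.
  · have hzb : z ∉ bdTiles L U T := by
      intro hzb
      obtain ⟨j, hzb⟩ := mem_bdTiles.1 hzb
      revert j
      rw [forall_perm π]
      refine ⟨fun hh => ?_, fun hh => ?_, fun hh => ?_⟩
      · rcases hh with hh | hh
        · linarith [(mem_lowSide.1 hh).2.1]
        · exact hza hh
      · rcases hh with hh | hh
        · linarith [(mem_lowSide.1 hh).2.1]
        · linarith [(mem_upSide.1 hh).2.2]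
      · rcases hh with hh | hh
        · linarith [(mem_lowSide.1 hh).2.1]
        · linarith [(mem_upSide.1 hh).2.2]
    have hbd : (bdTiles L U T).card = 7 := by
      rw [h.card_bdTiles hA hB, bdCount_perm π, ma, mb, mc, hu, hu, hu]
    have hT : T = insert z (bdTiles L U T) := by
      refine (eq_of_subset_of_card_le (insert_subset hz bdTiles_subset) ?_).symm
      rw [card_insert_of_notMem hzb, hbd]; exact hn
    have hcard : T.card = 8 := by rw [hT, card_insert_of_notMem hzb, hbd]
    have hsum : ∀ f : (Fin 3 → ℝ) → ℝ, ∑ r ∈ T, f r =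
        f z + ((f x + f y + f a) + (f p + f b) + (f q + f c)) := by
      intro f
      conv_lhs => rw [hT]
      rw [sum_insert hzb, h.sum_bdTiles hA hB, ← Equiv.sum_comp π, Fin.sum_univ_three, hxy, hp, hq,
        ha, hb, hc, sum_pair hne]
      simp only [sum_singleton]
    have bal : ∀ j e, L j < e → e < U j → _ := fun j e h1 h2 =>
      (hsum (fun r => if r j = e then wt r else 0)).symm.trans (h.balance j h1 h2)
    have wz : wt z = z (π 0) - L (π 0) := by linarith
    have hz0 : z (π 0) < U (π 0) := by
      refine lt_of_le_of_ne (h.up z hz _).1 fun hh => hza (mem_upSide.2 ⟨hz, hwz, hh⟩)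
    have ly := (h.low y gy.1 (π 1)).1
    have lx := (h.low x gx.1 (π 2)).1
    have key := eight_tiles (X := -wt x) (Y := -wt y) (Ab := lowLen L U (π 1))
      (Ac := lowLen L U (π 2)) (Ba := upLen L U (π 0)) (Bb := upLen L U (π 1))
      (Bc := upLen L U (π 2)) (m := wt z) (d := wt L + wt U) (by linarith) (by linarith)
      (by linarith) (by linarith) (by linarith) (by linarith) ?_ ?_ ?_
    · have hsz : sizes T ⊆ {2 * (wt L + wt U), 3 * (wt L + wt U), 4 * (wt L + wt U)} := by
        intro s hs
        obtain ⟨r, hr, rfl⟩ := mem_image.1 hs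
        refine key _ ?_
        rw [hT, mem_insert, mem_bdTiles, exists_perm π, hxy, hp, hq, ha, hb, hc] at hr
        simp only [mem_insert, mem_singleton] at hr ⊢
        rcases hr with rfl | ((rfl | rfl) | rfl) | (rfl | rfl) | (rfl | rfl)
        · rw [abs_of_pos hwz]; simp
        · rw [abs_of_neg gx.2.1]; simp
        · rw [abs_of_neg gy.2.1]; simp
        · rw [abs_of_pos ga.2.1, a0]; simp
        · rw [abs_of_neg gp.2.1, p0]; simp
        · rw [abs_of_pos gb.2.1, b0]; simp
        · rw [abs_of_neg gq.2.1, q0]; simp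
        · rw [abs_of_pos gc.2.1, c0]; simp
      have h3 := (card_le_card hsz).trans card_le_three
      have := defect_add_card_sizes (T := T)
      omega
    -- In the direction of the divided side, the levels are the far side of `z` and the inner sides
    -- of the tiles on the four neighbouring sides.
    · have bz := bal (π 0) (z (π 0)) (by linarith) hz0
      have bα := bal (π 0) (-L (π 1) - U (π 2)) (by linarith) (by linarith)
      have bβ := bal (π 0) (-U (π 1) - L (π 2)) (by linarith) (by linarith)
      simp only [gx.2.2, gy.2.2, ga.2.2, p3, q2, b3, c2] at bz bα bβ
      have n1 : L (π 0) ≠ z (π 0) := by intro hh; linarith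
      have n2 : U (π 0) ≠ z (π 0) := by intro hh; linarith
      have n3 : L (π 0) ≠ -L (π 1) - U (π 2) := by intro hh; linarith
      have n4 : U (π 0) ≠ -L (π 1) - U (π 2) := by intro hh; linarith
      have n5 : L (π 0) ≠ -U (π 1) - L (π 2) := by intro hh; linarith
      have n6 : U (π 0) ≠ -U (π 1) - L (π 2) := by intro hh; linarith
      have s1 : -U (π 2) - L (π 1) = -L (π 1) - U (π 2) := by ring
      have s2 : -L (π 2) - U (π 1) = -U (π 1) - L (π 2) := by ring
      simp only [n1, n2, n3, n4, n5, n6, s1, s2, if_true, if_false] at bz bα bβ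
      by_cases e1 : -L (π 1) - U (π 2) = z (π 0) <;> by_cases e2 : -U (π 1) - L (π 2) = z (π 0)
      · left
        simp only [e1, e2, if_true] at bz
        refine ⟨?_, ?_, ?_⟩ <;> linarith
      · right; left
        have e3 : -U (π 1) - L (π 2) ≠ -L (π 1) - U (π 2) := by rw [e1]; exact e2
        simp only [e1, e2, if_true, if_false] at bz
        simp only [e1, Ne.symm e2, if_false] at bβ
        refine ⟨?_, ?_, ?_⟩ <;> linarith
      · right; right
        simp only [e1, e2, if_true, if_false] at bz
        simp only [e2, Ne.symm e1, if_false] at bα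
        refine ⟨?_, ?_, ?_⟩ <;> linarith
      · exfalso
        simp only [e1, e2, if_false] at bz
        linarith
    · have hb3 := three_levels (v := x (π 1)) (y := y (π 1)) (g := -U (π 0) - L (π 2))
        (m1 := wt z + wt x) (m2 := upLen L U (π 2) + wt y)
        (m3 := upLen L U (π 0) - lowLen L U (π 2)) (by intro hh; linarith) (by
          intro e he
          have hlo : L (π 1) < e := by rcases he with rfl | rfl | rfl <;> linarith
          have hhi : e < U (π 1) := by rcases he with rfl | rfl | rfl <;> linarith
          have be := bal (π 1) e hlo hhi
          simp only [z1, a2, gp.2.2, gb.2.2, q3, c3, hlo.ne, hhi.ne', if_false] at be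
          have s1 : -L (π 2) - U (π 0) = -U (π 0) - L (π 2) := by ring
          have s2 : -U (π 2) - L (π 0) = y (π 1) := by rw [y1]; ring
          rw [s1, s2, a0, c0, ← neg_neg (wt q), q0] at be
          split_ifs at be ⊢ <;> linarith)
      rcases hb3 with ⟨k1, k2⟩ | ⟨k1, k2⟩ | ⟨k1, k2, k3⟩
      · left; constructor <;> linarith
      · right; left; constructor <;> linarith
      · right; right; refine ⟨?_, ?_, ?_⟩ <;> linarith
    · have hb3 := three_levels (v := y (π 2)) (y := x (π 2)) (g := -U (π 0) - L (π 1))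
        (m1 := wt z + wt y) (m2 := upLen L U (π 1) + wt x)
        (m3 := upLen L U (π 0) - lowLen L U (π 1)) (by intro hh; linarith) (by
          intro e he
          have hlo : L (π 2) < e := by rcases he with rfl | rfl | rfl <;> linarith
          have hhi : e < U (π 2) := by rcases he with rfl | rfl | rfl <;> linarith
          have be := bal (π 2) e hlo hhi
          simp only [z2, a3, gq.2.2, gc.2.2, p2, b2, hlo.ne, hhi.ne', if_false] at be
          have s1 : -L (π 1) - U (π 0) = -U (π 0) - L (π 1) := by ring
          have s2 : -U (π 1) - L (π 0) = x (π 2) := by rw [x2]; ring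
          rw [s1, s2, a0, b0, ← neg_neg (wt p), p0] at be
          split_ifs at be ⊢ <;> linarith)
      rcases hb3 with ⟨k1, k2⟩ | ⟨k1, k2⟩ | ⟨k1, k2, k3⟩
      · left; constructor <;> linarith
      · right; left; constructor <;> linarith
      · right; right; refine ⟨?_, ?_, ?_⟩ <;> linarith

/-- The defect of a tiling of a hexagon. -/
lemma TightTiling.hexagon (h : TightTiling L U T) (hA : ∀ j, 0 < lowLen L U j)
    (hB : ∀ j, 0 < upLen L U j) :
    (6 ≤ T.card ∧ T.card ≤ 8 ∧ 5 ≤ defect T) ∨ (9 ≤ T.card ∧ 4 ≤ defect T) := by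
  have hcard := (h.card_bdTiles hA hB).symm.trans_le (card_le_card bdTiles_subset)
  have hbd := h.bdCount_le
  have hM := bdCount_perm (L := L) (U := U) (T := T) 1
  have ka := fun j => h.low_card_pos (hA j)
  have kb := fun j => h.up_card_pos (hB j)
  have a0 := ka 0
  have a1 := ka 1
  have a2 := ka 2
  have b0 := kb 0
  have b1 := kb 1
  have b2 := kb 2
  simp only [Equiv.Perm.coe_one, id_eq] at hM
  have hlt := h.defect_lt
  by_cases hD : 5 ≤ defect T
  · omega
  by_cases h9 : 9 ≤ T.card
  · by_cases hD4 : 4 ≤ defect T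
    · omega
    · exact absurd (h.hexagon_of_six hA hB (fun j => by fin_cases j <;> simp <;> omega)
        (fun j => by fin_cases j <;> simp <;> omega)) hD
  exfalso
  refine hD ?_
  by_cases h6 : bdCount L U T = 6
  · exact h.hexagon_of_six hA hB (fun j => by fin_cases j <;> simp <;> omega)
      (fun j => by fin_cases j <;> simp <;> omega)
  -- With seven incidences exactly one side carries two tiles. A cyclic rotation, and if necessary a
  -- reflection, makes it the lower side to which `hexagon_of_seven` applies.
  have hlow : ∀ {L U T}, TightTiling L U T → (∀ j, 0 < lowLen L U j) → (∀ j, 0 < upLen L U j) →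
      (∀ j, (upSide U T j).card = 1) → bdCount L U T = 7 → T.card ≤ 8 →
      (∀ j, 1 ≤ (lowSide L T j).card) → 5 ≤ defect T := by
    intro L U T h hA hB hu hM7 hn hl
    have hM := bdCount_perm (L := L) (U := U) (T := T) 1
    simp only [Equiv.Perm.coe_one, id_eq, hu] at hM
    have l0 := hl 0
    have l1 := hl 1
    have l2 := hl 2
    have : ((lowSide L T 0).card = 2 ∧ (lowSide L T 1).card = 1 ∧ (lowSide L T 2).card = 1) ∨
      ((lowSide L T 1).card = 2 ∧ (lowSide L T 2).card = 1 ∧ (lowSide L T 0).card = 1) ∨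
      ((lowSide L T 2).card = 2 ∧ (lowSide L T 0).card = 1 ∧ (lowSide L T 1).card = 1) := by omega
    rcases this with ⟨m0, m1, m2⟩ | ⟨m0, m1, m2⟩ | ⟨m0, m1, m2⟩
    · exact h.hexagon_of_seven hA hB 1 m0 m1 m2 hu hn
    · exact h.hexagon_of_seven hA hB rot (by rwa [rot_zero]) (by rwa [rot_one]) (by rwa [rot_two])
        hu hn
    · exact h.hexagon_of_seven hA hB rot⁻¹ (by rwa [rot_symm_zero]) (by rwa [rot_symm_one])
        (by rwa [rot_symm_two]) hu hn
  by_cases hu : ∀ j, (upSide U T j).card = 1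
  · exact hlow h hA hB hu (by omega) (by omega) ka
  · have hl : ∀ j, (lowSide L T j).card = 1 := by
      intro j
      by_contra hj
      refine hu fun i => ?_
      fin_cases i <;> fin_cases j <;> simp at hj ⊢ <;> omega
    have := hlow h.neg (fun j => by rw [lowLen_neg]; exact hB j)
      (fun j => by rw [upLen_neg]; exact hA j)
      (fun j => by rw [upSide_neg, card_negTiles]; exact hl j) (by rw [bdCount_neg]; omega)
      (by rw [card_negTiles]; omega) (fun j => by rw [lowSide_neg, card_negTiles]; exact kb j)
    rwa [defect_negTiles] at this

end TriTiling

namespace TriTiling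

/-! ### Constructions -/

open Finset

variable {L U : Fin 3 → ℝ} {T : Finset (Fin 3 → ℝ)}

open Classical in
/-- Adding a strip of tiles beyond the line `f (π 2) = U (π 2)`. -/
lemma HexTiling.glue (h : HexTiling L U T) (π : Equiv.Perm (Fin 3)) {c : ℝ} (hc : U (π 2) ≤ c)
    {N : Finset (Fin 3 → ℝ)} (hw : ∀ p ∈ N, wt p ≠ 0)
    (hlow : ∀ p ∈ N, ∀ j, L j ≤ p j ∧ L j ≤ p j - wt p)
    (hup : ∀ p ∈ N, ∀ j, p j ≤ vec π (U (π 0)) (U (π 1)) c j ∧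
      p j - wt p ≤ vec π (U (π 0)) (U (π 1)) c j)
    (hout : ∀ p ∈ N, U (π 2) ≤ p (π 2) ∧ U (π 2) ≤ p (π 2) - wt p)
    (hcov : ∀ f, wt f = 0 → (∀ j, L j ≤ f j) → U (π 2) ≤ f (π 2) → f (π 2) ≤ c →
      ∃ p ∈ N, Covers p f)
    (hap : ∀ p ∈ N, ∀ q ∈ N, p ≠ q → Apart p q) :
    HexTiling L (vec π (U (π 0)) (U (π 1)) c) (T ∪ N) ∧ Disjoint T N := by
  have key : ∀ p ∈ T, ∀ q ∈ N, Apart p q := by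
    intro p hp q hq f hf h1 h2
    have e := wt_perm π f
    have ep := wt_perm π p
    have eq := wt_perm π q
    have u := h.up p hp (π 2)
    have o := hout q hq
    rcases h1 with ⟨-, h1⟩ | ⟨-, h1⟩ <;> rcases h2 with ⟨-, h2⟩ | ⟨-, h2⟩ <;>
      linarith [h1 (π 0), h1 (π 1), h1 (π 2), h2 (π 0), h2 (π 1), h2 (π 2)]
  refine ⟨⟨?_, ?_, ?_, ?_, ?_⟩, ?_⟩
  · intro p hp
    rcases mem_union.1 hp with hp | hp
    · exact h.wt_ne p hp
    · exact hw p hp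
  · intro p hp
    rcases mem_union.1 hp with hp | hp
    · exact h.low p hp
    · exact hlow p hp
  · intro p hp
    rcases mem_union.1 hp with hp | hp
    · have := h.up p hp
      rw [forall_perm π] at this ⊢
      simp only [vec_zero, vec_one, vec_two]
      exact ⟨this.1, this.2.1, this.2.2.1.trans hc, this.2.2.2.trans hc⟩
    · exact hup p hp
  · intro f hf hj
    by_cases h2 : f (π 2) ≤ U (π 2)
    · obtain ⟨p, hp, hpf⟩ := h.cover f hf (by
        rw [forall_perm π] at hj ⊢
        simp only [vec_zero, vec_one, vec_two] at hj
        exact ⟨hj.1, hj.2.1, hj.2.2.1, h2⟩)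
      exact ⟨p, mem_union_left _ hp, hpf⟩
    · have h3 := (hj (π 2)).2
      rw [vec_two] at h3
      obtain ⟨p, hp, hpf⟩ := hcov f hf (fun j => (hj j).1) (le_of_not_ge h2) h3
      exact ⟨p, mem_union_right _ hp, hpf⟩
  · intro p hp q hq hne
    rcases mem_union.1 hp with hp | hp <;> rcases mem_union.1 hq with hq | hq
    · exact h.apart p hp q hq hne
    · exact key p hp q hq
    · exact (key q hq p hp).symm
    · exact hap p hp q hq hne
  · rw [disjoint_left]
    intro p hp hq
    have u := h.up p hp (π 2)
    have o := hout p hq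
    exact hw p hq (by linarith)

/-- There is a tiling by `n` tiles whose sizes form the set `S`, for a convex region with cyclically
ordered side lengths `x0, …, x5`. -/
def Realizable (n : ℕ) (S : Finset ℝ) (x0 x1 x2 x3 x4 x5 : ℝ) : Prop :=
  ∃ (L U : Fin 3 → ℝ) (T : Finset (Fin 3 → ℝ)) (π : Equiv.Perm (Fin 3)), TightTiling L U T ∧
    T.card = n ∧ sizes T = S ∧ lowLen L U (π 0) = x0 ∧ upLen L U (π 1) = x1 ∧
    lowLen L U (π 2) = x2 ∧ upLen L U (π 0) = x3 ∧ lowLen L U (π 1) = x4 ∧ upLen L U (π 2) = x5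

variable {n : ℕ} {S : Finset ℝ} {x0 x1 x2 x3 x4 x5 : ℝ}

/-- Point reflection exchanges lower and upper sides; together with a rotation of the indices it
shifts the cyclic list of lengths by one place. -/
lemma Realizable.rotate (h : Realizable n S x0 x1 x2 x3 x4 x5) :
    Realizable n S x1 x2 x3 x4 x5 x0 := by
  obtain ⟨L, U, T, π, hT, hn, hS, h0, h1, h2, h3, h4, h5⟩ := h
  refine ⟨-U, -L, negTiles T, π * rot, hT.neg, by rw [card_negTiles, hn], by rw [sizes_negTiles, hS],
    ?_⟩
  simp only [Equiv.Perm.mul_apply, rot_zero, rot_one, rot_two, lowLen_neg, upLen_neg]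
  exact ⟨h1, h2, h3, h4, h5, h0⟩

open Classical in
/-- Adding a strip of tiles along a side. -/
lemma TightTiling.glue (h : TightTiling L U T) (π : Equiv.Perm (Fin 3)) {t : ℝ} (ht : 0 ≤ t)
    (ht' : t ≤ upLen L U (π 2)) {N : Finset (Fin 3 → ℝ)}
    (hN : HexTiling L (vec π (U (π 0)) (U (π 1)) (U (π 2) + t)) (T ∪ N)) (hd : Disjoint T N) :
    Realizable (T.card + N.card) (sizes T ∪ sizes N) (lowLen L U (π 0) + t) (upLen L U (π 1))
      (lowLen L U (π 2)) (upLen L U (π 0)) (lowLen L U (π 1) + t) (upLen L U (π 2) - t) := by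
  have a := lowLen_perm (L := L) (U := U) π
  have b := upLen_perm (L := L) (U := U) π
  have a' := lowLen_perm (L := L) (U := vec π (U (π 0)) (U (π 1)) (U (π 2) + t)) π
  have b' := upLen_perm (L := L) (U := vec π (U (π 0)) (U (π 1)) (U (π 2) + t)) π
  simp only [vec_zero, vec_one, vec_two] at a' b'
  have hl := (forall_perm π).1 h.low_nonneg
  have hu := (forall_perm π).1 h.up_nonneg
  refine ⟨_, _, _, π, ⟨hN, ⟨(forall_perm π).2 ⟨?_, ?_, ?_⟩, (forall_perm π).2 ⟨?_, ?_, ?_⟩⟩, ?_⟩,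
    card_union_of_disjoint hd, ?_, ?_, ?_, ?_, ?_, ?_, ?_⟩
  any_goals linarith
  · exact h.nonempty.mono subset_union_left
  · ext; simp [sizes, or_and_right, exists_or]

/-- Adding one tile along a side. -/
lemma Realizable.add_tile (h : Realizable n S x0 x1 x2 x3 x4 x5) (hx : 0 < x5) :
    Realizable (n + 1) (insert x5 S) (x0 + x5) x1 x2 x3 (x4 + x5) 0 := by
  classical
  obtain ⟨L, U, T, π, hT, rfl, rfl, rfl, rfl, rfl, rfl, rfl, rfl⟩ := h
  have a := lowLen_perm (L := L) (U := U) π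
  have b := upLen_perm (L := L) (U := U) π
  have hl := (forall_perm π).1 hT.low_nonneg
  -- The up tile standing on the whole upper side: its other two sides prolong the neighbouring
  -- lower sides.
  set p := vec π (L (π 0)) (L (π 1)) (U (π 2)) with hp
  have hw : wt p = -upLen L U (π 2) := by rw [hp, wt_vec]; linarith
  obtain ⟨h1, h2⟩ := hT.toHexTiling.glue π (c := U (π 2) + upLen L U (π 2)) (by linarith) (N := {p})
    (by simp only [mem_singleton, forall_eq]; linarith)
    (by
      simp only [mem_singleton, forall_eq, forall_perm π, hw]
      simp only [hp, vec_zero, vec_one, vec_two]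
      have := hT.lt (π 2)
      refine ⟨⟨?_, ?_⟩, ⟨?_, ?_⟩, ⟨?_, ?_⟩⟩ <;> linarith)
    (by
      simp only [mem_singleton, forall_eq, forall_perm π, hw]
      simp only [hp, vec_zero, vec_one, vec_two]
      have := hT.lt (π 0)
      have := hT.lt (π 1)
      refine ⟨⟨?_, ?_⟩, ⟨?_, ?_⟩, ⟨?_, ?_⟩⟩ <;> linarith)
    (by
      simp only [mem_singleton, forall_eq, hw]
      simp only [hp, vec_two]
      constructor <;> linarith)
    (by
      intro f hf hL h2 _
      refine ⟨p, mem_singleton_self _, Or.inl ⟨by linarith, (forall_perm π).2 ?_⟩⟩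
      simp only [hp, vec_zero, vec_one, vec_two]
      exact ⟨hL _, hL _, h2⟩)
    (by
      simp only [mem_singleton, forall_eq]
      exact fun hh => absurd rfl hh)
  have := hT.glue π hx.le le_rfl h1 h2
  rw [card_singleton, sub_self] at this
  have hs : sizes T ∪ sizes {p} = insert (upLen L U (π 2)) (sizes T) := by
    ext s
    simp only [sizes, mem_union, mem_insert, mem_image, mem_singleton, exists_eq_left, hw, abs_neg,
      abs_of_pos hx, eq_comm (a := s)]
    exact or_comm
  rwa [hs] at this

/-- Adding three tiles along a side. -/
lemma Realizable.add_three (h : Realizable n S x0 x1 x2 x3 x4 x5) (hx : 0 < x5) :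
    Realizable (n + 3) (insert (x5 / 2) S) (x0 + x5 / 2) x1 x2 x3 (x4 + x5 / 2) (x5 / 2) := by
  classical
  obtain ⟨L, U, T, π, hT, rfl, rfl, rfl, rfl, rfl, rfl, rfl, rfl⟩ := h
  have a := lowLen_perm (L := L) (U := U) π
  have b := upLen_perm (L := L) (U := U) π
  have hl := (forall_perm π).1 hT.low_nonneg
  have hu := (forall_perm π).1 hT.up_nonneg
  set t := upLen L U (π 2) / 2 with ht
  have ht0 : 0 < t := by positivity
  have hb : upLen L U (π 2) = 2 * t := by rw [ht]; ring
  -- Two up tiles stand on the halves of the side and a down tile fits between them, so half of the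
  -- side remains.
  set p := vec π (L (π 0)) (L (π 1) + t) (U (π 2)) with hp
  set q := vec π (L (π 0) + t) (L (π 1)) (U (π 2)) with hq
  set r := vec π (L (π 0) + t) (L (π 1) + t) (U (π 2) + t) with hr
  have hwp : wt p = -t := by rw [hp, wt_vec]; linarith
  have hwq : wt q = -t := by rw [hq, wt_vec]; linarith
  have hwr : wt r = t := by rw [hr, wt_vec]; linarith
  have hpq : p ≠ q := fun hh => by
    have := congrFun hh (π 0)
    rw [hp, hq, vec_zero, vec_zero] at this
    linarith
  have hpr : p ≠ r := fun hh => by rw [hh] at hwp; linarith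
  have hqr : q ≠ r := fun hh => by rw [hh] at hwq; linarith
  have l0 := hT.lt (π 0)
  have l1 := hT.lt (π 1)
  have l2 := hT.lt (π 2)
  have apq : Apart p q := by
    rintro f hf (⟨-, k1⟩ | ⟨k1, -⟩) (⟨-, k2⟩ | ⟨k2, -⟩) <;> try linarith
    have := k1 (π 1)
    have := k2 (π 0)
    have := k1 (π 2)
    have := wt_perm π f
    simp only [hp, hq, vec_zero, vec_one, vec_two] at *
    linarith
  have apr : Apart p r := by
    rintro f hf (⟨-, k1⟩ | ⟨k1, -⟩) (⟨k2, -⟩ | ⟨-, k2⟩) <;> try linarith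
    have := k1 (π 1)
    have := k2 (π 1)
    simp only [hp, hr, vec_one] at *
    linarith
  have aqr : Apart q r := by
    rintro f hf (⟨-, k1⟩ | ⟨k1, -⟩) (⟨k2, -⟩ | ⟨-, k2⟩) <;> try linarith
    have := k1 (π 0)
    have := k2 (π 0)
    simp only [hq, hr, vec_zero] at *
    linarith
  obtain ⟨h1, h2⟩ := hT.toHexTiling.glue π (c := U (π 2) + t) (by linarith) (N := {p, q, r})
    (by
      simp only [mem_insert, mem_singleton, forall_eq_or_imp, forall_eq, hwp, hwq, hwr]
      refine ⟨?_, ?_, ?_⟩ <;> linarith)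
    (by
      simp only [mem_insert, mem_singleton, forall_eq_or_imp, forall_eq, forall_perm π, hwp, hwq, hwr]
      simp only [hp, hq, hr, vec_zero, vec_one, vec_two]
      refine ⟨⟨⟨?_, ?_⟩, ⟨?_, ?_⟩, ⟨?_, ?_⟩⟩, ⟨⟨?_, ?_⟩, ⟨?_, ?_⟩, ⟨?_, ?_⟩⟩,
        ⟨⟨?_, ?_⟩, ⟨?_, ?_⟩, ⟨?_, ?_⟩⟩⟩ <;> linarith)
    (by
      simp only [mem_insert, mem_singleton, forall_eq_or_imp, forall_eq, forall_perm π, hwp, hwq, hwr]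
      simp only [hp, hq, hr, vec_zero, vec_one, vec_two]
      refine ⟨⟨⟨?_, ?_⟩, ⟨?_, ?_⟩, ⟨?_, ?_⟩⟩, ⟨⟨?_, ?_⟩, ⟨?_, ?_⟩, ⟨?_, ?_⟩⟩,
        ⟨⟨?_, ?_⟩, ⟨?_, ?_⟩, ⟨?_, ?_⟩⟩⟩ <;> linarith)
    (by
      simp only [mem_insert, mem_singleton, forall_eq_or_imp, forall_eq, hwp, hwq, hwr]
      simp only [hp, hq, hr, vec_two]
      refine ⟨⟨?_, ?_⟩, ⟨?_, ?_⟩, ⟨?_, ?_⟩⟩ <;> linarith)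
    (by
      intro f hf hL k2 k3
      by_cases f1 : L (π 1) + t ≤ f (π 1)
      · refine ⟨p, by simp, Or.inl ⟨by linarith, (forall_perm π).2 ?_⟩⟩
        simp only [hp, vec_zero, vec_one, vec_two]
        exact ⟨hL _, f1, k2⟩
      · by_cases f0 : L (π 0) + t ≤ f (π 0)
        · refine ⟨q, by simp, Or.inl ⟨by linarith, (forall_perm π).2 ?_⟩⟩
          simp only [hq, vec_zero, vec_one, vec_two]
          exact ⟨f0, hL _, k2⟩
        · refine ⟨r, by simp, Or.inr ⟨by linarith, (forall_perm π).2 ?_⟩⟩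
          simp only [hr, vec_zero, vec_one, vec_two]
          exact ⟨by linarith, by linarith, k3⟩)
    (by
      simp only [mem_insert, mem_singleton, forall_eq_or_imp, forall_eq]
      exact ⟨⟨fun hh => absurd rfl hh, fun _ => apq, fun _ => apr⟩,
        ⟨fun _ => apq.symm, fun hh => absurd rfl hh, fun _ => aqr⟩,
        fun _ => apr.symm, fun _ => aqr.symm, fun hh => absurd rfl hh⟩)
  have := hT.glue π ht0.le (by linarith) h1 h2
  rw [card_eq_three.2 ⟨p, q, r, hpq, hpr, hqr, rfl⟩] at this
  have hs : sizes T ∪ sizes {p, q, r} = insert t (sizes T) := by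
    ext s
    simp only [sizes, mem_union, mem_insert, mem_image, mem_singleton, exists_eq_or_imp,
      exists_eq_left, hwp, hwq, hwr, abs_neg, abs_of_pos ht0, eq_comm (a := s),
      or_self]
    exact or_comm
  have he : upLen L U (π 2) - t = t := by linarith
  rwa [hs, he] at this

/-- A single tile. -/
lemma realizable_one : Realizable 1 {1} 1 0 1 0 1 0 := by
  have hw : wt ![0, 0, -1] = -1 := by simp [wt]
  have hw' : wt ![1, 1, 0] = 2 := by simp [wt]; norm_num
  have ha : ∀ j, lowLen ![0, 0, -1] ![1, 1, 0] j = 1 := by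
    intro j; rw [lowLen, hw']; fin_cases j <;> norm_num
  have hb : ∀ j, upLen ![0, 0, -1] ![1, 1, 0] j = 0 := by
    intro j; rw [upLen, hw]; fin_cases j <;> norm_num
  refine ⟨![0, 0, -1], ![1, 1, 0], {![0, 0, -1]}, 1, ⟨⟨?_, ?_, ?_, ?_, ?_⟩, ⟨?_, ?_⟩, ?_⟩,
    card_singleton _, ?_, ha _, hb _, ha _, hb _, ha _, hb _⟩
  · simp only [mem_singleton, forall_eq, hw]; norm_num
  · simp only [mem_singleton, forall_eq, hw]
    intro j; constructor <;> linarith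
  · simp only [mem_singleton, forall_eq, hw]
    intro j; fin_cases j <;> norm_num
  · intro f hf hj
    exact ⟨_, mem_singleton_self _, Or.inl ⟨by rw [hw]; norm_num, fun j => (hj j).1⟩⟩
  · simp only [mem_singleton, forall_eq]
    exact fun hh => absurd rfl hh
  · intro j; rw [ha]; norm_num
  · intro j; rw [hb]
  · exact singleton_nonempty _
  · simp [sizes, hw]

end TriTiling

namespace TriTiling

/-! ### Spiral tilings -/

open Finset

variable {n : ℕ} {S : Finset ℝ} {x0 x1 x2 x3 x4 x5 : ℝ}

/-! ### Attaching tiles along other sides -/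

lemma Realizable.add_zero (h : Realizable n S x0 x1 x2 x3 x4 x5) (hx : 0 < x0) :
    Realizable (n + 1) (insert x0 S) 0 (x1 + x0) x2 x3 x4 (x5 + x0) :=
  (h.rotate.add_tile hx).rotate.rotate.rotate.rotate.rotate

lemma Realizable.add_two (h : Realizable n S x0 x1 x2 x3 x4 x5) (hx : 0 < x2) :
    Realizable (n + 1) (insert x2 S) x0 (x1 + x2) 0 (x3 + x2) x4 x5 :=
  (h.rotate.rotate.add_zero hx).rotate.rotate.rotate.rotate

lemma Realizable.add_side_three (h : Realizable n S x0 x1 x2 x3 x4 x5) (hx : 0 < x3) :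
    Realizable (n + 1) (insert x3 S) x0 x1 (x2 + x3) 0 (x4 + x3) x5 :=
  (h.rotate.add_two hx).rotate.rotate.rotate.rotate.rotate

lemma Realizable.add_four (h : Realizable n S x0 x1 x2 x3 x4 x5) (hx : 0 < x4) :
    Realizable (n + 1) (insert x4 S) x0 x1 x2 (x3 + x4) 0 (x5 + x4) :=
  (h.rotate.add_side_three hx).rotate.rotate.rotate.rotate.rotate

lemma Realizable.halve_two (h : Realizable n S x0 x1 x2 x3 x4 x5) (hx : 0 < x2) :
    Realizable (n + 3) (insert (x2 / 2) S) x0 (x1 + x2 / 2) (x2 / 2) (x3 + x2 / 2) x4 x5 :=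
  (h.rotate.rotate.rotate.add_three hx).rotate.rotate.rotate

/-- One step of the spiral of triangles around a pentagon. -/
lemma Realizable.spiral {a c d e f : ℝ} (h : Realizable n S a 0 c d e f) (hc : 0 < c) :
    Realizable (n + 1) (insert c S) c 0 (c + d) e f a := by
  have := (h.add_two hc).rotate
  rwa [zero_add, add_comm d c] at this

/-- The side lengths in the spiral of triangles. -/
def padovan : ℕ → ℕ
  | 0 => 1
  | 1 => 1
  | 2 => 2
  | 3 => 2
  | 4 => 3
  | n + 5 => padovan (n + 4) + padovan n

lemma padovan_add_five (n : ℕ) : padovan (n + 5) = padovan (n + 4) + padovan n := by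
  rw [padovan]

/-- The shorter recurrence locates half of a term between two earlier ones. -/
lemma padovan_add_four : ∀ n, padovan (n + 4) = padovan (n + 2) + padovan (n + 1)
  | 0 => rfl
  | 1 => rfl
  | n + 2 => by
    have h1 := padovan_add_four n
    have h2 := padovan_add_four (n + 1)
    have h3 := padovan_add_five (n + 1)
    simp only [add_assoc, Nat.reduceAdd] at *
    omega

lemma padovan_pos (n : ℕ) : 0 < padovan n := by
  induction n using padovan.induct with
  | case1 => decide
  | case2 => decide
  | case3 => decide
  | case4 => decide
  | case5 => decide
  | case6 n h1 h2 => rw [padovan]; omega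

lemma padovan_monotone : Monotone padovan := by
  refine monotone_nat_of_le_succ fun n => ?_
  match n with
  | 0 => decide
  | 1 => decide
  | 2 => decide
  | 3 => decide
  | n + 4 => rw [padovan_add_five]; omega

lemma padovan_lt (n : ℕ) : padovan (n + 3) < padovan (n + 4) := by
  match n with
  | 0 => decide
  | n + 1 => 
    have := padovan_pos n
    rw [show n + 1 + 4 = n + 5 from rfl, padovan_add_five]
    exact Nat.lt_add_of_pos_right this

/-- The sizes of the triangles in the spiral. -/
noncomputable def spiralSizes (m : ℕ) : Finset ℝ :=
  ((range (m + 4)).image padovan).image (fun k : ℕ => (k : ℝ))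

/-- The first four terms `1, 1, 2, 2` have two values; from then on every term is new. -/
lemma card_spiralSizes (m : ℕ) : (spiralSizes m).card = m + 2 := by
  rw [spiralSizes, card_image_of_injective _ Nat.cast_injective]
  induction m with
  | zero => decide
  | succ m ih =>
    rw [show m + 1 + 4 = (m + 4) + 1 from rfl, range_add_one, image_insert, card_insert_of_notMem, ih]
    intro hmem
    obtain ⟨k, hk, he⟩ := mem_image.1 hmem
    have h1 := padovan_monotone (show k ≤ m + 3 by have := mem_range.1 hk; omega)
    have h2 := padovan_lt m
    omega

lemma padovan_mem_spiralSizes {m k : ℕ} (h : k < m + 4) : (padovan k : ℝ) ∈ spiralSizes m :=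
  mem_image_of_mem _ (mem_image_of_mem _ (mem_range.2 h))

lemma insert_spiralSizes (m : ℕ) :
    insert (padovan (m + 4) : ℝ) (spiralSizes m) = spiralSizes (m + 1) := by
  have : range (m + 1 + 4) = insert (m + 4) (range (m + 4)) := range_add_one
  simp only [spiralSizes, this, image_insert]

/-- `padovan (m + 4)` is the sum of two consecutive terms, which differ unless `m = 1`. Its half
lies strictly between them and so is not a term. -/
lemma half_notMem_spiralSizes {m : ℕ} (hm : m ≠ 1) : (padovan (m + 4) / 2 : ℝ) ∉ spiralSizes m := by
  intro hmem
  obtain ⟨a, ha, he⟩ := mem_image.1 hmem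
  obtain ⟨k, hk, rfl⟩ := mem_image.1 ha
  have h1 : 2 * padovan k = padovan (m + 4) := by
    have : (2 : ℝ) * padovan k = padovan (m + 4) := by linarith
    exact_mod_cast this
  have h2 := padovan_add_four m
  have h3 : padovan (m + 1) < padovan (m + 2) := by
    match m with
    | 0 => decide
    | 1 => exact absurd rfl hm
    | m + 2 => exact padovan_lt m
  rcases le_or_gt k (m + 1) with hk | hk
  · have := padovan_monotone hk; omega
  · have := padovan_monotone (show m + 2 ≤ k from hk); omega

lemma realizable_parallelogram_two : Realizable 2 {1} 1 0 1 1 0 1 := by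
  convert realizable_one.spiral one_pos using 1 <;> simp

lemma realizable_trapezoid_three : Realizable 3 {1} 1 0 2 0 1 1 := by
  convert realizable_parallelogram_two.spiral one_pos using 1
  · simp
  · norm_num

lemma realizable_pentagon_four : Realizable 4 {1, 2} 2 0 2 1 1 1 := by
  convert realizable_trapezoid_three.spiral two_pos using 1
  · exact pair_comm _ _
  · norm_num

/-- Each step attaches a tile along the longest side of a pentagon and gives a pentagon again; its
new longest side follows the Padovan recurrence. -/
lemma realizable_spiral (m : ℕ) : Realizable (m + 5) (spiralSizes m) (padovan (m + 3)) 0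
    (padovan (m + 4)) (padovan m) (padovan (m + 1)) (padovan (m + 2)) := by
  induction m with
  | zero =>
    convert realizable_pentagon_four.spiral two_pos using 1
    · have : (range (0 + 4)).image padovan = {1, 2} := by decide
      rw [spiralSizes, this]
      ext s
      simp
    all_goals norm_num [padovan]
  | succ m ih =>
    have h := ih.spiral (Nat.cast_pos.2 (padovan_pos _))
    rw [insert_spiralSizes] at h
    convert h using 1
    rw [show m + 1 + 4 = m + 5 from rfl, padovan_add_five]
    push_cast
    rfl

/-- Pentagons. -/
lemma exists_pentagon {n : ℕ} (hn : 5 ≤ n) : ∃ S x0 x2 x3 x4 x5, Realizable n S x0 0 x2 x3 x4 x5 ∧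
    0 < x0 ∧ 0 < x2 ∧ 0 < x3 ∧ 0 < x4 ∧ 0 < x5 ∧ S.card = n - 3 ∧ x3 ∈ S ∧ x4 ∈ S ∧ x5 ∈ S := by
  obtain ⟨m, rfl⟩ := Nat.exists_eq_add_of_le' hn
  refine ⟨_, _, _, _, _, _, realizable_spiral m, ?_, ?_, ?_, ?_, ?_, ?_,
    padovan_mem_spiralSizes (by omega), padovan_mem_spiralSizes (by omega),
    padovan_mem_spiralSizes (by omega)⟩
  any_goals exact Nat.cast_pos.2 (padovan_pos _)
  rw [card_spiralSizes]
  omega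

/-- A tile of a size already present closes one side of the pentagon and costs one unit of defect.
The next two lemmas do the same along other sides. -/
lemma Realizable.trapezoid_of_pentagon (h : Realizable n S x0 0 x2 x3 x4 x5) (h3 : 0 < x3)
    (hS : x3 ∈ S) : Realizable (n + 1) S x0 0 (x2 + x3) 0 (x4 + x3) x5 := by
  have := h.add_side_three h3
  rwa [insert_eq_self.2 hS] at this

lemma Realizable.parallelogram_of_pentagon (h : Realizable n S x0 0 x2 x3 x4 x5) (h4 : 0 < x4)
    (hS : x4 ∈ S) : Realizable (n + 1) S x0 0 x2 (x3 + x4) 0 (x5 + x4) := by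
  have := h.add_four h4
  rwa [insert_eq_self.2 hS] at this

lemma Realizable.triangle_of_trapezoid (h : Realizable n S x0 0 x2 0 x4 x5) (h5 : 0 < x5)
    (hS : x5 ∈ S) : Realizable (n + 1) S (x0 + x5) 0 x2 0 (x4 + x5) 0 := by
  have := h.add_tile h5
  rwa [insert_eq_self.2 hS] at this

lemma exists_trapezoid {n : ℕ} (hn : 6 ≤ n) : ∃ S x0 x2 x4 x5, Realizable n S x0 0 x2 0 x4 x5 ∧
    0 < x0 ∧ 0 < x2 ∧ 0 < x4 ∧ 0 < x5 ∧ S.card = n - 4 ∧ x5 ∈ S := by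
  obtain ⟨m, rfl⟩ := Nat.exists_eq_add_of_le' (show 1 ≤ n by omega)
  obtain ⟨S, x0, x2, x3, x4, x5, h, h0, h2, h3, h4, h5, hc, m3, m4, m5⟩ :=
    exists_pentagon (n := m) (by omega)
  exact ⟨_, _, _, _, _, h.trapezoid_of_pentagon h3 m3, by positivity, by positivity, by positivity,
    by positivity, by omega, m5⟩

lemma exists_parallelogram {n : ℕ} (hn : 6 ≤ n) : ∃ S x0 x2 x3 x5, Realizable n S x0 0 x2 x3 0 x5 ∧
    0 < x0 ∧ 0 < x2 ∧ 0 < x3 ∧ 0 < x5 ∧ S.card = n - 4 := by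
  obtain ⟨m, rfl⟩ := Nat.exists_eq_add_of_le' (show 1 ≤ n by omega)
  obtain ⟨S, x0, x2, x3, x4, x5, h, h0, h2, h3, h4, h5, hc, m3, m4, m5⟩ :=
    exists_pentagon (n := m) (by omega)
  exact ⟨_, _, _, _, _, h.parallelogram_of_pentagon h4 m4, by positivity, by positivity,
    by positivity, by positivity, by omega⟩

lemma exists_triangle {n : ℕ} (hn : 7 ≤ n) : ∃ S x0 x2 x4, Realizable n S x0 0 x2 0 x4 0 ∧
    0 < x0 ∧ 0 < x2 ∧ 0 < x4 ∧ S.card = n - 5 := by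
  obtain ⟨m, rfl⟩ := Nat.exists_eq_add_of_le' (show 1 ≤ n by omega)
  obtain ⟨S, x0, x2, x4, x5, h, h0, h2, h4, h5, hc, m5⟩ := exists_trapezoid (n := m) (by omega)
  exact ⟨_, _, _, _, h.triangle_of_trapezoid h5 m5, by positivity, by positivity, by positivity,
    by omega⟩

lemma realizable_trapezoid_five : Realizable 5 {1, 2} 2 0 3 0 2 1 := by
  convert realizable_pentagon_four.trapezoid_of_pentagon one_pos (by simp) using 1 <;> norm_num

lemma realizable_parallelogram_five : Realizable 5 {1, 2} 2 0 2 2 0 2 := by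
  convert realizable_pentagon_four.parallelogram_of_pentagon one_pos (by simp) using 1 <;> norm_num

lemma realizable_triangle_six : Realizable 6 {1, 2} 3 0 3 0 3 0 := by
  convert realizable_trapezoid_five.triangle_of_trapezoid one_pos (by simp) using 1 <;> norm_num

lemma realizable_triangle_four : Realizable 4 {1} 2 0 2 0 2 0 := by
  convert realizable_trapezoid_three.triangle_of_trapezoid one_pos (by simp) using 1 <;> norm_num

lemma realizable_parallelogram_four : Realizable 4 {1} 2 0 1 2 0 1 := by
  have h := (realizable_trapezoid_three.add_zero one_pos).rotate.rotate
  convert h using 1 <;> norm_num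

/-- Attaching three tiles of half a side brings one new size. The case `n = 9` is excluded, since
half of the side 4 is the size 2 already present. -/
lemma exists_hexagon {n : ℕ} (hn : (6 ≤ n ∧ n ≤ 8) ∨ 10 ≤ n) :
    ∃ S x0 x1 x2 x3 x4 x5, Realizable n S x0 x1 x2 x3 x4 x5 ∧
    0 < x0 ∧ 0 < x1 ∧ 0 < x2 ∧ 0 < x3 ∧ 0 < x4 ∧ 0 < x5 ∧ S.card = n - 5 := by
  by_cases h6 : n = 6
  · subst h6
    refine ⟨_, _, _, _, _, _, _, realizable_trapezoid_three.halve_two two_pos, ?_⟩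
    norm_num
  by_cases h7 : n = 7
  · subst h7
    refine ⟨_, _, _, _, _, _, _, realizable_pentagon_four.halve_two two_pos, ?_⟩
    norm_num
  obtain ⟨m, rfl⟩ := Nat.exists_eq_add_of_le' (show 8 ≤ n by omega)
  have hp := fun k => (Nat.cast_pos (α := ℝ)).2 (padovan_pos k)
  refine ⟨_, _, _, _, _, _, _, (realizable_spiral m).halve_two (hp _), hp _, ?_, ?_, ?_, hp _, hp _,
    ?_⟩
  · have := hp (m + 4); positivity
  · have := hp (m + 4); positivity
  · have := hp (m + 4); have := hp m; positivity
  · rw [card_insert_of_notMem (half_notMem_spiralSizes (by omega)), card_spiralSizes]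
    omega

end TriTiling

namespace TriTiling

open Finset MeasureTheory

variable {L U : Fin 3 → ℝ} {T : Finset (Fin 3 → ℝ)}

/-! ### Tilings of a triangle by area -/

/-- The point of the plane with given first two coordinates. -/
def lift (v : ℝ × ℝ) : Fin 3 → ℝ := ![v.1, v.2, -v.1 - v.2]

@[simp] lemma wt_lift (v : ℝ × ℝ) : wt (lift v) = 0 := by simp [wt, lift]

lemma continuous_lift (j : Fin 3) : Continuous fun v => lift v j := by
  fin_cases j <;> simp [lift] <;> fun_prop

lemma lift_eq {f : Fin 3 → ℝ} (hf : wt f = 0) : lift (f 0, f 1) = f := by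
  rw [wt] at hf
  ext j
  fin_cases j
  · rfl
  · rfl
  · simp [lift]; linarith

lemma isOpen_inside (p : Fin 3 → ℝ) : IsOpen {v : ℝ × ℝ | Inside p (lift v)} := by
  simp only [Inside, Set.ofPred_or, Set.ofPred_and, Set.ofPred_forall]
  refine (isOpen_const.inter ?_).union (isOpen_const.inter ?_)
  · exact isOpen_iInter_of_finite fun j => isOpen_lt continuous_const (continuous_lift j)
  · exact isOpen_iInter_of_finite fun j => isOpen_lt (continuous_lift j) continuous_const

lemma isClosed_covers (p : Fin 3 → ℝ) : IsClosed {v : ℝ × ℝ | Covers p (lift v)} := by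
  simp only [Covers, Set.ofPred_or, Set.ofPred_and, Set.ofPred_forall]
  refine (isClosed_const.inter ?_).union (isClosed_const.inter ?_)
  · exact isClosed_iInter fun j => isClosed_le continuous_const (continuous_lift j)
  · exact isClosed_iInter fun j => isClosed_le (continuous_lift j) continuous_const

/-- Every tile is the image of the unit up tile under `v ↦ p - wt p • v`, so its area is
proportional to `wt p ^ 2`, with the same factor for up and down tiles. -/
lemma inside_add_smul {p : Fin 3 → ℝ} (hp : wt p ≠ 0) (v : ℝ × ℝ) :
    Inside p (lift ((p 0, p 1) + (-wt p) • v)) ↔ ∀ j, ![0, 0, -1] j < lift v j := by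
  have key : ∀ j, lift ((p 0, p 1) + (-wt p) • v) j = p j + -wt p * (lift v j - ![0, 0, -1] j) := by
    intro j
    fin_cases j <;> simp [lift, wt] ; ring
  simp only [Inside, key]
  rcases lt_or_gt_of_ne hp with hw | hw
  · have h1 : ∀ x : ℝ, 0 < -wt p * x ↔ 0 < x := fun x => mul_pos_iff_of_pos_left (by linarith)
    simp only [hw, hw.le.not_gt, true_and, false_and, or_false, lt_add_iff_pos_right, h1, sub_pos]
  · have h1 : ∀ x : ℝ, -wt p * x < 0 ↔ 0 < x := fun x => by
      rw [neg_mul, neg_lt_zero, mul_pos_iff_of_pos_left hw]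
    simp only [hw, hw.le.not_gt, true_and, false_and, false_or, add_lt_iff_neg_left, h1, sub_pos]

lemma volume_inside {p : Fin 3 → ℝ} (hp : wt p ≠ 0) :
    volume {v : ℝ × ℝ | Inside p (lift v)} =
      ENNReal.ofReal (wt p ^ 2) * volume {v : ℝ × ℝ | ∀ j, ![0, 0, -1] j < lift v j} := by
  have h1 : {v : ℝ × ℝ | ∀ j, ![0, 0, -1] j < lift v j} =
      (fun v => (-wt p) • v) ⁻¹' ((fun v => (p 0, p 1) + v) ⁻¹' {v | Inside p (lift v)}) := by
    ext v
    exact (inside_add_smul hp v).symm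
  have h2 := Measure.addHaar_preimage_smul (volume : Measure (ℝ × ℝ)) (neg_ne_zero.2 hp)
    ((fun v => (p 0, p 1) + v) ⁻¹' {v | Inside p (lift v)})
  rw [← h1, measure_preimage_add] at h2
  have h3 : Module.finrank ℝ (ℝ × ℝ) = 2 := by simp
  rw [h2, h3, ← mul_assoc, ← ENNReal.ofReal_mul (sq_nonneg _), neg_sq, abs_of_nonneg (by positivity),
    mul_inv_cancel₀ (pow_ne_zero 2 hp), ENNReal.ofReal_one, one_mul]

lemma volume_unit : volume {v : ℝ × ℝ | ∀ j, ![0, 0, -1] j < lift v j} ≠ ⊤ := by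
  refine ((measure_mono (t := Set.Icc 0 1 ×ˢ Set.Icc 0 1) ?_).trans_lt ?_).ne
  · rintro ⟨x, y⟩ h
    have h0 := h 0
    have h1 := h 1
    have h2 := h 2
    simp [lift] at h0 h1 h2
    exact ⟨⟨h0.le, by simp; linarith⟩, ⟨h1.le, by simp; linarith⟩⟩
  · exact (isCompact_Icc.prod isCompact_Icc).measure_lt_top

/-- Disjoint tiles of the right total area cover the triangle. -/
lemma hexTiling_of_area {L : Fin 3 → ℝ} (hL : wt L < 0) {T : Finset (Fin 3 → ℝ)}
    (hw : ∀ p ∈ T, wt p ≠ 0) (hlow : ∀ p ∈ T, ∀ j, L j ≤ p j ∧ L j ≤ p j - wt p)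
    (hap : ∀ p ∈ T, ∀ q ∈ T, p ≠ q → Apart p q) (hs : ∑ p ∈ T, wt p ^ 2 = wt L ^ 2) :
    HexTiling L (fun j => L j - wt L) T := by
  have e : ∀ p : Fin 3 → ℝ, p 0 + p 1 + p 2 = wt p := fun p => rfl
  have hup : ∀ p ∈ T, ∀ j, p j ≤ L j - wt L ∧ p j - wt p ≤ L j - wt L := by
    intro p hp j
    have h0 := hlow p hp 0
    have h1 := hlow p hp 1
    have h2 := hlow p hp 2
    have ep := e p
    have eL := e L
    fin_cases j <;> constructor <;> simp <;> linarith
  have hin : ∀ p ∈ T, ∀ f, wt f = 0 → Inside p f → Inside L f := by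
    intro p hp f hf h
    refine Or.inl ⟨hL, ?_⟩
    have hl := hlow p hp
    rcases h with ⟨-, h⟩ | ⟨-, h⟩
    · exact fun j => (hl j).1.trans_lt (h j)
    · have h0 := h 0
      have h1 := h 1
      have h2 := h 2
      have ep := e p
      have ef := e f
      intro j
      have := (hl j).2
      fin_cases j <;> simp at this ⊢ <;> linarith
  refine ⟨hw, hlow, hup, ?_, hap⟩
  intro f hf hj
  by_contra! hcon
  -- The uncovered part of the open triangle. It is open, so if nonempty it has positive area, for
  -- which the tiles leave no room.
  set W : Set (ℝ × ℝ) := {v | Inside L (lift v)} ∩ ⋂ p ∈ T, {v | Covers p (lift v)}ᶜ with hW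
  have hWo : IsOpen W := (isOpen_inside L).inter
    (isOpen_biInter_finset fun p _ => (isClosed_covers p).isOpen_compl)
  have hWne : W.Nonempty := by
    have ho : IsOpen (⋂ p ∈ T, {v | Covers p (lift v)}ᶜ) :=
      isOpen_biInter_finset fun p _ => (isClosed_covers p).isOpen_compl
    have hmem : ((f 0, f 1) : ℝ × ℝ) ∈ ⋂ p ∈ T, {v | Covers p (lift v)}ᶜ := by
      simp only [Set.mem_iInter]
      intro p hp hc
      simp only [Set.mem_ofPred_eq, lift_eq hf] at hc
      exact hcon p hp hc
    -- An uncovered point may lie on the boundary of the triangle; moving it slightly towards the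
    -- centre `g` makes it interior and keeps it uncovered.
    set g : ℝ × ℝ := (L 0 - wt L / 3, L 1 - wt L / 3) with hg
    have hc : Continuous fun t : ℝ => ((f 0, f 1) : ℝ × ℝ) + t • (g - (f 0, f 1)) := by fun_prop
    have ht : ∀ᶠ t in nhdsWithin (0 : ℝ) (Set.Ioi 0),
        ((f 0, f 1) : ℝ × ℝ) + t • (g - (f 0, f 1)) ∈ ⋂ p ∈ T, {v | Covers p (lift v)}ᶜ := by
      refine nhdsWithin_le_nhds (hc.continuousAt.preimage_mem_nhds (ho.mem_nhds ?_))
      simpa using hmem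
    have ht2 : ∀ᶠ t in nhdsWithin (0 : ℝ) (Set.Ioi 0), t ∈ Set.Ioo (0 : ℝ) 1 :=
      Ioo_mem_nhdsGT one_pos
    obtain ⟨t, h1, h2, h3⟩ := (ht.and ht2).exists
    refine ⟨_, ?_, h1⟩
    refine Or.inl ⟨hL, fun j => ?_⟩
    have key : lift (((f 0, f 1) : ℝ × ℝ) + t • (g - (f 0, f 1))) j - L j =
        (1 - t) * (f j - L j) + t * (-wt L / 3) := by
      have ef := e f
      have eL := e L
      rw [hf] at ef
      fin_cases j
      · simp [lift, hg]; ring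
      · simp [lift, hg]; ring
      · simp [lift, hg]
        have h1 : f 2 = - f 0 - f 1 := by linarith
        have h2 : L 2 = wt L - L 0 - L 1 := by linarith
        rw [h1, h2]; ring
    have p1 : 0 ≤ (1 - t) * (f j - L j) :=
      mul_nonneg (by linarith) (by linarith [(hj j).1])
    have p2 : 0 < t * (-wt L / 3) := mul_pos h2 (by linarith)
    linarith
  have hWpos := hWo.measure_pos volume hWne
  have hdis : Disjoint W (⋃ p ∈ T, {v | Inside p (lift v)}) := by
    rw [Set.disjoint_left]
    rintro v ⟨-, h1⟩ h2
    simp only [Set.mem_iInter, Set.mem_iUnion] at h1 h2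
    obtain ⟨p, hp, h2⟩ := h2
    refine h1 p hp ?_
    rcases h2 with ⟨h2, h3⟩ | ⟨h2, h3⟩
    · exact Or.inl ⟨h2, fun j => (h3 j).le⟩
    · exact Or.inr ⟨h2, fun j => (h3 j).le⟩
  have hsub : W ∪ (⋃ p ∈ T, {v | Inside p (lift v)}) ⊆ {v | Inside L (lift v)} := by
    rintro v (⟨h1, -⟩ | h2)
    · exact h1
    · simp only [Set.mem_iUnion] at h2
      obtain ⟨p, hp, h2⟩ := h2
      exact hin p hp _ (wt_lift v) h2
  have hle := measure_mono (μ := volume) hsub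
  rw [measure_union hdis (Finset.measurableSet_biUnion _ fun p _ => (isOpen_inside p).measurableSet),
    measure_biUnion_finset (fun p hp q hq hne => by
      simp only [Function.onFun]
      rw [Set.disjoint_left]
      exact fun v h1 h2 => hap p hp q hq hne _ (wt_lift v) h1 h2)
      (fun p _ => (isOpen_inside p).measurableSet),
    sum_congr rfl (fun p hp => volume_inside (hw p hp)), ← sum_mul,
    ← ENNReal.ofReal_sum_of_nonneg (fun p _ => sq_nonneg _), hs, volume_inside hL.ne] at hle
  have hfin : ENNReal.ofReal (wt L ^ 2) * volume {v : ℝ × ℝ | ∀ j, ![0, 0, -1] j < lift v j} ≠ ⊤ :=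
    ENNReal.mul_ne_top ENNReal.ofReal_ne_top volume_unit
  have : volume W ≤ 0 := by
    refine (ENNReal.add_le_add_iff_right hfin).1 ?_
    rwa [zero_add]
  exact absurd hWpos (not_lt.2 this)

end TriTiling

namespace TriTiling

/-! ### Hexagons with four sizes less than tiles -/

open Finset

/-- The sum of the coordinates of an integral vector. -/
def intWt (p : ℤ × ℤ × ℤ) : ℤ := p.1 + p.2.1 + p.2.2

/-- A decidable criterion for disjoint interiors. -/
def IntApart (p q : ℤ × ℤ × ℤ) : Prop :=
  (intWt p < 0 ∧ intWt q < 0 ∧ 0 ≤ max p.1 q.1 + max p.2.1 q.2.1 + max p.2.2 q.2.2) ∨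
  (0 < intWt p ∧ 0 < intWt q ∧ min p.1 q.1 + min p.2.1 q.2.1 + min p.2.2 q.2.2 ≤ 0) ∨
  (intWt p < 0 ∧ 0 < intWt q ∧ (q.1 ≤ p.1 ∨ q.2.1 ≤ p.2.1 ∨ q.2.2 ≤ p.2.2)) ∨
  (0 < intWt p ∧ intWt q < 0 ∧ (p.1 ≤ q.1 ∨ p.2.1 ≤ q.2.1 ∨ p.2.2 ≤ q.2.2))

instance (p q : ℤ × ℤ × ℤ) : Decidable (IntApart p q) := by
  unfold IntApart
  infer_instance

/-- The `n` tiles in the list `R` together with three corner tiles of sizes `a`, `b`, `c` tile a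
triangle of size `s`, and the tiles in `R` have `n - 4` sizes. -/
def certificate (n : ℕ) (s a b c : ℤ) (R : List (ℤ × ℤ × ℤ)) : Prop :=
  (0 < a ∧ 0 < b ∧ 0 < c ∧ a + b < s ∧ b + c < s ∧ a + c < s) ∧
  ((-a, 0, 0) :: (-s, s - b, 0) :: (-s, 0, s - c) :: R).Nodup ∧
  (∀ p ∈ (-a, 0, 0) :: (-s, s - b, 0) :: (-s, 0, s - c) :: R, intWt p ≠ 0 ∧
    (-s ≤ p.1 ∧ intWt p ≤ p.1 + s) ∧ (0 ≤ p.2.1 ∧ intWt p ≤ p.2.1) ∧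
    (0 ≤ p.2.2 ∧ intWt p ≤ p.2.2)) ∧
  ((-a, 0, 0) :: (-s, s - b, 0) :: (-s, 0, s - c) :: R).Pairwise IntApart ∧
  (((-a, 0, 0) :: (-s, s - b, 0) :: (-s, 0, s - c) :: R).map fun p => intWt p ^ 2).sum = s ^ 2 ∧
  0 < n ∧ R.length = n ∧ (R.map fun p => |intWt p|).toFinset.card = n - 4

instance (n : ℕ) (s a b c : ℤ) (R : List (ℤ × ℤ × ℤ)) : Decidable (certificate n s a b c R) := by
  unfold certificate
  infer_instance

/-- The real tile given by an integral vector. -/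
def toReal (p : ℤ × ℤ × ℤ) : Fin 3 → ℝ := ![(p.1 : ℝ), (p.2.1 : ℝ), (p.2.2 : ℝ)]

lemma wt_toReal (p : ℤ × ℤ × ℤ) : wt (toReal p) = intWt p := by
  simp [wt, toReal, intWt]

lemma toReal_injective : Function.Injective toReal := by
  rintro ⟨a, b, c⟩ ⟨a', b', c'⟩ h
  have h0 := congrFun h 0
  have h1 := congrFun h 1
  have h2 := congrFun h 2
  simp [toReal] at h0 h1 h2
  simp [h0, h1, h2]

lemma IntApart.apart {p q : ℤ × ℤ × ℤ} (h : IntApart p q) : Apart (toReal p) (toReal q) := by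
  rcases h with ⟨hp, hq, h⟩ | ⟨hp, hq, h⟩ | ⟨hp, hq, h⟩ | ⟨hp, hq, h⟩
  · refine apart_of_up_up (by rw [wt_toReal]; exact_mod_cast hp)
      (by rw [wt_toReal]; exact_mod_cast hq) ?_
    simp only [toReal, Matrix.cons_val]
    exact_mod_cast h
  · refine apart_of_down_down (by rw [wt_toReal]; exact_mod_cast hp)
      (by rw [wt_toReal]; exact_mod_cast hq) ?_
    simp only [toReal, Matrix.cons_val]
    exact_mod_cast h
  · have hp' : wt (toReal p) < 0 := by rw [wt_toReal]; exact_mod_cast hp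
    have hq' : 0 < wt (toReal q) := by rw [wt_toReal]; exact_mod_cast hq
    rcases h with h | h | h
    · exact apart_of_up_down hp' hq' 0 (by simp [toReal, h])
    · exact apart_of_up_down hp' hq' 1 (by simp [toReal, h])
    · exact apart_of_up_down hp' hq' 2 (by simp [toReal, h])
  · have hp' : 0 < wt (toReal p) := by rw [wt_toReal]; exact_mod_cast hp
    have hq' : wt (toReal q) < 0 := by rw [wt_toReal]; exact_mod_cast hq
    rcases h with h | h | h
    · exact (apart_of_up_down hq' hp' 0 (by simp [toReal, h])).symm
    · exact (apart_of_up_down hq' hp' 1 (by simp [toReal, h])).symm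
    · exact (apart_of_up_down hq' hp' 2 (by simp [toReal, h])).symm

/-- By area, the list tiles a triangle of side `s`. Cutting off its three corner tiles leaves a
hexagon, where `a + b < s` and its analogues keep the shortened sides positive. Only sizes in `R`
are counted, so the corner tiles are free auxiliaries. -/
lemma certificate.realizable {n : ℕ} {s a b c : ℤ} {R : List (ℤ × ℤ × ℤ)}
    (h : certificate n s a b c R) : ∃ S x0 x1 x2 x3 x4 x5, Realizable n S x0 x1 x2 x3 x4 x5 ∧
    0 < x0 ∧ 0 < x1 ∧ 0 < x2 ∧ 0 < x3 ∧ 0 < x4 ∧ 0 < x5 ∧ S.card = n - 4 := by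
  classical
  obtain ⟨⟨ha, hb, hc, hab, hbc, hac⟩, hnd, hmem, hap, harea, hn, hlen, hsize⟩ := h
  set l := (-a, 0, 0) :: (-s, s - b, 0) :: (-s, 0, s - c) :: R with hl
  set L : Fin 3 → ℝ := toReal (-s, 0, 0) with hL
  set T := l.toFinset.image toReal with hT
  have hLw : wt L = -s := by rw [hL, wt_toReal]; simp [intWt]
  have hs0 : (0 : ℝ) < s := by exact_mod_cast (show 0 < s by omega)
  have a0 : (0 : ℝ) < a := by exact_mod_cast ha
  have b0 : (0 : ℝ) < b := by exact_mod_cast hb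
  have c0 : (0 : ℝ) < c := by exact_mod_cast hc
  have ab0 : (a + b : ℝ) < s := by exact_mod_cast hab
  have bc0 : (b + c : ℝ) < s := by exact_mod_cast hbc
  have ac0 : (a + c : ℝ) < s := by exact_mod_cast hac
  have hforall : ∀ P : (Fin 3 → ℝ) → Prop, (∀ p ∈ T, P p) ↔ ∀ p ∈ l, P (toReal p) := by
    intro P
    simp only [hT, forall_mem_image, List.mem_toFinset]
  have hex : HexTiling L (fun j => L j - wt L) T := by
    refine hexTiling_of_area (by rw [hLw]; linarith) ?_ ?_ ?_ ?_
    · rw [hforall]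
      intro p hp
      rw [wt_toReal]
      exact_mod_cast (hmem p hp).1
    · rw [hforall]
      intro p hp j
      obtain ⟨-, h0, h1, h2⟩ := hmem p hp
      rw [wt_toReal]
      fin_cases j
      · simp only [hL, toReal]; simp; exact_mod_cast h0
      · simp only [hL, toReal]; simp; exact_mod_cast h1
      · simp only [hL, toReal]; simp; exact_mod_cast h2
    · have h2 : l.Pairwise fun p q => Apart (toReal p) (toReal q) := hap.imp fun h => h.apart
      intro p hp q hq hne
      obtain ⟨p', hp', rfl⟩ := mem_image.1 hp
      obtain ⟨q', hq', rfl⟩ := mem_image.1 hq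
      have : Std.Symm fun p q => Apart (toReal p) (toReal q) := ⟨fun _ _ h => Apart.symm h⟩
      exact h2.forall (List.mem_toFinset.1 hp') (List.mem_toFinset.1 hq')
        (fun hh => hne (congrArg _ hh))
    · rw [hT, sum_image toReal_injective.injOn, List.sum_toFinset _ hnd, hLw]
      have : (l.map fun p => wt (toReal p) ^ 2) = (l.map fun p => intWt p ^ 2).map (Int.cast : ℤ → ℝ) := by
        rw [List.map_map]
        refine List.map_congr_left fun p _ => ?_
        simp [wt_toReal]
      rw [this, ← Int.cast_list_sum, harea]
      push_cast
      ring
  have hlow : ∀ j, lowLen L (fun j => L j - wt L) j = s := by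
    intro j
    have : wt (fun j => L j - wt L) = wt L - 3 * wt L := by simp only [wt]; ring
    rw [lowLen, this, hLw]; ring
  have hupl : ∀ j, upLen L (fun j => L j - wt L) j = 0 := by
    intro j
    rw [upLen]; ring
  have t1 : toReal (-a, 0, 0) ∈ T := mem_image_of_mem _ (by simp [hl])
  have t2 : toReal (-s, s - b, 0) ∈ T := mem_image_of_mem _ (by simp [hl])
  have t3 : toReal (-s, 0, s - c) ∈ T := mem_image_of_mem _ (by simp [hl])
  rw [List.nodup_cons, List.nodup_cons, List.nodup_cons] at hnd
  obtain ⟨n1, n2, n3, hR⟩ := hnd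
  have d12 : toReal (-s, s - b, 0) ≠ toReal (-a, 0, 0) := fun hh => n1 (by
    rw [← toReal_injective hh]; simp)
  have d13 : toReal (-s, 0, s - c) ≠ toReal (-a, 0, 0) := fun hh => n1 (by
    rw [← toReal_injective hh]; simp)
  have d23 : toReal (-s, 0, s - c) ≠ toReal (-s, s - b, 0) := fun hh => n2 (by
    rw [← toReal_injective hh]; simp)
  have w1 : wt (toReal (-a, 0, 0)) = -a := by rw [wt_toReal]; simp [intWt]
  have w2 : wt (toReal (-s, s - b, 0)) = -b := by
    rw [wt_toReal, intWt]; push_cast; ring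
  have w3 : wt (toReal (-s, 0, s - c)) = -c := by
    rw [wt_toReal, intWt]; push_cast; ring
  have hti : TightTiling L (fun j => L j - wt L) T :=
    ⟨hex, ⟨fun j => by rw [hlow]; exact hs0.le, fun j => by rw [hupl]⟩, ⟨_, t1⟩⟩
  obtain ⟨U1, h1, A1, B1, -⟩ := hti.erase_up_corner 1 t1 (by rw [w1]; linarith) (by simp [hL, toReal])
    (by simp [hL, toReal]) t2 d12
  obtain ⟨U2, h2, A2, B2, -⟩ := h1.erase_up_corner rot (mem_erase.2 ⟨d12, t2⟩)
    (by rw [w2]; linarith) (by simp [hL, toReal, rot_one]) (by simp [hL, toReal, rot_two])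
    (mem_erase.2 ⟨d13, t3⟩) d23
  have hRne : R ≠ [] := by
    rintro rfl
    rw [List.length_nil] at hlen
    omega
  obtain ⟨r, hr⟩ := List.exists_mem_of_ne_nil R hRne
  obtain ⟨U3, h3, A3, B3, -⟩ := h2.erase_up_corner rot⁻¹ (mem_erase.2 ⟨d23, mem_erase.2 ⟨d13, t3⟩⟩)
    (by rw [w3]; linarith) (by rw [rot_symm_one]; simp [hL, toReal])
    (by rw [rot_symm_two]; simp [hL, toReal]) (q := toReal r)
    (mem_erase.2 ⟨fun hh => n2 (by rw [← toReal_injective hh]; simp [hr]),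
      mem_erase.2 ⟨fun hh => n1 (by rw [← toReal_injective hh]; simp [hr]),
      mem_image_of_mem _ (by simp [hl, hr])⟩⟩) (fun hh => n3 (by rw [← toReal_injective hh]; exact hr))
  simp only [Equiv.Perm.coe_one, id_eq, rot_zero, rot_one, rot_two, rot_symm_zero, rot_symm_one,
    rot_symm_two, hlow, hupl, w1, w2, w3] at A1 B1 A2 B2 A3 B3
  have hTR : ((T.erase (toReal (-a, 0, 0))).erase (toReal (-s, s - b, 0))).erase
      (toReal (-s, 0, s - c)) = R.toFinset.image toReal := by
    have m1 : ∀ {p}, p ∉ R → toReal p ∉ R.toFinset.image toReal := fun hp hh => by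
      obtain ⟨q, hq, he⟩ := mem_image.1 hh
      rw [toReal_injective he, List.mem_toFinset] at hq
      exact hp hq
    rw [hT, hl, List.toFinset_cons, List.toFinset_cons, List.toFinset_cons, image_insert,
      image_insert, image_insert, erase_insert, erase_insert, erase_insert]
    · exact m1 n3
    · rw [mem_insert, not_or]
      exact ⟨d23.symm, m1 fun hh => n2 (List.mem_cons_of_mem _ hh)⟩
    · rw [mem_insert, mem_insert, not_or, not_or]
      exact ⟨d12.symm, d13.symm, m1 fun hh => n1 (by simp [hh])⟩
  rw [hTR] at h3
  refine ⟨_, _, _, _, _, _, _, ⟨L, U3, _, 1, h3, ?_, rfl, rfl, rfl, rfl, rfl, rfl, rfl⟩, ?_, ?_, ?_, ?_,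
    ?_, ?_, ?_⟩
  · rw [card_image_of_injective _ toReal_injective, List.toFinset_card_of_nodup hR, hlen]
  any_goals rw [Equiv.Perm.one_apply]
  any_goals linarith
  rw [sizes, image_image]
  have : R.toFinset.image ((fun p => |wt p|) ∘ toReal) =
      ((R.map fun p => |intWt p|).toFinset).image (Int.cast : ℤ → ℝ) := by
    ext x
    simp [wt_toReal]
  rw [this, card_image_of_injective _ Int.cast_injective, hsize]

/-! ### Explicit integral tilings, verified by evaluation -/

lemma hexagon_9 : certificate 9 16 5 7 6 [
    (-5, 5, 5), (-10, 0, 5), (-9, 5, 0), (-10, 5, 4), (-9, 9, 4), (-10, 6, 10), (-16, 6, 7),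
    (-13, 6, 4), (-13, 9, 7)] := by
  decide +kernel

lemma hexagon_10 : certificate 10 21 6 9 8 [
    (-6, 6, 6), (-12, 6, 0), (-12, 7, 6), (-13, 0, 6), (-12, 12, 5), (-13, 7, 5), (-13, 8, 13),
    (-21, 8, 9), (-17, 8, 5), (-17, 12, 9)] := by
  decide +kernel

lemma hexagon_11 : certificate 11 28 9 11 10 [
    (-9, 9, 9), (-18, 0, 9), (-17, 9, 0), (-18, 9, 8), (-18, 10, 18), (-28, 10, 11),
    (-21, 17, 11), (-21, 10, 8), (-17, 17, 4), (-17, 13, 8), (-21, 13, 4)] := by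
  decide +kernel

lemma hexagon_12 : certificate 12 37 12 14 13 [
    (-12, 12, 12), (-24, 0, 12), (-23, 12, 0), (-24, 12, 11), (-24, 13, 24), (-37, 13, 14),
    (-30, 23, 14), (-23, 23, 7), (-23, 16, 11), (-30, 16, 7), (-27, 13, 11), (-27, 16, 14)] := by
  decide +kernel

lemma hexagon_13 : certificate 13 48 14 20 15 [
    (-28, 14, 0), (-14, 14, 14), (-28, 28, 9), (-28, 19, 14), (-33, 0, 14), (-33, 15, 33),
    (-48, 15, 20), (-37, 28, 20), (-37, 19, 9), (-33, 19, 18), (-35, 15, 18), (-37, 17, 18),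
    (-35, 17, 20)] := by
  decide +kernel

lemma hexagon_14 : certificate 14 65 21 25 23 [
    (-21, 21, 21), (-42, 0, 21), (-40, 21, 0), (-42, 21, 19), (-42, 23, 42), (-65, 23, 25),
    (-51, 40, 25), (-40, 40, 11), (-40, 29, 19), (-51, 29, 11), (-48, 23, 19), (-48, 26, 25),
    (-48, 29, 22), (-51, 26, 22)] := by
  decide +kernel

lemma hexagon_15 : certificate 15 43 14 16 15 [
    (-14, 14, 14), (-28, 0, 14), (-27, 14, 0), (-28, 14, 13), (-28, 15, 28), (-43, 15, 16),
    (-36, 27, 16), (-27, 27, 9), (-27, 18, 13), (-31, 15, 13), (-31, 20, 16), (-36, 20, 9),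
    (-29, 18, 9), (-31, 18, 11), (-29, 20, 11)] := by
  decide +kernel

lemma hexagon_16 : certificate 16 58 17 24 20 [
    (-17, 17, 17), (-34, 17, 0), (-34, 21, 17), (-38, 0, 17), (-34, 34, 13), (-39, 21, 13),
    (-38, 21, 18), (-38, 20, 38), (-58, 20, 24), (-47, 34, 24), (-47, 26, 13), (-39, 26, 18),
    (-44, 20, 18), (-44, 23, 24), (-44, 26, 21), (-47, 23, 21)] := by
  decide +kernel

lemma hexagon_17 : certificate 17 84 32 28 27 [
    (-44, 20, 12), (-32, 32, 12), (-44, 32, 24), (-52, 20, 24), (-32, 20, 32), (-56, 32, 0),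
    (-56, 28, 24), (-52, 28, 27), (-52, 25, 32), (-57, 0, 32), (-56, 56, 28), (-55, 28, 28),
    (-55, 25, 27), (-57, 25, 30), (-57, 27, 57), (-84, 27, 28), (-55, 27, 30)] := by
  decide +kernel

lemma hexagon_18 : certificate 18 226 95 77 70 [
    (-136, 41, 85), (-126, 51, 85), (-136, 51, 75), (-136, 61, 95), (-95, 41, 95),
    (-126, 41, 54), (-126, 72, 75), (-147, 61, 75), (-156, 61, 86), (-156, 0, 95), (-95, 95, 54),
    (-149, 72, 54), (-149, 95, 0), (-147, 72, 77), (-147, 70, 86), (-156, 70, 156),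
    (-226, 70, 77), (-149, 149, 77)] := by
  decide +kernel

lemma hexagon_19 : certificate 19 147 56 48 49 [
    (-56, 21, 56), (-77, 21, 35), (-77, 42, 56), (-98, 0, 56), (-56, 56, 35), (-91, 42, 35),
    (-98, 42, 49), (-98, 49, 98), (-99, 56, 0), (-91, 56, 43), (-91, 48, 49), (-97, 49, 49),
    (-147, 49, 48), (-99, 99, 48), (-99, 51, 43), (-97, 51, 48), (-94, 48, 43), (-97, 48, 46),
    (-94, 51, 46)] := by
  decide +kernel

lemma hexagon_21 : certificate 21 277 86 120 92 [
    (-173, 101, 71), (-173, 102, 72), (-174, 101, 72), (-172, 101, 73), (-172, 86, 71),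
    (-157, 102, 71), (-174, 102, 55), (-174, 119, 73), (-192, 99, 73), (-172, 99, 86),
    (-86, 86, 86), (-157, 86, 0), (-157, 157, 55), (-212, 119, 55), (-192, 119, 93),
    (-185, 99, 93), (-185, 0, 86), (-212, 157, 120), (-212, 92, 93), (-277, 92, 120),
    (-185, 92, 185)] := by
  decide +kernel

lemma hexagon_22 : certificate 22 649 193 217 263 [
    (-193, 193, 193), (-386, 0, 193), (-432, 193, 0), (-386, 193, 239), (-386, 147, 386),
    (-533, 263, 386), (-649, 263, 217), (-432, 432, 217), (-432, 215, 239), (-454, 147, 239),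
    (-533, 147, 307), (-533, 226, 270), (-480, 263, 270), (-480, 215, 217), (-454, 215, 265),
    (-454, 189, 307), (-496, 226, 307), (-496, 210, 270), (-480, 210, 265), (-475, 189, 265),
    (-496, 189, 286), (-475, 210, 286)] := by
  decide +kernel

lemma hexagon_24 : certificate 24 463 153 184 150 [
    (-326, 180, 149), (-329, 177, 149), (-326, 177, 146), (-306, 180, 146), (-329, 180, 126),
    (-329, 203, 152), (-323, 177, 152), (-323, 160, 146), (-306, 160, 153), (-306, 153, 126),
    (-279, 203, 126), (-355, 203, 76), (-355, 171, 152), (-323, 171, 163), (-313, 160, 163),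
    (-313, 0, 153), (-153, 153, 153), (-279, 153, 0), (-279, 279, 76), (-355, 279, 184),
    (-334, 171, 184), (-334, 150, 163), (-313, 150, 313), (-463, 150, 184)] := by
  decide +kernel

lemma hexagon_25 : certificate 25 988 325 398 320 [
    (-325, 325, 325), (-668, 0, 325), (-590, 325, 0), (-650, 325, 265), (-650, 343, 325),
    (-668, 343, 348), (-668, 320, 668), (-988, 320, 398), (-795, 590, 398), (-590, 590, 205),
    (-590, 385, 265), (-650, 385, 307), (-691, 343, 307), (-691, 370, 348), (-718, 320, 348),
    (-718, 397, 398), (-795, 397, 308), (-795, 487, 205), (-692, 385, 205), (-692, 487, 308),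
    (-692, 384, 307), (-691, 384, 321), (-718, 370, 321), (-705, 384, 308),
    (-705, 397, 321)] := by
  decide +kernel

/-- Hexagons with more sizes. -/
lemma exists_hexagon_special {n : ℕ} (hn : (9 ≤ n ∧ n ≤ 19) ∨ n = 21 ∨ n = 22 ∨ n = 24 ∨ n = 25) :
    ∃ S x0 x1 x2 x3 x4 x5, Realizable n S x0 x1 x2 x3 x4 x5 ∧
    0 < x0 ∧ 0 < x1 ∧ 0 < x2 ∧ 0 < x3 ∧ 0 < x4 ∧ 0 < x5 ∧ S.card = n - 4 := by
  rcases hn with ⟨h1, h2⟩ | rfl | rfl | rfl | rfl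
  · interval_cases n
    · exact hexagon_9.realizable
    · exact hexagon_10.realizable
    · exact hexagon_11.realizable
    · exact hexagon_12.realizable
    · exact hexagon_13.realizable
    · exact hexagon_14.realizable
    · exact hexagon_15.realizable
    · exact hexagon_16.realizable
    · exact hexagon_17.realizable
    · exact hexagon_18.realizable
    · exact hexagon_19.realizable
  · exact hexagon_21.realizable
  · exact hexagon_22.realizable
  · exact hexagon_24.realizable
  · exact hexagon_25.realizable

end TriTiling

namespace TriTiling

open Finset

/-! ### Frames of the Euclidean plane -/

open scoped RealInnerProductSpace

/-- Three vectors of length `2 / √3` with mutual angles of 120°. -/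
structure IsFrame (ν : Fin 3 → Plane) : Prop where
  inner_self : ∀ i, ⟪ν i, ν i⟫ = 4 / 3
  inner_ne : ∀ i j, i ≠ j → ⟪ν i, ν j⟫ = -2 / 3

/-- The triangular coordinates of a point. -/
noncomputable def chart (ν : Fin 3 → Plane) (z : Plane) : Fin 3 → ℝ := fun j => ⟪ν j, z⟫

/-- The point with given triangular coordinates. -/
noncomputable def point (ν : Fin 3 → Plane) (f : Fin 3 → ℝ) : Plane :=
  (1 / 2 : ℝ) • (f 0 • ν 0 + f 1 • ν 1 + f 2 • ν 2)

variable {ν μ : Fin 3 → Plane}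

lemma inner_plane (x y : Plane) : ⟪x, y⟫ = x 0 * y 0 + x 1 * y 1 := by
  simp [PiLp.inner_apply, Fin.sum_univ_two]
  ring

lemma continuous_chart (ν : Fin 3 → Plane) (j : Fin 3) : Continuous fun z => chart ν z j := by
  unfold chart
  fun_prop

lemma chart_add (ν : Fin 3 → Plane) (z w : Plane) (j : Fin 3) :
    chart ν (z + w) j = chart ν z j + chart ν w j := inner_add_right _ _ _

lemma chart_sub (ν : Fin 3 → Plane) (z w : Plane) (j : Fin 3) :
    chart ν (z - w) j = chart ν z j - chart ν w j := inner_sub_right _ _ _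

lemma chart_smul (ν : Fin 3 → Plane) (t : ℝ) (z : Plane) (j : Fin 3) :
    chart ν (t • z) j = t * chart ν z j := inner_smul_right _ _ _

lemma IsFrame.neg (h : IsFrame ν) : IsFrame (-ν) :=
  ⟨fun i => by simpa using h.inner_self i, fun i j hij => by simpa using h.inner_ne i j hij⟩

lemma IsFrame.sum_eq_zero (h : IsFrame ν) : ν 0 + ν 1 + ν 2 = 0 := by
  rw [← inner_self_eq_zero (𝕜 := ℝ)]
  simp only [inner_add_left, inner_add_right, h.inner_self]
  rw [h.inner_ne 1 0 (by decide), h.inner_ne 2 0 (by decide), h.inner_ne 0 1 (by decide),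
    h.inner_ne 2 1 (by decide), h.inner_ne 0 2 (by decide), h.inner_ne 1 2 (by decide)]
  norm_num

lemma IsFrame.wt_chart (h : IsFrame ν) (z : Plane) : wt (chart ν z) = 0 := by
  simp only [wt, chart, ← inner_add_left, h.sum_eq_zero, inner_zero_left]

lemma IsFrame.chart_point (h : IsFrame ν) {f : Fin 3 → ℝ} (hf : wt f = 0) :
    chart ν (point ν f) = f := by
  rw [wt] at hf
  ext j
  simp only [chart, point, inner_smul_right, inner_add_right]
  fin_cases j
  · simp only [Fin.zero_eta]
    rw [h.inner_self, h.inner_ne 0 1 (by decide), h.inner_ne 0 2 (by decide)]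
    linear_combination (-1 / 3) * hf
  · simp only [Fin.mk_one]
    rw [h.inner_self, h.inner_ne 1 0 (by decide), h.inner_ne 1 2 (by decide)]
    linear_combination (-1 / 3) * hf
  · simp only [Fin.reduceFinMk]
    rw [h.inner_self, h.inner_ne 2 0 (by decide), h.inner_ne 2 1 (by decide)]
    linear_combination (-1 / 3) * hf

lemma IsFrame.chart_injective (h : IsFrame ν) {z w : Plane} (hzw : chart ν z = chart ν w) :
    z = w := by
  rw [← sub_eq_zero]
  set v := z - w with hv
  have h0 : ⟪ν 0, v⟫ = 0 := by
    rw [hv, inner_sub_right, sub_eq_zero]; exact congrFun hzw 0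
  have h1 : ⟪ν 1, v⟫ = 0 := by
    rw [hv, inner_sub_right, sub_eq_zero]; exact congrFun hzw 1
  have a := h.inner_self 0
  have b := h.inner_self 1
  have c := h.inner_ne 0 1 (by decide)
  rw [inner_plane] at h0 h1 a b c
  -- The Gram determinant of `ν 0` and `ν 1` is `(4/3)² - (2/3)² = 4/3`, so they form a basis.
  have hdet : (ν 0 0 * ν 1 1 - ν 0 1 * ν 1 0) ^ 2 = 4 / 3 := by
    linear_combination (ν 1 0 * ν 1 0 + ν 1 1 * ν 1 1) * a + 4 / 3 * b -
      (ν 0 0 * ν 1 0 + ν 0 1 * ν 1 1 - 2 / 3) * c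
  have hd : ν 0 0 * ν 1 1 - ν 0 1 * ν 1 0 ≠ 0 := by
    intro hh; rw [hh] at hdet; norm_num at hdet
  have e0 : (ν 0 0 * ν 1 1 - ν 0 1 * ν 1 0) * v 0 = 0 := by
    linear_combination ν 1 1 * h0 - ν 0 1 * h1
  have e1 : (ν 0 0 * ν 1 1 - ν 0 1 * ν 1 0) * v 1 = 0 := by
    linear_combination ν 0 0 * h1 - ν 1 0 * h0
  ext i
  fin_cases i
  · simpa [hd] using e0
  · simpa [hd] using e1

lemma IsFrame.point_chart (h : IsFrame ν) (z : Plane) : point ν (chart ν z) = z :=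
  h.chart_injective (h.chart_point (h.wt_chart z))

lemma exists_isFrame : ∃ ν : Fin 3 → Plane, IsFrame ν := by
  have h3 : (√3 : ℝ) * √3 = 3 := Real.mul_self_sqrt (by norm_num)
  have h0 : (√3 : ℝ) ≠ 0 := by positivity
  refine ⟨![!₂[2 / √3, 0], !₂[-1 / √3, 1], !₂[-1 / √3, -1]], fun i => ?_, fun i j hij => ?_⟩
  · rw [inner_plane]
    fin_cases i <;> simp <;> field_simp <;> linarith
  · rw [inner_plane]
    fin_cases i <;> fin_cases j <;> simp at hij ⊢ <;> field_simp <;> linarith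

/-- The tile `p` in the plane. -/
def tileSet (ν : Fin 3 → Plane) (p : Fin 3 → ℝ) : Set Plane := {z | Covers p (chart ν z)}

/-! ### Tiles as subsets of the Euclidean plane -/

lemma isClosed_tileSet (ν : Fin 3 → Plane) (p : Fin 3 → ℝ) : IsClosed (tileSet ν p) := by
  simp only [tileSet, Covers, Set.ofPred_or, Set.ofPred_and, Set.ofPred_forall]
  refine (isClosed_const.inter ?_).union (isClosed_const.inter ?_)
  · exact isClosed_iInter fun j => isClosed_le continuous_const (continuous_chart ν j)
  · exact isClosed_iInter fun j => isClosed_le (continuous_chart ν j) continuous_const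

lemma isOpen_insideSet (ν : Fin 3 → Plane) (p : Fin 3 → ℝ) :
    IsOpen {z | Inside p (chart ν z)} := by
  simp only [Inside, Set.ofPred_or, Set.ofPred_and, Set.ofPred_forall]
  refine (isOpen_const.inter ?_).union (isOpen_const.inter ?_)
  · exact isOpen_iInter_of_finite fun j => isOpen_lt continuous_const (continuous_chart ν j)
  · exact isOpen_iInter_of_finite fun j => isOpen_lt (continuous_chart ν j) continuous_const

lemma Inside.covers {p f : Fin 3 → ℝ} (h : Inside p f) : Covers p f :=
  h.imp (fun h => ⟨h.1, fun j => (h.2 j).le⟩) fun h => ⟨h.1, fun j => (h.2 j).le⟩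

/-- At a point where one inequality is an equality, an arbitrarily small step along that frame
vector or against it leaves the tile. -/
lemma IsFrame.interior_tileSet (h : IsFrame ν) (p : Fin 3 → ℝ) :
    interior (tileSet ν p) = {z | Inside p (chart ν z)} := by
  refine Set.Subset.antisymm (fun z hz => ?_)
    (interior_maximal (fun z hz => Inside.covers hz) (isOpen_insideSet ν p))
  have key : ∀ w : Plane, ∃ t : ℝ, 0 < t ∧ z + t • w ∈ tileSet ν p := by
    intro w
    have hc : Continuous fun t : ℝ => z + t • w := by fun_prop
    have h1 : ∀ᶠ t in nhdsWithin (0 : ℝ) (Set.Ioi 0), z + t • w ∈ tileSet ν p := by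
      refine nhdsWithin_le_nhds (hc.continuousAt.preimage_mem_nhds ?_)
      simpa using mem_interior_iff_mem_nhds.1 hz
    have h2 : ∀ᶠ t in nhdsWithin (0 : ℝ) (Set.Ioi 0), 0 < t := self_mem_nhdsWithin
    obtain ⟨t, ht, ht'⟩ := (h2.and h1).exists
    exact ⟨t, ht, ht'⟩
  rcases interior_subset hz with ⟨hw, hz'⟩ | ⟨hw, hz'⟩
  · refine Or.inl ⟨hw, fun j => lt_of_le_of_ne (hz' j) fun heq => ?_⟩
    obtain ⟨t, ht, htp⟩ := key (-ν j)
    rcases htp with ⟨-, hh⟩ | ⟨hh, -⟩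
    · have h1 := hh j
      rw [chart_add, chart_smul, ← heq] at h1
      have : chart ν (-ν j) j = -(4 / 3) := by
        rw [chart, inner_neg_right, h.inner_self]
      rw [this] at h1
      linarith
    · linarith
  · refine Or.inr ⟨hw, fun j => lt_of_le_of_ne (hz' j) fun heq => ?_⟩
    obtain ⟨t, ht, htp⟩ := key (ν j)
    rcases htp with ⟨hh, -⟩ | ⟨-, hh⟩
    · linarith
    · have h1 := hh j
      rw [chart_add, chart_smul, heq] at h1
      have : chart ν (ν j) j = 4 / 3 := by
        rw [chart, h.inner_self]
      rw [this] at h1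
      linarith

/-- The vertices of the tile `p`. -/
def vertexCoord (p : Fin 3 → ℝ) (i : Fin 3) : Fin 3 → ℝ := fun j => p j - if j = i then wt p else 0

lemma wt_vertexCoord (p : Fin 3 → ℝ) (i : Fin 3) : wt (vertexCoord p i) = 0 := by
  fin_cases i <;> simp [vertexCoord, wt] <;> ring

lemma IsFrame.convexHull_vertices (h : IsFrame ν) {p : Fin 3 → ℝ} (hp : wt p < 0) :
    convexHull ℝ (Set.range fun i => point ν (vertexCoord p i)) = tileSet ν p := by
  refine Set.Subset.antisymm (convexHull_min ?_ ?_) fun z hz => ?_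
  · rintro _ ⟨i, rfl⟩
    refine Or.inl ⟨hp, fun j => ?_⟩
    rw [h.chart_point (wt_vertexCoord p i), vertexCoord]
    split_ifs <;> linarith
  · intro x hx y hy a b ha hb hab
    rcases hx with ⟨-, hx⟩ | ⟨hx, -⟩
    · rcases hy with ⟨-, hy⟩ | ⟨hy, -⟩
      · refine Or.inl ⟨hp, fun j => ?_⟩
        rw [chart_add, chart_smul, chart_smul]
        have h1 := mul_le_mul_of_nonneg_left (hx j) ha
        have h2 := mul_le_mul_of_nonneg_left (hy j) hb
        have h3 : a * p j + b * p j = p j := by rw [← add_mul, hab, one_mul]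
        linarith
      · linarith
    · linarith
  · rcases hz with ⟨-, hz⟩ | ⟨hz, -⟩
    · have e := h.wt_chart z
      -- These are the barycentric coordinates of `z`.
      set c : Fin 3 → ℝ := fun i => (chart ν z i - p i) / (-wt p) with hc
      have hc0 : ∀ i, 0 ≤ c i := fun i => div_nonneg (by linarith [hz i]) (by linarith)
      have hc1 : c 0 + c 1 + c 2 = 1 := by
        simp only [hc]
        rw [← add_div, ← add_div, div_eq_one_iff_eq (by linarith)]
        simp only [wt] at e ⊢
        linarith
      have hz' : z = ∑ i, c i • point ν (vertexCoord p i) := by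
        apply h.chart_injective
        ext j
        rw [Fin.sum_univ_three, chart_add, chart_add, chart_smul, chart_smul, chart_smul,
          h.chart_point (wt_vertexCoord _ _), h.chart_point (wt_vertexCoord _ _),
          h.chart_point (wt_vertexCoord _ _)]
        have hcj : c j * (-wt p) = chart ν z j - p j := div_mul_cancel₀ _ (by linarith)
        simp only [vertexCoord]
        fin_cases j <;> simp at hcj ⊢ <;> linear_combination (-p _) * hc1 - hcj
      rw [hz']
      exact (convex_convexHull ℝ _).sum_mem (fun i _ => hc0 i) (by rw [Fin.sum_univ_three, hc1])
        fun i _ => subset_convexHull ℝ _ ⟨i, rfl⟩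
    · linarith

end TriTiling

namespace TriTiling

/-! ### Equilateral triangles as tiles -/

open Finset

open scoped RealInnerProductSpace

variable {ν μ : Fin 3 → Plane}

lemma tileSet_neg (ν : Fin 3 → Plane) (p : Fin 3 → ℝ) : tileSet (-ν) (-p) = tileSet ν p := by
  ext z
  have : chart (-ν) z = -chart ν z := by ext j; simp [chart]
  simp only [tileSet, Set.mem_ofPred_eq, this, covers_neg]

/-- Every tile is the region of an equilateral triangle. -/
lemma IsFrame.exists_triangle_of_up (h : IsFrame ν) {p : Fin 3 → ℝ} (hp : wt p < 0) :
    ∃ t : PlaneTriangle, t.Equilateral ∧ triangleRegion t = tileSet ν p ∧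
      triangleSize t = |wt p| := by
  set A : Fin 3 → Plane := fun i => point ν (vertexCoord p i) with hA
  have hchart : ∀ i j, chart ν (A i) j = p j - if j = i then wt p else 0 := fun i j => by
    rw [hA, h.chart_point (wt_vertexCoord p i), vertexCoord]
  have hind : AffineIndependent ℝ A := by
    rw [affineIndependent_iff_of_fintype]
    intro w hw0 hw j
    rw [Finset.weightedVSub_eq_linear_combination _ hw0] at hw
    have h1 := congrArg (fun z => chart ν z j) hw
    simp only [Fin.sum_univ_three, chart_add, chart_smul, hchart] at h1 hw0
    have h2 : chart ν 0 j = 0 := inner_zero_right _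
    rw [h2] at h1
    have h3 : w j * wt p = 0 := by
      fin_cases j <;> simp at h1 <;> simp only [Fin.zero_eta, Fin.mk_one, Fin.reduceFinMk] <;>
        linear_combination p _ * hw0 - h1
    exact (mul_eq_zero.1 h3).resolve_right hp.ne
  -- The length `2 / √3` of the frame vectors is chosen so that their differences have norm 2, which
  -- makes the side length exactly `|wt p|`.
  have hdist : ∀ i j, i ≠ j → dist (A i) (A j) = |wt p| := by
    intro i j hij
    have hv : A i - A j = (wt p / 2) • (ν j - ν i) := by
      apply h.chart_injective
      ext k
      rw [chart_sub, chart_smul, chart_sub, hchart, hchart]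
      have e : ∀ a b : Fin 3, ⟪ν b, ν a⟫ = if b = a then 4 / 3 else -2 / 3 := fun a b => by
        split_ifs with hab
        · rw [hab, h.inner_self]
        · exact h.inner_ne _ _ hab
      simp only [chart, e]
      split_ifs with h1 h2 h2 <;> first | (exfalso; exact hij (h1.symm.trans h2)) | ring
    have hn : ‖ν j - ν i‖ = 2 := by
      have : ‖ν j - ν i‖ ^ 2 = 4 := by
        rw [← real_inner_self_eq_norm_sq, inner_sub_left, inner_sub_right, inner_sub_right,
          h.inner_self, h.inner_self, h.inner_ne i j hij, h.inner_ne j i hij.symm]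
        norm_num
      nlinarith [norm_nonneg (ν j - ν i)]
    rw [dist_eq_norm, hv, norm_smul, hn, Real.norm_eq_abs, abs_div]
    simp
  refine ⟨⟨A, hind⟩, ⟨_, hdist⟩, h.convexHull_vertices hp, hdist 0 1 (by decide)⟩

lemma IsFrame.exists_triangle (h : IsFrame ν) {p : Fin 3 → ℝ} (hp : wt p ≠ 0) :
    ∃ t : PlaneTriangle, t.Equilateral ∧ triangleRegion t = tileSet ν p ∧
      triangleSize t = |wt p| := by
  rcases lt_or_gt_of_ne hp with hp | hp
  · exact h.exists_triangle_of_up hp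
  · obtain ⟨t, h1, h2, h3⟩ := h.neg.exists_triangle_of_up (p := -p) (by simpa using hp)
    exact ⟨t, h1, by rw [h2, tileSet_neg], by rw [h3, wt_neg, abs_neg]⟩

/-- Every equilateral triangle is a tile with respect to some frame. -/
lemma exists_frame {t : PlaneTriangle} (ht : t.Equilateral) : ∃ (μ : Fin 3 → Plane)
    (p : Fin 3 → ℝ), IsFrame μ ∧ wt p < 0 ∧ triangleRegion t = tileSet μ p ∧
      triangleSize t = |wt p| := by
  obtain ⟨s, hs⟩ := ht
  have hs0 : 0 < s := by
    rw [← hs 0 1 (by decide)]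
    exact dist_pos.2 (t.independent.injective.ne (by decide))
  set u := t.points 1 - t.points 0 with hu
  set v := t.points 2 - t.points 0 with hv
  clear_value u v
  have huu : ⟪u, u⟫ = s ^ 2 := by
    rw [real_inner_self_eq_norm_sq, hu, ← dist_eq_norm, hs 1 0 (by decide)]
  have hvv : ⟪v, v⟫ = s ^ 2 := by
    rw [real_inner_self_eq_norm_sq, hv, ← dist_eq_norm, hs 2 0 (by decide)]
  have huv : ⟪u, v⟫ = s ^ 2 / 2 := by
    have h1 : ⟪u - v, u - v⟫ = s ^ 2 := by
      rw [real_inner_self_eq_norm_sq, hu, hv, sub_sub_sub_cancel_right, ← dist_eq_norm,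
        hs 1 2 (by decide)]
    rw [inner_sub_left, inner_sub_right, inner_sub_right, real_inner_comm u v] at h1
    linarith
  have hvu : ⟪v, u⟫ = s ^ 2 / 2 := by rw [real_inner_comm, huv]
  -- The vectors from the centroid `G` to the vertices; scaled by `2 / s` they form a frame.
  set B : Fin 3 → Plane := ![-(1 / 3 : ℝ) • (u + v), (1 / 3 : ℝ) • ((2 : ℝ) • u - v),
    (1 / 3 : ℝ) • ((2 : ℝ) • v - u)] with hB
  have hBB : ∀ i j, ⟪B i, B j⟫ = if i = j then s ^ 2 / 3 else -s ^ 2 / 6 := by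
    intro i j
    fin_cases i <;> fin_cases j <;>
      simp only [hB, Fin.zero_eta, Fin.mk_one, Fin.reduceFinMk, Matrix.cons_val, inner_smul_left,
        inner_smul_right, inner_add_left, inner_add_right, inner_sub_left, inner_sub_right, huu, hvv,
        huv, hvu, RCLike.conj_to_real, Fin.reduceEq, if_true, if_false] <;> ring
  set G := t.points 0 + (1 / 3 : ℝ) • (u + v) with hG
  have hBG : ∀ i, t.points i = G + B i := by
    intro i
    have e1 : t.points 1 = t.points 0 + u := by rw [hu]; abel
    have e2 : t.points 2 = t.points 0 + v := by rw [hv]; abel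
    fin_cases i
    · simp only [hB, hG, Fin.zero_eta, Matrix.cons_val]; module
    · simp only [hB, hG, Fin.mk_one, Matrix.cons_val]; rw [e1]; module
    · simp only [hB, hG, Fin.reduceFinMk, Matrix.cons_val]; rw [e2]; module
  set μ : Fin 3 → Plane := fun j => (2 / s) • B j with hμ
  have hfr : IsFrame μ := by
    refine ⟨fun i => ?_, fun i j hij => ?_⟩
    · rw [hμ, inner_smul_left, inner_smul_right, hBB, if_pos rfl, RCLike.conj_to_real]
      field_simp; norm_num
    · rw [hμ, inner_smul_left, inner_smul_right, hBB, if_neg hij, RCLike.conj_to_real]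
      field_simp; norm_num
  -- In these coordinates the centroid lies `s / 3` above each of the three sides.
  set p : Fin 3 → ℝ := fun j => chart μ G j - s / 3 with hp
  have hwp : wt p = -s := by
    have := hfr.wt_chart G
    simp only [wt, hp] at this ⊢
    linarith
  have hpts : ∀ i, t.points i = point μ (vertexCoord p i) := by
    intro i
    apply hfr.chart_injective
    rw [hfr.chart_point (wt_vertexCoord p i)]
    ext j
    rw [hBG, chart_add, vertexCoord, hwp, hp]
    have : chart μ (B i) j = (2 / s) * if j = i then s ^ 2 / 3 else -s ^ 2 / 6 := by
      rw [chart, hμ, inner_smul_left, hBB, RCLike.conj_to_real]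
    rw [this]
    split_ifs <;> field_simp <;> ring
  refine ⟨μ, p, hfr, by rw [hwp]; linarith, ?_, ?_⟩
  · rw [← hfr.convexHull_vertices (by rw [hwp]; linarith), triangleRegion]
    congr 2
    exact funext hpts
  · rw [triangleSize, hs 0 1 (by decide), hwp, abs_neg, abs_of_pos hs0]

/-- One vector of a frame determines the other two up to their order, so one common side direction
aligns the whole frames. -/
lemma IsFrame.aligned_of_neg (hν : IsFrame ν) (hμ : IsFrame μ) {j k : Fin 3} (h : μ j = -ν k) :
    ∃ σ : Equiv.Perm (Fin 3), ∀ i, μ (σ i) = -ν i := by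
  obtain ⟨π, hπ⟩ : ∃ π : Equiv.Perm (Fin 3), π 0 = k := ⟨Equiv.swap 0 k, by simp⟩
  obtain ⟨τ, hτ⟩ : ∃ τ : Equiv.Perm (Fin 3), τ 0 = j := ⟨Equiv.swap 0 j, by simp⟩
  subst hπ hτ
  have hsumν : ν (π 0) + ν (π 1) + ν (π 2) = 0 := by
    rw [← hν.sum_eq_zero, ← Fin.sum_univ_three, ← Fin.sum_univ_three (f := fun i => ν (π i)),
      Equiv.sum_comp π]
  have hsumμ : μ (τ 0) + μ (τ 1) + μ (τ 2) = 0 := by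
    rw [← hμ.sum_eq_zero, ← Fin.sum_univ_three, ← Fin.sum_univ_three (f := fun i => μ (τ i)),
      Equiv.sum_comp τ]
  have hne : ∀ {i j : Fin 3}, i ≠ j → ⟪ν (π i), ν (π j)⟫ = -2 / 3 := fun hij =>
    hν.inner_ne _ _ (π.injective.ne hij)
  set f := chart ν (μ (τ 1)) with hf
  have h0 : f (π 0) = 2 / 3 := by
    have := hμ.inner_ne (τ 0) (τ 1) (τ.injective.ne (by decide))
    rw [h, inner_neg_left] at this
    rw [hf, chart]
    linarith
  have hw := hν.wt_chart (μ (τ 1))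
  rw [wt_perm π, ← hf, h0] at hw
  have hnorm : f (π 0) ^ 2 + f (π 1) ^ 2 + f (π 2) ^ 2 = 8 / 3 := by
    have h1 := hμ.inner_self (τ 1)
    nth_rw 1 [← hν.point_chart (μ (τ 1))] at h1
    simp only [point, inner_smul_left, inner_add_left, RCLike.conj_to_real] at h1
    have h2 : ∀ i, ⟪ν i, μ (τ 1)⟫ = f i := fun i => rfl
    rw [h2, h2, h2, ← hf] at h1
    have h3 := Equiv.sum_comp π (fun i => f i ^ 2)
    simp only [Fin.sum_univ_three] at h3
    linarith
  have hcases : f (π 1) = -4 / 3 ∨ f (π 2) = -4 / 3 := by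
    have h2 : f (π 2) = -2 / 3 - f (π 1) := by linarith
    have : (f (π 1) + 4 / 3) * (f (π 2) + 4 / 3) = 0 := by
      rw [h0, h2] at hnorm
      rw [h2]
      linarith
    rcases mul_eq_zero.1 this with hh | hh
    · left; linarith
    · right; linarith
  have hvec : ∀ a : Fin 3, f = -chart ν (ν a) → μ (τ 1) = -ν a := fun a ha => by
    apply hν.chart_injective
    rw [← hf, ha]
    ext i
    simp [chart]
  rcases hcases with hc | hc
  · have h1 : μ (τ 1) = -ν (π 1) := by
      refine hvec _ (ext_perm π ?_ ?_ ?_) <;> simp only [Pi.neg_apply, chart]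
      · rw [hne (by decide), h0]; norm_num
      · rw [hν.inner_self, hc]; norm_num
      · rw [hne (by decide)]; linarith
    have h2 : μ (τ 2) = -ν (π 2) := by
      rw [h, h1] at hsumμ
      have : μ (τ 2) = ν (π 0) + ν (π 1) := by
        rw [← sub_eq_zero, ← hsumμ]; abel
      rw [this, ← sub_eq_zero, ← hsumν]; abel
    refine ⟨π⁻¹.trans τ, (forall_perm π).2 ?_⟩
    simp [h, h1, h2]
  · have h1 : μ (τ 1) = -ν (π 2) := by
      refine hvec _ (ext_perm π ?_ ?_ ?_) <;> simp only [Pi.neg_apply, chart]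
      · rw [hne (by decide), h0]; norm_num
      · rw [hne (by decide)]; linarith
      · rw [hν.inner_self, hc]; norm_num
    have h2 : μ (τ 2) = -ν (π 1) := by
      rw [h, h1] at hsumμ
      have : μ (τ 2) = ν (π 0) + ν (π 2) := by
        rw [← sub_eq_zero, ← hsumμ]; abel
      rw [this, ← sub_eq_zero, ← hsumν]; abel
    refine ⟨(π⁻¹.trans (Equiv.swap 1 2)).trans τ, (forall_perm π).2 ?_⟩
    have e : (Equiv.swap 1 2 : Equiv.Perm (Fin 3)) 0 = 0 := by decide
    simp [h, h1, h2, e]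

end TriTiling

namespace TriTiling

/-! ### Tilings by equilateral triangles are aligned -/

open Finset Filter Topology

open scoped RealInnerProductSpace

variable {ν μ : Fin 3 → Plane}

/-- At a point of a tile that is not a vertex, the tile contains a half plane locally. -/
lemma IsFrame.exists_half_plane (h : IsFrame μ) {p : Fin 3 → ℝ} {z : Plane} (hp : wt p < 0)
    (hz : z ∈ tileSet μ p) (hv : ∀ i, z ≠ point μ (vertexCoord p i)) :
    ∃ j, ∀ w, 0 < ⟪μ j, w⟫ → ∀ᶠ t in 𝓝[>] (0 : ℝ), Inside p (chart μ (z + t • w)) := by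
  have hz' : ∀ j, p j ≤ chart μ z j := by
    rcases hz with ⟨-, hz⟩ | ⟨hz, -⟩
    · exact hz
    · linarith
  have hev : ∀ (i : Fin 3) (w : Plane), p i < chart μ z i →
      ∀ᶠ t in 𝓝[>] (0 : ℝ), p i < chart μ (z + t • w) i := by
    intro i w hi
    have hc : Continuous fun t : ℝ => chart μ (z + t • w) i :=
      (continuous_chart μ i).comp (by fun_prop)
    refine (hc.tendsto 0).mono_left nhdsWithin_le_nhds |>.eventually_const_lt ?_
    simpa using hi
  -- Two equalities would make `z` a vertex, so at most one of the three inequalities is tight.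
  have hone : ∃ j, ∀ i, i ≠ j → p i < chart μ z i := by
    by_contra! hcon
    obtain ⟨i, -, hi⟩ := hcon 0
    obtain ⟨j, hj, hj'⟩ := hcon i
    obtain ⟨π, rfl, rfl⟩ := exists_perm_of_ne i j hj.symm
    refine hv (π 2) (h.chart_injective ?_)
    rw [h.chart_point (wt_vertexCoord _ _)]
    have e0 := le_antisymm hi (hz' _)
    have e1 := le_antisymm hj' (hz' _)
    have ew := h.wt_chart z
    rw [wt_perm π] at ew
    have ep := wt_perm π p
    have n0 : π 0 ≠ π 2 := π.injective.ne (by decide)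
    have n1 : π 1 ≠ π 2 := π.injective.ne (by decide)
    refine ext_perm π ?_ ?_ ?_ <;> simp only [vertexCoord, n0, n1, if_true, if_false] <;> linarith
  obtain ⟨j, hj⟩ := hone
  refine ⟨j, fun w hw => ?_⟩
  have hall : ∀ᶠ t in 𝓝[>] (0 : ℝ), ∀ i, i ≠ j → p i < chart μ (z + t • w) i := by
    rw [eventually_all]
    intro i
    by_cases hij : i = j
    · exact Eventually.of_forall fun _ hh => absurd hij hh
    · exact (hev i w (hj i hij)).mono fun _ hh _ => hh
  have hpos : ∀ᶠ t in 𝓝[>] (0 : ℝ), 0 < t := self_mem_nhdsWithin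
  filter_upwards [hall, hpos] with t ht ht0
  refine Or.inl ⟨hp, fun i => ?_⟩
  by_cases hij : i = j
  · subst hij
    rw [chart_add, chart_smul]
    have := mul_pos ht0 hw
    have := hz' i
    simp only [chart] at *
    linarith
  · exact ht i hij

/-- Two tiles touching at a point that is not a vertex have a common edge direction. -/
lemma IsFrame.eq_neg_of_contact (hμ : IsFrame μ) (hν : IsFrame ν) {p q : Fin 3 → ℝ} {z : Plane}
    (hp : wt p < 0) (hq : wt q < 0) (hzp : z ∈ tileSet μ p) (hzq : z ∈ tileSet ν q)
    (hvp : ∀ i, z ≠ point μ (vertexCoord p i)) (hvq : ∀ i, z ≠ point ν (vertexCoord q i))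
    (hd : ∀ x, Inside p (chart μ x) → ¬ Inside q (chart ν x)) : ∃ j k, μ j = -ν k := by
  obtain ⟨j, hj⟩ := hμ.exists_half_plane hp hzp hvp
  obtain ⟨k, hk⟩ := hν.exists_half_plane hq hzq hvq
  refine ⟨j, k, ?_⟩
  by_contra hne
  -- The sum of two vectors of equal length that are not opposite points into both half planes, so
  -- the tiles would overlap.
  have hw : μ j + ν k ≠ 0 := fun hh => hne (eq_neg_of_add_eq_zero_left hh)
  have hpos := real_inner_self_pos.2 hw
  simp only [inner_add_left, inner_add_right, hμ.inner_self, hν.inner_self,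
    real_inner_comm (μ j) (ν k)] at hpos
  obtain ⟨t, h1, h2⟩ := ((hj (μ j + ν k) (by
      rw [inner_add_right, hμ.inner_self]; linarith)).and (hk (μ j + ν k) (by
      rw [inner_add_right, hν.inner_self, real_inner_comm]; linarith))).exists
  exact hd _ h1 h2

/-- A segment can be moved slightly in order to avoid finitely many points. -/
lemma exists_segment_avoiding {V : Set Plane} (hV : V.Finite) {a b : Plane} (ha : a ∉ V)
    (hab : b ≠ a) {O : Set Plane} (hO : IsOpen O) (hb : b ∈ O) :
    ∃ c ∈ O, ∀ s : ℝ, a + s • (c - a) ∉ V := by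
  set d := b - a with hd
  have hd0 : d ≠ 0 := sub_ne_zero.2 hab
  set u : Plane := !₂[-d 1, d 0] with hu
  have hud : ⟪u, d⟫ = 0 := by rw [inner_plane]; simp [hu]; ring
  have huu : ⟪u, u⟫ = ⟪d, d⟫ := by rw [inner_plane, inner_plane]; simp [hu]; ring
  have hN : 0 < ⟪d, d⟫ := real_inner_self_pos.2 hd0
  have hc : Continuous fun t : ℝ => b + t • u := by fun_prop
  have hmem : {t : ℝ | b + t • u ∈ O} ∈ 𝓝 (0 : ℝ) :=
    hc.continuousAt.preimage_mem_nhds (hO.mem_nhds (by simpa using hb))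
  have hinf : {t : ℝ | b + t • u ∈ O}.Infinite := infinite_of_mem_nhds 0 hmem
  -- As `u` is orthogonal to `b - a`, a point of `V` lies on the line from `a` through `b + t u` for
  -- at most the one value of `t` listed here.
  obtain ⟨t, ht, htV⟩ := hinf.exists_notMem_finite
    (hV.image fun v => ⟪u, v - a⟫ / ⟪d, v - a⟫)
  refine ⟨b + t • u, ht, fun s hs => htV ?_⟩
  refine ⟨_, hs, ?_⟩
  have he : b + t • u - a = d + t • u := by rw [hd]; abel
  have hs0 : s ≠ 0 := by
    rintro rfl
    rw [zero_smul, add_zero] at hs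
    exact ha hs
  simp only [add_sub_cancel_left, he, inner_smul_right, inner_add_right, hud, huu,
    real_inner_comm u d]
  rw [zero_add, mul_zero, add_zero]
  field_simp

/-- A convex set tiled by tiles of various frames. -/
structure FrameTiling {n : ℕ} (P : Set Plane) (μ : Fin n → Fin 3 → Plane)
    (p : Fin n → Fin 3 → ℝ) : Prop where
  frame : ∀ i, IsFrame (μ i)
  wt_neg : ∀ i, wt (p i) < 0
  union : ⋃ i, tileSet (μ i) (p i) = P
  disjoint : ∀ i j, i ≠ j → ∀ z, Inside (p i) (chart (μ i) z) → ¬ Inside (p j) (chart (μ j) z)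

variable {n : ℕ} {P : Set Plane} {M : Fin n → Fin 3 → Plane} {p : Fin n → Fin 3 → ℝ}

lemma IsFrame.exists_inside_notMem (h : IsFrame μ) {q : Fin 3 → ℝ} (hq : wt q < 0) {V : Set Plane}
    (hV : V.Finite) : ∃ a, Inside q (chart μ a) ∧ a ∉ V := by
  have hne : {z | Inside q (chart μ z)}.Nonempty := by
    refine ⟨point μ (fun j => q j - wt q / 3), Or.inl ⟨hq, fun j => ?_⟩⟩
    rw [h.chart_point (by simp only [wt]; ring)]
    linarith
  obtain ⟨a, h1, h2⟩ := (hV.countable.dense_compl ℝ).inter_open_nonempty _ (isOpen_insideSet μ q) hne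
  exact ⟨a, h1, h2⟩

lemma finite_vertices (M : Fin n → Fin 3 → Plane) (p : Fin n → Fin 3 → ℝ) :
    (Set.range fun x : Fin n × Fin 3 => point (M x.1) (vertexCoord (p x.1) x.2)).Finite :=
  Set.finite_range _

lemma FrameTiling.isClosed (h : FrameTiling P M p) : IsClosed P := by
  rw [← h.union]
  exact isClosed_iUnion_of_finite fun i => isClosed_tileSet _ _

/-- All tiles have the same directions of edges. -/
lemma FrameTiling.aligned (h : FrameTiling P M p) (hP : Convex ℝ P) (i₀ i : Fin n) :
    ∃ σ : Equiv.Perm (Fin 3), (∀ k, M i (σ k) = M i₀ k) ∨ ∀ k, M i (σ k) = -M i₀ k := by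
  by_contra hi
  set A : Fin n → Prop := fun i => ∃ σ : Equiv.Perm (Fin 3),
    (∀ k, M i (σ k) = M i₀ k) ∨ ∀ k, M i (σ k) = -M i₀ k with hA
  have hV := finite_vertices M p
  set V := Set.range fun x : Fin n × Fin 3 => point (M x.1) (vertexCoord (p x.1) x.2) with hVdef
  obtain ⟨a, ha, haV⟩ := (h.frame i₀).exists_inside_notMem (h.wt_neg i₀) hV
  obtain ⟨b, hb, hba⟩ := (h.frame i).exists_inside_notMem (h.wt_neg i) (Set.finite_singleton a)
  obtain ⟨c, hc, hcV⟩ := exists_segment_avoiding hV haV (by simpa using hba)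
    (isOpen_insideSet (M i) (p i)) hb
  have hmem : ∀ {i z}, Inside (p i) (chart (M i) z) → z ∈ tileSet (M i) (p i) :=
    fun hh => Inside.covers hh
  have haP : a ∈ P := h.union ▸ Set.mem_iUnion.2 ⟨i₀, hmem ha⟩
  have hcP : c ∈ P := h.union ▸ Set.mem_iUnion.2 ⟨i, hmem hc⟩
  -- Aligned and unaligned tiles give two closed sets covering the connected segment. They meet in a
  -- point that is not a vertex, and the contact there aligns an unaligned tile.
  have hconn := (convex_segment (𝕜 := ℝ) a c).isPreconnected
  rw [isPreconnected_closed_iff] at hconn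
  obtain ⟨z, hz, hz1, hz2⟩ := hconn (⋃ i, ⋃ (_ : A i), tileSet (M i) (p i))
    (⋃ i, ⋃ (_ : ¬ A i), tileSet (M i) (p i))
    (isClosed_iUnion_of_finite fun i => isClosed_iUnion_of_finite fun _ => isClosed_tileSet _ _)
    (isClosed_iUnion_of_finite fun i => isClosed_iUnion_of_finite fun _ => isClosed_tileSet _ _)
    (by
      intro z hz
      have := hP.segment_subset haP hcP hz
      rw [← h.union] at this
      obtain ⟨j, hj⟩ := Set.mem_iUnion.1 this
      by_cases hAj : A j
      · exact Or.inl (Set.mem_iUnion₂.2 ⟨j, hAj, hj⟩)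
      · exact Or.inr (Set.mem_iUnion₂.2 ⟨j, hAj, hj⟩))
    ⟨a, left_mem_segment ℝ a c, Set.mem_iUnion₂.2 ⟨i₀, ⟨1, Or.inl fun _ => rfl⟩, hmem ha⟩⟩
    ⟨c, right_mem_segment ℝ a c, Set.mem_iUnion₂.2 ⟨i, hi, hmem hc⟩⟩
  obtain ⟨j, ⟨σ, hσ⟩, hzj⟩ := Set.mem_iUnion₂.1 hz1
  obtain ⟨k, hk, hzk⟩ := Set.mem_iUnion₂.1 hz2
  have hzV : z ∉ V := by
    rw [segment_eq_image'] at hz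
    obtain ⟨s, -, rfl⟩ := hz
    exact hcV s
  have hjk : j ≠ k := by
    rintro rfl
    exact hk ⟨σ, hσ⟩
  obtain ⟨e, f, hef⟩ := (h.frame j).eq_neg_of_contact (h.frame k) (h.wt_neg j) (h.wt_neg k) hzj hzk
    (fun m hm => hzV ⟨(j, m), hm.symm⟩) (fun m hm => hzV ⟨(k, m), hm.symm⟩) (h.disjoint j k hjk)
  obtain ⟨e', rfl⟩ := σ.surjective e
  refine hk ?_
  rcases hσ with hσ | hσ
  · rw [hσ] at hef
    obtain ⟨τ, hτ⟩ := (h.frame i₀).aligned_of_neg (h.frame k) (j := f) (k := e')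
      (by rw [hef, neg_neg])
    exact ⟨τ, Or.inr hτ⟩
  · rw [hσ] at hef
    obtain ⟨τ, hτ⟩ := (h.frame i₀).neg.aligned_of_neg (h.frame k) (j := f) (k := e')
      (by rw [Pi.neg_apply, hef, neg_neg])
    exact ⟨τ, Or.inl fun m => by rw [hτ, Pi.neg_apply, neg_neg]⟩

/-- A convex set tiled by tiles is bounded by lines of the three directions. -/
lemma FrameTiling.mem_of_bounds (h : FrameTiling P M p) (hP : Convex ℝ P) (i₀ : Fin n)
    {L U : Fin 3 → ℝ} (hL : ∀ j, ∃ x ∈ P, chart (M i₀) x j = L j)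
    (hU : ∀ j, ∃ x ∈ P, chart (M i₀) x j = U j)
    (hb : ∀ x ∈ P, ∀ j, L j ≤ chart (M i₀) x j ∧ chart (M i₀) x j ≤ U j) {z : Plane}
    (hz : ∀ j, L j ≤ chart (M i₀) z j ∧ chart (M i₀) z j ≤ U j) : z ∈ P := by
  by_contra hzP
  have hV := finite_vertices M p
  set V := Set.range fun x : Fin n × Fin 3 => point (M x.1) (vertexCoord (p x.1) x.2) with hVdef
  obtain ⟨a, ha, haV⟩ := (h.frame i₀).exists_inside_notMem (h.wt_neg i₀) hV
  have haint : a ∈ interior P := by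
    refine interior_maximal ?_ (isOpen_insideSet (M i₀) (p i₀)) ha
    intro x hx
    rw [← h.union]
    exact Set.mem_iUnion.2 ⟨i₀, Inside.covers hx⟩
  have haP := interior_subset haint
  have hpush : ∀ w : Plane, ∃ t : ℝ, 0 < t ∧ a + t • w ∈ P := by
    intro w
    have hc : Continuous fun t : ℝ => a + t • w := by fun_prop
    have h1 : ∀ᶠ t in 𝓝[>] (0 : ℝ), a + t • w ∈ P := by
      refine nhdsWithin_le_nhds (hc.continuousAt.preimage_mem_nhds ?_)
      simpa using mem_interior_iff_mem_nhds.1 haint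
    have h2 : ∀ᶠ t in 𝓝[>] (0 : ℝ), 0 < t := self_mem_nhdsWithin
    obtain ⟨t, ht, ht'⟩ := (h2.and h1).exists
    exact ⟨t, ht, ht'⟩
  have haS : ∀ j, L j < chart (M i₀) a j ∧ chart (M i₀) a j < U j := by
    intro j
    have e : chart (M i₀) (M i₀ j) j = 4 / 3 := (h.frame i₀).inner_self j
    obtain ⟨t, ht, htP⟩ := hpush (M i₀ j)
    obtain ⟨s, hs, hsP⟩ := hpush (-M i₀ j)
    have e' : chart (M i₀) (-M i₀ j) j = -(4 / 3) := by rw [← e]; exact inner_neg_right _ _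
    have h1 := (hb _ htP j).2
    have h2 := (hb _ hsP j).1
    rw [chart_add, chart_smul, e] at h1
    rw [chart_add, chart_smul, e'] at h2
    constructor <;> linarith
  -- A point outside `P` strictly within the bounds exists near `z`; a generic segment from `a` to
  -- such a point leaves `P` at a point `y` that is not a vertex.
  set O : Set Plane := {x | ∀ j, L j < chart (M i₀) x j ∧ chart (M i₀) x j < U j} ∩ Pᶜ with hO
  have hOo : IsOpen O := by
    refine IsOpen.inter ?_ h.isClosed.isOpen_compl
    simp only [Set.ofPred_forall, Set.ofPred_and]
    exact isOpen_iInter_of_finite fun j => (isOpen_lt continuous_const (continuous_chart _ j)).inter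
      (isOpen_lt (continuous_chart _ j) continuous_const)
  obtain ⟨b, hbO⟩ : O.Nonempty := by
    have hc : Continuous fun t : ℝ => z + t • (a - z) := by fun_prop
    have h1 : ∀ᶠ t in 𝓝[>] (0 : ℝ), z + t • (a - z) ∈ Pᶜ :=
      nhdsWithin_le_nhds (hc.continuousAt.preimage_mem_nhds
        (h.isClosed.isOpen_compl.mem_nhds (by simpa using hzP)))
    have h2 : ∀ᶠ t in 𝓝[>] (0 : ℝ), t ∈ Set.Ioo (0 : ℝ) 1 := Ioo_mem_nhdsGT one_pos
    obtain ⟨t, ht, ht0, ht1⟩ := (h1.and h2).exists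
    refine ⟨_, fun j => ?_, ht⟩
    rw [chart_add, chart_smul, chart_sub]
    have k1 := mul_pos ht0 (sub_pos.2 (haS j).1)
    have k2 := mul_pos ht0 (sub_pos.2 (haS j).2)
    have k3 := mul_nonneg (sub_nonneg.2 ht1.le) (sub_nonneg.2 (hz j).1)
    have k4 := mul_nonneg (sub_nonneg.2 ht1.le) (sub_nonneg.2 (hz j).2)
    constructor <;> linarith
  obtain ⟨c, ⟨hcS, hcP⟩, hcV⟩ := exists_segment_avoiding hV haV
    (by rintro rfl; exact hbO.2 haP) hOo hbO
  set w := c - a with hw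
  set S : Set ℝ := {t | 0 ≤ t ∧ a + t • w ∈ P} with hS
  have hac : a + (1 : ℝ) • w = c := by rw [hw, one_smul]; abel
  have hS1 : ∀ t ∈ S, t < 1 := by
    rintro t ⟨ht0, htP⟩
    by_contra! ht
    refine hcP ?_
    have : c = (1 - 1 / t) • a + (1 / t) • (a + t • w) := by
      rw [smul_add, smul_smul, one_div_mul_cancel (by linarith), hac.symm]
      module
    rw [this]
    exact hP haP htP (by rw [sub_nonneg, div_le_one (by linarith)]; exact ht) (by positivity) (by ring)
  have hSc : IsClosed S := by
    have hc : Continuous fun t : ℝ => a + t • w := by fun_prop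
    exact isClosed_Ici.inter (h.isClosed.preimage hc)
  have h0S : (0 : ℝ) ∈ S := ⟨le_rfl, by simpa using haP⟩
  have hbdd : BddAbove S := ⟨1, fun t ht => (hS1 t ht).le⟩
  have hmax := hSc.csSup_mem ⟨0, h0S⟩ hbdd
  set s := sSup S with hs
  have hs1 := hS1 s hmax
  set y := a + s • w with hy
  have hyS : ∀ j, L j < chart (M i₀) y j ∧ chart (M i₀) y j < U j := by
    intro j
    rw [hy, hw, chart_add, chart_smul, chart_sub]
    have k1 := mul_nonneg hmax.1 (sub_pos.2 (hcS j).1).le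
    have k2 := mul_nonneg hmax.1 (sub_pos.2 (hcS j).2).le
    have k3 := mul_pos (sub_pos.2 hs1) (sub_pos.2 (haS j).1)
    have k4 := mul_pos (sub_pos.2 hs1) (sub_pos.2 (haS j).2)
    constructor <;> linarith
  have hyP : y ∈ P := hmax.2
  obtain ⟨i, hyi⟩ := Set.mem_iUnion.1 (h.union.symm ▸ hyP)
  obtain ⟨j, hj⟩ := (h.frame i).exists_half_plane (h.wt_neg i) hyi
    fun m hm => hcV s ⟨(i, m), hm.symm⟩
  -- By alignment the side at `y` is parallel to a bounding line, which is attained in `P`. So `P`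
  -- has a point strictly behind this side.
  obtain ⟨x, hxP, hxj⟩ : ∃ x ∈ P, 0 < ⟪M i j, y - x⟫ := by
    obtain ⟨σ, hσ⟩ := h.aligned hP i₀ i
    obtain ⟨k, rfl⟩ := σ.surjective j
    rcases hσ with hσ | hσ
    · obtain ⟨x, hxP, hx⟩ := hL k
      refine ⟨x, hxP, ?_⟩
      rw [hσ, inner_sub_right]
      have := (hyS k).1
      simp only [chart] at *
      linarith
    · obtain ⟨x, hxP, hx⟩ := hU k
      refine ⟨x, hxP, ?_⟩
      rw [hσ, inner_sub_right, inner_neg_left, inner_neg_left]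
      have := (hyS k).2
      simp only [chart] at *
      linarith
  -- For this `l` the direction `w + l (y - x)` leads into the tile. A point of the tile in this
  -- direction and `x` span a segment crossing the ray beyond `y`, contrary to the choice of `y`.
  set l := (1 + |⟪M i j, w⟫|) / ⟪M i j, y - x⟫ with hl
  have hl0 : 0 < l := by positivity
  have hpos : 0 < ⟪M i j, w + l • (y - x)⟫ := by
    rw [inner_add_right, inner_smul_right, hl, div_mul_cancel₀ _ hxj.ne']
    linarith [neg_abs_le ⟪M i j, w⟫]
  have hpos' : ∀ᶠ t in 𝓝[>] (0 : ℝ), 0 < t := self_mem_nhdsWithin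
  obtain ⟨t, ht, ht0⟩ := ((hj _ hpos).and hpos').exists
  have htP : y + t • (w + l • (y - x)) ∈ P := h.union ▸ Set.mem_iUnion.2 ⟨i, Inside.covers ht⟩
  have htl : 0 < 1 + t * l := by positivity
  have hnew : s + t / (1 + t * l) ∈ S := by
    refine ⟨add_nonneg hmax.1 (by positivity), ?_⟩
    have : a + (s + t / (1 + t * l)) • w =
        (1 / (1 + t * l)) • (y + t • (w + l • (y - x))) + (t * l / (1 + t * l)) • x := by
      have e1 : (1 / (1 + t * l)) • (y + t • (w + l • (y - x))) + (t * l / (1 + t * l)) • x =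
        (1 / (1 + t * l)) • ((1 + t * l) • y + t • w) := by
        rw [show t * l / (1 + t * l) = (1 / (1 + t * l)) * (t * l) by ring]
        module
      rw [e1, smul_add, smul_smul, one_div_mul_cancel htl.ne', hy]
      module
    rw [this]
    exact hP htP hxP (by positivity) (by positivity) (by field_simp)
  have := le_csSup hbdd hnew
  have : 0 < t / (1 + t * l) := by positivity
  linarith

end TriTiling

namespace TriTiling

/-! ### From the plane to coordinates and back -/
open Finset

variable {ν : Fin 3 → Plane} {n : ℕ} {P : Set Plane}

/-- The points whose triangular coordinates lie between given bounds. -/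
def region (ν : Fin 3 → Plane) (L U : Fin 3 → ℝ) : Set Plane :=
  {z | ∀ j, L j ≤ chart ν z j ∧ chart ν z j ≤ U j}

lemma exists_frameTiling {T : Fin n → PlaneTriangle} (h : IsEquilateralTiling P T) :
    ∃ M p, FrameTiling P M p ∧ ∀ i, triangleSize (T i) = |wt (p i)| := by
  choose M p h1 h2 h3 h4 using fun i => exists_frame (h.equilateral i)
  refine ⟨M, p, ⟨h1, h2, ?_, fun i j hij z hi hj => ?_⟩, h4⟩
  · rw [← h.union_eq]
    exact Set.iUnion_congr fun i => (h3 i).symm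
  · have := h.disjoint_interiors i j hij
    rw [h3, h3, (h1 i).interior_tileSet, (h1 j).interior_tileSet] at this
    exact Set.disjoint_left.1 this hi hj

lemma covers_vertexCoord {q : Fin 3 → ℝ} (hq : wt q ≠ 0) (i : Fin 3) :
    Covers q (vertexCoord q i) := by
  rcases lt_or_gt_of_ne hq with h | h
  · refine Or.inl ⟨h, fun j => ?_⟩
    rw [vertexCoord]; split_ifs <;> linarith
  · refine Or.inr ⟨h, fun j => ?_⟩
    rw [vertexCoord]; split_ifs <;> linarith

lemma exists_inside {q : Fin 3 → ℝ} (hq : wt q ≠ 0) : ∃ f, wt f = 0 ∧ Inside q f := by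
  refine ⟨fun j => q j - wt q / 3, by simp only [wt]; ring, ?_⟩
  rcases lt_or_gt_of_ne hq with h | h
  · exact Or.inl ⟨h, fun j => by linarith⟩
  · exact Or.inr ⟨h, fun j => by linarith⟩

lemma covers_comp_perm (σ : Equiv.Perm (Fin 3)) (q f : Fin 3 → ℝ) :
    Covers (q ∘ σ) (f ∘ σ) ↔ Covers q f := by
  have hw : wt (q ∘ σ) = wt q := (wt_perm σ q).symm
  simp only [Covers, hw, Function.comp_apply]
  rw [σ.forall_congr_left (p := fun i => q (σ i) ≤ f (σ i)),
    σ.forall_congr_left (p := fun i => f (σ i) ≤ q (σ i))]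
  simp

lemma exists_tileSet_eq {μ : Fin 3 → Plane} {σ : Equiv.Perm (Fin 3)}
    (hσ : (∀ k, μ (σ k) = ν k) ∨ ∀ k, μ (σ k) = -ν k) {p : Fin 3 → ℝ} (hp : wt p ≠ 0) :
    ∃ q, wt q ≠ 0 ∧ |wt q| = |wt p| ∧ tileSet μ p = tileSet ν q := by
  have hw : wt (p ∘ σ) = wt p := (wt_perm σ p).symm
  rcases hσ with h | h
  · refine ⟨p ∘ σ, by rwa [hw], by rw [hw], ?_⟩
    ext z
    have : chart ν z = chart μ z ∘ σ := by ext k; simp [chart, h]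
    simp only [tileSet, Set.mem_ofPred_eq, this, covers_comp_perm]
  · refine ⟨-(p ∘ σ), by rwa [wt_neg, hw, neg_ne_zero], by rw [wt_neg, hw, abs_neg], ?_⟩
    ext z
    have : chart ν z = -(chart μ z ∘ σ) := by ext k; simp [chart, h]
    simp only [tileSet, Set.mem_ofPred_eq, this, covers_neg, covers_comp_perm]

/-- A tiling of a compact convex set by equilateral triangles, in suitable coordinates. -/
theorem exists_tightTiling {T : Fin n → PlaneTriangle} (hP : IsCompact P) (hc : Convex ℝ P)
    (hne : P.Nonempty) (h : IsEquilateralTiling P T) : ∃ ν L U T', IsFrame ν ∧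
      TightTiling L U T' ∧ T'.card = n ∧ (sizes T').card = numSizes T ∧ P = region ν L U := by
  classical
  obtain ⟨M, p, hF, hs⟩ := exists_frameTiling h
  obtain ⟨i₀⟩ : Nonempty (Fin n) := by
    obtain ⟨x, hx⟩ := hne
    rw [← h.union_eq] at hx
    obtain ⟨i, -⟩ := Set.mem_iUnion.1 hx
    exact ⟨i⟩
  set ν := M i₀ with hν
  have hfr : IsFrame ν := hF.frame i₀
  have hLU : ∀ j, ∃ l u, (∃ x ∈ P, chart ν x j = l) ∧ (∃ x ∈ P, chart ν x j = u) ∧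
      ∀ x ∈ P, l ≤ chart ν x j ∧ chart ν x j ≤ u := fun j => by
    obtain ⟨x, hx, hx'⟩ := hP.exists_isMinOn hne (continuous_chart ν j).continuousOn
    obtain ⟨y, hy, hy'⟩ := hP.exists_isMaxOn hne (continuous_chart ν j).continuousOn
    exact ⟨_, _, ⟨x, hx, rfl⟩, ⟨y, hy, rfl⟩, fun z hz => ⟨hx' hz, hy' hz⟩⟩
  choose L U hL hU hb using hLU
  have hPr : P = region ν L U := Set.Subset.antisymm (fun z hz j => hb j z hz) fun z hz =>
    hF.mem_of_bounds hc i₀ hL hU (fun x hx j => hb j x hx) hz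
  have hq : ∀ i, ∃ q, wt q ≠ 0 ∧ |wt q| = |wt (p i)| ∧ tileSet (M i) (p i) = tileSet ν q :=
    fun i => by
      obtain ⟨σ, hσ⟩ := hF.aligned hc i₀ i
      exact exists_tileSet_eq hσ (hF.wt_neg i).ne
  choose q hq0 hqw hqt using hq
  have hin : ∀ i z, Inside (p i) (chart (M i) z) ↔ Inside (q i) (chart ν z) := fun i z => by
    have h1 := congrArg interior (hqt i)
    rw [(hF.frame i).interior_tileSet, hfr.interior_tileSet] at h1
    exact Set.ext_iff.1 h1 z
  have hdis : ∀ i j, i ≠ j → Apart (q i) (q j) := fun i j hij f hf hi hj => by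
    refine hF.disjoint i j hij (point ν f) ((hin _ _).2 ?_) ((hin _ _).2 ?_) <;>
      rwa [hfr.chart_point hf]
  have hinj : Function.Injective q := fun i j hij => by
    by_contra hne
    obtain ⟨f, hf, hi⟩ := exists_inside (hq0 i)
    exact hdis i j hne f hf hi (hij ▸ hi)
  have hvert : ∀ i k j, L j ≤ vertexCoord (q i) k j ∧ vertexCoord (q i) k j ≤ U j := by
    intro i k j
    have h1 : point ν (vertexCoord (q i) k) ∈ tileSet ν (q i) := by
      rw [tileSet, Set.mem_ofPred_eq, hfr.chart_point (wt_vertexCoord _ _)]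
      exact covers_vertexCoord (hq0 i) k
    have h2 : point ν (vertexCoord (q i) k) ∈ P := by
      rw [← hF.union]
      exact Set.mem_iUnion.2 ⟨i, by rwa [hqt]⟩
    have := hb j _ h2
    rwa [hfr.chart_point (wt_vertexCoord _ _)] at this
  have hval : ∀ i j, (L j ≤ q i j ∧ q i j ≤ U j) ∧
      L j ≤ q i j - wt (q i) ∧ q i j - wt (q i) ≤ U j := fun i j => by
    have h1 := hvert i j j
    have h2 := hvert i (j + 1) j
    have hj : j ≠ j + 1 := by fin_cases j <;> decide
    simp only [vertexCoord, if_true, if_neg hj, sub_zero] at h1 h2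
    exact ⟨h2, h1⟩
  refine ⟨ν, L, U, univ.image q, hfr, ⟨⟨?_, ?_, ?_, ?_, ?_⟩, ⟨?_, ?_⟩, ⟨q i₀, by simp⟩⟩, ?_, ?_, hPr⟩
  · simpa using hq0
  · simp only [mem_image, mem_univ, true_and, forall_exists_index, forall_apply_eq_imp_iff]
    exact fun i j => ⟨(hval i j).1.1, (hval i j).2.1⟩
  · simp only [mem_image, mem_univ, true_and, forall_exists_index, forall_apply_eq_imp_iff]
    exact fun i j => ⟨(hval i j).1.2, (hval i j).2.2⟩
  · intro f hf hLf
    have h1 : point ν f ∈ P := by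
      rw [hPr]
      intro j
      rw [hfr.chart_point hf]
      exact hLf j
    rw [← hF.union] at h1
    obtain ⟨i, hi⟩ := Set.mem_iUnion.1 h1
    rw [hqt, tileSet, Set.mem_ofPred_eq, hfr.chart_point hf] at hi
    exact ⟨q i, by simp, hi⟩
  · simp only [mem_image, mem_univ, true_and, forall_exists_index, forall_apply_eq_imp_iff]
    exact fun i j hij => hdis i j (fun h => hij (by rw [h]))
  · intro j
    -- The bound is attained at `x`, and the other two coordinates of `x` are at most `U`; so the
    -- length of this side is nonnegative.
    obtain ⟨x, hx, hxj⟩ := hL j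
    have h0 := hfr.wt_chart x
    have hbx := fun k => (hb k x hx).2
    have h1 := hbx 0; have h2 := hbx 1; have h3 := hbx 2
    rw [lowLen, ← hxj]
    simp only [wt] at *
    fin_cases j <;> simp only [Fin.zero_eta, Fin.mk_one, Fin.reduceFinMk] at * <;> linarith
  · intro j
    obtain ⟨x, hx, hxj⟩ := hU j
    have h0 := hfr.wt_chart x
    have hbx := fun k => (hb k x hx).1
    have h1 := hbx 0; have h2 := hbx 1; have h3 := hbx 2
    rw [upLen, ← hxj]
    simp only [wt] at *
    fin_cases j <;> simp only [Fin.zero_eta, Fin.mk_one, Fin.reduceFinMk] at * <;> linarith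
  · rw [card_image_of_injective _ hinj, card_univ, Fintype.card_fin]
  · rw [numSizes, ← Set.ncard_coe_finset]
    congr 1
    ext s
    simp [sizes, hqw, hs]

/-- Realizing a tiling given in coordinates. -/
theorem exists_isEquilateralTiling {L U : Fin 3 → ℝ} {T : Finset (Fin 3 → ℝ)} (hν : IsFrame ν)
    (h : TightTiling L U T) (hT : T.card = n) : ∃ T' : Fin n → PlaneTriangle,
      IsEquilateralTiling (region ν L U) T' ∧ numSizes T' = (sizes T).card := by
  classical
  subst hT
  choose t h1 h2 h3 using fun p : T => hν.exists_triangle (h.wt_ne p.1 p.2)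
  have e := T.equivFin
  refine ⟨fun i => t (e.symm i), ⟨fun i => h1 _, ?_, fun i j hij => ?_⟩, ?_⟩
  · ext z
    simp only [Set.mem_iUnion, h2]
    constructor
    · rintro ⟨i, hi⟩ j
      have hl := h.low _ (e.symm i).2 j
      have hu := h.up _ (e.symm i).2 j
      have h0 := hν.wt_chart z
      rcases hi with ⟨hw, hi⟩ | ⟨hw, hi⟩
      · have k0 := hi 0; have k1 := hi 1; have k2 := hi 2
        refine ⟨hl.1.trans (hi j), le_trans ?_ hu.2⟩
        simp only [wt] at *
        fin_cases j <;> simp only [Fin.zero_eta, Fin.mk_one, Fin.reduceFinMk] at * <;> linarith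
      · have k0 := hi 0; have k1 := hi 1; have k2 := hi 2
        refine ⟨hl.2.trans ?_, (hi j).trans hu.1⟩
        simp only [wt] at *
        fin_cases j <;> simp only [Fin.zero_eta, Fin.mk_one, Fin.reduceFinMk] at * <;> linarith
    · intro hz
      obtain ⟨p, hp, hc⟩ := h.cover _ (hν.wt_chart z) hz
      exact ⟨e ⟨p, hp⟩, by simpa [tileSet] using hc⟩
  · rw [h2, h2, hν.interior_tileSet, hν.interior_tileSet, Set.disjoint_left]
    refine fun z hi hj => h.apart _ (e.symm i).2 _ (e.symm j).2 (fun he => hij ?_) _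
      (hν.wt_chart z) hi hj
    exact e.symm.injective (Subtype.ext he)
  · rw [numSizes, ← Set.ncard_coe_finset (sizes T)]
    congr 1
    ext s
    simp only [h3, sizes, Set.mem_range, coe_image, Set.mem_image, mem_coe]
    constructor
    · rintro ⟨i, hi⟩
      exact ⟨_, (e.symm i).2, hi⟩
    · rintro ⟨p, hp, hs⟩
      exact ⟨e ⟨p, hp⟩, by simpa using hs⟩

end TriTiling

namespace TriTiling
open Finset

/-! ### Convex polygons and their extreme points -/

/-- Krein–Milman, where the closure is superfluous because the hull of a finite set is closed. -/
lemma convexHull_extremePoints_of_finite {P : Set Plane} (hP : IsCompact P) (hc : Convex ℝ P)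
    (hf : (P.extremePoints ℝ).Finite) : convexHull ℝ (P.extremePoints ℝ) = P := by
  rw [← (hf.isClosed_convexHull (𝕜 := ℝ)).closure_eq, closure_convexHull_extremePoints hP hc]

/-- If `v i` were not extreme, the remaining points would already span the hull and hence contain `v
i` in theirs. -/
lemma extremePoints_of_convexIndependent {ι : Type*} [Finite ι] {v : ι → Plane}
    (hv : ConvexIndependent ℝ v) :
    (convexHull ℝ (Set.range v)).extremePoints ℝ = Set.range v := by
  have hsub := extremePoints_convexHull_subset (𝕜 := ℝ) (A := Set.range v)
  refine hsub.antisymm ?_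
  rintro _ ⟨i, rfl⟩
  by_contra hi
  have hfin := Set.finite_range v
  have h1 := convexHull_extremePoints_of_finite (hfin.isCompact_convexHull (𝕜 := ℝ)) (convex_convexHull ℝ _)
    (hfin.subset hsub)
  refine convexIndependent_iff_notMem_convexHull_sdiff.1 hv i Set.univ ?_
  have h2 : v i ∈ convexHull ℝ ((convexHull ℝ (Set.range v)).extremePoints ℝ) := by
    rw [h1]; exact subset_convexHull ℝ _ ⟨i, rfl⟩
  refine convexHull_mono ?_ h2
  intro x hx
  obtain ⟨j, rfl⟩ := hsub hx
  exact ⟨j, ⟨trivial, fun hj => hi (by rwa [← (show j = i from hj)])⟩, rfl⟩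

/-- Polygons are compact and convex, and their vertices are the extreme points. -/
lemma isConvexPolygon_iff {k : ℕ} {P : Set Plane} (hk : 0 < k) : IsConvexPolygon k P ↔
    IsCompact P ∧ Convex ℝ P ∧ (P.extremePoints ℝ).ncard = k := by
  constructor
  · rintro ⟨v, hv, rfl⟩
    refine ⟨(Set.finite_range v).isCompact_convexHull (𝕜 := ℝ), convex_convexHull ℝ _, ?_⟩
    rw [extremePoints_of_convexIndependent hv, ← Set.image_univ,
      Set.ncard_image_of_injective _ hv.injective, Set.ncard_univ, Nat.card_fin]
  · rintro ⟨h1, h2, h3⟩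
    have hfin : (P.extremePoints ℝ).Finite := Set.finite_of_ncard_pos (by omega)
    have e : Fin k ≃ P.extremePoints ℝ := by
      have := hfin.fintype
      refine (Fintype.equivFinOfCardEq ?_).symm
      rw [← Nat.card_eq_fintype_card, ← h3]; rfl
    refine ⟨fun i => (e i : Plane),
      h2.convexIndependent_extremePoints.comp_embedding e.toEmbedding, ?_⟩
    rw [show (fun i => (e i : Plane)) = Subtype.val ∘ e from rfl, Set.range_comp,
      e.surjective.range_eq, Set.image_univ, Subtype.range_coe,
      convexHull_extremePoints_of_finite h1 h2 hfin]

/-! ### Trapezoids and parallelograms -/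

lemma affineIndependent_iff_smul {a b d : Plane} :
    AffineIndependent ℝ ![a, b, d] ↔ b - a ≠ 0 ∧ ∀ t : ℝ, t • (b - a) ≠ d - a := by
  rw [affineIndependent_iff_not_collinear_set, ← not_iff_not, not_not,
    collinear_iff_of_mem (p₀ := a) (by simp)]
  constructor
  · rintro ⟨v, hv⟩ ⟨h1, h2⟩
    obtain ⟨r, hr⟩ := hv b (by simp)
    obtain ⟨s, hs⟩ := hv d (by simp)
    rw [vadd_eq_add] at hr hs
    have hr' : b - a = r • v := by rw [hr]; abel
    have hs' : d - a = s • v := by rw [hs]; abel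
    have hr0 : r ≠ 0 := by rintro rfl; exact h1 (by rw [hr', zero_smul])
    exact h2 (s / r) (by rw [hr', hs', smul_smul, div_mul_cancel₀ _ hr0])
  · intro h
    by_cases h1 : b - a = 0
    · refine ⟨d - a, ?_⟩
      simp only [Set.mem_insert_iff, Set.mem_singleton_iff, forall_eq_or_imp, forall_eq, vadd_eq_add]
      exact ⟨⟨0, by simp⟩, ⟨0, by simpa [sub_eq_zero] using h1⟩, ⟨1, by simp⟩⟩
    · have : ∃ t : ℝ, t • (b - a) = d - a := by
        by_contra! hh; exact h ⟨h1, hh⟩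
      obtain ⟨t, ht⟩ := this
      refine ⟨b - a, ?_⟩
      simp only [Set.mem_insert_iff, Set.mem_singleton_iff, forall_eq_or_imp, forall_eq, vadd_eq_add]
      exact ⟨⟨0, by simp⟩, ⟨1, by simp⟩, ⟨t, by simp [ht]⟩⟩

/-- Affine coordinates in the plane. -/
lemma exists_coordinates {a b d : Plane} (h : AffineIndependent ℝ ![a, b, d]) :
    ∃ f g : Plane →ₗ[ℝ] ℝ, f (b - a) = 1 ∧ f (d - a) = 0 ∧ g (b - a) = 0 ∧ g (d - a) = 1 := by
  obtain ⟨h1, h2⟩ := affineIndependent_iff_smul.1 h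
  have hli : LinearIndependent ℝ ![b - a, d - a] := (LinearIndependent.pair_iff' h1).2 h2
  set B := basisOfLinearIndependentOfCardEqFinrank hli (by simp) with hB
  have h0 : B 0 = b - a := by simp [hB]
  have h1 : B 1 = d - a := by simp [hB]
  refine ⟨B.coord 0, B.coord 1, ?_, ?_, ?_, ?_⟩ <;> simp only [← h0, ← h1] <;> simp

/-- A quadrilateral with two parallel sides is a convex polygon. -/
lemma isConvexPolygon_of_parallel {a b c d : Plane} {r : ℝ} (h : AffineIndependent ℝ ![a, b, d])
    (hr : 0 < r) (hc : c - d = r • (b - a)) : IsConvexPolygon 4 (convexHull ℝ {a, b, c, d}) := by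
  obtain ⟨f, g, f1, f2, g1, g2⟩ := exists_coordinates h
  have f3 := congrArg f hc
  have g3 := congrArg g hc
  rw [map_sub, map_smul, f1, smul_eq_mul, mul_one] at f3
  rw [map_sub, map_smul, g1, smul_zero] at g3
  rw [map_sub] at f1 f2 g1 g2
  refine ⟨![a, b, c, d], ?_, ?_⟩
  · rw [convexIndependent_iff_notMem_convexHull_sdiff]
    have key : ∀ (l : Plane →ₗ[ℝ] ℝ) (i : Fin 4) (s : Set (Fin 4)),
        (∀ j, j ≠ i → l (![a, b, c, d] j) < l (![a, b, c, d] i)) →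
        ![a, b, c, d] i ∉ convexHull ℝ (![a, b, c, d] '' (s \ {i})) := by
      intro l i s hl hi
      have := convexHull_min (𝕜 := ℝ) (t := {z | l z < l (![a, b, c, d] i)}) ?_
        (convex_halfSpace_lt l.isLinear _) hi
      · exact lt_irrefl (l (![a, b, c, d] i)) this
      · rintro _ ⟨j, ⟨-, hj⟩, rfl⟩
        exact hl j hj
    -- In the coordinates `(f, g)` based at `a` the vertices are `(0, 0)`, `(1, 0)`, `(r, 1)`, `(0,
    -- 1)`; each is the unique maximum of a linear function.
    intro i s
    fin_cases i
    · refine key (-f - g) 0 s fun j hj => ?_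
      fin_cases j
      · exact absurd rfl hj
      all_goals simp; linarith
    · refine key (f - (1 + r) • g) 1 s fun j hj => ?_
      fin_cases j
      · simp; nlinarith
      · exact absurd rfl hj
      all_goals simp; nlinarith
    · refine key (f + g) 2 s fun j hj => ?_
      fin_cases j
      · simp; linarith
      · simp; linarith
      · exact absurd rfl hj
      · simp; linarith
    · refine key (g - f) 3 s fun j hj => ?_
      fin_cases j
      · simp; linarith
      · simp; linarith
      · simp; linarith
      · exact absurd rfl hj
  · congr 1
    ext z
    simp only [Matrix.range_cons, Matrix.range_empty, Set.union_empty, Set.mem_union,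
      Set.mem_insert_iff, Set.mem_singleton_iff]

/-- A centrally symmetric trapezoid is a parallelogram. -/
lemma eq_one_of_symmetric {a b c d w : Plane} {r : ℝ} (h : AffineIndependent ℝ ![a, b, d])
    (hr : 0 < r) (hc : c - d = r • (b - a))
    (hw : ∀ z ∈ convexHull ℝ {a, b, c, d}, w - z ∈ convexHull ℝ {a, b, c, d}) : r = 1 := by
  obtain ⟨f, g, f1, f2, g1, g2⟩ := exists_coordinates h
  have f3 := congrArg f hc
  have g3 := congrArg g hc
  rw [map_sub, map_smul, f1, smul_eq_mul, mul_one] at f3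
  rw [map_sub, map_smul, g1, smul_zero] at g3
  rw [map_sub] at f1 f2 g1 g2
  have hull : ∀ (l : Plane →ₗ[ℝ] ℝ) (t : ℝ), l a ≤ t → l b ≤ t → l c ≤ t → l d ≤ t →
      ∀ z ∈ convexHull ℝ {a, b, c, d}, l z ≤ t := by
    intro l t ha hb hc hd z hz
    refine convexHull_min (𝕜 := ℝ) (t := {z | l z ≤ t}) ?_ (convex_halfSpace_le l.isLinear _) hz
    simp [Set.insert_subset_iff, ha, hb, hc, hd]
  -- The four functions bound the sides. At the images of `a` and `b` they give `1 ≤ r`, at those of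
  -- `c` and `d` they give `r ≤ 1`.
  have b1 := hull (-f) (-f a) le_rfl (by simp; linarith) (by simp; linarith) (by simp; linarith)
  have b2 := hull (f - (r - 1) • g) (f b - (r - 1) * g a) (by simp; linarith)
    (by simp; nlinarith) (by simp; nlinarith) (by simp; nlinarith)
  have b3 := hull g (g d) (by linarith) (by linarith) (by linarith) le_rfl
  have b4 := hull (-g) (-g a) le_rfl (by simp; linarith) (by simp; linarith) (by simp; linarith)
  simp only [LinearMap.neg_apply, LinearMap.sub_apply, LinearMap.smul_apply, smul_eq_mul] at b1 b2 b4
  have ha : a ∈ convexHull ℝ {a, b, c, d} := subset_convexHull ℝ _ (by simp)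
  have hb : b ∈ convexHull ℝ {a, b, c, d} := subset_convexHull ℝ _ (by simp)
  have hcc : c ∈ convexHull ℝ {a, b, c, d} := subset_convexHull ℝ _ (by simp)
  have hd : d ∈ convexHull ℝ {a, b, c, d} := subset_convexHull ℝ _ (by simp)
  have ha' := hw a ha; have hb' := hw b hb; have hc' := hw c hcc; have hd' := hw d hd
  have e1 := b1 _ hb'; have e2 := b2 _ ha'; have e3 := b3 _ ha'; have e4 := b4 _ hd'
  have e5 := b1 _ hc'; have e6 := b2 _ hd'
  simp only [map_sub] at e1 e2 e3 e4 e5 e6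
  have hgw : g w = g d + g a := by linarith
  rw [hgw] at e2 e6
  nlinarith

lemma symmetric_of_isParallelogram {P : Set Plane} (h : IsParallelogram P) :
    ∃ w, ∀ z ∈ P, w - z ∈ P := by
  obtain ⟨a, b, c, d, -, hc, rfl⟩ := h
  refine ⟨a + c, fun z hz => ?_⟩
  have hcv : Convex ℝ {z : Plane | a + c - z ∈ convexHull ℝ {a, b, c, d}} := by
    intro x hx y hy s t hs ht hst
    have := convex_convexHull ℝ {a, b, c, d} hx hy hs ht hst
    rw [Set.mem_ofPred_eq]
    convert this using 1
    rw [smul_sub, smul_sub]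
    nth_rewrite 1 [← one_smul ℝ (a + c)]
    rw [← hst]
    module
  refine convexHull_min ?_ hcv hz
  have h1 : a + c - b = d := by rw [← sub_eq_zero] at hc ⊢; rw [← hc]; abel
  have h2 : a + c - d = b := by rw [← h1]; abel
  have h3 : a + c - a = c := by abel
  have h4 : a + c - c = a := by abel
  have hin := subset_convexHull ℝ ({a, b, c, d} : Set Plane)
  simp only [Set.insert_subset_iff, Set.singleton_subset_iff, Set.mem_ofPred_eq, h1, h2, h3, h4]
  exact ⟨hin (by simp), hin (by simp), hin (by simp), hin (by simp)⟩

end TriTiling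

namespace TriTiling
open Finset

variable {ν : Fin 3 → Plane} {L U : Fin 3 → ℝ}

/-! ### Extreme points of regions -/

/-- The point on the lower side `i` and on the upper side `j`. -/
def corner (L U : Fin 3 → ℝ) (i j : Fin 3) : Fin 3 → ℝ :=
  fun m => if m = i then L i else if m = j then U j else -L i - U j

lemma corner_perm (π : Equiv.Perm (Fin 3)) (L U : Fin 3 → ℝ) :
    corner L U (π 0) (π 1) (π 0) = L (π 0) ∧ corner L U (π 0) (π 1) (π 1) = U (π 1) ∧
      corner L U (π 0) (π 1) (π 2) = -L (π 0) - U (π 1) := by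
  simp [corner]

lemma wt_corner {i j : Fin 3} (hij : i ≠ j) : wt (corner L U i j) = 0 := by
  obtain ⟨π, rfl, rfl⟩ := exists_perm_of_ne i j hij
  rw [wt_perm π, (corner_perm π L U).1, (corner_perm π L U).2.1, (corner_perm π L U).2.2]
  ring

lemma isCompact_region (hν : IsFrame ν) (L U : Fin 3 → ℝ) : IsCompact (region ν L U) := by
  refine IsCompact.of_isClosed_subset ((isCompact_Icc (a := L) (b := U)).image (f := point ν) ?_)
    ?_ fun z hz => ⟨chart ν z, ⟨fun j => (hz j).1, fun j => (hz j).2⟩, hν.point_chart z⟩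
  · unfold point; fun_prop
  · simp only [region, Set.ofPred_forall, Set.ofPred_and]
    exact isClosed_iInter fun j => (isClosed_le continuous_const (continuous_chart ν j)).inter
      (isClosed_le (continuous_chart ν j) continuous_const)

lemma convex_region (ν : Fin 3 → Plane) (L U : Fin 3 → ℝ) : Convex ℝ (region ν L U) := by
  intro x hx y hy s t hs ht hst j
  rw [chart_add, chart_smul, chart_smul]
  have h1 := mul_le_mul_of_nonneg_left (hx j).1 hs
  have h2 := mul_le_mul_of_nonneg_left (hx j).2 hs
  have h3 := mul_le_mul_of_nonneg_left (hy j).1 ht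
  have h4 := mul_le_mul_of_nonneg_left (hy j).2 ht
  have h5 : s * L j + t * L j = L j := by rw [← add_mul, hst, one_mul]
  have h6 : s * U j + t * U j = U j := by rw [← add_mul, hst, one_mul]
  constructor <;> linarith

lemma Tight.corner_mem (h : Tight L U) (hlt : ∀ j, L j < U j) {i j : Fin 3} (hij : i ≠ j) (m : Fin 3) :
    L m ≤ corner L U i j m ∧ corner L U i j m ≤ U m := by
  obtain ⟨π, rfl, rfl⟩ := exists_perm_of_ne i j hij
  have h1 := h.low_nonneg (π 0)
  have h2 := h.up_nonneg (π 1)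
  rw [(lowLen_perm π).1] at h1
  rw [(upLen_perm π).2.1] at h2
  revert m
  rw [forall_perm π, (corner_perm π L U).1, (corner_perm π L U).2.1, (corner_perm π L U).2.2]
  exact ⟨⟨le_rfl, (hlt _).le⟩, ⟨(hlt _).le, le_rfl⟩, by linarith, by linarith⟩

/-- Two labels name the same corner only across a side that has shrunk to a point. -/
lemma corner_eq (hlt : ∀ j, L j < U j) {i j k l : Fin 3} (hij : i ≠ j) (hkl : k ≠ l)
    (h : corner L U i j = corner L U k l) : (i = k ∧ j = l) ∨ (i = k ∧ lowLen L U i = 0) ∨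
      (j = l ∧ upLen L U j = 0) := by
  obtain ⟨π, rfl, rfl⟩ := exists_perm_of_ne i j hij
  obtain ⟨a, rfl⟩ := π.surjective k
  obtain ⟨b, rfl⟩ := π.surjective l
  have h0 := congrFun h (π 0)
  have h1 := congrFun h (π 1)
  have h2 := congrFun h (π 2)
  rw [(corner_perm π L U).1] at h0
  rw [(corner_perm π L U).2.1] at h1
  rw [(corner_perm π L U).2.2] at h2
  rw [(lowLen_perm π).1, (upLen_perm π).2.1]
  have l0 := hlt (π 0); have l1 := hlt (π 1); have l2 := hlt (π 2)
  fin_cases a <;> fin_cases b <;> simp [corner] at h0 h1 h2 hkl ⊢ <;> linarith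

lemma corner_eq_of_lowLen {i j k : Fin 3} (hij : i ≠ j) (hik : i ≠ k) (hi : lowLen L U i = 0) :
    corner L U i j = corner L U i k := by
  rcases eq_or_ne j k with rfl | hjk
  · rfl
  obtain ⟨π, rfl, rfl⟩ := exists_perm_of_ne i j hij
  obtain ⟨a, rfl⟩ := π.surjective k
  rw [(lowLen_perm π).1] at hi
  fin_cases a <;> simp at hik hjk
  refine ext_perm π ?_ ?_ ?_ <;> simp [corner] <;> linarith

lemma corner_eq_of_upLen {i k j : Fin 3} (hij : i ≠ j) (hkj : k ≠ j) (hj : upLen L U j = 0) :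
    corner L U i j = corner L U k j := by
  rcases eq_or_ne i k with rfl | hik
  · rfl
  obtain ⟨π, rfl, rfl⟩ := exists_perm_of_ne i j hij
  obtain ⟨a, rfl⟩ := π.surjective k
  rw [(upLen_perm π).2.1] at hj
  fin_cases a <;> simp at hik hkj
  refine ext_perm π ?_ ?_ ?_ <;> simp [corner] <;> linarith

/-- If two coordinates were strictly between their bounds, the point could move both ways along the
third line direction. So two coordinates are at bounds; if both are lower or both upper, tightness
forces the third to the opposite bound. -/
lemma exists_corner_of_mem_extremePoints (hν : IsFrame ν) (h : Tight L U) {z : Plane}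
    (hz : z ∈ (region ν L U).extremePoints ℝ) :
    ∃ i j, i ≠ j ∧ chart ν z = corner L U i j := by
  obtain ⟨hzR, hz⟩ := mem_extremePoints.1 hz
  have hw := hν.wt_chart z
  set f := chart ν z with hf
  have key : ∀ π : Equiv.Perm (Fin 3), ¬ ((L (π 0) < f (π 0) ∧ f (π 0) < U (π 0)) ∧
      L (π 1) < f (π 1) ∧ f (π 1) < U (π 1)) := by
    rintro π ⟨⟨h1, h2⟩, h3, h4⟩
    obtain ⟨ε, he, h1', h2', h3', h4'⟩ : ∃ ε : ℝ, 0 < ε ∧ ε ≤ f (π 0) - L (π 0) ∧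
        ε ≤ U (π 0) - f (π 0) ∧ ε ≤ f (π 1) - L (π 1) ∧ ε ≤ U (π 1) - f (π 1) := by
      refine ⟨min (min (f (π 0) - L (π 0)) (U (π 0) - f (π 0)))
        (min (f (π 1) - L (π 1)) (U (π 1) - f (π 1))), ?_, ?_, ?_, ?_, ?_⟩
      · simp only [lt_min_iff, sub_pos]; exact ⟨⟨h1, h2⟩, h3, h4⟩
      · exact (min_le_left _ _).trans (min_le_left _ _)
      · exact (min_le_left _ _).trans (min_le_right _ _)
      · exact (min_le_right _ _).trans (min_le_left _ _)
      · exact (min_le_right _ _).trans (min_le_right _ _)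
    set v := point ν (vec π ε (-ε) 0) with hv
    have hcv : chart ν v = vec π ε (-ε) 0 :=
      hν.chart_point (by rw [wt_perm π, vec_zero, vec_one, vec_two]; ring)
    have hR := (forall_perm π).1 hzR
    have m1 : z + v ∈ region ν L U := by
      refine (forall_perm π).2 ?_
      simp only [chart_add, hcv, ← hf, vec_zero, vec_one, vec_two]
      refine ⟨⟨?_, ?_⟩, ⟨?_, ?_⟩, ?_, ?_⟩ <;> linarith [hR.2.2.1, hR.2.2.2]
    have m2 : z - v ∈ region ν L U := by
      refine (forall_perm π).2 ?_
      simp only [chart_sub, hcv, ← hf, vec_zero, vec_one, vec_two]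
      refine ⟨⟨?_, ?_⟩, ⟨?_, ?_⟩, ?_, ?_⟩ <;> linarith [hR.2.2.1, hR.2.2.2]
    have := (hz _ m1 _ m2 ⟨1 / 2, 1 / 2, by norm_num, by norm_num, by norm_num, by module⟩).1
    have h5 : chart ν (z + v) (π 0) = f (π 0) := by rw [this]
    rw [chart_add, hcv, vec_zero] at h5
    linarith
  have fin : ∀ π : Equiv.Perm (Fin 3), (L (π 0) = f (π 0) ∨ f (π 0) = U (π 0)) →
      (L (π 1) = f (π 1) ∨ f (π 1) = U (π 1)) → ∃ i j, i ≠ j ∧ f = corner L U i j := by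
    have main : ∀ π : Equiv.Perm (Fin 3), L (π 0) = f (π 0) → f (π 1) = U (π 1) →
        ∃ i j, i ≠ j ∧ f = corner L U i j := by
      intro π h0 h1
      refine ⟨π 0, π 1, by simp, ext_perm π ?_ ?_ ?_⟩
      · rw [(corner_perm π L U).1, h0]
      · rw [(corner_perm π L U).2.1, h1]
      · rw [(corner_perm π L U).2.2, h0, ← h1]
        rw [wt_perm π] at hw; linarith
    intro π h0 h1
    have hw' := hw
    rw [wt_perm π] at hw'
    rcases h0 with h0 | h0 <;> rcases h1 with h1 | h1
    · have h2 := h.up_nonneg (π 2)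
      rw [(upLen_perm π).2.2] at h2
      obtain ⟨τ, t0, t1⟩ := exists_perm_of_ne (π 0) (π 2) (by simp)
      refine main τ (by rw [t0, h0]) ?_
      rw [t1]
      linarith [(hzR (π 2)).2]
    · exact main π h0 h1
    · obtain ⟨τ, t0, t1⟩ := exists_perm_of_ne (π 1) (π 0) (by simp)
      exact main τ (by rw [t0, h1]) (by rw [t1, h0])
    · have h2 := h.low_nonneg (π 2)
      rw [(lowLen_perm π).2.2] at h2
      obtain ⟨τ, t0, t1⟩ := exists_perm_of_ne (π 2) (π 1) (by simp)
      refine main τ ?_ (by rw [t1, h1])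
      rw [t0]
      linarith [(hzR (π 2)).1]
  have tight_or : ∀ j, (L j = f j ∨ f j = U j) ∨ (L j < f j ∧ f j < U j) := fun j => by
    rcases (hzR j).1.eq_or_lt with h | h
    · exact Or.inl (Or.inl h)
    · rcases (hzR j).2.eq_or_lt with h' | h'
      · exact Or.inl (Or.inr h')
      · exact Or.inr ⟨h, h'⟩
  obtain ⟨τ, t0, t1⟩ := exists_perm_of_ne 0 1 (by decide)
  obtain ⟨ρ, r0, r1⟩ := exists_perm_of_ne 0 2 (by decide)
  obtain ⟨κ, k0, k1⟩ := exists_perm_of_ne 1 2 (by decide)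
  rcases tight_or 0 with h0 | h0 <;> rcases tight_or 1 with h1 | h1
  · exact fin τ (by rwa [t0]) (by rwa [t1])
  · rcases tight_or 2 with h2 | h2
    · exact fin ρ (by rwa [r0]) (by rwa [r1])
    · exact absurd ⟨by rwa [k0], by rwa [k1]⟩ (key κ)
  · rcases tight_or 2 with h2 | h2
    · exact fin κ (by rwa [k0]) (by rwa [k1])
    · exact absurd ⟨by rwa [r0], by rwa [r1]⟩ (key ρ)
  · exact absurd ⟨by rwa [t0], by rwa [t1]⟩ (key τ)

/-- A corner minimises one coordinate and maximises another, and these two coordinates determine it.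
-/
lemma corner_mem_extremePoints (hν : IsFrame ν) (h : Tight L U) (hlt : ∀ j, L j < U j)
    {i j : Fin 3} (hij : i ≠ j) :
    point ν (corner L U i j) ∈ (region ν L U).extremePoints ℝ := by
  have hc := hν.chart_point (wt_corner (L := L) (U := U) hij)
  refine mem_extremePoints_iff_left.2 ⟨fun m => ?_, ?_⟩
  · rw [hc]; exact h.corner_mem hlt hij m
  · rintro x hx y hy ⟨s, t, hs, ht, hst, hz⟩
    refine hν.chart_injective ?_
    rw [hc]
    obtain ⟨π, rfl, rfl⟩ := exists_perm_of_ne i j hij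
    have hch : ∀ m, s * chart ν x m + t * chart ν y m = corner L U (π 0) (π 1) m := fun m => by
      rw [← hc, ← hz, chart_add, chart_smul, chart_smul]
    have h0 := hch (π 0)
    have h1 := hch (π 1)
    rw [(corner_perm π L U).1] at h0
    rw [(corner_perm π L U).2.1] at h1
    have e0 : chart ν x (π 0) = L (π 0) := by
      have := (hx (π 0)).1
      have := (hy (π 0)).1
      have ht' : t = 1 - s := by linarith
      subst ht'
      nlinarith
    have e1 : chart ν x (π 1) = U (π 1) := by
      have := (hx (π 1)).2
      have := (hy (π 1)).2
      have ht' : t = 1 - s := by linarith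
      subst ht'
      nlinarith
    have hw := hν.wt_chart x
    rw [wt_perm π] at hw
    refine ext_perm π ?_ ?_ ?_
    · rw [(corner_perm π L U).1, e0]
    · rw [(corner_perm π L U).2.1, e1]
    · rw [(corner_perm π L U).2.2]; linarith

lemma extremePoints_region (hν : IsFrame ν) (h : Tight L U) (hlt : ∀ j, L j < U j) :
    (region ν L U).extremePoints ℝ =
      (fun x : Fin 3 × Fin 3 => point ν (corner L U x.1 x.2)) '' {x | x.1 ≠ x.2} := by
  ext z
  constructor
  · intro hz
    obtain ⟨i, j, hij, hz⟩ := exists_corner_of_mem_extremePoints hν h hz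
    exact ⟨(i, j), hij, by simp only [← hz, hν.point_chart]⟩
  · rintro ⟨x, hx, rfl⟩
    exact corner_mem_extremePoints hν h hlt hx

/-- The number of sides of positive length. -/
noncomputable def numSides (L U : Fin 3 → ℝ) : ℕ :=
  ∑ j, ((if lowLen L U j = 0 then 0 else 1) + if upLen L U j = 0 then 0 else 1)

lemma numSides_perm (π : Equiv.Perm (Fin 3)) : numSides L U =
    ((if lowLen L U (π 0) = 0 then 0 else 1) + if upLen L U (π 0) = 0 then 0 else 1) +
    ((if lowLen L U (π 1) = 0 then 0 else 1) + if upLen L U (π 1) = 0 then 0 else 1) +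
    ((if lowLen L U (π 2) = 0 then 0 else 1) + if upLen L U (π 2) = 0 then 0 else 1) := by
  rw [numSides, ← Equiv.sum_comp π, Fin.sum_univ_three]

/-- The final corners of the sides in cyclic order. -/
def sideEnd : Fin 3 ⊕ Fin 3 → Fin 3 × Fin 3 :=
  Sum.elim (fun i => (i, i + 1)) fun j => (j + 1, j)

/-- Going round the region, every side of positive length is matched with its final corner. A side
of length zero adds no corner, since its final corner is already that of the preceding side, which
has positive length. -/
lemma ncard_extremePoints_region (hν : IsFrame ν) (h : Tight L U) (hlt : ∀ j, L j < U j) :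
    ((region ν L U).extremePoints ℝ).ncard = numSides L U := by
  classical
  have hadj : ∀ i j, i ≠ j → lowLen L U i = 0 → upLen L U j ≠ 0 := fun i j hij hi hj => by
    obtain ⟨π, rfl, rfl⟩ := exists_perm_of_ne i j hij
    rw [(lowLen_perm π).1] at hi
    rw [(upLen_perm π).2.1] at hj
    linarith [hlt (π 2)]
  set len : Fin 3 ⊕ Fin 3 → ℝ := Sum.elim (lowLen L U) (upLen L U) with hlen
  have hne : ∀ x, (sideEnd x).1 ≠ (sideEnd x).2 := by decide
  have hcorner : ∀ {i j k l : Fin 3}, i ≠ j → k ≠ l →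
      point ν (corner L U i j) = point ν (corner L U k l) → corner L U i j = corner L U k l := by
    intro i j k l hij hkl he
    rw [← hν.chart_point (wt_corner (L := L) (U := U) hij), he, hν.chart_point (wt_corner hkl)]
  have himg : (region ν L U).extremePoints ℝ =
      (fun x => point ν (corner L U (sideEnd x).1 (sideEnd x).2)) ''
        ((univ.filter fun x => len x ≠ 0 : Finset (Fin 3 ⊕ Fin 3)) : Set (Fin 3 ⊕ Fin 3)) := by
    rw [extremePoints_region hν h hlt]
    refine Set.Subset.antisymm ?_ ?_
    · rintro _ ⟨⟨i, j⟩, hij, rfl⟩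
      have hcase : j = i + 1 ∨ i = j + 1 := by
        revert i j; decide
      rcases hcase with rfl | rfl
      · by_cases hi : lowLen L U i = 0
        · refine ⟨Sum.inr (i + 2), by simpa [hlen] using hadj i (i + 2) (by simp) hi, ?_⟩
          have : i + 2 + 1 = i := (by decide : ∀ i : Fin 3, i + 2 + 1 = i) i
          simp only [sideEnd, Sum.elim_inr, this]
          rw [corner_eq_of_lowLen (i := i) (j := i + 2) (k := i + 1) (by simp) (by simp) hi]
        · exact ⟨Sum.inl i, by simpa [hlen] using hi, rfl⟩
      · by_cases hj : upLen L U j = 0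
        · refine ⟨Sum.inl (j + 2), by
            simpa [hlen] using fun hh => hadj (j + 2) j (by simp) hh hj, ?_⟩
          have : j + 2 + 1 = j := (by decide : ∀ i : Fin 3, i + 2 + 1 = i) j
          simp only [sideEnd, Sum.elim_inl, this]
          rw [corner_eq_of_upLen (i := j + 2) (j := j) (k := j + 1) (by simp) (by simp) hj]
        · exact ⟨Sum.inr j, by simpa [hlen] using hj, rfl⟩
    · rintro _ ⟨x, -, rfl⟩
      exact ⟨sideEnd x, hne x, rfl⟩
  have hinj : Set.InjOn (fun x => point ν (corner L U (sideEnd x).1 (sideEnd x).2))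
      ((univ.filter fun x => len x ≠ 0 : Finset (Fin 3 ⊕ Fin 3)) : Set (Fin 3 ⊕ Fin 3)) := by
    intro x hx y hy hxy
    simp only [coe_filter, mem_univ, true_and, Set.mem_ofPred_eq] at hx hy
    rcases x with i | i <;> rcases y with k | k <;>
      rcases corner_eq hlt (hne _) (hne _) (hcorner (hne _) (hne _) hxy) with h | h | h <;>
      simp [sideEnd, hlen] at h hx hy ⊢ <;> first | exact h | exact h.1 | skip
    · exact (by decide : ∀ i k : Fin 3, ¬ (i = k + 1 ∧ i + 1 = k)) i k h
    · exact hx h.2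
    · exact hy (h.1 ▸ h.2)
    · exact (by decide : ∀ i k : Fin 3, ¬ (i + 1 = k ∧ i = k + 1)) i k h
    · exact hy (h.1 ▸ h.2)
    · exact hx h.2
  rw [himg, hinj.ncard_image, Set.ncard_coe_finset, card_filter, numSides,
    Fintype.sum_sum_type, ← sum_add_distrib]
  simp only [hlen, Sum.elim_inl, Sum.elim_inr, ite_not]

end TriTiling

namespace TriTiling
open Finset

variable {ν : Fin 3 → Plane} {L U : Fin 3 → ℝ} {n : ℕ} {P : Set Plane} {T : Fin n → PlaneTriangle}

/-! ### The shape of a region -/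

lemma upLen_ne_zero (hlt : ∀ j, L j < U j) {i j : Fin 3} (hij : i ≠ j) (hi : lowLen L U i = 0) :
    upLen L U j ≠ 0 := by
  intro hj
  obtain ⟨π, rfl, rfl⟩ := exists_perm_of_ne i j hij
  rw [(lowLen_perm π).1] at hi
  rw [(upLen_perm π).2.1] at hj
  linarith [hlt (π 2)]

lemma isConvexPolygon_region (hν : IsFrame ν) (h : Tight L U) (hlt : ∀ j, L j < U j) {k : ℕ}
    (hk : 0 < k) : IsConvexPolygon k (region ν L U) ↔ numSides L U = k := by
  rw [isConvexPolygon_iff hk, ncard_extremePoints_region hν h hlt]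
  simp [isCompact_region hν, convex_region]

/-- The symmetry exchanges opposite bounding lines, so `w` has coordinates `L + U`, whose sum must
vanish. This criterion separates parallelograms from trapezoids. -/
lemma wt_add_wt_of_symmetric (hν : IsFrame ν) (h : Tight L U) (hlt : ∀ j, L j < U j) {w : Plane}
    (hw : ∀ z ∈ region ν L U, w - z ∈ region ν L U) : wt L + wt U = 0 := by
  have key : ∀ i j, i ≠ j → chart ν w i = L i + U i := fun i j hij => by
    have h1 := hw _ (fun m => by
      rw [hν.chart_point (wt_corner (L := L) (U := U) hij)]; exact h.corner_mem hlt hij m) i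
    have h2 := hw _ (fun m => by
      rw [hν.chart_point (wt_corner (L := L) (U := U) hij.symm)]; exact h.corner_mem hlt hij.symm m) i
    rw [chart_sub, hν.chart_point (wt_corner hij)] at h1
    rw [chart_sub, hν.chart_point (wt_corner hij.symm)] at h2
    simp only [corner, if_true, if_neg hij] at h1 h2
    linarith
  have := hν.wt_chart w
  simp only [wt] at *
  rw [key 0 1 (by decide), key 1 0 (by decide), key 2 0 (by decide)] at this
  linarith

lemma symmetric_of_wt_add_wt (hν : IsFrame ν) (h : wt L + wt U = 0) :
    ∃ w, ∀ z ∈ region ν L U, w - z ∈ region ν L U := by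
  have hw : wt (fun j => L j + U j) = 0 := by simp only [wt] at *; linarith
  refine ⟨point ν fun j => L j + U j, fun z hz j => ?_⟩
  rw [chart_sub, hν.chart_point hw]
  constructor <;> linarith [(hz j).1, (hz j).2]

lemma numSides_eq_three (hlt : ∀ j, L j < U j) (h : numSides L U = 3) :
    (∀ j, upLen L U j = 0) ∨ ∀ j, lowLen L U j = 0 := by
  have a := fun i j (hij : i ≠ j) => upLen_ne_zero (L := L) (U := U) hlt hij
  have a01 := a 0 1 (by decide)
  have a02 := a 0 2 (by decide)
  have a10 := a 1 0 (by decide)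
  have a12 := a 1 2 (by decide)
  have a20 := a 2 0 (by decide)
  have a21 := a 2 1 (by decide)
  rw [numSides, Fin.sum_univ_three] at h
  simp only [Fin.forall_fin_succ, Fin.succ_zero_eq_one, Fin.succ_one_eq_two,
    IsEmpty.forall_iff, and_true]
  grind

lemma numSides_eq_four_of_eq (h : numSides L U = 4) (hd : wt L + wt U = 0) :
    ∃ π : Equiv.Perm (Fin 3), lowLen L U (π 2) = 0 ∧ upLen L U (π 2) = 0 := by
  have e : ∀ j, lowLen L U j = upLen L U j := fun j => by
    linarith [low_sub_up (L := L) (U := U) j]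
  obtain ⟨j, hj⟩ : ∃ j, upLen L U j = 0 := by
    by_contra! hne
    simp [numSides, e, hne] at h
  exact ⟨Equiv.swap 2 j, by simp [e, hj]⟩

/-- Every lower side is longer than the opposite upper side, so the two vanishing sides are both
upper. -/
lemma numSides_eq_four_of_pos (ht : Tight L U) (h : numSides L U = 4) (hd : 0 < wt L + wt U) :
    ∃ π : Equiv.Perm (Fin 3), upLen L U (π 0) = 0 ∧ upLen L U (π 1) = 0 ∧ 0 < upLen L U (π 2) := by
  have e : ∀ j, lowLen L U j ≠ 0 := fun j => by
    have := low_sub_up (L := L) (U := U) j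
    have := ht.up_nonneg j
    intro h; linarith
  have hpos : ∀ j, upLen L U j ≠ 0 → 0 < upLen L U j := fun j hj => (ht.up_nonneg j).lt_of_ne' hj
  simp only [numSides, e, if_false, Fin.sum_univ_three] at h
  have : ∃ i j k : Fin 3, i ≠ j ∧ i ≠ k ∧ j ≠ k ∧ upLen L U i = 0 ∧ upLen L U j = 0 ∧
      upLen L U k ≠ 0 := by
    by_cases h0 : upLen L U 0 = 0 <;> by_cases h1 : upLen L U 1 = 0 <;>
      by_cases h2 : upLen L U 2 = 0 <;> simp [h0, h1, h2] at h
    · exact ⟨0, 1, 2, by decide, by decide, by decide, h0, h1, h2⟩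
    · exact ⟨0, 2, 1, by decide, by decide, by decide, h0, h2, h1⟩
    · exact ⟨1, 2, 0, by decide, by decide, by decide, h1, h2, h0⟩
  obtain ⟨i, j, k, hij, hik, hjk, hi, hj, hk⟩ := this
  obtain ⟨π, rfl, rfl⟩ := exists_perm_of_ne i j hij
  have : k = π 2 := by
    obtain ⟨a, rfl⟩ := π.surjective k
    fin_cases a <;> simp at hik hjk ⊢
  exact ⟨π, hi, hj, hpos _ (this ▸ hk)⟩

lemma numSides_eq_five (ht : Tight L U) (h : numSides L U = 5) :
    ∃ π : Equiv.Perm (Fin 3),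
      (upLen L U (π 2) = 0 ∧ 0 < upLen L U (π 0) ∧ 0 < upLen L U (π 1) ∧ ∀ j, 0 < lowLen L U j) ∨
      (lowLen L U (π 2) = 0 ∧ 0 < lowLen L U (π 0) ∧ 0 < lowLen L U (π 1) ∧
        ∀ j, 0 < upLen L U j) := by
  have hpu : ∀ j, 0 < upLen L U j ↔ upLen L U j ≠ 0 := fun j =>
    ⟨fun h => h.ne', fun hj => (ht.up_nonneg j).lt_of_ne' hj⟩
  have hpl : ∀ j, 0 < lowLen L U j ↔ lowLen L U j ≠ 0 := fun j =>
    ⟨fun h => h.ne', fun hj => (ht.low_nonneg j).lt_of_ne' hj⟩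
  simp only [hpu, hpl]
  obtain ⟨j, hj⟩ : ∃ j, upLen L U j = 0 ∨ lowLen L U j = 0 := by
    by_contra! hne
    simp [numSides, hne] at h
  obtain ⟨π, rfl⟩ : ∃ π : Equiv.Perm (Fin 3), π 2 = j := ⟨Equiv.swap 2 j, by simp⟩
  refine ⟨π, ?_⟩
  rw [forall_perm π, forall_perm π]
  rw [numSides_perm π] at h
  clear hpu hpl ht
  generalize lowLen L U (π 0) = a0, lowLen L U (π 1) = a1, lowLen L U (π 2) = a2,
    upLen L U (π 0) = b0, upLen L U (π 1) = b1, upLen L U (π 2) = b2 at *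
  rcases hj with rfl | rfl
  · left
    refine ⟨rfl, ?_, ?_, ?_, ?_, ?_⟩ <;> rintro rfl <;> simp only [if_true] at h <;>
      split_ifs at h <;> omega
  · right
    refine ⟨rfl, ?_, ?_, ?_, ?_, ?_⟩ <;> rintro rfl <;> simp only [if_true] at h <;>
      split_ifs at h <;> omega

lemma numSides_eq_six (ht : Tight L U) (h : numSides L U = 6) :
    (∀ j, 0 < lowLen L U j) ∧ ∀ j, 0 < upLen L U j := by
  have hpu : ∀ j, 0 < upLen L U j ↔ upLen L U j ≠ 0 := fun j =>
    ⟨fun h => h.ne', fun hj => (ht.up_nonneg j).lt_of_ne' hj⟩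
  have hpl : ∀ j, 0 < lowLen L U j ↔ lowLen L U j ≠ 0 := fun j =>
    ⟨fun h => h.ne', fun hj => (ht.low_nonneg j).lt_of_ne' hj⟩
  simp only [hpu, hpl]
  rw [numSides, Fin.sum_univ_three] at h
  simp only [Fin.forall_fin_succ, Fin.succ_zero_eq_one, Fin.succ_one_eq_two,
    IsEmpty.forall_iff, and_true]
  refine ⟨⟨?_, ?_, ?_⟩, ?_, ?_, ?_⟩ <;> intro h0 <;> simp only [h0, if_true] at h <;>
    split_ifs at h <;> omega

/-! ### Upper bounds for tilings of polygons -/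

lemma exists_tightTiling_of_polygon {k : ℕ} (hk : 0 < k) (hP : IsConvexPolygon k P)
    (h : IsEquilateralTiling P T) : ∃ ν L U T', IsFrame ν ∧ TightTiling L U T' ∧ T'.card = n ∧
      defect T' + numSizes T = n ∧ P = region ν L U ∧ numSides L U = k := by
  obtain ⟨h1, h2, h3⟩ := (isConvexPolygon_iff hk).1 hP
  obtain ⟨x, hx⟩ := Set.nonempty_of_ncard_ne_zero (h3.trans_ne hk.ne')
  obtain ⟨ν, L, U, T', hν, hT, hn, hs, rfl⟩ :=
    exists_tightTiling h1 h2 ⟨x, extremePoints_subset hx⟩ h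
  refine ⟨ν, L, U, T', hν, hT, hn, ?_, rfl,
    (isConvexPolygon_region hν hT.toTight hT.lt hk).1 hP⟩
  rw [← hs, defect_add_card_sizes, hn]

theorem triangle_bound (hP : IsTriangle P) (h : IsEquilateralTiling P T) :
    (n = 1 ∧ numSizes T ≤ 1) ∨ (n = 4 ∧ numSizes T ≤ 1) ∨ (n = 6 ∧ numSizes T ≤ 2) ∨
      (7 ≤ n ∧ numSizes T ≤ n - 5) := by
  obtain ⟨ν, L, U, T', -, hT, hn, hs, -, h3⟩ := exists_tightTiling_of_polygon (by norm_num) hP h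
  rcases numSides_eq_three hT.lt h3 with h0 | h0
  · have := hT.triangle h0
    omega
  · have := hT.triangle_down h0
    omega

lemma isConvexPolygon_of_isTrapezoid (hP : IsTrapezoid P) : IsConvexPolygon 4 P := by
  obtain ⟨a, b, c, d, hi, ⟨r, hr, -, hc⟩, rfl⟩ := hP
  exact isConvexPolygon_of_parallel hi hr hc

lemma isConvexPolygon_of_isParallelogram (hP : IsParallelogram P) : IsConvexPolygon 4 P := by
  obtain ⟨a, b, c, d, hi, hc, rfl⟩ := hP
  exact isConvexPolygon_of_parallel hi one_pos (by rw [hc, one_smul])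

theorem trapezoid_bound (hP : IsTrapezoid P) (h : IsEquilateralTiling P T) :
    (n = 3 ∧ numSizes T ≤ 1) ∨ (n = 5 ∧ numSizes T ≤ 2) ∨ (6 ≤ n ∧ numSizes T ≤ n - 4) := by
  obtain ⟨ν, L, U, T', hν, hT, hn, hs, hR, h4⟩ :=
    exists_tightTiling_of_polygon (by norm_num) (isConvexPolygon_of_isTrapezoid hP) h
  have hd : wt L + wt U ≠ 0 := fun h0 => by
    obtain ⟨w, hw⟩ := symmetric_of_wt_add_wt hν h0
    obtain ⟨a, b, c, d, hi, ⟨r, hr, hr1, hc⟩, hP⟩ := hP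
    rw [← hR, hP] at hw
    exact hr1 (eq_one_of_symmetric hi hr hc hw)
  rcases lt_or_gt_of_ne hd with hd | hd
  · have h4' : numSides (-U) (-L) = 4 := by
      rw [← h4, numSides, numSides]
      simp only [lowLen_neg, upLen_neg, add_comm]
    obtain ⟨π, h0, h1, h2⟩ := numSides_eq_four_of_pos hT.toTight.neg h4'
      (by simp only [wt_neg]; linarith)
    have := hT.neg.trapezoid π h0 h1 h2
    rw [card_negTiles, defect_negTiles] at this
    omega
  · obtain ⟨π, h0, h1, h2⟩ := numSides_eq_four_of_pos hT.toTight h4 hd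
    have := hT.trapezoid π h0 h1 h2
    omega

theorem parallelogram_bound (hP : IsParallelogram P) (h : IsEquilateralTiling P T) :
    (n = 2 ∧ numSizes T ≤ 1) ∨ (n = 4 ∧ numSizes T ≤ 1) ∨ (n = 5 ∧ numSizes T ≤ 2) ∨
      (6 ≤ n ∧ numSizes T ≤ n - 4) := by
  obtain ⟨ν, L, U, T', hν, hT, hn, hs, rfl, h4⟩ :=
    exists_tightTiling_of_polygon (by norm_num) (isConvexPolygon_of_isParallelogram hP) h
  obtain ⟨w, hw⟩ := symmetric_of_isParallelogram hP
  obtain ⟨π, h0, h1⟩ := numSides_eq_four_of_eq h4 (wt_add_wt_of_symmetric hν hT.toTight hT.lt hw)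
  have := hT.parallelogram π h0 h1
  omega

theorem pentagon_bound (hP : IsConvexPentagon P) (h : IsEquilateralTiling P T) :
    (n = 4 ∧ numSizes T ≤ 2) ∨ (5 ≤ n ∧ numSizes T ≤ n - 3) := by
  obtain ⟨ν, L, U, T', -, hT, hn, hs, -, h5⟩ := exists_tightTiling_of_polygon (by norm_num) hP h
  obtain ⟨π, ⟨h2, h0, h1, hA⟩ | ⟨h2, h0, h1, hB⟩⟩ := numSides_eq_five hT.toTight h5
  · have := hT.pentagon π h2 h0 h1 hA
    omega
  · have := hT.neg.pentagon π (by rwa [upLen_neg]) (by rwa [upLen_neg]) (by rwa [upLen_neg])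
      (fun j => by rw [lowLen_neg]; exact hB j)
    rw [card_negTiles, defect_negTiles] at this
    omega

theorem hexagon_bound (hP : IsConvexHexagon P) (h : IsEquilateralTiling P T) :
    (6 ≤ n ∧ n ≤ 8 ∧ numSizes T ≤ n - 5) ∨ (9 ≤ n ∧ numSizes T ≤ n - 4) := by
  obtain ⟨ν, L, U, T', -, hT, hn, hs, -, h6⟩ := exists_tightTiling_of_polygon (by norm_num) hP h
  obtain ⟨hA, hB⟩ := numSides_eq_six hT.toTight h6
  have := hT.hexagon hA hB
  omega

/-! ### Polygons of given shape -/

variable {S : Finset ℝ} {x0 x1 x2 x3 x4 x5 : ℝ}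

lemma Realizable.card_mem_sizeCounts (h : Realizable n S x0 x1 x2 x3 x4 x5)
    {Shape : Set Plane → Prop} (hS : ∀ (ν : Fin 3 → Plane) (L U : Fin 3 → ℝ)
      (π : Equiv.Perm (Fin 3)), IsFrame ν → Tight L U → (∀ j, L j < U j) → lowLen L U (π 0) = x0 →
      upLen L U (π 1) = x1 → lowLen L U (π 2) = x2 → upLen L U (π 0) = x3 →
      lowLen L U (π 1) = x4 → upLen L U (π 2) = x5 → Shape (region ν L U)) :
    S.card ∈ sizeCounts Shape n := by
  obtain ⟨L, U, T, π, hT, hn, hs, e0, e1, e2, e3, e4, e5⟩ := h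
  obtain ⟨ν, hν⟩ := exists_isFrame
  obtain ⟨T', hT', hs'⟩ := exists_isEquilateralTiling hν hT hn
  exact ⟨_, hS ν L U π hν hT.toTight hT.lt e0 e1 e2 e3 e4 e5, T', hT', by rw [hs', hs]⟩

lemma Realizable.triangle (h : Realizable n S x0 0 x2 0 x4 0) (h0 : 0 < x0) (h2 : 0 < x2)
    (h4 : 0 < x4) : S.card ∈ sizeCounts IsTriangle n := by
  refine h.card_mem_sizeCounts fun ν L U π hν ht hlt e0 e1 e2 e3 e4 e5 => ?_
  refine (isConvexPolygon_region hν ht hlt (by norm_num)).2 ?_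
  rw [numSides_perm π, e0, e1, e2, e3, e4, e5]
  simp [h0.ne', h2.ne', h4.ne']

lemma Realizable.pentagon (h : Realizable n S x0 0 x2 x3 x4 x5) (h0 : 0 < x0) (h2 : 0 < x2)
    (h3 : 0 < x3) (h4 : 0 < x4) (h5 : 0 < x5) : S.card ∈ sizeCounts IsConvexPentagon n := by
  refine h.card_mem_sizeCounts fun ν L U π hν ht hlt e0 e1 e2 e3 e4 e5 => ?_
  refine (isConvexPolygon_region hν ht hlt (by norm_num)).2 ?_
  rw [numSides_perm π, e0, e1, e2, e3, e4, e5]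
  simp [h0.ne', h2.ne', h3.ne', h4.ne', h5.ne']

lemma Realizable.hexagon (h : Realizable n S x0 x1 x2 x3 x4 x5) (h0 : 0 < x0) (h1 : 0 < x1)
    (h2 : 0 < x2) (h3 : 0 < x3) (h4 : 0 < x4) (h5 : 0 < x5) :
    S.card ∈ sizeCounts IsConvexHexagon n := by
  refine h.card_mem_sizeCounts fun ν L U π hν ht hlt e0 e1 e2 e3 e4 e5 => ?_
  refine (isConvexPolygon_region hν ht hlt (by norm_num)).2 ?_
  rw [numSides_perm π, e0, e1, e2, e3, e4, e5]
  simp [h0.ne', h1.ne', h2.ne', h3.ne', h4.ne', h5.ne']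

lemma affineIndependent_of_chart {a b d : Plane} (i j : Fin 3)
    (h : chart ν (b - a) i * chart ν (d - a) j ≠ chart ν (b - a) j * chart ν (d - a) i) :
    AffineIndependent ℝ ![a, b, d] := by
  refine affineIndependent_iff_smul.2 ⟨fun h0 => h ?_, fun t ht => h ?_⟩
  · simp [h0, chart]
  · rw [← ht, chart_smul, chart_smul]; ring

lemma region_eq_convexHull (hν : IsFrame ν) (ht : Tight L U) (hlt : ∀ j, L j < U j)
    {s : Set Plane} (hs : s ⊆ region ν L U)
    (h : ∀ i j, i ≠ j → point ν (corner L U i j) ∈ s) : region ν L U = convexHull ℝ s := by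
  refine Set.Subset.antisymm ?_ (convexHull_min hs (convex_region ν L U))
  have hfin : ((region ν L U).extremePoints ℝ).Finite := by
    rw [extremePoints_region hν ht hlt]
    exact (Set.toFinite _).image _
  rw [← convexHull_extremePoints_of_finite (isCompact_region hν L U) (convex_region ν L U) hfin]
  refine convexHull_mono ?_
  rw [extremePoints_region hν ht hlt]
  rintro _ ⟨x, hx, rfl⟩
  exact h _ _ hx

/-- A region with four corners is the convex hull of these. -/
lemma region_eq_convexHull_four (hν : IsFrame ν) (ht : Tight L U) (hlt : ∀ j, L j < U j)
    {i0 i1 i2 i3 j0 j1 j2 j3 : Fin 3} (n0 : i0 ≠ j0) (n1 : i1 ≠ j1) (n2 : i2 ≠ j2) (n3 : i3 ≠ j3)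
    (h : ∀ i j, i ≠ j → corner L U i j = corner L U i0 j0 ∨ corner L U i j = corner L U i1 j1 ∨
      corner L U i j = corner L U i2 j2 ∨ corner L U i j = corner L U i3 j3) :
    region ν L U = convexHull ℝ {point ν (corner L U i0 j0), point ν (corner L U i1 j1),
      point ν (corner L U i2 j2), point ν (corner L U i3 j3)} := by
  have hm : ∀ i j, i ≠ j → point ν (corner L U i j) ∈ region ν L U := fun i j hij =>
    extremePoints_subset (corner_mem_extremePoints hν ht hlt hij)
  refine region_eq_convexHull hν ht hlt ?_ fun i j hij => ?_
  · simp only [Set.insert_subset_iff, Set.singleton_subset_iff]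
    exact ⟨hm _ _ n0, hm _ _ n1, hm _ _ n2, hm _ _ n3⟩
  · simp only [Set.mem_insert_iff, Set.mem_singleton_iff]
    rcases h i j hij with h | h | h | h <;> simp [h]

lemma Realizable.trapezoid (h : Realizable n S x0 0 x2 0 x4 x5) (h0 : 0 < x0) (h2 : 0 < x2)
    (h5 : 0 < x5) : S.card ∈ sizeCounts IsTrapezoid n := by
  refine h.card_mem_sizeCounts fun ν L U π hν ht hlt e0 e1 e2 e3 e4 e5 => ?_
  have n01 : π 0 ≠ π 1 := by simp
  have n02 : π 0 ≠ π 2 := by simp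
  have n12 : π 1 ≠ π 2 := by simp
  have c1 := corner_eq_of_upLen n12.symm n01 e1
  have c0 := corner_eq_of_upLen n01.symm n02.symm e3
  rw [(lowLen_perm π).1] at e0
  rw [(upLen_perm π).2.1] at e1
  rw [(lowLen_perm π).2.2] at e2
  rw [(upLen_perm π).1] at e3
  rw [(lowLen_perm π).2.1] at e4
  rw [(upLen_perm π).2.2] at e5
  -- The first two points end the upper side `π 2`, of length `x5`; the last two end the lower side
  -- `π 2`, of length `x2`. These are the parallel sides, with ratio `x2 / x5`.
  refine ⟨point ν (corner L U (π 0) (π 2)), point ν (corner L U (π 1) (π 2)),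
    point ν (corner L U (π 2) (π 0)), point ν (corner L U (π 0) (π 1)),
    affineIndependent_of_chart (ν := ν) (π 0) (π 2) ?_,
    ⟨x2 / x5, div_pos h2 h5, ?_, hν.chart_injective (ext_perm π ?_ ?_ ?_)⟩,
    region_eq_convexHull_four hν ht hlt n02 n12 n02.symm n01 ?_⟩
  · simp only [chart_sub, hν.chart_point (wt_corner n02), hν.chart_point (wt_corner n12),
      hν.chart_point (wt_corner n01)]
    simp [corner]
    constructor <;> intro <;> linarith
  · rw [Ne, div_eq_one_iff_eq h5.ne']
    intro; linarith
  iterate 3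
    simp only [chart_sub, chart_smul, hν.chart_point (wt_corner n02),
      hν.chart_point (wt_corner n12), hν.chart_point (wt_corner n01),
      hν.chart_point (wt_corner n02.symm)]
    simp [corner]
    try field_simp
    first
    | linarith
    | rw [show U (π 0) - L (π 0) = x2 by linarith,
        show -L (π 1) - U (π 2) - L (π 0) = x5 by linarith]
    | rw [show -L (π 2) - U (π 0) - U (π 1) = -x2 by linarith,
        show L (π 1) - (-L (π 0) - U (π 2)) = -x5 by linarith]
      ring
  rw [forall_perm π]
  simp only [forall_perm π]
  simp [c0, c1]

lemma Realizable.parallelogram (h : Realizable n S x0 0 x2 x3 0 x5) (h0 : 0 < x0) (h2 : 0 < x2) :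
    S.card ∈ sizeCounts IsParallelogram n := by
  refine h.card_mem_sizeCounts fun ν L U π hν ht hlt e0 e1 e2 e3 e4 e5 => ?_
  have n01 : π 0 ≠ π 1 := by simp
  have n02 : π 0 ≠ π 2 := by simp
  have n12 : π 1 ≠ π 2 := by simp
  have c1 := corner_eq_of_upLen n12.symm n01 e1
  have c0 := corner_eq_of_lowLen n12 n01.symm e4
  rw [(lowLen_perm π).1] at e0
  rw [(upLen_perm π).2.1] at e1
  rw [(lowLen_perm π).2.2] at e2
  rw [(upLen_perm π).1] at e3
  rw [(lowLen_perm π).2.1] at e4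
  rw [(upLen_perm π).2.2] at e5
  refine ⟨point ν (corner L U (π 0) (π 1)), point ν (corner L U (π 2) (π 0)),
    point ν (corner L U (π 1) (π 0)), point ν (corner L U (π 0) (π 2)),
    affineIndependent_of_chart (ν := ν) (π 0) (π 2) ?_,
    hν.chart_injective (ext_perm π ?_ ?_ ?_),
    region_eq_convexHull_four hν ht hlt n01 n02.symm n01.symm n02 ?_⟩
  · simp only [chart_sub, hν.chart_point (wt_corner n02), hν.chart_point (wt_corner n02.symm),
      hν.chart_point (wt_corner n01)]
    simp [corner]
    constructor <;> intro <;> linarith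
  iterate 3
    simp only [chart_sub, hν.chart_point (wt_corner n02),
      hν.chart_point (wt_corner n01.symm), hν.chart_point (wt_corner n01),
      hν.chart_point (wt_corner n02.symm)]
    simp [corner]
    try linarith
  rw [forall_perm π]
  simp only [forall_perm π]
  simp [c0, c1]

end TriTiling

namespace TriTiling
open Finset

/-! ### The maximal numbers of sizes -/

lemma mem_tilingDomain_iff {Shape : Set Plane → Prop} {n : ℕ} :
    n ∈ tilingDomain Shape ↔ (sizeCounts Shape n).Nonempty := by
  constructor
  · rintro ⟨P, hP, T, hT⟩
    exact ⟨_, P, hP, T, hT, rfl⟩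
  · rintro ⟨_, P, hP, T, hT, -⟩
    exact ⟨P, hP, T, hT⟩

/-- A bound that excludes all other numbers of tiles and is attained determines the maximum. -/
lemma isMaxSizes_of_bound {Shape : Set Plane → Prop} {n s : ℕ} (h : s ∈ sizeCounts Shape n)
    (hb : ∀ P, Shape P → ∀ T : Fin n → PlaneTriangle, IsEquilateralTiling P T → numSizes T ≤ s) :
    IsMaxSizes Shape n s := by
  refine ⟨h, ?_⟩
  rintro _ ⟨P, hP, T, hT, rfl⟩
  exact hb P hP T hT

lemma IsMaxSizes.mem_tilingDomain {Shape : Set Plane → Prop} {n s : ℕ} (h : IsMaxSizes Shape n s) :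
    n ∈ tilingDomain Shape := mem_tilingDomain_iff.2 ⟨s, h.1⟩

theorem isMaxSizes_triangle : IsMaxSizes IsTriangle 1 1 ∧ IsMaxSizes IsTriangle 4 1 ∧
    IsMaxSizes IsTriangle 6 2 ∧ ∀ n : ℕ, 7 ≤ n → IsMaxSizes IsTriangle n (n - 5) := by
  refine ⟨isMaxSizes_of_bound ?_ ?_, isMaxSizes_of_bound ?_ ?_, isMaxSizes_of_bound ?_ ?_,
    fun n hn => isMaxSizes_of_bound ?_ ?_⟩
  · simpa using realizable_one.triangle (by norm_num) (by norm_num) (by norm_num)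
  · intro P hP T hT; have := triangle_bound hP hT; omega
  · simpa using realizable_triangle_four.triangle (by norm_num) (by norm_num) (by norm_num)
  · intro P hP T hT; have := triangle_bound hP hT; omega
  · have := realizable_triangle_six.triangle (by norm_num) (by norm_num) (by norm_num)
    rwa [card_pair (by norm_num)] at this
  · intro P hP T hT; have := triangle_bound hP hT; omega
  · obtain ⟨S, x0, x2, x4, h, h0, h2, h4, hS⟩ := exists_triangle hn
    exact hS ▸ h.triangle h0 h2 h4
  · intro P hP T hT; have := triangle_bound hP hT; omega

theorem tilingDomain_triangle : tilingDomain IsTriangle = {1, 4} ∪ {n : ℕ | 6 ≤ n} := by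
  obtain ⟨h1, h4, h6, h7⟩ := isMaxSizes_triangle
  ext n
  constructor
  · rintro ⟨P, hP, T, hT⟩
    have := triangle_bound hP hT
    simp only [Set.mem_union, Set.mem_insert_iff, Set.mem_singleton_iff, Set.mem_ofPred_eq]
    omega
  · rintro ((rfl | rfl) | hn)
    · exact IsMaxSizes.mem_tilingDomain h1
    · exact IsMaxSizes.mem_tilingDomain h4
    · rcases eq_or_lt_of_le (show 6 ≤ n from hn) with rfl | hn
      · exact IsMaxSizes.mem_tilingDomain h6
      · exact IsMaxSizes.mem_tilingDomain (h7 n hn)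

theorem isMaxSizes_trapezoid : IsMaxSizes IsTrapezoid 3 1 ∧ IsMaxSizes IsTrapezoid 5 2 ∧
    ∀ n : ℕ, 6 ≤ n → IsMaxSizes IsTrapezoid n (n - 4) := by
  refine ⟨isMaxSizes_of_bound ?_ ?_, isMaxSizes_of_bound ?_ ?_,
    fun n hn => isMaxSizes_of_bound ?_ ?_⟩
  · simpa using realizable_trapezoid_three.trapezoid (by norm_num) (by norm_num)
      (by norm_num)
  · intro P hP T hT; have := trapezoid_bound hP hT; omega
  · have := realizable_trapezoid_five.trapezoid (by norm_num) (by norm_num)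
      (by norm_num)
    rwa [card_pair (by norm_num)] at this
  · intro P hP T hT; have := trapezoid_bound hP hT; omega
  · obtain ⟨S, x0, x2, x4, x5, h, h0, h2, -, h5, hS, -⟩ := exists_trapezoid hn
    exact hS ▸ h.trapezoid h0 h2 h5
  · intro P hP T hT; have := trapezoid_bound hP hT; omega

theorem tilingDomain_trapezoid : tilingDomain IsTrapezoid = {3} ∪ {n : ℕ | 5 ≤ n} := by
  obtain ⟨h3, h5, h6⟩ := isMaxSizes_trapezoid
  ext n
  constructor
  · rintro ⟨P, hP, T, hT⟩
    have := trapezoid_bound hP hT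
    simp only [Set.mem_union, Set.mem_singleton_iff, Set.mem_ofPred_eq]
    omega
  · rintro (rfl | hn)
    · exact IsMaxSizes.mem_tilingDomain h3
    · rcases eq_or_lt_of_le (show 5 ≤ n from hn) with rfl | hn
      · exact IsMaxSizes.mem_tilingDomain h5
      · exact IsMaxSizes.mem_tilingDomain (h6 n hn)

theorem isMaxSizes_parallelogram : IsMaxSizes IsParallelogram 2 1 ∧
    IsMaxSizes IsParallelogram 4 1 ∧ IsMaxSizes IsParallelogram 5 2 ∧
    ∀ n : ℕ, 6 ≤ n → IsMaxSizes IsParallelogram n (n - 4) := by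
  refine ⟨isMaxSizes_of_bound ?_ ?_, isMaxSizes_of_bound ?_ ?_, isMaxSizes_of_bound ?_ ?_,
    fun n hn => isMaxSizes_of_bound ?_ ?_⟩
  · simpa using realizable_parallelogram_two.parallelogram (by norm_num) (by norm_num)
  · intro P hP T hT; have := parallelogram_bound hP hT; omega
  · simpa using realizable_parallelogram_four.parallelogram (by norm_num) (by norm_num)
  · intro P hP T hT; have := parallelogram_bound hP hT; omega
  · have := realizable_parallelogram_five.parallelogram (by norm_num) (by norm_num)
    rwa [card_pair (by norm_num)] at this
  · intro P hP T hT; have := parallelogram_bound hP hT; omega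
  · obtain ⟨S, x0, x2, x3, x5, h, h0, h2, -, -, hS⟩ := exists_parallelogram hn
    exact hS ▸ h.parallelogram h0 h2
  · intro P hP T hT; have := parallelogram_bound hP hT; omega

theorem tilingDomain_parallelogram : tilingDomain IsParallelogram = {2} ∪ {n : ℕ | 4 ≤ n} := by
  obtain ⟨h2, h4, h5, h6⟩ := isMaxSizes_parallelogram
  ext n
  constructor
  · rintro ⟨P, hP, T, hT⟩
    have := parallelogram_bound hP hT
    simp only [Set.mem_union, Set.mem_singleton_iff, Set.mem_ofPred_eq]
    omega
  · rintro (rfl | hn)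
    · exact IsMaxSizes.mem_tilingDomain h2
    · obtain rfl | rfl | hn : n = 4 ∨ n = 5 ∨ 6 ≤ n := by
        have : 4 ≤ n := hn
        omega
      · exact IsMaxSizes.mem_tilingDomain h4
      · exact IsMaxSizes.mem_tilingDomain h5
      · exact IsMaxSizes.mem_tilingDomain (h6 n hn)

theorem isMaxSizes_pentagon : IsMaxSizes IsConvexPentagon 4 2 ∧
    ∀ n : ℕ, 5 ≤ n → IsMaxSizes IsConvexPentagon n (n - 3) := by
  refine ⟨isMaxSizes_of_bound ?_ ?_, fun n hn => isMaxSizes_of_bound ?_ ?_⟩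
  · have := realizable_pentagon_four.pentagon (by norm_num) (by norm_num) (by norm_num)
      (by norm_num) (by norm_num)
    rwa [card_pair (by norm_num)] at this
  · intro P hP T hT; have := pentagon_bound hP hT; omega
  · obtain ⟨S, x0, x2, x3, x4, x5, h, h0, h2, h3, h4, h5, hS, -⟩ := exists_pentagon hn
    exact hS ▸ h.pentagon h0 h2 h3 h4 h5
  · intro P hP T hT; have := pentagon_bound hP hT; omega

theorem tilingDomain_pentagon : tilingDomain IsConvexPentagon = {n : ℕ | 4 ≤ n} := by
  obtain ⟨h4, h5⟩ := isMaxSizes_pentagon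
  ext n
  constructor
  · rintro ⟨P, hP, T, hT⟩
    have := pentagon_bound hP hT
    simp only [Set.mem_ofPred_eq]
    omega
  · intro hn
    rcases eq_or_lt_of_le (show 4 ≤ n from hn) with rfl | hn
    · exact IsMaxSizes.mem_tilingDomain h4
    · exact IsMaxSizes.mem_tilingDomain (h5 n hn)

lemma sub_five_mem_sizeCounts {n : ℕ} (hn : (6 ≤ n ∧ n ≤ 8) ∨ 10 ≤ n) :
    n - 5 ∈ sizeCounts IsConvexHexagon n := by
  obtain ⟨S, x0, x1, x2, x3, x4, x5, h, h0, h1, h2, h3, h4, h5, hS⟩ := exists_hexagon hn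
  exact hS ▸ h.hexagon h0 h1 h2 h3 h4 h5

theorem isMaxSizes_hexagon_small (n : ℕ) (h6 : 6 ≤ n) (h8 : n ≤ 8) :
    IsMaxSizes IsConvexHexagon n (n - 5) := by
  refine isMaxSizes_of_bound (sub_five_mem_sizeCounts (Or.inl ⟨h6, h8⟩)) ?_
  intro P hP T hT; have := hexagon_bound hP hT; omega

theorem isMaxSizes_hexagon_of_mem {n : ℕ} (h9 : 9 ≤ n)
    (h : n - 4 ∈ sizeCounts IsConvexHexagon n) : IsMaxSizes IsConvexHexagon n (n - 4) := by
  refine isMaxSizes_of_bound h ?_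
  intro P hP T hT; have := hexagon_bound hP hT; omega

theorem isMaxSizes_hexagon (n : ℕ)
    (hn : (9 ≤ n ∧ n ≤ 19) ∨ n = 21 ∨ n = 22 ∨ n = 24 ∨ n = 25) :
    IsMaxSizes IsConvexHexagon n (n - 4) := by
  refine isMaxSizes_hexagon_of_mem (by omega) ?_
  obtain ⟨S, x0, x1, x2, x3, x4, x5, h, h0, h1, h2, h3, h4, h5, hS⟩ := exists_hexagon_special hn
  exact hS ▸ h.hexagon h0 h1 h2 h3 h4 h5

/-- Only the value `n - 4` lies between the construction with `n - 5` sizes and the upper bound; the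
maximum depends on whether it is attained. -/
theorem isMaxSizes_hexagon_or {n : ℕ} (hn : 10 ≤ n) :
    IsMaxSizes IsConvexHexagon n (n - 5) ∨ IsMaxSizes IsConvexHexagon n (n - 4) := by
  by_cases h : n - 4 ∈ sizeCounts IsConvexHexagon n
  · exact Or.inr (isMaxSizes_hexagon_of_mem (by omega) h)
  · refine Or.inl (isMaxSizes_of_bound (sub_five_mem_sizeCounts (Or.inr hn)) ?_)
    intro P hP T hT
    have h1 := hexagon_bound hP hT
    have h2 : numSizes T ≠ n - 4 := fun he => h ⟨P, hP, T, hT, he⟩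
    omega

theorem tilingDomain_hexagon : tilingDomain IsConvexHexagon = {n : ℕ | 6 ≤ n} := by
  ext n
  constructor
  · rintro ⟨P, hP, T, hT⟩
    have := hexagon_bound hP hT
    simp only [Set.mem_ofPred_eq]
    omega
  · intro hn
    rw [Set.mem_ofPred_eq] at hn
    -- The construction with `n - 5` sizes misses `n = 9`, which the explicit tiling supplies.
    by_cases h9 : n = 9
    · exact IsMaxSizes.mem_tilingDomain (isMaxSizes_hexagon n (by omega))
    · exact mem_tilingDomain_iff.2 ⟨_, sub_five_mem_sizeCounts (n := n) (by omega)⟩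

end TriTiling

theorem theorem1 :
    -- triangles
    (tilingDomain IsTriangle = {1, 4} ∪ {n : ℕ | 6 ≤ n} ∧
      IsMaxSizes IsTriangle 1 1 ∧ IsMaxSizes IsTriangle 4 1 ∧
      IsMaxSizes IsTriangle 6 2 ∧
      ∀ n : ℕ, 7 ≤ n → IsMaxSizes IsTriangle n (n - 5)) ∧
    -- trapezoids
    (tilingDomain IsTrapezoid = {3} ∪ {n : ℕ | 5 ≤ n} ∧
      IsMaxSizes IsTrapezoid 3 1 ∧
      IsMaxSizes IsTrapezoid 5 2 ∧
      ∀ n : ℕ, 6 ≤ n → IsMaxSizes IsTrapezoid n (n - 4)) ∧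
    -- parallelograms
    (tilingDomain IsParallelogram = {2} ∪ {n : ℕ | 4 ≤ n} ∧
      IsMaxSizes IsParallelogram 2 1 ∧ IsMaxSizes IsParallelogram 4 1 ∧
      IsMaxSizes IsParallelogram 5 2 ∧
      ∀ n : ℕ, 6 ≤ n → IsMaxSizes IsParallelogram n (n - 4)) ∧
    -- pentagons
    (tilingDomain IsConvexPentagon = {n : ℕ | 4 ≤ n} ∧
      IsMaxSizes IsConvexPentagon 4 2 ∧
      ∀ n : ℕ, 5 ≤ n → IsMaxSizes IsConvexPentagon n (n - 3)) ∧
    -- hexagons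
    (tilingDomain IsConvexHexagon = {n : ℕ | 6 ≤ n} ∧
      (∀ n : ℕ, 6 ≤ n → n ≤ 8 → IsMaxSizes IsConvexHexagon n (n - 5)) ∧
      (∀ n : ℕ, (9 ≤ n ∧ n ≤ 19) ∨ n = 21 ∨ n = 22 ∨ n = 24 ∨ n = 25 →
        IsMaxSizes IsConvexHexagon n (n - 4)) ∧
      (∀ n : ℕ, n = 20 ∨ n = 23 ∨ 26 ≤ n →
        IsMaxSizes IsConvexHexagon n (n - 5) ∨ IsMaxSizes IsConvexHexagon n (n - 4))) := by
  refine ⟨⟨TriTiling.tilingDomain_triangle, TriTiling.isMaxSizes_triangle⟩,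
    ⟨TriTiling.tilingDomain_trapezoid, TriTiling.isMaxSizes_trapezoid⟩,
    ⟨TriTiling.tilingDomain_parallelogram, TriTiling.isMaxSizes_parallelogram⟩,
    ⟨TriTiling.tilingDomain_pentagon, TriTiling.isMaxSizes_pentagon⟩,
    TriTiling.tilingDomain_hexagon, TriTiling.isMaxSizes_hexagon_small,
    TriTiling.isMaxSizes_hexagon, fun n hn => TriTiling.isMaxSizes_hexagon_or (by omega)⟩
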